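/- **Setting.** Let $\xi^*\in\mathbb R^3$ and let $G,g_1,g_2$ be holomorphic near $\xi^*$ in $\mathbb C^3$ and real at real points. Put $\sigma_k=\{g_k=0\}$, $\sigma_k'=\sigma_k\cap\mathbb R^3$. Assume that $\xi^*\in\sigma_1'\cap\sigma_2'$; that the crossing is transversal ($\nabla g_1(\xi^*),\nabla g_2(\xi^*)$ are linearly independent); that $\xi^*$ is a nondegenerate critical point of the restriction of $G$ to the line $\sigma_1'\cap\sigma_2'$; and that $\nabla G(\xi^*)$ is a multiple neither of $\nabla g_1(\xi^*)$ nor of $\nabla g_2(\xi^*)$. A real vector field $\eta$ defines, for small $\varepsilon>0$, the domain $\Gamma_\varepsilon(\eta)=\{x+i\varepsilon\eta(x)\}$, $x\in\mathbb R^3$, oriented as $\mathbb R^3$. The initial domain $\Gamma$ is given by a continuous field $\eta_0$ with $\eta_0\cdot\nabla g_k\ne0$ at $\xi^*$, $k=1,2$. Let $s_k$ be the sign of $\eta_0(\xi^*)\cdot\nabla g_k(\xi^*)$. The amplitude $F$ may be branched about $\sigma_1$ and $\sigma_2$; its branch along $\Gamma$ is holomorphic near $\xi^*$ in the cut domain $\Omega=\{\xi: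 g_k(\xi)\notin -i s_k[0,\infty),\ k=1,2\}$. Let $D$ be an open neighbourhood of $\xi^*$ in $\mathbb R^3$. A deformation of $\eta_0$ over $\overline D$ is *allowed* if it is a continuous family of fields $\eta_\tau$, $0\le\tau\le 1$, with $\eta_\tau\cdot\nabla g_k\neq0$ on $\sigma_k'\cap\overline D$ for $k=1,2$ (so that $\Gamma_\varepsilon(\eta_\tau)$ does not meet $\sigma_k$ over $\overline D$ for small $\varepsilon$). A field $\eta$ is *desired* on a set if $\eta\cdot\nabla G>0$ there (so that $\operatorname{Im}G>0$ on compact parts of $\Gamma_\varepsilon(\eta)$ for small $\varepsilon$). The *contribution* of $\xi^*$ is represented by the integrals $$u_{D,\eta,\varepsilon}(\Lambda)=\int_{\Gamma_\varepsilon(\eta)\text{ over }D}F(\xi)\,e^{i\Lambda G(\xi)}\,d\xi_1\wedge d\xi_2\wedge d\xi_3 ,$$ where $D$ is contained with its closure in a sufficiently small neighbourhood $U$ of $\xi^*$, the smooth field $\eta$ is obtained from $\eta_0$ by an allowed deformation over $\overline D$ and is desired on $\overline D\setminus K$ for some compact $K\subset D$, and $\varepsilon>0$ is sufficiently small (depending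 on $D,\eta$). **Claim.** (i) There are normalized coordinates: a biholomorphic real change of variables $\xi\mapsto w=(w_1,w_2,w_3)$ near $\xi^*$, $w(\xi^*)=0$, with $$w_1=\alpha_1g_1,\qquad w_2=\alpha_2g_2,\qquad G=G(\xi^*)+w_1+w_2+\tfrac12\beta w_3^2+O\big(|w|(|w_1|+|w_2|)+|w_3|^3\big),$$ where $\alpha_1,\alpha_2,\beta$ are real and non-zero. Take any such coordinates. Say that $\Gamma$ bypasses $\sigma_k$ above (below) in these coordinates if $\alpha_k\,\eta_0\cdot\nabla g_k$ is positive (negative) at $\xi^*$. There is a neighbourhood $U$ of $\xi^*$ such that (ii) and (iii) hold. (ii) If $\Gamma$ bypasses at least one of $\sigma_1,\sigma_2$ above, then $\xi^*$ does not contribute: for some $D$ there is an allowed deformation of $\eta_0$ over $\overline D$ into a smooth field that is desired on all of $\overline D$, and each $u_{D,\eta,\varepsilon}(\Lambda)$ is $O(e^{-\zeta\Lambda})$ as $\Lambda\to+\infty$ for some $\zeta>0$. (iii) If $\Gamma$ bypasses both $\sigma_1$ and $\sigma_2$ below, then no allowed deformation leads to a field that is desired at $\xi^*$, while for some $D$ and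 every neighbourhood $N$ of $\xi^*$ there is an allowed deformation of $\eta_0$ over $\overline D$ into a smooth field that is desired on $\overline D\setminus N$. Suppose moreover that the leading term of $F$ is a power: $$F\sim C(w_3)\,w_1^{\mu_1}w_2^{\mu_2}\qquad(\xi\to\xi^*,\ \xi\in\Omega),$$ where $C$ is holomorphic at $0$, $C(0)\ne0$, each complex exponent $\mu_k$ is either $-1$ or not an integer, and $w^\mu$ is the branch with $-\tfrac{3\pi}2<\arg w<\tfrac\pi2$. Put $$\Phi(\Lambda)=C(0)\,\Lambda^{-\mu_1-\mu_2-2}\,I(\mu_1)I(\mu_2),\qquad I(-1)=2\pi i,\qquad I(\mu)=e^{\pi i(\mu+1)/2}\big(1-e^{-2\pi i\mu}\big)\,\Gamma_E(1+\mu)\quad(\mu\notin\mathbb Z),$$ where $\Gamma_E$ is the Euler Gamma function. Then, as $\Lambda\to+\infty$, $\Phi$ is the leading term of $$\Phi'(\Lambda)=\int_{\tilde\gamma_-}\int_{\tilde\gamma_-}F(w_1,w_2,0)\,e^{i\Lambda(w_1+w_2)}\,dw_1\,dw_2,$$ where $\tilde\gamma_-$ is the contour $t\mapsto t+i(t^2-a)$,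 $-r\le t\le r$, $0<a<r^2$, $r$ small, which passes from left to right below the origin and ends in the upper half-plane; and each representative of the contribution satisfies $$u_{D,\eta,\varepsilon}(\Lambda)\;\sim\;\Phi(\Lambda)\,\exp\Big\{i\Lambda G(\xi^*)+\frac{i\pi}4\operatorname{sign}\beta\Big\}\,\frac{\sqrt{2\pi}\,J}{\sqrt{\Lambda|\beta|}},\qquad J=\left|\det\frac{\partial(\xi_1,\xi_2,\xi_3)}{\partial(w_1,w_2,w_3)}\right|_{w=0}.$$ Here $\sim$ means that the quotient of the two sides tends to $1$. -/

import Mathlib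

open Filter Topology MeasureTheory Asymptotics

noncomputable section

namespace CrossingPhase

/-- Real points, and complex points. -/
abbrev R3 := Fin 3 → ℝ
abbrev C3 := Fin 3 → ℂ

/-- The inclusion of real points into complex points. -/
def toC3 (x : R3) : C3 := fun i => (x i : ℂ)

/-- `f` takes real values at the real points near `x₀`. -/
def RealNear (f : C3 → ℂ) (x₀ : R3) : Prop :=
  ∀ᶠ x in 𝓝 x₀, (f (toC3 x)).im = 0

/-- The scalar product `∇f(x) · v` for a real point `x` and a real vector `v`
(a real number as soon as `f` is real at real points, which is the case in all uses). -/
def gradDot (f : C3 → ℂ) (x v : R3) : ℝ := (fderiv ℂ f (toC3 x) (toC3 v)).re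

/-- `x₀` is a nondegenerate critical point of the restriction of `G` to the line of crossing
of the real surfaces `g₁ = 0` and `g₂ = 0`: along a regular parametrization `c` of that line
the first derivative of `G` vanishes at `x₀` and the second one does not. -/
def IsNondegenerateCriticalOnCrossing (G g₁ g₂ : C3 → ℂ) (x₀ : R3) : Prop :=
  ∃ c : ℝ → R3, ContDiffAt ℝ 2 c 0 ∧ c 0 = x₀ ∧ deriv c 0 ≠ 0 ∧
    (∀ᶠ t in 𝓝 (0 : ℝ), g₁ (toC3 (c t)) = 0 ∧ g₂ (toC3 (c t)) = 0) ∧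
    deriv (fun t => (G (toC3 (c t))).re) 0 = 0 ∧
    deriv (deriv fun t => (G (toC3 (c t))).re) 0 ≠ 0

/-- Normalized coordinates `w = Ψ(ξ)` near `x₀`: a biholomorphic real change of variables with
`w₁ = α₁ g₁`, `w₂ = α₂ g₂` and `G = G(x₀) + w₁ + w₂ + β w₃² / 2 + …`, where the dots stand for
the further terms of the Taylor expansion: those of degree at least two that contain
`w₁` or `w₂`, and powers of `w₃` of degree at least three. (The coordinates `w₁, w₂, w₃`
have the indices `0, 1, 2`.) -/
structure IsNormalizedChart (G g₁ g₂ : C3 → ℂ) (x₀ : R3)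
    (Ψ : OpenPartialHomeomorph C3 C3) (α₁ α₂ β : ℝ) : Prop where
  mem_source : toC3 x₀ ∈ Ψ.source
  map_center : Ψ (toC3 x₀) = 0
  analytic : AnalyticOnNhd ℂ Ψ Ψ.source
  analytic_symm : AnalyticOnNhd ℂ Ψ.symm Ψ.target
  real_iff : ∀ ξ ∈ Ψ.source, (∀ i, (ξ i).im = 0) ↔ (∀ i, (Ψ ξ i).im = 0)
  alpha₁_ne : α₁ ≠ 0
  alpha₂_ne : α₂ ≠ 0
  beta_ne : β ≠ 0
  coord₁ : ∀ ξ ∈ Ψ.source, Ψ ξ 0 = α₁ * g₁ ξ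
  coord₂ : ∀ ξ ∈ Ψ.source, Ψ ξ 1 = α₂ * g₂ ξ
  normal_form :
    (fun w : C3 => G (Ψ.symm w) - (G (toC3 x₀) + w 0 + w 1 + (β : ℂ) / 2 * w 2 ^ 2))
      =O[𝓝 0] fun w => ‖w‖ * (‖w 0‖ + ‖w 1‖) + ‖w 2‖ ^ 3

/-- The point `x + i ε η(x)` of the integration domain over the real point `x`. -/
def shifted (η : R3 → R3) (ε : ℝ) (x : R3) : C3 :=
  toC3 x + (ε * Complex.I : ℂ) • toC3 (η x)

/-- The density, with respect to Lebesgue measure `dx`, of the form `F exp(iΛG) dξ₁ ∧ dξ₂ ∧ dξ₃`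
on the domain `{x + i ε η(x)}`, parametrized by the real parts `x`. -/
def density (F G : C3 → ℂ) (η : R3 → R3) (ε Λ : ℝ) (x : R3) : ℂ :=
  F (shifted η ε x) * Complex.exp (Complex.I * Λ * G (shifted η ε x)) *
    ((1 : Matrix (Fin 3) (Fin 3) ℂ) + (ε * Complex.I : ℂ) •
      (LinearMap.toMatrix' (fderiv ℝ η x).toLinearMap).map Complex.ofReal).det

/-- The integral of `F exp(iΛG) dξ` over the part of `{x + i ε η(x)}` that lies over `D`. -/
def localIntegral (F G : C3 → ℂ) (η : R3 → R3) (ε : ℝ) (D : Set R3) (Λ : ℝ) : ℂ :=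
  ∫ x in D, density F G η ε Λ x

/-- The displacement field `η` at the real point `x` does not touch the singularity `g = 0`:
if `x` lies on the singularity then `η(x) · ∇g(x) ≠ 0`. On a compact set of points `x`
this guarantees that `{x + i ε η(x)}` does not meet `g = 0` for small `ε > 0`. -/
def AvoidsAt (g : C3 → ℂ) (x v : R3) : Prop := g (toC3 x) = 0 → gradDot g x v ≠ 0

/-- Allowed deformation over `closure D` of the displacement field `η₀` into `η₁`: a continuous
family of fields along which the integration domain does not hit either singularity. -/
def AllowedDeformation (g₁ g₂ : C3 → ℂ) (D : Set R3) (η₀ η₁ : R3 → R3) : Prop :=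
  ∃ h : ℝ → R3 → R3,
    ContinuousOn (Function.uncurry h) (Set.Icc (0 : ℝ) 1 ×ˢ closure D) ∧
    (∀ x ∈ closure D, h 0 x = η₀ x) ∧ (∀ x ∈ closure D, h 1 x = η₁ x) ∧
    ∀ τ ∈ Set.Icc (0 : ℝ) 1, ∀ x ∈ closure D, AvoidsAt g₁ x (h τ x) ∧ AvoidsAt g₂ x (h τ x)

/-- The displacement field `η` is desired on `S`: `∇G · η > 0` there. On a compact set of points
`x` this guarantees `Im G(x + i ε η(x)) > 0` for small `ε > 0`, if `G` is real at real points. -/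
def DesiredOn (G : C3 → ℂ) (S : Set R3) (η : R3 → R3) : Prop :=
  ∀ x ∈ S, 0 < gradDot G x (η x)

/-- `η` is a smooth field obtained from `η₀` by an allowed deformation over `closure D`
that is desired except on `K`. -/
structure IsDeformedField (G g₁ g₂ : C3 → ℂ) (η₀ : R3 → R3) (D K : Set R3)
    (η : R3 → R3) : Prop where
  smooth : ContDiff ℝ (⊤ : ℕ∞) η
  allowed : AllowedDeformation g₁ g₂ D η₀ η
  desired : DesiredOn G (closure D \ K) η

/-- A local piece `D` around `x₀`, inside `U`. -/
structure IsLocalPiece (x₀ : R3) (U D : Set R3) : Prop where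
  isOpen : IsOpen D
  mem : x₀ ∈ D
  subset : closure D ⊆ U

/-- The domain `Γ` given by the displacement field `η₀` bypasses above, respectively below, the
singularity `w = 0` near its real point `x₀`, where `w = α g`. -/
def BypassesAbove (α : ℝ) (g : C3 → ℂ) (x₀ : R3) (η₀ : R3 → R3) : Prop :=
  0 < α * gradDot g x₀ (η₀ x₀)

/-- See `BypassesAbove`. -/
def BypassesBelow (α : ℝ) (g : C3 → ℂ) (x₀ : R3) (η₀ : R3 → R3) : Prop :=
  α * gradDot g x₀ (η₀ x₀) < 0

/-- The complex space cut along `{Re g = 0, s · Im g ≤ 0}`, which contains the singularity `g = 0`.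
If `s` has the sign of `η · ∇g` on the real surface `g = 0`, then this is a neighbourhood of the
points `x + i ε η(x)`, `ε > 0` small, on which the branch of a function along `{x + i ε η(x)}`
that ramifies about `g = 0` is single-valued. -/
def sideDomain (g : C3 → ℂ) (s : ℝ) : Set C3 := {ξ | (g ξ).re = 0 → 0 < s * (g ξ).im}

/-- The branch of `w ^ μ` in the plane cut along the positive imaginary axis
(`-3π/2 < arg w < π/2`): it is positive for real `μ` and `w > 0`, and it is continued from there
to `w < 0` below the origin. -/
def powBelow (w μ : ℂ) : ℂ :=
  Complex.exp (μ * (Complex.log (Complex.I * w) - Complex.I * Real.pi / 2))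

/-- The constants `I(μ)`. -/
def Iconst (μ : ℂ) : ℂ :=
  if μ = -1 then 2 * Real.pi * Complex.I
  else Complex.exp (Real.pi * Complex.I * (μ + 1) / 2) *
    (1 - Complex.exp (-(2 * Real.pi * Complex.I * μ))) * Complex.Gamma (1 + μ)

/-- The exponents considered: simple poles and branch points. -/
def IsPoleOrBranchExponent (μ : ℂ) : Prop := μ = -1 ∨ ∀ n : ℤ, μ ≠ n

/-- `Φ(Λ) = C(0) Λ^(-μ₁-μ₂-2) I(μ₁) I(μ₂)`. -/
def Phi (C : ℂ → ℂ) (μ₁ μ₂ : ℂ) (Λ : ℝ) : ℂ :=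
  C 0 * (Λ : ℂ) ^ (-μ₁ - μ₂ - 2) * Iconst μ₁ * Iconst μ₂

/-- The contour `t ↦ t + i (t² - a)`: for `-r ≤ t ≤ r` and `0 < a < r²` it passes from left to
right below the origin, and its ends lie in the upper half-plane. -/
def contourBelow (a t : ℝ) : ℂ := t + Complex.I * (t ^ 2 - a)

/-- `Φ'(Λ)`, the integral of `F(w₁, w₂, 0) exp(iΛ(w₁ + w₂)) dw₁ dw₂` over the square of the
contour that passes below the origin. -/
def PhiPrime (F : C3 → ℂ) (Ψ : OpenPartialHomeomorph C3 C3) (r a Λ : ℝ) : ℂ :=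
  ∫ t₁ in (-r)..r, ∫ t₂ in (-r)..r,
    F (Ψ.symm ![contourBelow a t₁, contourBelow a t₂, 0]) *
      Complex.exp (Complex.I * Λ * (contourBelow a t₁ + contourBelow a t₂)) *
      deriv (contourBelow a) t₁ * deriv (contourBelow a) t₂

/-- The leading term
`Φ(Λ) exp(iΛG(x₀) + (iπ/4) sign β) √(2π) J / √(Λ|β|)`, where `J` is the absolute value of the
Jacobian determinant `∂(ξ₁,ξ₂,ξ₃)/∂(w₁,w₂,w₃)` at `w = 0`. -/
def leadingTerm (G : C3 → ℂ) (x₀ : R3) (Ψ : OpenPartialHomeomorph C3 C3) (β : ℝ)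
    (C : ℂ → ℂ) (μ₁ μ₂ : ℂ) (Λ : ℝ) : ℂ :=
  Phi C μ₁ μ₂ Λ *
    Complex.exp (Complex.I * Λ * G (toC3 x₀) + Complex.I * (Real.pi / 4) * Real.sign β) *
    ((Real.sqrt (2 * Real.pi) * ‖(fderiv ℂ Ψ.symm 0).det‖ / Real.sqrt (Λ * |β|) : ℝ) : ℂ)

end CrossingPhase

end

open CrossingPhase

/-! In normalized coordinates the phase is `G₀ + w₁ + w₂ + β w₃² / 2` up to small terms, so
displacing a real point `y` by `i ε v` raises `Im G` by about `ε (v₁ + v₂ + β y₃ v₃)`. The choice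
`v₃ = sign β · y₃` makes the last term nonnegative, so everything depends on `v₁` and `v₂`, whose
signs on `w₁ = 0` and `w₂ = 0` cannot change along an allowed deformation (`side_of_deformation`).
If one of these signs is positive, a constant vector with `v₁ + v₂ ≥ 1` respects both sides and is
desired on a whole neighbourhood (`IsGoodNbhd.exists_desired_direction`). If both are negative, then
`v₁ + v₂ < 0` at the crossing. The field with `v_k = √(δ² + w_k²) - 2 δ`, however, goes the wrong
way only close to `w_k = 0`, and it is desired off a ball that shrinks with `δ`
(`exists_phase_estimate`, `phase_lower_of_large`).

Representatives are compared by Cauchy's theorem for three-dimensional chains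
(`chainIntegral_eq_of_homotopy`); there is no boundary term because the homotopies are constant off
a compact set. After the change of variables, `IsGoodNbhd.eventually_deform` replaces any
representative by a chain that is displaced along a chosen field wherever needed, stays in the cut
domain, and has `Im G` bounded below off a prescribed set. For the constant field this set is empty,
and exponential decay follows.

When both singularities are bypassed below, the chain is deformed once more near the crossing, from
the fixed scale `δ₀` to the scale `δ = 1 / Λ` (`tendsto_below`). In the transition zone the
integrand grows at most like a power of `Λ` times an exponentially small factor. On the inner ball
the scaling `w₁, w₂ ~ Λ⁻¹`, `w₃ ~ Λ^(-1/2)` turns the chain into a fixed one, and dominated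
convergence gives a product of two Hankel integrals and a Gaussian integral (`tendsto_inner`). The
Hankel integrals satisfy a recurrence in the exponent, which implies their homogeneity. They are
computed by collapsing the curve to two rays if `Re μ ≥ 0`, by the recurrence for other non-integral
exponents, and by continuity at `μ = -1` (`hankel_eq_Iconst`).

The same scaling in two variables gives the asymptotics of `Φ'`, once the parabolic contour has been
replaced by a dip curve with the same ends (`isEquivalent_PhiPrime`). Normalized coordinates come
from Lagrange multipliers on the crossing line and the inverse function theorem
(`exists_isNormalizedChart`). -/

noncomputable section
namespace CrossingPhase

/-! ### Cauchy's theorem for three-dimensional chains in `ℂ³` -/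

/-- The determinant of three columns in `ℂ³`. -/
def det3 (a b c : C3) : ℂ :=
  a 0 * (b 1 * c 2 - c 1 * b 2) - b 0 * (a 1 * c 2 - c 1 * a 2) + c 0 * (a 1 * b 2 - b 1 * a 2)

/-- The partial derivative of a map of real points in the direction of a coordinate. -/
def pderiv (φ : R3 → C3) (j : Fin 3) (x : R3) : C3 := fderiv ℝ φ x (Pi.single j 1)

/-- The Jacobian of a chain `φ` of real dimension three in `ℂ³`. -/
def chainDet (φ : R3 → C3) (x : R3) : ℂ := det3 (pderiv φ 0 x) (pderiv φ 1 x) (pderiv φ 2 x)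

theorem hasDerivAt_det3 {a b c : ℝ → C3} {a' b' c' : C3} {t : ℝ} (ha : HasDerivAt a a' t)
    (hb : HasDerivAt b b' t) (hc : HasDerivAt c c' t) :
    HasDerivAt (fun s => det3 (a s) (b s) (c s))
      (det3 a' (b t) (c t) + det3 (a t) b' (c t) + det3 (a t) (b t) c') t := by
  rw [hasDerivAt_pi] at ha hb hc
  unfold det3
  refine ((((ha 0).mul (((hb 1).mul (hc 2)).sub ((hc 1).mul (hb 2)))).sub
    ((hb 0).mul (((ha 1).mul (hc 2)).sub ((hc 1).mul (ha 2))))).add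
    ((hc 0).mul (((ha 1).mul (hb 2)).sub ((hb 1).mul (ha 2))))).congr_deriv ?_
  simp only [Pi.mul_apply, Pi.sub_apply]
  ring

theorem ContinuousOn.det3 {X : Type*} [TopologicalSpace X] {s : Set X} {a b c : X → C3}
    (ha : ContinuousOn a s) (hb : ContinuousOn b s) (hc : ContinuousOn c s) :
    ContinuousOn (fun x => det3 (a x) (b x) (c x)) s := by
  unfold CrossingPhase.det3
  rw [continuousOn_pi] at ha hb hc
  exact (((ha 0).mul (((hb 1).mul (hc 2)).sub ((hc 1).mul (hb 2)))).sub
    ((hb 0).mul (((ha 1).mul (hc 2)).sub ((hc 1).mul (ha 2))))).add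
    ((hc 0).mul (((ha 1).mul (hb 2)).sub ((hb 1).mul (ha 2))))

/-- Cramer's rule: four vectors of `ℂ³` are linearly dependent, with determinants as coefficients.
This relation lets the term `df(v) det(∂φ)` of the variation be distributed over the three
coordinate directions, and so become part of a divergence. -/
theorem linearMap_mul_det3 (L : C3 →L[ℂ] ℂ) (v a b c : C3) :
    L v * det3 a b c = L a * det3 v b c + L b * det3 a v c + L c * det3 a b v := by
  have h : ∀ u : C3, L u = u 0 * L (Pi.single 0 1) + u 1 * L (Pi.single 1 1)
      + u 2 * L (Pi.single 2 1) := by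
    intro u
    have : u = u 0 • Pi.single 0 1 + u 1 • Pi.single 1 1 + u 2 • Pi.single 2 1 := by
      ext i; fin_cases i <;> simp
    conv_lhs => rw [this]
    simp
  rw [h v, h a, h b, h c]
  unfold det3
  ring

/-- A continuous function on an open set that vanishes off a compact subset extends by zero. -/
theorem continuous_indicator_of_eq_zero_off_compact {E : Type*} [NormedAddCommGroup E]
    {D K : Set R3} {g : R3 → E}
    (hD : IsOpen D) (hK : IsCompact K) (hKD : K ⊆ D) (hg : ContinuousOn g D)
    (h0 : ∀ x ∈ D, x ∉ K → g x = 0) : Continuous (D.indicator g) := by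
  rw [continuous_iff_continuousAt]
  intro x
  by_cases hx : x ∈ D
  · refine (hg.continuousAt (hD.mem_nhds hx)).congr ?_
    filter_upwards [hD.mem_nhds hx] with y hy
    simp [hy]
  · have : x ∈ Kᶜ := fun h => hx (hKD h)
    refine (continuousAt_const (y := (0 : E))).congr ?_
    filter_upwards [hK.isClosed.isOpen_compl.mem_nhds this] with y hy
    by_cases hyD : y ∈ D
    · simp [hyD, h0 y hyD hy]
    · simp [hyD]

theorem integrable_indicator_of_eq_zero_off_compact
    {D K : Set R3} {g : R3 → ℂ}
    (hD : IsOpen D) (hK : IsCompact K) (hKD : K ⊆ D) (hg : ContinuousOn g D)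
    (h0 : ∀ x ∈ D, x ∉ K → g x = 0) : Integrable (D.indicator g) := by
  refine (continuous_indicator_of_eq_zero_off_compact hD hK hKD hg h0).integrable_of_hasCompactSupport
    (HasCompactSupport.intro hK ?_)
  intro x hx
  by_cases hxD : x ∈ D
  · simp [hxD, h0 x hxD hx]
  · simp [hxD]

/-- The integral of a derivative of a compactly supported function vanishes. -/
theorem integral_lineDeriv_eq_zero_of_compact {D K : Set R3} {V V' : R3 → ℂ} {e : R3}
    (hD : IsOpen D) (hK : IsCompact K) (hKD : K ⊆ D)
    (hV : ContinuousOn V D) (hV' : ContinuousOn V' D)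
    (h0 : ∀ x ∈ D, x ∉ K → V x = 0) (h0' : ∀ x ∈ D, x ∉ K → V' x = 0)
    (hd : ∀ x ∈ D, HasLineDerivAt ℝ V (V' x) x e) :
    ∫ x in D, V' x = 0 := by
  have hI := integrable_indicator_of_eq_zero_off_compact hD hK hKD hV h0
  have hI' := integrable_indicator_of_eq_zero_off_compact hD hK hKD hV' h0'
  rw [← integral_indicator hD.measurableSet]
  -- Integration by parts against the constant function `1`, after extension by zero to the whole
  -- space.
  have key := integral_bilinear_hasLineDerivAt_right_eq_neg_left_of_integrable
    (μ := (volume : Measure R3)) (f := fun _ => (1 : ℂ)) (f' := fun _ => (0 : ℂ))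
    (g := D.indicator V) (g' := D.indicator V') (v := e) (B := ContinuousLinearMap.mul ℝ ℂ)
    (by simp) (by simpa using hI') (by simpa using hI)
    (fun x _ => by
      simpa [HasLineDerivAt] using hasDerivAt_const (0 : ℝ) (1 : ℂ))
    (fun x _ => by
      by_cases hx : x ∈ D
      · have : D.indicator V =ᶠ[𝓝 x] V := by
          filter_upwards [hD.mem_nhds hx] with y hy
          simp [hy]
        rw [Set.indicator_of_mem hx]
        exact (this.hasLineDerivAt_iff).2 (hd x hx)
      · have hxK : x ∈ Kᶜ := fun h => hx (hKD h)
        have : D.indicator V =ᶠ[𝓝 x] fun _ => 0 := by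
          filter_upwards [hK.isClosed.isOpen_compl.mem_nhds hxK] with y hy
          by_cases hyD : y ∈ D
          · simp [hyD, h0 y hyD hy]
          · simp [hyD]
        rw [Set.indicator_of_notMem hx]
        refine (this.hasLineDerivAt_iff).2 ?_
        simpa [HasLineDerivAt] using hasDerivAt_const (0 : ℝ) (0 : ℂ))
  simpa using key


theorem hasLineDerivAt_curve {E : Type*} [NormedAddCommGroup E] [NormedSpace ℝ E] {φ : R3 → E} {x : R3}
    (h : DifferentiableAt ℝ φ x) (e : R3) :
    HasDerivAt (fun s : ℝ => φ (x + s • e)) (fderiv ℝ φ x e) 0 := h.hasFDerivAt.hasLineDerivAt e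

theorem pderiv_differentiableAt {φ : R3 → C3} {x : R3} (h : ContDiffAt ℝ 2 φ x) (j : Fin 3) :
    DifferentiableAt ℝ (pderiv φ j) x :=
  ((h.fderiv_right (m := 1) (by norm_num)).differentiableAt (by norm_num)).clm_apply
    (differentiableAt_const _)

theorem pderiv_comm {φ : R3 → C3} {x : R3} (h : ContDiffAt ℝ 2 φ x) (j k : Fin 3) :
    fderiv ℝ (pderiv φ j) x (Pi.single k 1) = fderiv ℝ (pderiv φ k) x (Pi.single j 1) := by
  have hd : DifferentiableAt ℝ (fderiv ℝ φ) x :=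
    (h.fderiv_right (m := 1) (by norm_num)).differentiableAt (by norm_num)
  have hs := h.isSymmSndFDerivAt (by simp)
  have e : ∀ i l : Fin 3, fderiv ℝ (pderiv φ i) x (Pi.single l 1)
      = fderiv ℝ (fderiv ℝ φ) x (Pi.single l 1) (Pi.single i 1) := by
    intro i l
    unfold pderiv
    rw [fderiv_clm_apply hd (differentiableAt_const _)]
    simp
  rw [e, e]
  exact hs _ _

theorem continuousOn_pderiv {φ : R3 → C3} {D : Set R3} (h : ∀ x ∈ D, ContDiffAt ℝ 1 φ x)
    (j : Fin 3) : ContinuousOn (pderiv φ j) D := fun x hx =>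
  (((h x hx).fderiv_right (m := 0) (by norm_num)).continuousAt.clm_apply
    continuousAt_const).continuousWithinAt

/-- The variation of the integrand `f(φ) chainDet φ` in the direction of a field `v`. -/
def variation (f : C3 → ℂ) (φ v : R3 → C3) (x : R3) : ℂ :=
  fderiv ℂ f (φ x) (v x) * chainDet φ x + f (φ x) *
    (det3 (pderiv v 0 x) (pderiv φ 1 x) (pderiv φ 2 x) +
      det3 (pderiv φ 0 x) (pderiv v 1 x) (pderiv φ 2 x) +
      det3 (pderiv φ 0 x) (pderiv φ 1 x) (pderiv v 2 x))

theorem pderiv_eq_zero_off {D K : Set R3} {v : R3 → C3} (hD : IsOpen D) (hK : IsCompact K)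
    (hv0 : ∀ x ∈ D, x ∉ K → v x = 0) (j : Fin 3) : ∀ x ∈ D, x ∉ K → pderiv v j x = 0 := by
  intro x hx hxK
  have : v =ᶠ[𝓝 x] fun _ => 0 := by
    filter_upwards [hD.mem_nhds hx, hK.isClosed.isOpen_compl.mem_nhds hxK] with y hy hy'
      using hv0 y hy hy'
  simp [pderiv, this.fderiv_eq]

/-- The variation is a divergence, so its integral vanishes. -/
theorem integral_variation_eq_zero {D K : Set R3} {f : C3 → ℂ} {W : Set C3} {φ v : R3 → C3}
    (hD : IsOpen D) (hK : IsCompact K) (hKD : K ⊆ D) (hf : AnalyticOnNhd ℂ f W)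
    (hφ : ∀ x ∈ D, ContDiffAt ℝ 2 φ x) (hv : ∀ x ∈ D, ContDiffAt ℝ 2 v x)
    (hv0 : ∀ x ∈ D, x ∉ K → v x = 0) (hW : ∀ x ∈ D, φ x ∈ W) :
    ∫ x in D, variation f φ v x = 0 := by
  have hφd : ∀ x ∈ D, DifferentiableAt ℝ φ x := fun x hx => (hφ x hx).differentiableAt (by norm_num)
  have hvd : ∀ x ∈ D, DifferentiableAt ℝ v x := fun x hx => (hv x hx).differentiableAt (by norm_num)
  have cφ : ContinuousOn φ D := fun x hx => (hφd x hx).continuousAt.continuousWithinAt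
  have cv : ContinuousOn v D := fun x hx => (hvd x hx).continuousAt.continuousWithinAt
  have cp : ∀ j, ContinuousOn (pderiv φ j) D :=
    continuousOn_pderiv fun x hx => (hφ x hx).of_le (by norm_num)
  have cpv : ∀ j, ContinuousOn (pderiv v j) D :=
    continuousOn_pderiv fun x hx => (hv x hx).of_le (by norm_num)
  have cpp : ∀ j k : Fin 3,
      ContinuousOn (fun x => fderiv ℝ (pderiv φ j) x (Pi.single k 1)) D := by
    intro j k x hx
    have : ContDiffAt ℝ 1 (pderiv φ j) x :=
      ((hφ x hx).fderiv_right (m := 1) (by norm_num)).clm_apply contDiffAt_const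
    exact ((this.fderiv_right (m := 0) (by norm_num)).continuousAt.clm_apply
      continuousAt_const).continuousWithinAt
  have cf : ContinuousOn (fun x => f (φ x)) D := hf.continuousOn.comp cφ hW
  have cf' : ContinuousOn (fun x => fderiv ℂ f (φ x)) D := hf.fderiv.continuousOn.comp cφ hW
  have cfa : ∀ j, ContinuousOn (fun x => fderiv ℂ f (φ x) (pderiv φ j x)) D := fun j =>
    cf'.clm_apply (cp j)
  have hfl : ∀ x ∈ D, ∀ e : R3,
      HasDerivAt (fun s : ℝ => f (φ (x + s • e))) (fderiv ℂ f (φ x) (fderiv ℝ φ x e)) 0 := by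
    intro x hx e
    have h1 : HasFDerivAt f ((fderiv ℂ f (φ x)).restrictScalars ℝ) (φ (x + (0 : ℝ) • e)) := by
      simpa using ((hf _ (hW x hx)).differentiableAt.hasFDerivAt).restrictScalars ℝ
    exact h1.comp_hasDerivAt (0 : ℝ) (hasLineDerivAt_curve (hφd x hx) e)
  have pz := pderiv_eq_zero_off hD hK hv0
  set S : Fin 3 → Fin 3 → R3 → C3 := fun j k x => fderiv ℝ (pderiv φ j) x (Pi.single k 1) with hS
  have dp : ∀ x ∈ D, ∀ j k : Fin 3,
      HasDerivAt (fun s : ℝ => pderiv φ j (x + s • Pi.single k 1)) (S j k x) 0 :=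
    fun x hx j k => hasLineDerivAt_curve (pderiv_differentiableAt (hφ x hx) j) _
  have dv : ∀ x ∈ D, ∀ k : Fin 3,
      HasDerivAt (fun s : ℝ => v (x + s • Pi.single k 1)) (pderiv v k x) 0 :=
    fun x hx k => hasLineDerivAt_curve (hvd x hx) _
  -- `T0`, `T1`, `T2` are the derivatives, each in its own coordinate direction, of `f(φ)` times the
  -- Jacobian with one column replaced by `v`. Each has integral zero, so it remains to see that
  -- they add up to the variation.
  set T0 : R3 → ℂ := fun x => fderiv ℂ f (φ x) (pderiv φ 0 x) * det3 (v x) (pderiv φ 1 x) (pderiv φ 2 x)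
    + f (φ x) * (det3 (pderiv v 0 x) (pderiv φ 1 x) (pderiv φ 2 x)
      + det3 (v x) (S 1 0 x) (pderiv φ 2 x) + det3 (v x) (pderiv φ 1 x) (S 2 0 x)) with hT0
  set T1 : R3 → ℂ := fun x => fderiv ℂ f (φ x) (pderiv φ 1 x) * det3 (pderiv φ 0 x) (v x) (pderiv φ 2 x)
    + f (φ x) * (det3 (S 0 1 x) (v x) (pderiv φ 2 x)
      + det3 (pderiv φ 0 x) (pderiv v 1 x) (pderiv φ 2 x)
      + det3 (pderiv φ 0 x) (v x) (S 2 1 x)) with hT1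
  set T2 : R3 → ℂ := fun x => fderiv ℂ f (φ x) (pderiv φ 2 x) * det3 (pderiv φ 0 x) (pderiv φ 1 x) (v x)
    + f (φ x) * (det3 (S 0 2 x) (pderiv φ 1 x) (v x)
      + det3 (pderiv φ 0 x) (S 1 2 x) (v x)
      + det3 (pderiv φ 0 x) (pderiv φ 1 x) (pderiv v 2 x)) with hT2
  have c0 : ContinuousOn T0 D := ((cfa 0).mul (cv.det3 (cp 1) (cp 2))).add (cf.mul
    ((((cpv 0).det3 (cp 1) (cp 2)).add (cv.det3 (cpp 1 0) (cp 2))).add (cv.det3 (cp 1) (cpp 2 0))))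
  have c1 : ContinuousOn T1 D := ((cfa 1).mul ((cp 0).det3 cv (cp 2))).add (cf.mul
    ((((cpp 0 1).det3 cv (cp 2)).add ((cp 0).det3 (cpv 1) (cp 2))).add ((cp 0).det3 cv (cpp 2 1))))
  have c2 : ContinuousOn T2 D := ((cfa 2).mul ((cp 0).det3 (cp 1) cv)).add (cf.mul
    ((((cpp 0 2).det3 (cp 1) cv).add ((cp 0).det3 (cpp 1 2) cv)).add ((cp 0).det3 (cp 1) (cpv 2))))
  have z0 : ∀ x ∈ D, x ∉ K → T0 x = 0 := fun x hx hxK => by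
    simp [hT0, hv0 x hx hxK, pz 0 x hx hxK, det3]
  have z1 : ∀ x ∈ D, x ∉ K → T1 x = 0 := fun x hx hxK => by
    simp [hT1, hv0 x hx hxK, pz 1 x hx hxK, det3]
  have z2 : ∀ x ∈ D, x ∉ K → T2 x = 0 := fun x hx hxK => by
    simp [hT2, hv0 x hx hxK, pz 2 x hx hxK, det3]
  have i0 : ∫ x in D, T0 x = 0 :=
    integral_lineDeriv_eq_zero_of_compact (e := Pi.single 0 1) hD hK hKD
      (V := fun x => f (φ x) * det3 (v x) (pderiv φ 1 x) (pderiv φ 2 x))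
      (cf.mul (cv.det3 (cp 1) (cp 2))) c0
      (fun x hx hxK => by simp [hv0 x hx hxK, det3]) z0 (fun x hx => by
        have := (hfl x hx (Pi.single 0 1)).mul (hasDerivAt_det3 (dv x hx 0) (dp x hx 1 0) (dp x hx 2 0))
        simpa [HasLineDerivAt, hT0, pderiv] using! this)
  have i1 : ∫ x in D, T1 x = 0 :=
    integral_lineDeriv_eq_zero_of_compact (e := Pi.single 1 1) hD hK hKD
      (V := fun x => f (φ x) * det3 (pderiv φ 0 x) (v x) (pderiv φ 2 x))
      (cf.mul ((cp 0).det3 cv (cp 2))) c1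
      (fun x hx hxK => by simp [hv0 x hx hxK, det3]) z1 (fun x hx => by
        have := (hfl x hx (Pi.single 1 1)).mul (hasDerivAt_det3 (dp x hx 0 1) (dv x hx 1) (dp x hx 2 1))
        simpa [HasLineDerivAt, hT1, pderiv] using! this)
  have i2 : ∫ x in D, T2 x = 0 :=
    integral_lineDeriv_eq_zero_of_compact (e := Pi.single 2 1) hD hK hKD
      (V := fun x => f (φ x) * det3 (pderiv φ 0 x) (pderiv φ 1 x) (v x))
      (cf.mul ((cp 0).det3 (cp 1) cv)) c2
      (fun x hx hxK => by simp [hv0 x hx hxK, det3]) z2 (fun x hx => by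
        have := (hfl x hx (Pi.single 2 1)).mul (hasDerivAt_det3 (dp x hx 0 2) (dp x hx 1 2) (dv x hx 2))
        simpa [HasLineDerivAt, hT2, pderiv] using! this)
  have int : ∀ {T : R3 → ℂ}, ContinuousOn T D → (∀ x ∈ D, x ∉ K → T x = 0) → IntegrableOn T D :=
    fun hc hz => (integrable_indicator_iff hD.measurableSet).1
      (integrable_indicator_of_eq_zero_off_compact hD hK hKD hc hz)
  have hsum : ∫ x in D, variation f φ v x = ∫ x in D, (T0 x + T1 x + T2 x) := by
    refine setIntegral_congr_fun hD.measurableSet fun x hx => ?_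
    -- The mixed second derivatives occur in pairs with opposite signs, because the determinant is
    -- alternating.
    have s1 : S 1 0 x = S 0 1 x := pderiv_comm (hφ x hx) 1 0
    have s2 : S 2 0 x = S 0 2 x := pderiv_comm (hφ x hx) 2 0
    have s3 : S 2 1 x = S 1 2 x := pderiv_comm (hφ x hx) 2 1
    have hL := linearMap_mul_det3 (fderiv ℂ f (φ x)) (v x) (pderiv φ 0 x) (pderiv φ 1 x)
      (pderiv φ 2 x)
    simp only [hT0, hT1, hT2, variation, chainDet, s1, s2, s3]
    rw [hL]
    unfold det3
    ring
  have h01 : IntegrableOn (fun x => T0 x + T1 x) D := (int c0 z0).add (int c1 z1)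
  rw [hsum, integral_add h01 (int c2 z2), integral_add (int c0 z0) (int c1 z1), i0, i1, i2]
  simp

/-- Cauchy's theorem for chains: the integral of `f dw₁ ∧ dw₂ ∧ dw₃` does not change along a
linear homotopy of chains with fixed values off a compact set. -/
theorem chainIntegral_eq_of_homotopy {D K : Set R3} {f : C3 → ℂ} {W : Set C3} {φ₀ φ₁ : R3 → C3}
    (hD : IsOpen D) (hK : IsCompact K) (hKD : K ⊆ D) (hf : AnalyticOnNhd ℂ f W)
    (h₀ : ∀ x ∈ D, ContDiffAt ℝ 2 φ₀ x) (h₁ : ∀ x ∈ D, ContDiffAt ℝ 2 φ₁ x)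
    (heq : ∀ x ∈ D, x ∉ K → φ₁ x = φ₀ x)
    (hW : ∀ t ∈ Set.Icc (0 : ℝ) 1, ∀ x ∈ D, φ₀ x + t • (φ₁ x - φ₀ x) ∈ W)
    (hint : IntegrableOn (fun x => f (φ₀ x) * chainDet φ₀ x) D) :
    IntegrableOn (fun x => f (φ₁ x) * chainDet φ₁ x) D ∧
    ∫ x in D, f (φ₁ x) * chainDet φ₁ x = ∫ x in D, f (φ₀ x) * chainDet φ₀ x := by
  set v : R3 → C3 := fun x => φ₁ x - φ₀ x with hvdef
  set φ : ℝ → R3 → C3 := fun t x => φ₀ x + t • v x with hφdef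
  have hv : ∀ x ∈ D, ContDiffAt ℝ 2 v x := fun x hx => (h₁ x hx).sub (h₀ x hx)
  have hφ : ∀ t, ∀ x ∈ D, ContDiffAt ℝ 2 (φ t) x := fun t x hx =>
    (h₀ x hx).add ((hv x hx).const_smul t)
  have hv0 : ∀ x ∈ D, x ∉ K → v x = 0 := fun x hx hxK => by simp [hvdef, heq x hx hxK]
  have hd0 : ∀ x ∈ D, DifferentiableAt ℝ φ₀ x := fun x hx => (h₀ x hx).differentiableAt (by norm_num)
  have hdv : ∀ x ∈ D, DifferentiableAt ℝ v x := fun x hx => (hv x hx).differentiableAt (by norm_num)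
  have hpd : ∀ t, ∀ x ∈ D, ∀ j, pderiv (φ t) j x = pderiv φ₀ j x + t • pderiv v j x := by
    intro t x hx j
    have := (hd0 x hx).hasFDerivAt.add ((hdv x hx).hasFDerivAt.const_smul t)
    have e : fderiv ℝ (φ t) x = _ := this.fderiv
    simp [pderiv, e]
  have c0 : ContinuousOn φ₀ D := fun x hx => (hd0 x hx).continuousAt.continuousWithinAt
  have cv : ContinuousOn v D := fun x hx => (hdv x hx).continuousAt.continuousWithinAt
  have cp : ∀ j, ContinuousOn (pderiv φ₀ j) D :=
    continuousOn_pderiv fun x hx => (h₀ x hx).of_le (by norm_num)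
  have cpv : ∀ j, ContinuousOn (pderiv v j) D :=
    continuousOn_pderiv fun x hx => (hv x hx).of_le (by norm_num)
  -- the explicit variation, as a function of `(t, x)`
  set P : Fin 3 → ℝ × R3 → C3 := fun j p => pderiv φ₀ j p.2 + p.1 • pderiv v j p.2 with hP
  set T : ℝ × R3 → ℂ := fun p => fderiv ℂ f (φ p.1 p.2) (v p.2) * det3 (P 0 p) (P 1 p) (P 2 p) +
    f (φ p.1 p.2) * (det3 (pderiv v 0 p.2) (P 1 p) (P 2 p) + det3 (P 0 p) (pderiv v 1 p.2) (P 2 p)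
      + det3 (P 0 p) (P 1 p) (pderiv v 2 p.2)) with hT
  have hTvar : ∀ t, ∀ x ∈ D, T (t, x) = variation f (φ t) v x := by
    intro t x hx
    simp only [hT, hP, variation, chainDet, hpd t x hx]
  set ID : Set (ℝ × R3) := Set.Icc (0 : ℝ) 1 ×ˢ D with hID
  have snd : Set.MapsTo Prod.snd ID D := fun p hp => hp.2
  have cs : ∀ {u : R3 → C3}, ContinuousOn u D → ContinuousOn (fun p : ℝ × R3 => u p.2) ID :=
    fun hu => hu.comp continuousOn_snd snd
  have cφ : ContinuousOn (fun p : ℝ × R3 => φ p.1 p.2) ID :=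
    (cs c0).add (continuousOn_fst.smul (cs cv))
  have mφ : Set.MapsTo (fun p : ℝ × R3 => φ p.1 p.2) ID W := fun p hp => hW p.1 hp.1 p.2 hp.2
  have cP : ∀ j, ContinuousOn (P j) ID := fun j => (cs (cp j)).add (continuousOn_fst.smul (cs (cpv j)))
  have cT : ContinuousOn T ID :=
    (((hf.fderiv.continuousOn.comp cφ mφ).clm_apply (cs cv)).mul ((cP 0).det3 (cP 1) (cP 2))).add
    ((hf.continuousOn.comp cφ mφ).mul ((((cs (cpv 0)).det3 (cP 1) (cP 2)).add
      ((cP 0).det3 (cs (cpv 1)) (cP 2))).add ((cP 0).det3 (cP 1) (cs (cpv 2)))))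
  -- the fundamental theorem of calculus in `t`
  have hFTC : ∀ x ∈ D, ∫ t in (0 : ℝ)..1, T (t, x)
      = f (φ₁ x) * chainDet φ₁ x - f (φ₀ x) * chainDet φ₀ x := by
    intro x hx
    have hder : ∀ t ∈ Set.uIcc (0 : ℝ) 1, HasDerivAt
        (fun t : ℝ => f (φ t x) * det3 (P 0 (t, x)) (P 1 (t, x)) (P 2 (t, x))) (T (t, x)) t := by
      intro t ht
      rw [Set.uIcc_of_le zero_le_one] at ht
      have h1 : HasDerivAt (fun t : ℝ => φ t x) (v x) t := by
        have := ((hasDerivAt_id t).smul_const (v x)).const_add (φ₀ x)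
        rw [one_smul] at this
        exact this
      have h2 : ∀ j, HasDerivAt (fun t : ℝ => P j (t, x)) (pderiv v j x) t := by
        intro j
        have := ((hasDerivAt_id t).smul_const (pderiv v j x)).const_add (pderiv φ₀ j x)
        rw [one_smul] at this
        exact this
      have h3 := ((hf _ (hW t ht x hx)).differentiableAt.hasFDerivAt.restrictScalars ℝ).comp_hasDerivAt
        t h1
      exact h3.mul (hasDerivAt_det3 (h2 0) (h2 1) (h2 2))
    rw [intervalIntegral.integral_eq_sub_of_hasDerivAt hder]
    · have e1 : ∀ j, P j (1, x) = pderiv φ₁ j x := by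
        intro j
        have : φ 1 = φ₁ := by ext1 y; simp [hφdef, hvdef]
        rw [← this, hpd 1 x hx j]
      have e0 : ∀ j, P j (0, x) = pderiv φ₀ j x := by intro j; simp [hP]
      simp only [e1, e0]
      simp [hφdef, hvdef, chainDet]
    · refine ContinuousOn.intervalIntegrable ?_
      rw [Set.uIcc_of_le zero_le_one]
      exact cT.comp (by fun_prop) fun t ht => ⟨ht, hx⟩
  have pz := pderiv_eq_zero_off hD hK hv0
  have hTz : ∀ t, ∀ x ∈ D, x ∉ K → T (t, x) = 0 := by
    intro t x hx hxK
    simp [hT, hv0 x hx hxK, pz _ x hx hxK, det3]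
  -- The variation vanishes where the homotopy is constant; the fundamental theorem of calculus
  -- transfers this to the difference of the two integrands.
  have hdiff : ∀ x ∈ D, x ∉ K → f (φ₁ x) * chainDet φ₁ x - f (φ₀ x) * chainDet φ₀ x = 0 := by
    intro x hx hxK
    rw [← hFTC x hx]
    simp [hTz _ x hx hxK]
  have hcd : ∀ {ψ : R3 → C3}, (∀ x ∈ D, ContDiffAt ℝ 2 ψ x) → (∀ x ∈ D, ψ x ∈ W) →
      ContinuousOn (fun x => f (ψ x) * chainDet ψ x) D := by
    intro ψ hψ hψW
    have cq : ∀ j, ContinuousOn (pderiv ψ j) D :=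
      continuousOn_pderiv fun x hx => (hψ x hx).of_le (by norm_num)
    exact (hf.continuousOn.comp (fun x hx => (hψ x hx).continuousAt.continuousWithinAt) hψW).mul
      ((cq 0).det3 (cq 1) (cq 2))
  -- On the open set `D` the individual integrands need not be integrable, but their difference is
  -- supported in `K`. Hence integrability for `φ₀` is a hypothesis and integrability for `φ₁` is a
  -- conclusion.
  have hdint : IntegrableOn
      (fun x => f (φ₁ x) * chainDet φ₁ x - f (φ₀ x) * chainDet φ₀ x) D := by
    refine (integrable_indicator_iff hD.measurableSet).1
      (integrable_indicator_of_eq_zero_off_compact hD hK hKD ?_ hdiff)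
    exact (hcd h₁ fun x hx => by simpa using hW 1 (by simp) x hx).sub
      (hcd h₀ fun x hx => by simpa using hW 0 (by simp) x hx)
  have hint1 : IntegrableOn (fun x => f (φ₁ x) * chainDet φ₁ x) D := by
    refine (hdint.add hint).congr_fun (fun x _ => ?_) hD.measurableSet
    simp
  refine ⟨hint1, ?_⟩
  rw [← sub_eq_zero, ← integral_sub hint1 hint]
  have hDK : ∀ {g : R3 → ℂ}, (∀ x ∈ D, x ∉ K → g x = 0) → ∫ x in D, g x = ∫ x in K, g x := by
    intro g hg
    exact (setIntegral_eq_of_subset_of_forall_sdiff_eq_zero hD.measurableSet hKD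
      fun x hx => hg x hx.1 hx.2)
  rw [hDK hdiff]
  have h1 : ∫ x in K, (f (φ₁ x) * chainDet φ₁ x - f (φ₀ x) * chainDet φ₀ x)
      = ∫ x in K, ∫ t in (0 : ℝ)..1, T (t, x) :=
    setIntegral_congr_fun hK.measurableSet fun x hx => (hFTC x (hKD hx)).symm
  rw [h1, ← intervalIntegral_integral_swap (f := fun t x => T (t, x))]
  · rw [intervalIntegral.integral_congr (g := fun _ => (0 : ℂ))]
    · simp
    intro t ht
    rw [Set.uIcc_of_le zero_le_one] at ht
    simp only
    rw [← hDK (hTz t), setIntegral_congr_fun hD.measurableSet (fun x hx => hTvar t x hx)]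
    exact integral_variation_eq_zero hD hK hKD hf (hφ t) hv hv0 (hW t ht)
  -- Fubini's theorem is applied on the compact set `[0, 1] × K` only, where continuity of `T`
  -- suffices.
  · have : IntegrableOn T (Set.Icc (0 : ℝ) 1 ×ˢ K) (volume.prod volume) :=
      (cT.mono (Set.prod_mono_right hKD)).integrableOn_compact (isCompact_Icc.prod hK)
    rw [Set.uIoc_of_le zero_le_one]
    have h2 := this.mono_set (Set.prod_mono_left (t := K) Set.Ioc_subset_Icc_self)
    rw [IntegrableOn, ← Measure.prod_restrict] at h2
    exact h2


/-! ### Growth of the imaginary part of a phase in normal form -/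

/-- The further terms of the Taylor expansion of a phase with the given normal form. -/
def remainder (G : C3 → ℂ) (G₀ : ℂ) (β : ℝ) (w : C3) : ℂ :=
  G w - (G₀ + w 0 + w 1 + (β : ℂ) / 2 * w 2 ^ 2)

theorem norm_decomp (w : C3) : ‖w‖ ≤ ‖w 0‖ + ‖w 1‖ + ‖w 2‖ := by
  rw [pi_norm_le_iff_of_nonneg (by positivity)]
  intro i
  have := norm_nonneg (w 0)
  have := norm_nonneg (w 1)
  have := norm_nonneg (w 2)
  fin_cases i <;> simp <;> linarith

theorem hasFDerivAt_quadratic (G₀ : ℂ) (β : ℝ) (w : C3) :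
    HasFDerivAt (fun w : C3 => G₀ + w 0 + w 1 + (β : ℂ) / 2 * w 2 ^ 2)
      ((ContinuousLinearMap.proj 0 : C3 →L[ℂ] ℂ) + (ContinuousLinearMap.proj 1 : C3 →L[ℂ] ℂ)
        + ((β : ℂ) * w 2) • (ContinuousLinearMap.proj 2 : C3 →L[ℂ] ℂ)) w := by
  have p : ∀ i : Fin 3, HasFDerivAt (fun w : C3 => w i) (ContinuousLinearMap.proj i : C3 →L[ℂ] ℂ) w :=
    fun i => (ContinuousLinearMap.proj i : C3 →L[ℂ] ℂ).hasFDerivAt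
  have := (((p 0).const_add G₀).add (p 1)).add (((p 2).pow 2).const_mul ((β : ℂ) / 2))
  refine this.congr_fderiv ?_
  ext v
  simp
  ring

/-- The normal form bounds the derivative of the further terms. -/
theorem exists_fderiv_remainder_le {G : C3 → ℂ} {G₀ : ℂ} {β : ℝ} (hG : AnalyticAt ℂ G 0)
    (hnf : remainder G G₀ β =O[𝓝 0] fun w => ‖w‖ * (‖w 0‖ + ‖w 1‖) + ‖w 2‖ ^ 3) :
    ∃ A > 0, ∃ r > 0, ∀ w : C3, ‖w‖ < r → AnalyticAt ℂ G w ∧ ∀ v : C3,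
      ‖fderiv ℂ (remainder G G₀ β) w v‖ ≤
        A * (‖w‖ * (‖v 0‖ + ‖v 1‖) + (‖w 0‖ + ‖w 1‖ + ‖w 2‖ ^ 2) * ‖v 2‖) := by
  set R := remainder G G₀ β with hR
  have hquad : ∀ w : C3, AnalyticAt ℂ (fun w : C3 => G₀ + w 0 + w 1 + (β : ℂ) / 2 * w 2 ^ 2) w := by
    intro w
    have p : ∀ i : Fin 3, AnalyticAt ℂ (fun w : C3 => w i) w :=
      fun i => (ContinuousLinearMap.proj i : C3 →L[ℂ] ℂ).analyticAt w
    exact ((analyticAt_const.add (p 0)).add (p 1)).add (analyticAt_const.mul ((p 2).pow 2))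
  have hRa : AnalyticAt ℂ R 0 := hG.sub (hquad 0)
  obtain ⟨B, hBpos, hB⟩ := hnf.exists_pos
  have hB := hB.bound
  have hR0 : R 0 = 0 := by simpa using hB.self_of_nhds
  -- the derivative vanishes at the origin
  have hd0 : HasFDerivAt R (0 : C3 →L[ℂ] ℂ) 0 := by
    refine HasFDerivAt.of_isLittleO ?_
    have h1 : (fun w : C3 => ‖w‖ * (‖w 0‖ + ‖w 1‖) + ‖w 2‖ ^ 3) =o[𝓝 0] fun w : C3 => w := by
      have h2 : (fun w : C3 => ‖w‖ * (‖w 0‖ + ‖w 1‖) + ‖w 2‖ ^ 3) =O[𝓝 0]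
          fun w : C3 => ‖w‖ ^ 2 := by
        refine IsBigO.of_bound 3 ?_
        filter_upwards [Metric.ball_mem_nhds (0 : C3) one_pos] with w hw
        rw [mem_ball_zero_iff] at hw
        have n := norm_nonneg w
        have a0 := norm_le_pi_norm w 0
        have a1 := norm_le_pi_norm w 1
        have a2 := norm_le_pi_norm w 2
        rw [Real.norm_of_nonneg (by positivity), Real.norm_of_nonneg (by positivity)]
        have : ‖w 2‖ ^ 3 ≤ ‖w‖ ^ 2 := by
          calc ‖w 2‖ ^ 3 ≤ ‖w‖ ^ 3 := by gcongr
            _ = ‖w‖ ^ 2 * ‖w‖ := by ring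
            _ ≤ ‖w‖ ^ 2 * 1 := by gcongr
            _ = _ := by ring
        nlinarith
      refine h2.trans_isLittleO ?_
      have := (isLittleO_pow_id (one_lt_two)).comp_tendsto (tendsto_norm_zero (E := C3))
      exact (isLittleO_norm_right).1 (by simpa [Function.comp_def] using! this)
    simpa [hR0] using! hnf.trans_isLittleO h1
  have hdR0 : fderiv ℂ R 0 = 0 := hd0.fderiv
  obtain ⟨K, t, ht, hK⟩ := ((hRa.fderiv.contDiffAt (n := 1))).exists_lipschitzOnWith
  obtain ⟨r₁, hr₁, hr₁t⟩ := Metric.mem_nhds_iff.1 ht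
  obtain ⟨r₂, hr₂, hr₂B⟩ := Metric.eventually_nhds_iff_ball.1 hB
  obtain ⟨r₃, hr₃, hr₃G⟩ := Metric.eventually_nhds_iff_ball.1 hG.eventually_analyticAt
  -- The quarters leave room for the circle of radius `‖w 2‖` about `w 2` used below, whose points
  -- have modulus at most `2 ‖w 2‖`.
  refine ⟨2 * K + 8 * B, by positivity, min (min r₁ (r₃ / 4)) (r₂ / 4), by positivity, ?_⟩
  intro w hw
  have hw1 : ‖w‖ < r₁ := hw.trans_le ((min_le_left _ _).trans (min_le_left _ _))
  have hw4 : ‖w‖ < r₃ / 4 := hw.trans_le ((min_le_left _ _).trans (min_le_right _ _))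
  have hw3 : ‖w‖ < r₃ := by linarith
  have hw2 : ‖w‖ < r₂ / 4 := hw.trans_le (min_le_right _ _)
  refine ⟨hr₃G w (by simpa using hw3), fun v => ?_⟩
  have memt : ∀ u : C3, ‖u‖ < r₁ → u ∈ t := fun u hu => hr₁t (by simpa using hu)
  have b1 : ‖fderiv ℂ R w‖ ≤ K * ‖w‖ := by
    have := hK.norm_sub_le (memt w hw1) (memt 0 (by simpa using hr₁))
    simpa [hdR0] using this
  -- the restriction to the third axis
  set w' : C3 := Pi.single 2 (w 2) with hw'
  have nw2 := norm_le_pi_norm w 2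
  have nw' : ‖w'‖ ≤ ‖w‖ := by
    rw [hw', Pi.norm_single]; exact nw2
  -- The third partial derivative needs a better bound than `K ‖w‖`. It is compared with its value
  -- on the third axis, where the normal form is cubic in `w 2`.
  have b2 : ‖fderiv ℂ R w - fderiv ℂ R w'‖ ≤ K * (‖w 0‖ + ‖w 1‖) := by
    refine (hK.norm_sub_le (memt w hw1) (memt w' (nw'.trans_lt hw1))).trans ?_
    gcongr
    refine (norm_decomp _).trans ?_
    simp [hw']
  have b3 : ‖fderiv ℂ R w' (Pi.single 2 1)‖ ≤ 8 * B * ‖w 2‖ ^ 2 := by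
    set h : ℂ → ℂ := fun z => R (Pi.single 2 z) with hh
    have hline : ∀ z : ℂ, HasDerivAt (fun z : ℂ => (Pi.single 2 z : C3)) (Pi.single 2 1) z := by
      intro z
      have := ((hasDerivAt_id z).smul_const (Pi.single 2 (1 : ℂ) : C3))
      simp only [one_smul] at this
      refine this.congr_of_eventuallyEq (Eventually.of_forall fun u => ?_)
      ext i; fin_cases i <;> simp
    have hnorm : ∀ z : ℂ, ‖z‖ < r₂ → ‖h z‖ ≤ B * ‖z‖ ^ 3 := by
      intro z hz
      have := hr₂B (Pi.single 2 z) (by simpa [Pi.norm_single] using hz)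
      simpa [hh] using this
    have hdh : ∀ z : ℂ, ‖z‖ < r₃ → HasDerivAt h (fderiv ℂ R (Pi.single 2 z) (Pi.single 2 1)) z := by
      intro z hz
      have : AnalyticAt ℂ R (Pi.single 2 z) :=
        (hr₃G _ (by simpa [Pi.norm_single] using hz)).sub (hquad _)
      exact this.differentiableAt.hasFDerivAt.comp_hasDerivAt z (hline z)
    have hz3 : ‖w 2‖ < r₃ := nw2.trans_lt hw3
    rw [hw', ← (hdh (w 2) hz3).deriv]
    rcases eq_or_ne (w 2) 0 with h0 | h0
    · have hp : (Pi.single 2 (0 : ℂ) : C3) = 0 := by simp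
      rw [h0, (hdh 0 (by simpa using hr₃)).deriv, hp, hdR0]
      simp
    · have hpos : 0 < ‖w 2‖ := norm_pos_iff.2 h0
      -- Cauchy's estimate on the circle about `w 2` through the origin: `B (2 ‖w 2‖)³ / ‖w 2‖ = 8 B
      -- ‖w 2‖²`.
      have hdc : DiffContOnCl ℂ h (Metric.ball (w 2) ‖w 2‖) := by
        refine DifferentiableOn.diffContOnCl fun z hz => ?_
        rw [closure_ball _ hpos.ne', mem_closedBall_iff_norm] at hz
        refine (hdh z ?_).differentiableAt.differentiableWithinAt
        have := norm_le_norm_add_norm_sub' z (w 2)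
        linarith
      have := Complex.norm_deriv_le_of_forall_mem_sphere_norm_le (C := B * (2 * ‖w 2‖) ^ 3) hpos hdc
        fun z hz => by
          rw [mem_sphere_iff_norm] at hz
          have h2 : ‖z‖ ≤ 2 * ‖w 2‖ := by
            have := norm_le_norm_add_norm_sub' z (w 2)
            linarith
          refine (hnorm z (by linarith)).trans ?_
          gcongr
      refine this.trans (le_of_eq ?_)
      field_simp
      ring
  have hv : v = (v - Pi.single 2 (v 2)) + v 2 • (Pi.single 2 1 : C3) := by
    ext i; fin_cases i <;> simp
  have b4 : ‖fderiv ℂ R w (v - Pi.single 2 (v 2))‖ ≤ K * ‖w‖ * (‖v 0‖ + ‖v 1‖) := by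
    refine ((fderiv ℂ R w).le_opNorm _).trans ?_
    gcongr
    refine (norm_decomp _).trans ?_
    simp
  have b5 : ‖fderiv ℂ R w (Pi.single 2 1)‖ ≤ K * (‖w 0‖ + ‖w 1‖) + 8 * B * ‖w 2‖ ^ 2 := by
    have : fderiv ℂ R w (Pi.single 2 1) = (fderiv ℂ R w - fderiv ℂ R w') (Pi.single 2 1)
      + fderiv ℂ R w' (Pi.single 2 1) := by simp
    rw [this]
    refine (norm_add_le _ _).trans (add_le_add ?_ b3)
    refine ((ContinuousLinearMap.le_opNorm _ _).trans ?_)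
    simpa [Pi.norm_single] using b2
  have n0 := norm_nonneg (w 0)
  have n1 := norm_nonneg (w 1)
  have hKnn := K.2
  have m0 := norm_nonneg (v 0)
  have m1 := norm_nonneg (v 1)
  calc ‖fderiv ℂ R w v‖ ≤ ‖fderiv ℂ R w (v - Pi.single 2 (v 2))‖
      + ‖fderiv ℂ R w (v 2 • (Pi.single 2 1 : C3))‖ := by
        conv_lhs => rw [hv, map_add]
        exact norm_add_le _ _
    _ ≤ K * ‖w‖ * (‖v 0‖ + ‖v 1‖) + (K * (‖w 0‖ + ‖w 1‖) + 8 * B * ‖w 2‖ ^ 2) * ‖v 2‖ := by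
        refine add_le_add b4 ?_
        rw [map_smul, norm_smul, mul_comm]
        gcongr
    _ ≤ (2 * K + 8 * B) * (‖w‖ * (‖v 0‖ + ‖v 1‖)) +
        (2 * K + 8 * B) * (‖w 0‖ + ‖w 1‖ + ‖w 2‖ ^ 2) * ‖v 2‖ := by
        refine add_le_add ?_ (mul_le_mul_of_nonneg_right ?_ (norm_nonneg _))
        · rw [← mul_assoc]
          gcongr
          nlinarith [K.2]
        · have : 0 ≤ ‖w 2‖ ^ 2 := by positivity
          have e : (0:ℝ) ≤ K := K.2
          nlinarith [mul_nonneg e n0, mul_nonneg e n1, mul_nonneg e this, mul_nonneg hBpos.le n0, mul_nonneg hBpos.le n1]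
    _ = _ := by ring


theorem norm_toC3 (x : R3) : ‖toC3 x‖ = ‖x‖ := by
  refine le_antisymm ?_ ?_
  · rw [pi_norm_le_iff_of_nonneg (norm_nonneg _)]
    intro i
    simpa [toC3] using norm_le_pi_norm x i
  · rw [pi_norm_le_iff_of_nonneg (norm_nonneg _)]
    intro i
    simpa [toC3] using norm_le_pi_norm (toC3 x) i

/-- The inclusion of real points as a continuous real-linear map. -/
def toC3L : R3 →L[ℝ] C3 :=
  ContinuousLinearMap.pi fun i => Complex.ofRealCLM.comp (ContinuousLinearMap.proj i)

theorem toC3L_apply (x : R3) : toC3L x = toC3 x := rfl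

@[fun_prop]
theorem continuous_toC3 : Continuous toC3 := toC3L.continuous

@[simp] theorem toC3_zero : toC3 0 = 0 := by ext i; simp [toC3]

@[simp] theorem toC3_apply (x : R3) (i : Fin 3) : toC3 x i = (x i : ℂ) := rfl

theorem remainder_analyticAt {G : C3 → ℂ} {w : C3} (G₀ : ℂ) (β : ℝ) (hG : AnalyticAt ℂ G w) :
    AnalyticAt ℂ (remainder G G₀ β) w := by
  have p : ∀ i : Fin 3, AnalyticAt ℂ (fun w : C3 => w i) w :=
    fun i => (ContinuousLinearMap.proj i : C3 →L[ℂ] ℂ).analyticAt w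
  exact hG.sub (((analyticAt_const.add (p 0)).add (p 1)).add (analyticAt_const.mul ((p 2).pow 2)))

theorem remainder_zero {G : C3 → ℂ} {G₀ : ℂ} {β : ℝ}
    (hnf : remainder G G₀ β =O[𝓝 0] fun w => ‖w‖ * (‖w 0‖ + ‖w 1‖) + ‖w 2‖ ^ 3) :
    remainder G G₀ β 0 = 0 := by
  obtain ⟨B, hB⟩ := hnf.bound
  simpa using hB.self_of_nhds

theorem sign_mul_self_eq_abs (β : ℝ) : Real.sign β * β = |β| := by
  rcases lt_trichotomy β 0 with h | h | h
  · simp [Real.sign_of_neg h, abs_of_neg h]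
  · simp [h]
  · simp [Real.sign_of_pos h, abs_of_pos h]

/-- Displacements along which the imaginary part of a phase in normal form grows: `v` is up to
`2 d` the absolute value in the first two coordinates, and has the sign of `β w₃` in the third. -/
structure IsLift (β d : ℝ) (y v : R3) : Prop where
  lower₀ : |y 0| - 2 * d ≤ v 0
  upper₀ : v 0 ≤ |y 0|
  lower₁ : |y 1| - 2 * d ≤ v 1
  upper₁ : v 1 ≤ |y 1|
  third : v 2 = Real.sign β * y 2

/-- The quadratic model contributes `ε (v 0 + v 1 + |β| (y 2)²)`, which is at least `ε (|y 0| + |y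
1| - 4 d + |β| (y 2)²)`. By the mean value inequality along `s ↦ y + i s v`, the further terms cost
at most a quarter of the sum of moduli, half of the square and one `d`. The radius `r₀` does not
depend on `d` or on the lift, so one estimate serves all scales and all interpolations between them.
-/
theorem exists_phase_estimate {G : C3 → ℂ} {G₀ : ℂ} {β : ℝ} (hG : AnalyticAt ℂ G 0)
    (hreal : ∀ᶠ y in 𝓝 (0 : R3), (G (toC3 y)).im = 0) (hβ : β ≠ 0)
    (hnf : remainder G G₀ β =O[𝓝 0] fun w => ‖w‖ * (‖w 0‖ + ‖w 1‖) + ‖w 2‖ ^ 3) :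
    ∃ r₀ > 0, ∀ y v : R3, ∀ d : ℝ, 0 ≤ d → d ≤ r₀ → ‖y‖ ≤ r₀ → IsLift β d y v →
      (∀ ε ∈ Set.Icc (0 : ℝ) 1, ε * ((|y 0| + |y 1|) / 2 + |β| / 2 * y 2 ^ 2 - 6 * d)
        ≤ (G (toC3 y + (ε * Complex.I : ℂ) • toC3 v)).im) ∧
      (|y 0| + |y 1|) / 2 + |β| / 2 * y 2 ^ 2 - 6 * d ≤ gradDot G y v := by
  obtain ⟨A, hA, r₁, hr₁, hest⟩ := exists_fderiv_remainder_le hG hnf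
  obtain ⟨r₂, hr₂, hre⟩ := Metric.eventually_nhds_iff_ball.1 hreal
  have hβ' : 0 < |β| := abs_pos.2 hβ
  have hR0 := remainder_zero hnf
  have hG0 : G₀.im = 0 := by
    have h := hre 0 (by simpa using hr₂)
    have : G 0 = G₀ := by simpa [remainder, sub_eq_zero] using hR0
    simpa [this] using h
  -- The displaced points have norm at most `4 r`, which stays below `r₁`. The bound `A r ≤ 1 / 24`
  -- controls the terms in `|y 0| + |y 1|` and `d`; the bound `A r ≤ |β| / 8` leaves half of the
  -- term `|β| (y 2)²`.
  refine ⟨min (min (r₁ / 8) (r₂ / 2)) (min (1 / (24 * A)) (|β| / (8 * A))), by positivity, ?_⟩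
  intro y v d hd hdr hy hv
  set r := min (min (r₁ / 8) (r₂ / 2)) (min (1 / (24 * A)) (|β| / (8 * A))) with hr
  have hrpos : 0 < r := by positivity
  have hr1 : r ≤ r₁ / 8 := (min_le_left _ _).trans (min_le_left _ _)
  have hr2 : r ≤ r₂ / 2 := (min_le_left _ _).trans (min_le_right _ _)
  have hr3 : A * r ≤ 1 / 24 := by
    have : r ≤ 1 / (24 * A) := (min_le_right _ _).trans (min_le_left _ _)
    rw [le_div_iff₀ (by positivity)] at this
    linarith
  have hr4 : A * r ≤ |β| / 8 := by
    have : r ≤ |β| / (8 * A) := (min_le_right _ _).trans (min_le_right _ _)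
    rw [le_div_iff₀ (by positivity)] at this
    linarith
  have y0 : |y 0| ≤ r := (norm_le_pi_norm y 0).trans hy
  have y1 : |y 1| ≤ r := (norm_le_pi_norm y 1).trans hy
  have y2 : |y 2| ≤ r := (norm_le_pi_norm y 2).trans hy
  have v0 : |v 0| ≤ |y 0| + 2 * d := abs_le.2 ⟨by linarith [hv.lower₀, abs_nonneg (y 0)],
    by linarith [hv.upper₀]⟩
  have v1 : |v 1| ≤ |y 1| + 2 * d := abs_le.2 ⟨by linarith [hv.lower₁, abs_nonneg (y 1)],
    by linarith [hv.upper₁]⟩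
  have v2 : |v 2| = |y 2| := by
    rw [hv.third, abs_mul]
    rcases lt_or_gt_of_ne hβ with h | h
    · simp [Real.sign_of_neg h]
    · simp [Real.sign_of_pos h]
  set S := |y 0| + |y 1| with hS
  have hS0 : 0 ≤ S := by positivity
  -- The error per unit of displacement.
  set E := S / 4 + d + |β| / 2 * y 2 ^ 2 with hE
  set w : ℝ → C3 := fun s => toC3 y + (s * Complex.I : ℂ) • toC3 v with hw
  have hwi : ∀ s ∈ Set.Icc (0 : ℝ) 1, ∀ i, ‖w s i‖ ≤ |y i| + |v i| := by
    intro s hs i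
    simp only [hw, Pi.add_apply, Pi.smul_apply, toC3_apply, smul_eq_mul]
    refine (norm_add_le _ _).trans ?_
    simp only [norm_mul, Complex.norm_real, Complex.norm_I, mul_one, Real.norm_eq_abs]
    gcongr
    rw [abs_of_nonneg hs.1]
    exact mul_le_of_le_one_left (abs_nonneg _) hs.2
  have hwn : ∀ s ∈ Set.Icc (0 : ℝ) 1, ‖w s‖ ≤ 4 * r := by
    intro s hs
    rw [pi_norm_le_iff_of_nonneg (by positivity)]
    intro i
    refine (hwi s hs i).trans ?_
    fin_cases i <;> simp <;> linarith
  have hbound : ∀ s ∈ Set.Icc (0 : ℝ) 1,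
      ‖fderiv ℂ (remainder G G₀ β) (w s) (toC3 v)‖ ≤ E := by
    intro s hs
    have hws := hwn s hs
    refine ((hest (w s) (by linarith)).2 (toC3 v)).trans ?_
    simp only [toC3_apply, Complex.norm_real, Real.norm_eq_abs]
    have a0 : ‖w s 0‖ ≤ 2 * |y 0| + 2 * d := (hwi s hs 0).trans (by linarith)
    have a1 : ‖w s 1‖ ≤ 2 * |y 1| + 2 * d := (hwi s hs 1).trans (by linarith)
    have a2 : ‖w s 2‖ ≤ 2 * |y 2| := (hwi s hs 2).trans (by linarith)
    have a22 : ‖w s 2‖ ^ 2 ≤ 4 * y 2 ^ 2 := by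
      calc ‖w s 2‖ ^ 2 ≤ (2 * |y 2|) ^ 2 := by gcongr
        _ = 4 * y 2 ^ 2 := by rw [mul_pow, sq_abs]; ring
    have sq := sq_nonneg (y 2)
    calc A * (‖w s‖ * (|v 0| + |v 1|) + (‖w s 0‖ + ‖w s 1‖ + ‖w s 2‖ ^ 2) * |v 2|)
        ≤ A * (4 * r * (S + 4 * d) + (2 * S + 4 * d + 4 * y 2 ^ 2) * r) := by
          have b1 : |v 0| + |v 1| ≤ S + 4 * d := by linarith
          have b2 : ‖w s 0‖ + ‖w s 1‖ + ‖w s 2‖ ^ 2 ≤ 2 * S + 4 * d + 4 * y 2 ^ 2 := by linarith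
          have b3 : |v 2| ≤ r := by rw [v2]; exact y2
          gcongr
      _ = (A * r) * (6 * S + 20 * d) + (A * r) * (4 * y 2 ^ 2) := by ring
      _ ≤ (1 / 24) * (6 * S + 20 * d) + (|β| / 8) * (4 * y 2 ^ 2) := by
          gcongr
      _ ≤ E := by simp only [hE]; linarith
  have hws0 : w 0 = toC3 y := by simp [hw]
  have hsgn := sign_mul_self_eq_abs β
  constructor
  · intro ε hε
    have hder : ∀ s ∈ Set.Icc (0 : ℝ) ε, HasDerivWithinAt (fun s => remainder G G₀ β (w s))
        (fderiv ℂ (remainder G G₀ β) (w s) (Complex.I • toC3 v)) (Set.Icc 0 ε) s := by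
      intro s hs
      have hsI : s ∈ Set.Icc (0 : ℝ) 1 := ⟨hs.1, hs.2.trans hε.2⟩
      have h1 : HasDerivAt w (Complex.I • toC3 v) s := by
        have := (((Complex.ofRealCLM.hasDerivAt (x := s)).mul_const Complex.I).smul_const
          (toC3 v)).const_add (toC3 y)
        simpa [hw] using! this
      have ha : AnalyticAt ℂ (remainder G G₀ β) (w s) :=
        remainder_analyticAt _ _ (hest (w s) (by linarith [hwn s hsI])).1
      exact ((ha.differentiableAt.hasFDerivAt.restrictScalars ℝ).comp_hasDerivAt s h1).hasDerivWithinAt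
    have hb : ∀ s ∈ Set.Icc (0 : ℝ) ε,
        ‖fderiv ℂ (remainder G G₀ β) (w s) (Complex.I • toC3 v)‖ ≤ E := by
      intro s hs
      rw [map_smul, norm_smul, Complex.norm_I, one_mul]
      exact hbound s ⟨hs.1, hs.2.trans hε.2⟩
    have hmv := (convex_Icc (0 : ℝ) ε).norm_image_sub_le_of_norm_hasDerivWithin_le hder hb
      (Set.left_mem_Icc.2 hε.1) (Set.right_mem_Icc.2 hε.1)
    rw [hws0, sub_zero, Real.norm_of_nonneg hε.1] at hmv
    have hre0 : (remainder G G₀ β (toC3 y)).im = 0 := by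
      have : (G (toC3 y)).im = 0 := hre y (by rw [mem_ball_zero_iff]; linarith)
      simp [remainder, this, hG0, pow_two]
    have him : -(E * ε) ≤ (remainder G G₀ β (w ε)).im := by
      have := (Complex.abs_im_le_norm _).trans hmv
      rw [Complex.sub_im, hre0, sub_zero] at this
      exact (abs_le.1 this).1
    have hmain : (G (w ε)).im = (remainder G G₀ β (w ε)).im + ε * (v 0 + v 1 + |β| * y 2 ^ 2) := by
      simp only [remainder, Complex.sub_im, Complex.add_im, hG0]
      simp [hw, pow_two, hv.third]
      rw [← hsgn]
      ring
    change _ ≤ (G (w ε)).im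
    rw [hmain]
    have : ε * (S / 2 + |β| / 2 * y 2 ^ 2 - 6 * d) ≤ ε * (v 0 + v 1 + |β| * y 2 ^ 2 - E) := by
      refine mul_le_mul_of_nonneg_left ?_ hε.1
      simp only [hE]
      linarith [hv.lower₀, hv.lower₁]
    linarith
  -- The infinitesimal version is the same derivative bound at the undisplaced point.
  · have h0 := hbound 0 (by simp)
    rw [hws0] at h0
    have ha : AnalyticAt ℂ G (toC3 y) := (hest (toC3 y) (by
      rw [norm_toC3]; linarith)).1
    have hfd : fderiv ℂ (remainder G G₀ β) (toC3 y) (toC3 v) =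
        fderiv ℂ G (toC3 y) (toC3 v) - (v 0 + v 1 + β * y 2 * v 2 : ℝ) := by
      have := (ha.differentiableAt.hasFDerivAt.sub (hasFDerivAt_quadratic G₀ β (toC3 y))).fderiv
      have e : fderiv ℂ (remainder G G₀ β) (toC3 y) = _ := this
      rw [e]
      simp
    rw [hfd] at h0
    have := (abs_le.1 ((Complex.abs_re_le_norm _).trans h0)).1
    rw [Complex.sub_re, Complex.ofReal_re] at this
    have e2 : β * y 2 * v 2 = |β| * y 2 ^ 2 := by rw [hv.third, ← hsgn]; ring
    unfold gradDot
    simp only [hE] at this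
    linarith [hv.lower₀, hv.lower₁]


/-! ### Powers below the origin and the curves that dip below it -/

/-- The plane cut along the closed positive imaginary axis. -/
def belowPlane : Set ℂ := {w | w.re = 0 → w.im < 0}

theorem I_mul_mem_slitPlane {w : ℂ} : Complex.I * w ∈ Complex.slitPlane ↔ w ∈ belowPlane := by
  simp only [Complex.mem_slitPlane_iff, Complex.mul_re, Complex.mul_im, Complex.I_re, Complex.I_im,
    belowPlane, Set.mem_ofPred_eq]
  constructor
  · rintro (h | h) h0
    · linarith
    · simp [h0] at h
  · intro h
    by_cases h0 : w.re = 0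
    · left; linarith [h h0]
    · right; simpa using h0

theorem ne_zero_of_mem_belowPlane {w : ℂ} (h : w ∈ belowPlane) : w ≠ 0 := by
  rintro rfl
  have := h rfl
  simp at this

theorem powBelow_ne_zero (w μ : ℂ) : powBelow w μ ≠ 0 := Complex.exp_ne_zero _

theorem powBelow_add (w μ ν : ℂ) : powBelow w (μ + ν) = powBelow w μ * powBelow w ν := by
  simp only [powBelow, ← Complex.exp_add]; ring_nf

theorem powBelow_one {w : ℂ} (hw : w ≠ 0) : powBelow w 1 = w := by
  have h : Complex.exp (Complex.I * Real.pi / 2) = Complex.I := by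
    rw [mul_comm, mul_div_right_comm]
    exact_mod_cast Complex.exp_pi_div_two_mul_I
  rw [powBelow, one_mul, Complex.exp_sub, Complex.exp_log (mul_ne_zero Complex.I_ne_zero hw), h]
  field_simp

theorem powBelow_add_one {w : ℂ} (hw : w ≠ 0) (μ : ℂ) : powBelow w (μ + 1) = powBelow w μ * w := by
  rw [powBelow_add, powBelow_one hw]

theorem powBelow_ofReal_mul {s : ℝ} (hs : 0 < s) {w : ℂ} (hw : w ≠ 0) (μ : ℂ) :
    powBelow (s * w) μ = (s : ℂ) ^ μ * powBelow w μ := by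
  have h : Complex.I * (s * w) = s * (Complex.I * w) := by ring
  rw [powBelow, powBelow, h, Complex.log_ofReal_mul hs (mul_ne_zero Complex.I_ne_zero hw),
    Complex.cpow_def_of_ne_zero (by exact_mod_cast hs.ne'), ← Complex.exp_add,
    Complex.ofReal_log hs.le]
  ring_nf

theorem hasDerivAt_powBelow {w : ℂ} (hw : w ∈ belowPlane) (μ : ℂ) :
    HasDerivAt (fun w => powBelow w (μ + 1)) ((μ + 1) * powBelow w μ) w := by
  have h0 := ne_zero_of_mem_belowPlane hw
  have h1 : HasDerivAt (fun w : ℂ => Complex.I * w) Complex.I w := by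
    simpa using (hasDerivAt_id w).const_mul Complex.I
  have h2 := (((h1.clog (I_mul_mem_slitPlane.2 hw)).sub_const
    (Complex.I * Real.pi / 2)).const_mul (μ + 1)).cexp
  refine h2.congr_deriv ?_
  have h3 : powBelow w μ * w = Complex.exp ((μ + 1) * (Complex.log (Complex.I * w)
    - Complex.I * Real.pi / 2)) := (powBelow_add_one h0 μ).symm
  rw [← h3]
  field_simp

theorem continuousAt_powBelow {w : ℂ} (hw : w ∈ belowPlane) (μ : ℂ) :
    ContinuousAt (fun w => powBelow w μ) w := by
  have := (hasDerivAt_powBelow hw (μ - 1)).continuousAt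
  simpa using this

theorem continuous_powBelow_exponent (w : ℂ) : Continuous fun μ => powBelow w μ := by
  unfold powBelow; fun_prop

/-- The argument of the branch lies between `-3π/2` and `π/2`, so the imaginary part of the exponent
costs only a constant factor. -/
theorem norm_powBelow_le {w : ℂ} (hw : w ≠ 0) (μ : ℂ) :
    ‖powBelow w μ‖ ≤ Real.exp (2 * Real.pi * |μ.im|) * ‖w‖ ^ μ.re := by
  have hpos : 0 < ‖w‖ := norm_pos_iff.2 hw
  rw [powBelow, Complex.norm_exp, Real.rpow_def_of_pos hpos, ← Real.exp_add, Real.exp_le_exp]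
  set a := (Complex.I * w).arg
  have ha := Complex.arg_mem_Ioc (Complex.I * w)
  have e1 : (Complex.log (Complex.I * w) - Complex.I * Real.pi / 2).re = Real.log ‖w‖ := by
    simp [Complex.log_re]
  have e2 : (Complex.log (Complex.I * w) - Complex.I * Real.pi / 2).im = a - Real.pi / 2 := by
    simp [Complex.log_im, a]
  rw [Complex.mul_re, e1, e2]
  have h3 : |μ.im * (a - Real.pi / 2)| ≤ |μ.im| * (2 * Real.pi) := by
    rw [abs_mul]
    gcongr
    rw [abs_le]
    constructor <;> linarith [ha.1, ha.2, Real.pi_pos]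
  have := neg_abs_le (μ.im * (a - Real.pi / 2))
  linarith

/-- The profile `√(δ² + t²) - 2 δ`, a smoothed absolute value that is negative near the origin. -/
def dip (δ t : ℝ) : ℝ := √(δ ^ 2 + t ^ 2) - 2 * δ

theorem dip_lower (δ t : ℝ) : |t| - 2 * δ ≤ dip δ t := by
  have : |t| ≤ √(δ ^ 2 + t ^ 2) := Real.abs_le_sqrt (by nlinarith [sq_nonneg δ])
  unfold dip; linarith

theorem dip_upper {δ : ℝ} (hδ : 0 ≤ δ) (t : ℝ) : dip δ t ≤ |t| - δ := by
  have : √(δ ^ 2 + t ^ 2) ≤ δ + |t| := by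
    rw [Real.sqrt_le_left (by positivity)]
    nlinarith [sq_abs t, mul_nonneg hδ (abs_nonneg t)]
  unfold dip; linarith

/-- `√2 ≤ 3 / 2`. Thus a whole interval of length `2 δ`, and not only its midpoint, is displaced
downwards; this keeps the curves at a distance comparable to `δ` from the origin. -/
theorem dip_le_of_abs_le {δ t : ℝ} (hδ : 0 ≤ δ) (ht : |t| ≤ δ) : dip δ t ≤ -(δ / 2) := by
  have : √(δ ^ 2 + t ^ 2) ≤ 3 / 2 * δ := by
    rw [Real.sqrt_le_left (by positivity)]
    have : t ^ 2 ≤ δ ^ 2 := by rw [← sq_abs]; gcongr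
    nlinarith
  unfold dip; linarith

theorem abs_dip_le {δ : ℝ} (hδ : 0 ≤ δ) (t : ℝ) : |dip δ t| ≤ |t| + 2 * δ :=
  abs_le.2 ⟨by linarith [dip_lower δ t, abs_nonneg t], by linarith [dip_upper hδ t]⟩

theorem hasDerivAt_dip {δ : ℝ} (hδ : 0 < δ) (t : ℝ) :
    HasDerivAt (dip δ) (t / √(δ ^ 2 + t ^ 2)) t := by
  have h : HasDerivAt (fun t : ℝ => δ ^ 2 + t ^ 2) (2 * t) t := by
    simpa using ((hasDerivAt_pow 2 t).const_add (δ ^ 2))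
  refine ((h.sqrt (by positivity)).sub_const (2 * δ)).congr_deriv ?_
  rw [mul_div_mul_left _ _ two_ne_zero]

theorem contDiff_dip {δ : ℝ} (hδ : 0 < δ) {n : WithTop ℕ∞} : ContDiff ℝ n (dip δ) := by
  unfold dip
  refine ContDiff.sub (ContDiff.sqrt (by fun_prop) fun t => by positivity) contDiff_const

theorem continuous_dip : Continuous fun p : ℝ × ℝ => dip p.1 p.2 := by
  unfold dip; fun_prop

/-- Joint homogeneity in scale and position. Because of it, the chain of scale `1 / Λ` becomes
independent of `Λ` after rescaling. -/
theorem dip_scale {δ : ℝ} (hδ : 0 < δ) (t : ℝ) : dip δ (δ * t) = δ * dip 1 t := by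
  unfold dip
  have : δ ^ 2 + (δ * t) ^ 2 = δ ^ 2 * (1 ^ 2 + t ^ 2) := by ring
  rw [this, Real.sqrt_mul (by positivity), Real.sqrt_sq hδ.le]
  ring

/-- The slope of the profile `dip`. -/
def dipSlope (δ t : ℝ) : ℝ := t / √(δ ^ 2 + t ^ 2)

theorem abs_dipSlope_le (δ t : ℝ) : |dipSlope δ t| ≤ 1 := by
  unfold dipSlope
  rw [abs_div, abs_of_nonneg (Real.sqrt_nonneg _)]
  refine div_le_one_of_le₀ (Real.abs_le_sqrt (by nlinarith [sq_nonneg δ])) (Real.sqrt_nonneg _)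

theorem dipSlope_scale {δ : ℝ} (hδ : 0 < δ) (t : ℝ) : dipSlope δ (δ * t) = dipSlope 1 t := by
  unfold dipSlope
  have : δ ^ 2 + (δ * t) ^ 2 = δ ^ 2 * (1 ^ 2 + t ^ 2) := by ring
  rw [this, Real.sqrt_mul (by positivity), Real.sqrt_sq hδ.le, mul_div_mul_left _ _ hδ.ne']

/-- The curve `t + i κ (√(δ² + t²) - 2 δ)`, which passes below the origin. -/
def dipCurve (κ δ t : ℝ) : ℂ := t + Complex.I * ((κ * dip δ t : ℝ) : ℂ)

/-- The velocity of `dipCurve`. -/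
def dipVel (κ δ t : ℝ) : ℂ := 1 + Complex.I * ((κ * dipSlope δ t : ℝ) : ℂ)

@[simp] theorem dipCurve_re (κ δ t : ℝ) : (dipCurve κ δ t).re = t := by simp [dipCurve]
@[simp] theorem dipCurve_im (κ δ t : ℝ) : (dipCurve κ δ t).im = κ * dip δ t := by simp [dipCurve]

theorem hasDerivAt_dipCurve (κ : ℝ) {δ : ℝ} (hδ : 0 < δ) (t : ℝ) :
    HasDerivAt (dipCurve κ δ) (dipVel κ δ t) t := by
  have := ((hasDerivAt_dip hδ t).const_mul κ).ofReal_comp.const_mul Complex.I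
  exact (Complex.ofRealCLM.hasDerivAt (x := t)).add this

theorem dipCurve_scale (κ : ℝ) {δ : ℝ} (hδ : 0 < δ) (t : ℝ) :
    dipCurve κ δ (δ * t) = δ * dipCurve κ 1 t := by
  simp only [dipCurve, dip_scale hδ]; push_cast; ring

/-- The abscissa is the parameter, so the imaginary axis is met at `t = 0` only, where the ordinate
is negative. -/
theorem dipCurve_mem {κ δ : ℝ} (hκ : 0 < κ) (hδ : 0 < δ) (t : ℝ) :
    dipCurve κ δ t ∈ belowPlane := by
  intro h
  rw [dipCurve_re] at h
  rw [dipCurve_im, h]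
  have := dip_le_of_abs_le (t := 0) hδ.le (by simpa using hδ.le)
  nlinarith

theorem norm_dipVel_le {κ : ℝ} (hκ : 0 ≤ κ) (δ t : ℝ) : ‖dipVel κ δ t‖ ≤ 1 + κ := by
  refine (norm_add_le _ _).trans ?_
  rw [norm_one, norm_mul, Complex.norm_I, one_mul, Complex.norm_real, Real.norm_eq_abs, abs_mul,
    abs_of_nonneg hκ]
  have := mul_le_mul_of_nonneg_left (abs_dipSlope_le δ t) hκ
  linarith

theorem continuous_dipVel (κ : ℝ) {δ : ℝ} (hδ : 0 < δ) : Continuous (dipVel κ δ) := by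
  unfold dipVel dipSlope
  have : ∀ t : ℝ, √(δ ^ 2 + t ^ 2) ≠ 0 := fun t => by positivity
  have : Continuous fun t : ℝ => t / √(δ ^ 2 + t ^ 2) := continuous_id.div (by fun_prop) this
  fun_prop

theorem continuous_dipCurve (κ δ : ℝ) : Continuous (dipCurve κ δ) := by
  unfold dipCurve dip; fun_prop

theorem norm_dipCurve_le {κ δ : ℝ} (hκ : 0 ≤ κ) (hδ : 0 ≤ δ) (t : ℝ) :
    ‖dipCurve κ δ t‖ ≤ (1 + κ) * |t| + 2 * κ * δ := by
  refine (norm_add_le _ _).trans ?_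
  rw [norm_mul, Complex.norm_I, one_mul, Complex.norm_real, Complex.norm_real, Real.norm_eq_abs,
    Real.norm_eq_abs, abs_mul, abs_of_nonneg hκ]
  have := mul_le_mul_of_nonneg_left (abs_dip_le hδ t) hκ
  linarith

/-- A curve `t + i κ s` with `s ≤ - δ / 2` for `|t| ≤ δ` stays away from the origin. -/
theorem le_norm_of_dip {κ δ : ℝ} (hκ : 0 < κ) (hδ : 0 < δ) {w : ℂ}
    (h : |w.re| ≤ δ → w.im ≤ -(κ * δ / 2)) : min 1 (κ / 2) * δ ≤ ‖w‖ := by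
  by_cases ht : |w.re| ≤ δ
  · have h1 := h ht
    have h2 : κ * δ / 2 ≤ |w.im| := by rw [abs_of_neg (by nlinarith)]; linarith
    calc min 1 (κ / 2) * δ ≤ κ / 2 * δ := by gcongr; exact min_le_right _ _
      _ ≤ |w.im| := by linarith
      _ ≤ ‖w‖ := Complex.abs_im_le_norm _
  · calc min 1 (κ / 2) * δ ≤ 1 * δ := by gcongr; exact min_le_left _ _
      _ ≤ |w.re| := by linarith [not_le.1 ht]
      _ ≤ ‖w‖ := Complex.abs_re_le_norm _

/-- Real parts of exponents of either sign occur, so both `x` and `x⁻¹` have to be controlled. -/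
theorem rpow_le_of_two_sided {x a A B : ℝ} (hx : 0 < x) (hB : x ≤ B) (hA : x⁻¹ ≤ B) (hB1 : 1 ≤ B)
    (ha : |a| ≤ A) : x ^ a ≤ B ^ A := by
  rcases le_total 0 a with h | h
  · calc x ^ a ≤ B ^ a := by gcongr
      _ ≤ B ^ A := Real.rpow_le_rpow_of_exponent_le hB1 ((le_abs_self a).trans ha)
  · calc x ^ a = (x⁻¹) ^ (-a) := by rw [Real.inv_rpow hx.le, Real.rpow_neg hx.le, inv_inv]
      _ ≤ B ^ (-a) := Real.rpow_le_rpow (by positivity) hA (by linarith)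
      _ ≤ B ^ A := Real.rpow_le_rpow_of_exponent_le hB1 ((neg_le_abs a).trans ha)

theorem exists_rpow_le_exp (A : ℝ) (hA : 0 ≤ A) {c : ℝ} (hc : 0 < c) :
    ∃ M > 0, ∀ t : ℝ, 0 ≤ t → (1 + t) ^ A ≤ M * Real.exp (c * t) := by
  set s := min 1 (c / (A + 1)) with hs
  have hspos : 0 < s := by positivity
  -- With `s ≤ 1` one has `1 + t ≤ s⁻¹ exp (s t)`, and `s ≤ c / (A + 1)` gives `s A ≤ c` after the
  -- power is taken.
  refine ⟨(s⁻¹) ^ A, by positivity, fun t ht => ?_⟩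
  have h1 : 1 + t ≤ s⁻¹ * Real.exp (s * t) := by
    rw [inv_mul_eq_div, le_div_iff₀ hspos]
    have := Real.add_one_le_exp (s * t)
    have h2 : s ≤ 1 := min_le_left _ _
    nlinarith
  calc (1 + t) ^ A ≤ (s⁻¹ * Real.exp (s * t)) ^ A := by gcongr
    _ = (s⁻¹) ^ A * Real.exp (s * t * A) := by
      rw [Real.mul_rpow (by positivity) (by positivity), ← Real.exp_mul]
    _ ≤ (s⁻¹) ^ A * Real.exp (c * t) := by
      refine mul_le_mul_of_nonneg_left (Real.exp_le_exp.2 ?_) (by positivity)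
      have : s ≤ c / (A + 1) := min_le_right _ _
      rw [le_div_iff₀ (by positivity)] at this
      nlinarith

/-- Powers grow slower than exponentials along the curves `dipCurve κ 1`, locally uniformly. -/
theorem exists_norm_powBelow_dipCurve_le (m : ℝ) {κ₀ κ₁ c : ℝ} (hκ₀ : 0 < κ₀) (hc : 0 < c) :
    ∃ M > 0, ∀ μ : ℂ, ‖μ‖ ≤ m → ∀ κ ∈ Set.Icc κ₀ κ₁, ∀ t : ℝ,
      ‖powBelow (dipCurve κ 1 t) μ‖ ≤ M * Real.exp (c * |t|) := by
  rcases lt_or_ge m 0 with hm | hm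
  · exact ⟨1, one_pos, fun μ hμ => absurd (norm_nonneg μ) (by linarith)⟩
  obtain ⟨M, hM, hexp⟩ := exists_rpow_le_exp m hm hc
  -- `B` bounds both the growth of the curve at infinity and the inverse of its distance to the
  -- origin, uniformly for slopes in the interval.
  set B := max (1 + 2 * |κ₁|) (min 1 (κ₀ / 2))⁻¹ with hB
  have hB1 : 1 ≤ B := le_trans (by linarith [abs_nonneg κ₁]) (le_max_left _ _)
  refine ⟨Real.exp (2 * Real.pi * m) * (B ^ m * M), by positivity, fun μ hμ κ hκ t => ?_⟩
  have hκpos : 0 < κ := hκ₀.trans_le hκ.1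
  have hmem := dipCurve_mem hκpos one_pos t
  have h0 := ne_zero_of_mem_belowPlane hmem
  have hlow : min 1 (κ₀ / 2) ≤ ‖dipCurve κ 1 t‖ := by
    have := le_norm_of_dip (w := dipCurve κ 1 t) hκpos one_pos (fun h => by
      rw [dipCurve_re] at h
      have := dip_le_of_abs_le zero_le_one h
      rw [dipCurve_im]; nlinarith)
    rw [mul_one] at this
    exact (min_le_min le_rfl (by linarith [hκ.1])).trans this
  have hup : ‖dipCurve κ 1 t‖ ≤ B * (1 + |t|) := by
    have h1 := norm_dipCurve_le hκpos.le zero_le_one t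
    have h2 : 1 + 2 * |κ₁| ≤ B := le_max_left _ _
    have h3 : κ ≤ |κ₁| := hκ.2.trans (le_abs_self _)
    have := mul_le_mul_of_nonneg_right h2 (by positivity : 0 ≤ 1 + |t|)
    nlinarith [abs_nonneg t]
  have hinv : ‖dipCurve κ 1 t‖⁻¹ ≤ B * (1 + |t|) := by
    calc ‖dipCurve κ 1 t‖⁻¹ ≤ (min 1 (κ₀ / 2))⁻¹ := by gcongr
      _ ≤ B := le_max_right _ _
      _ ≤ B * (1 + |t|) := le_mul_of_one_le_right (by positivity) (by linarith [abs_nonneg t])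
  calc ‖powBelow (dipCurve κ 1 t) μ‖
      ≤ Real.exp (2 * Real.pi * |μ.im|) * ‖dipCurve κ 1 t‖ ^ μ.re := norm_powBelow_le h0 μ
    _ ≤ Real.exp (2 * Real.pi * m) * (B * (1 + |t|)) ^ m := by
        gcongr
        · exact (Complex.abs_im_le_norm μ).trans hμ
        · exact rpow_le_of_two_sided (norm_pos_iff.2 h0) hup hinv
            (one_le_mul_of_one_le_of_one_le hB1 (by linarith [abs_nonneg t]))
            ((Complex.abs_re_le_norm μ).trans hμ)
    _ = Real.exp (2 * Real.pi * m) * (B ^ m * (1 + |t|) ^ m) := by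
        rw [Real.mul_rpow (by positivity) (by positivity)]
    _ ≤ Real.exp (2 * Real.pi * m) * (B ^ m * (M * Real.exp (c * |t|))) := by
        gcongr
        exact hexp |t| (abs_nonneg t)
    _ = _ := by ring

theorem integrable_exp_neg_mul_abs {c : ℝ} (hc : 0 < c) :
    Integrable fun t : ℝ => Real.exp (-(c * |t|)) := by
  rw [← integrableOn_univ, ← Set.Iic_union_Ioi (a := (0 : ℝ)), integrableOn_union]
  constructor
  · refine (integrableOn_exp_mul_Iic hc 0).congr_fun (fun t ht => ?_) measurableSet_Iic
    simp [abs_of_nonpos (Set.mem_Iic.1 ht)]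
  · refine (exp_neg_integrableOn_Ioi 0 hc).congr_fun (fun t ht => ?_) measurableSet_Ioi
    simp [abs_of_pos (Set.mem_Ioi.1 ht)]


/-! ### Hankel integrals -/

/-- The integrand of the Hankel integral along `dipCurve κ 1`. -/
def hankelIntegrand (κ p : ℝ) (μ : ℂ) (t : ℝ) : ℂ :=
  powBelow (dipCurve κ 1 t) μ * Complex.exp (Complex.I * p * dipCurve κ 1 t) * dipVel κ 1 t

theorem norm_exp_I_mul (p : ℝ) (w : ℂ) :
    ‖Complex.exp (Complex.I * p * w)‖ = Real.exp (-(p * w.im)) := by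
  rw [Complex.norm_exp]; congr 1; simp

theorem norm_exp_dipCurve_le {κ p δ : ℝ} (hκ : 0 ≤ κ) (hp : 0 ≤ p) (t : ℝ) :
    ‖Complex.exp (Complex.I * p * dipCurve κ δ t)‖
      ≤ Real.exp (2 * p * κ * δ) * Real.exp (-(p * κ * |t|)) := by
  rw [norm_exp_I_mul, dipCurve_im, ← Real.exp_add, Real.exp_le_exp]
  have := mul_le_mul_of_nonneg_left (dip_lower δ t) (mul_nonneg hp hκ)
  linarith

theorem exists_norm_hankelIntegrand_le {κ : ℝ} (hκ : 0 < κ) (m : ℝ) {p₀ p₁ : ℝ} (hp₀ : 0 < p₀) :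
    ∃ M > 0, ∀ μ : ℂ, ‖μ‖ ≤ m → ∀ p ∈ Set.Icc p₀ p₁, ∀ t : ℝ,
      ‖hankelIntegrand κ p μ t‖ ≤ M * Real.exp (-(p₀ * κ / 2 * |t|)) := by
  obtain ⟨M, hM, hb⟩ := exists_norm_powBelow_dipCurve_le m (κ₀ := κ) (κ₁ := κ) (c := p₀ * κ / 2) hκ
    (by positivity)
  refine ⟨M * Real.exp (2 * p₁ * κ) * (1 + κ), by positivity, fun μ hμ p hp t => ?_⟩
  have hppos : 0 < p := hp₀.trans_le hp.1
  have h1 := hb μ hμ κ (by simp) t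
  have h2 := norm_exp_dipCurve_le (δ := 1) hκ.le hppos.le t
  have h3 := norm_dipVel_le hκ.le 1 t
  have h4 : Real.exp (2 * p * κ * 1) * Real.exp (-(p * κ * |t|))
      ≤ Real.exp (2 * p₁ * κ) * Real.exp (-(p₀ * κ * |t|)) := by
    rw [mul_one]
    have := hp.1; have := hp.2
    gcongr
  unfold hankelIntegrand
  rw [norm_mul, norm_mul]
  calc _ ≤ M * Real.exp (p₀ * κ / 2 * |t|) *
        (Real.exp (2 * p₁ * κ) * Real.exp (-(p₀ * κ * |t|))) * (1 + κ) := by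
        gcongr
        exact h2.trans h4
    _ = M * Real.exp (2 * p₁ * κ) * (1 + κ) *
        (Real.exp (p₀ * κ / 2 * |t|) * Real.exp (-(p₀ * κ * |t|))) := by ring
    _ = _ := by rw [← Real.exp_add]; congr 2; ring

theorem continuous_hankelIntegrand {κ : ℝ} (hκ : 0 < κ) (p : ℝ) (μ : ℂ) :
    Continuous (hankelIntegrand κ p μ) := by
  have h1 : Continuous fun t => powBelow (dipCurve κ 1 t) μ := by
    rw [continuous_iff_continuousAt]
    exact fun t => ContinuousAt.comp (f := dipCurve κ 1) (g := fun w => powBelow w μ)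
      (continuousAt_powBelow (dipCurve_mem hκ one_pos t) μ) (continuous_dipCurve κ 1).continuousAt
  have h2 := continuous_dipCurve κ 1
  have h3 := continuous_dipVel κ one_pos
  unfold hankelIntegrand
  fun_prop

theorem integrable_hankelIntegrand {κ : ℝ} (hκ : 0 < κ) {p : ℝ} (hp : 0 < p) (μ : ℂ) :
    Integrable (hankelIntegrand κ p μ) := by
  obtain ⟨M, hM, hb⟩ := exists_norm_hankelIntegrand_le hκ ‖μ‖ (p₁ := p) hp
  exact ((integrable_exp_neg_mul_abs (by positivity)).const_mul M).mono'
    (continuous_hankelIntegrand hκ p μ).aestronglyMeasurable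
    (Eventually.of_forall fun t => hb μ le_rfl p (by simp) t)

/-- The Hankel integral along `dipCurve κ 1`. -/
def hankel (κ p : ℝ) (μ : ℂ) : ℂ := ∫ t, hankelIntegrand κ p μ t

/-- The left side is the integral along the curve of the derivative of `w ^ (μ + 1) exp(i p w)`,
which decays at both ends. -/
theorem hankel_recurrence {κ : ℝ} (hκ : 0 < κ) {p : ℝ} (hp : 0 < p) (μ : ℂ) :
    (μ + 1) * hankel κ p μ + Complex.I * p * hankel κ p (μ + 1) = 0 := by
  set f : ℝ → ℂ := fun t => powBelow (dipCurve κ 1 t) (μ + 1) *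
    Complex.exp (Complex.I * p * dipCurve κ 1 t) with hf
  have hd : ∀ t, HasDerivAt f ((μ + 1) * hankelIntegrand κ p μ t +
      Complex.I * p * hankelIntegrand κ p (μ + 1) t) t := by
    intro t
    have h1 := hasDerivAt_dipCurve κ one_pos t
    have h2 := (hasDerivAt_powBelow (dipCurve_mem hκ one_pos t) μ).comp_of_eq t h1 rfl
    have h3 := (h1.const_mul (Complex.I * p)).cexp
    refine (h2.mul h3).congr_deriv ?_
    simp only [hankelIntegrand, Function.comp_apply]
    ring
  have hi : Integrable f := by
    obtain ⟨M, hM, hb⟩ := exists_norm_powBelow_dipCurve_le ‖μ + 1‖ (κ₀ := κ) (κ₁ := κ)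
      (c := p * κ / 2) hκ (by positivity)
    refine ((integrable_exp_neg_mul_abs (c := p * κ / 2) (by positivity)).const_mul
      (M * Real.exp (2 * p * κ))).mono'
      (continuous_iff_continuousAt.2 fun t => (hd t).continuousAt).aestronglyMeasurable
      (Eventually.of_forall fun t => ?_)
    have h1 := hb _ le_rfl κ (by simp) t
    have h2 := norm_exp_dipCurve_le (δ := 1) hκ.le hp.le t
    rw [hf, norm_mul]
    calc _ ≤ M * Real.exp (p * κ / 2 * |t|) *
          (Real.exp (2 * p * κ * 1) * Real.exp (-(p * κ * |t|))) := by gcongr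
      _ = M * Real.exp (2 * p * κ) *
          (Real.exp (p * κ / 2 * |t|) * Real.exp (-(p * κ * |t|))) := by rw [mul_one]; ring
      _ = _ := by rw [← Real.exp_add]; congr 2; ring
  have i1 := (integrable_hankelIntegrand hκ hp μ).const_mul (μ + 1)
  have i2 := (integrable_hankelIntegrand hκ hp (μ + 1)).const_mul (Complex.I * p)
  have := integral_eq_zero_of_hasDerivAt_of_integrable hd (i1.add i2) hi
  rw [integral_add i1 i2, integral_const_mul, integral_const_mul] at this
  exact this

/-- Differentiating the exponential in `p` brings down `i w`, which raises the exponent by one. -/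
theorem hasDerivAt_hankel {κ : ℝ} (hκ : 0 < κ) {p : ℝ} (hp : 0 < p) (μ : ℂ) :
    HasDerivAt (fun p => hankel κ p μ) (Complex.I * hankel κ p (μ + 1)) p := by
  obtain ⟨M, hM, hb⟩ := exists_norm_hankelIntegrand_le hκ ‖μ + 1‖ (p₀ := p / 2) (p₁ := 2 * p)
    (by positivity)
  have := hasDerivAt_integral_of_dominated_loc_of_deriv_le (μ := volume)
    (F := fun p t => hankelIntegrand κ p μ t)
    (F' := fun p t => Complex.I * hankelIntegrand κ p (μ + 1) t)
    (bound := fun t => M * Real.exp (-(p / 2 * κ / 2 * |t|)))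
    (s := Set.Icc (p / 2) (2 * p)) (x₀ := p) (Icc_mem_nhds (by linarith) (by linarith))
    (Eventually.of_forall fun q => (continuous_hankelIntegrand hκ q μ).aestronglyMeasurable)
    (integrable_hankelIntegrand hκ hp μ)
    ((continuous_hankelIntegrand hκ p (μ + 1)).const_mul Complex.I).aestronglyMeasurable
    (Eventually.of_forall fun t q hq => by
      simpa using hb (μ + 1) le_rfl q hq t)
    ((integrable_exp_neg_mul_abs (by positivity)).const_mul M)
    (Eventually.of_forall fun t q hq => by
      have h0 := ne_zero_of_mem_belowPlane (dipCurve_mem hκ one_pos t)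
      have h1 : HasDerivAt (fun q : ℝ => Complex.I * (q : ℂ) * dipCurve κ 1 t)
          (Complex.I * dipCurve κ 1 t) q := by
        simpa using! ((Complex.ofRealCLM.hasDerivAt (x := q)).const_mul Complex.I).mul_const
          (dipCurve κ 1 t)
      refine ((h1.cexp.const_mul (powBelow (dipCurve κ 1 t) μ)).mul_const
        (dipVel κ 1 t)).congr_deriv ?_
      simp only [hankelIntegrand, powBelow_add_one h0]
      ring)
  have h := this.2
  rw [integral_const_mul] at h
  exact h

/-- The Hankel integral is homogeneous. -/
theorem hankel_homogeneous {κ : ℝ} (hκ : 0 < κ) {p : ℝ} (hp : 0 < p) (μ : ℂ) :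
    (p : ℂ) ^ (μ + 1) * hankel κ p μ = hankel κ 1 μ := by
  set h : ℝ → ℂ := fun p => (p : ℂ) ^ (μ + 1) * hankel κ p μ with hh
  have hd : ∀ q ∈ Set.Ioi (0 : ℝ), HasDerivAt h 0 q := by
    intro q hq
    rw [Set.mem_Ioi] at hq
    have hq0 : (q : ℂ) ≠ 0 := by exact_mod_cast hq.ne'
    have h1 : HasDerivAt (fun q : ℝ => (q : ℂ) ^ (μ + 1)) ((μ + 1) * (q : ℂ) ^ μ) q := by
      have := (hasDerivAt_id (q : ℂ)).cpow_const (c := μ + 1) (Or.inl (by simpa using hq))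
      simpa using! this.comp_ofReal
    refine (h1.mul (hasDerivAt_hankel hκ hq μ)).congr_deriv ?_
    rw [Complex.cpow_add _ _ hq0, Complex.cpow_one]
    -- The derivative of `q ^ (μ + 1)` times the integral is `q ^ μ` times the left side of the
    -- recurrence. Homogeneity thus follows without deforming an infinite contour.
    linear_combination (q : ℂ) ^ μ * hankel_recurrence hκ hq μ
  have := (convex_Ioi (0 : ℝ)).is_const_of_fderivWithin_eq_zero (𝕜 := ℝ) (f := h)
    (fun q hq => (hd q hq).differentiableAt.differentiableWithinAt)
    (fun q hq => by
      have h1 := (hd q hq).hasFDerivAt.hasFDerivWithinAt (s := Set.Ioi 0)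
      rw [h1.fderivWithin (isOpen_Ioi.uniqueDiffWithinAt hq)]
      simp) (x := p) (y := 1) hp (Set.mem_Ioi.2 one_pos)
  simpa [hh] using this

/-- The Laplace transform of a power, for complex parameters. -/
theorem integral_cpow_mul_exp_neg_mul_Ioi_complex {μ s : ℂ} (hμ : 0 ≤ μ.re) (hs : 0 < s.re) :
    ∫ t in Set.Ioi (0 : ℝ), (t : ℂ) ^ μ * Complex.exp (-(s * t)) =
      Complex.exp (-(μ + 1) * Complex.log s) * Complex.Gamma (μ + 1) := by
  set L : ℂ → ℂ → ℂ := fun ν s => ∫ t in Set.Ioi (0 : ℝ), (t : ℂ) ^ ν * Complex.exp (-(s * t))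
    with hL
  have hcont : ∀ ν s : ℂ, ContinuousOn (fun t : ℝ => (t : ℂ) ^ ν * Complex.exp (-(s * t)))
      (Set.Ioi 0) := by
    intro ν s
    refine ContinuousOn.mul (fun t ht => ?_) (by fun_prop)
    exact (Complex.continuousAt_ofReal_cpow_const t ν (Or.inr (ne_of_gt ht))).continuousWithinAt
  have hmeas : ∀ ν s : ℂ, AEStronglyMeasurable
      (fun t : ℝ => (t : ℂ) ^ ν * Complex.exp (-(s * t))) (volume.restrict (Set.Ioi 0)) :=
    fun ν s => (hcont ν s).aestronglyMeasurable measurableSet_Ioi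
  have hnorm : ∀ ν s : ℂ, ∀ t ∈ Set.Ioi (0 : ℝ), ‖(t : ℂ) ^ ν * Complex.exp (-(s * t))‖
      = t ^ ν.re * Real.exp (-s.re * t) := by
    intro ν s t ht
    rw [norm_mul, Complex.norm_cpow_eq_rpow_re_of_pos ht, Complex.norm_exp]
    simp
  have hbint : ∀ a c : ℝ, 0 ≤ a → 0 < c → IntegrableOn (fun t : ℝ => t ^ a * Real.exp (-c * t))
      (Set.Ioi 0) := by
    intro a c ha hc
    simpa using integrableOn_rpow_mul_exp_neg_mul_rpow (s := a) (p := 1) (b := c) (by linarith) one_pos hc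
  have hint : ∀ ν s : ℂ, 0 ≤ ν.re → 0 < s.re → IntegrableOn
      (fun t : ℝ => (t : ℂ) ^ ν * Complex.exp (-(s * t))) (Set.Ioi 0) := by
    intro ν s hν hs
    refine (hbint ν.re s.re hν hs).mono' (hmeas ν s) ?_
    filter_upwards [ae_restrict_mem measurableSet_Ioi] with t ht using (hnorm ν s t ht).le
  have hder : ∀ s : ℂ, 0 < s.re → HasDerivAt (L μ) (-(L (μ + 1) s)) s := by
    intro s hs
    have := hasDerivAt_integral_of_dominated_loc_of_deriv_le (μ := volume.restrict (Set.Ioi (0 : ℝ)))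
      (F := fun (s : ℂ) (t : ℝ) => (t : ℂ) ^ μ * Complex.exp (-(s * t)))
      (F' := fun s t => -((t : ℂ) ^ (μ + 1) * Complex.exp (-(s * t))))
      (bound := fun t => t ^ (μ + 1).re * Real.exp (-(s.re / 2) * t))
      (s := {z | s.re / 2 < z.re}) (x₀ := s)
      ((isOpen_lt continuous_const Complex.continuous_re).mem_nhds
        (by simp only [Set.mem_ofPred_eq]; linarith))
      (Eventually.of_forall fun z => hmeas μ z) (hint μ s hμ hs) (hmeas (μ + 1) s).neg
      (by
        filter_upwards [ae_restrict_mem measurableSet_Ioi] with t ht z hz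
        rw [norm_neg, hnorm _ _ t ht]
        have : (0 : ℝ) < t := ht
        have hz : s.re / 2 < z.re := hz
        gcongr)
      (hbint _ _ (by simp; linarith) (by linarith))
      (by
        filter_upwards [ae_restrict_mem measurableSet_Ioi] with t ht z hz
        have ht0 : (t : ℂ) ≠ 0 := by exact_mod_cast (ne_of_gt ht)
        have h1 : HasDerivAt (fun z : ℂ => -(z * t)) (-(t : ℂ)) z := by
          have := ((hasDerivAt_id z).mul_const (t : ℂ)).neg
          rw [one_mul] at this
          exact this
        refine (h1.cexp.const_mul ((t : ℂ) ^ μ)).congr_deriv ?_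
        rw [Complex.cpow_add _ _ ht0, Complex.cpow_one]
        ring)
    have h := this.2
    rw [integral_neg] at h
    exact h
  have hrec : ∀ s : ℂ, 0 < s.re → s * L (μ + 1) s = (μ + 1) * L μ s := by
    intro s hs
    have hf : ∀ t ∈ Set.Ioi (0 : ℝ), HasDerivAt
        (fun t : ℝ => (t : ℂ) ^ (μ + 1) * Complex.exp (-(s * t)))
        ((μ + 1) * ((t : ℂ) ^ μ * Complex.exp (-(s * t))) -
          s * ((t : ℂ) ^ (μ + 1) * Complex.exp (-(s * t)))) t := by
      intro t ht
      have h1 : HasDerivAt (fun q : ℝ => (q : ℂ) ^ (μ + 1)) ((μ + 1) * (t : ℂ) ^ μ) t := by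
        have := (hasDerivAt_id (t : ℂ)).cpow_const (c := μ + 1) (Or.inl (by simpa using ht))
        simpa using! this.comp_ofReal
      have h2 : HasDerivAt (fun q : ℝ => -(s * (q : ℂ))) (-s) t := by
        simpa using! ((Complex.ofRealCLM.hasDerivAt (x := t)).const_mul s).neg
      refine (h1.mul h2.cexp).congr_deriv ?_
      ring
    have i1 := (hint μ s hμ hs).const_mul (μ + 1)
    have i2 := (hint (μ + 1) s (by simp; linarith) hs).const_mul s
    have c0 : ContinuousWithinAt (fun t : ℝ => (t : ℂ) ^ (μ + 1) * Complex.exp (-(s * t)))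
        (Set.Ici 0) 0 := by
      refine ContinuousAt.continuousWithinAt (ContinuousAt.mul ?_ (by fun_prop))
      exact Complex.continuousAt_ofReal_cpow_const 0 (μ + 1) (Or.inl (by simp; linarith))
    have lim : Tendsto (fun t : ℝ => (t : ℂ) ^ (μ + 1) * Complex.exp (-(s * t))) atTop (𝓝 0) :=
      tendsto_zero_of_hasDerivAt_of_integrableOn_Ioi (a := 0) hf (i1.sub i2)
        (hint (μ + 1) s (by simp; linarith) hs)
    have := integral_Ioi_of_hasDerivAt_of_tendsto c0 hf (i1.sub i2) lim
    rw [integral_sub i1 i2, integral_const_mul, integral_const_mul] at this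
    have h0 : μ + 1 ≠ 0 := fun h => by
      have := congrArg Complex.re h
      simp at this; linarith
    simp only [Complex.ofReal_zero, Complex.zero_cpow h0, zero_mul, sub_zero] at this
    exact (sub_eq_zero.1 this).symm
  -- Integration by parts (`hrec`) makes `s ^ (μ + 1) L μ s` constant on the right half-plane; its
  -- value at `s = 1` is Euler's integral.
  set h : ℂ → ℂ := fun s => Complex.exp ((μ + 1) * Complex.log s) * L μ s with hh
  have hconst : ∀ s : ℂ, 0 < s.re → HasDerivAt h 0 s := by
    intro s hs
    have hs0 : s ≠ 0 := fun h => by simp [h] at hs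
    have h1 := ((Complex.hasDerivAt_log (Or.inl hs)).const_mul (μ + 1)).cexp
    refine (h1.mul (hder s hs)).congr_deriv ?_
    have h2 := hrec s hs
    field_simp
    linear_combination (-Complex.exp ((μ + 1) * Complex.log s)) * h2
  have hopen : IsOpen {z : ℂ | 0 < z.re} := isOpen_lt continuous_const Complex.continuous_re
  have hc := (convex_halfSpace_re_gt 0).is_const_of_fderivWithin_eq_zero (𝕜 := ℂ) (f := h)
    (fun q hq => (hconst q hq).differentiableAt.differentiableWithinAt)
    (fun q hq => by
      have h1 := (hconst q hq).hasFDerivAt.hasFDerivWithinAt (s := {z : ℂ | 0 < z.re})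
      rw [h1.fderivWithin (hopen.uniqueDiffWithinAt hq)]
      simp) (x := s) (y := 1) hs (by simp)
  have hone : h 1 = Complex.Gamma (μ + 1) := by
    have := Complex.integral_cpow_mul_exp_neg_mul_Ioi (a := μ + 1) (r := 1) (by simp; linarith) one_pos
    simpa [hh, hL] using this
  rw [hone] at hc
  have e : Complex.exp (-(μ + 1) * Complex.log s) * Complex.exp ((μ + 1) * Complex.log s) = 1 := by
    rw [← Complex.exp_add, ← Complex.exp_zero]; congr 1; ring
  rw [← hc, hh, ← mul_assoc, e, one_mul]


theorem log_neg_of_im_neg {z : ℂ} (h : z.im < 0) :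
    Complex.log (-z) = Complex.log z + Real.pi * Complex.I := by
  rw [Complex.log, Complex.log, norm_neg, Complex.arg_neg_eq_arg_add_pi_of_im_neg h]
  push_cast; ring

theorem log_neg_of_im_pos {z : ℂ} (h : 0 < z.im) :
    Complex.log (-z) = Complex.log z - Real.pi * Complex.I := by
  rw [Complex.log, Complex.log, norm_neg, Complex.arg_neg_eq_arg_sub_pi_of_im_pos h]
  push_cast; ring

/-- The value of the Hankel integral for exponents that are not integers. -/
def hankelValue (μ : ℂ) : ℂ :=
  Complex.exp (Real.pi * Complex.I * (μ + 1) / 2) *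
    (1 - Complex.exp (-(2 * Real.pi * Complex.I * μ))) * Complex.Gamma (1 + μ)

/-- The integral of `w ^ μ exp(i w) dw` along a ray `t ↦ t b` in the upper half-plane. -/
theorem integral_ray {μ b : ℂ} (hμ : 0 ≤ μ.re) (hb : 0 < b.im) :
    ∫ t in Set.Ioi (0 : ℝ), powBelow (t * b) μ * Complex.exp (Complex.I * (t * b)) * b =
      Complex.exp ((μ + 1) * (Complex.log (Complex.I * b) - Complex.log (-(Complex.I * b))
        - Complex.I * Real.pi / 2)) * Complex.Gamma (μ + 1) := by
  have hb0 : b ≠ 0 := by rintro rfl; simp at hb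
  have hre : 0 < (-(Complex.I * b)).re := by simpa using hb
  have h1 : ∀ t ∈ Set.Ioi (0 : ℝ), powBelow (t * b) μ * Complex.exp (Complex.I * (t * b)) * b =
      (powBelow b (μ + 1)) * ((t : ℂ) ^ μ * Complex.exp (-(-(Complex.I * b) * t))) := by
    intro t ht
    rw [powBelow_ofReal_mul ht hb0, powBelow_add_one hb0]
    have : Complex.I * (t * b) = -(-(Complex.I * b) * t) := by ring
    rw [this]; ring
  rw [setIntegral_congr_fun measurableSet_Ioi h1, integral_const_mul,
    integral_cpow_mul_exp_neg_mul_Ioi_complex hμ hre, powBelow, ← mul_assoc, ← Complex.exp_add]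
  congr 2; ring

/-- The Hankel integral for exponents with nonnegative real part, by collapsing the curve to two
rays. -/
theorem hankel_of_re_nonneg {κ : ℝ} (hκ : 0 < κ) {μ : ℂ} (hμ : 0 ≤ μ.re) :
    hankel κ 1 μ = hankelValue μ := by
  set g : ℝ → ℝ → ℂ := fun p u => powBelow (dipCurve κ p u) μ *
    Complex.exp (Complex.I * (1 : ℝ) * dipCurve κ p u) * dipVel κ p u with hg
  set vee : ℝ → ℂ := fun u => u + Complex.I * ((κ * |u| : ℝ) : ℂ) with hvee
  set gV : ℝ → ℂ := fun u => powBelow (vee u) μ * Complex.exp (Complex.I * (1 : ℝ) * vee u) *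
    (1 + Complex.I * ((κ * (u / |u|) : ℝ) : ℂ)) with hgV
  -- the scaled integrals
  have hscale : ∀ p : ℝ, 0 < p → ∫ u, g p u = hankel κ 1 μ := by
    intro p hp
    -- Homogeneity shows that the integral along the curve of scale `p` does not depend on `p`, so
    -- the scale may tend to zero.
    rw [← hankel_homogeneous hκ hp μ]
    have h1 := Measure.integral_comp_mul_left (g p) p
    have h2 : ∀ t, g p (p * t) = (p : ℂ) ^ μ * hankelIntegrand κ p μ t := by
      intro t
      have h0 := ne_zero_of_mem_belowPlane (dipCurve_mem hκ one_pos t)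
      have hv : dipVel κ p (p * t) = dipVel κ 1 t := by simp [dipVel, dipSlope_scale hp]
      simp only [hg, dipCurve_scale κ hp, hv, powBelow_ofReal_mul hp h0, hankelIntegrand]
      have : Complex.I * ((1 : ℝ) : ℂ) * (p * dipCurve κ 1 t) = Complex.I * p * dipCurve κ 1 t := by
        push_cast; ring
      rw [this]; ring
    simp only [h2, integral_const_mul] at h1
    rw [abs_of_pos (inv_pos.2 hp), Complex.real_smul] at h1
    have hp0 : (p : ℂ) ≠ 0 := by exact_mod_cast hp.ne'
    rw [Complex.cpow_add _ _ hp0, Complex.cpow_one, hankel]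
    push_cast at h1
    field_simp at h1
    linear_combination (-1 : ℂ) * h1
  obtain ⟨M, hM, hexp⟩ := exists_rpow_le_exp μ.re hμ (c := κ / 2) (by positivity)
  set B : ℝ := Real.exp (2 * Real.pi * |μ.im|) * ((1 + 2 * κ) ^ μ.re * M) *
    Real.exp (2 * κ) * (1 + κ) with hB
  -- For `Re μ ≥ 0` an upper bound for the modulus of the curve suffices, and such a bound is
  -- uniform in the scale. For `Re μ < 0` the limiting curve would be singular at the origin.
  have hbound : ∀ p ∈ Set.Ioc (0 : ℝ) 1, ∀ u, ‖g p u‖ ≤ B * Real.exp (-(κ / 2 * |u|)) := by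
    intro p hp u
    have h0 := ne_zero_of_mem_belowPlane (dipCurve_mem hκ hp.1 u)
    have h1 := norm_powBelow_le h0 μ
    have h2 : ‖dipCurve κ p u‖ ≤ (1 + 2 * κ) * (1 + |u|) := by
      have := norm_dipCurve_le hκ.le hp.1.le u
      nlinarith [hp.2, abs_nonneg u, mul_nonneg hκ.le (abs_nonneg u)]
    have h3 := norm_exp_dipCurve_le (δ := p) (p := 1) hκ.le zero_le_one u
    have h4 := norm_dipVel_le hκ.le p u
    have h5 : Real.exp (2 * 1 * κ * p) ≤ Real.exp (2 * κ) := by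
      rw [Real.exp_le_exp]; nlinarith [hp.2]
    simp only [hg, norm_mul]
    calc _ ≤ (Real.exp (2 * Real.pi * |μ.im|) * ((1 + 2 * κ) * (1 + |u|)) ^ μ.re) *
          (Real.exp (2 * κ) * Real.exp (-(1 * κ * |u|))) * (1 + κ) := by
          have h6 := h1.trans (mul_le_mul_of_nonneg_left
            (Real.rpow_le_rpow (norm_nonneg _) h2 hμ) (Real.exp_pos _).le)
          have h7 := h3.trans (mul_le_mul_of_nonneg_right h5 (Real.exp_pos _).le)
          exact mul_le_mul (mul_le_mul h6 h7 (norm_nonneg _) (by positivity)) h4 (norm_nonneg _)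
            (by positivity)
      _ ≤ (Real.exp (2 * Real.pi * |μ.im|) * ((1 + 2 * κ) ^ μ.re * (M * Real.exp (κ / 2 * |u|)))) *
          (Real.exp (2 * κ) * Real.exp (-(1 * κ * |u|))) * (1 + κ) := by
          rw [Real.mul_rpow (by positivity) (by positivity)]
          have := hexp |u| (abs_nonneg u)
          gcongr
      _ = B * (Real.exp (κ / 2 * |u|) * Real.exp (-(1 * κ * |u|))) := by rw [hB]; ring
      _ = _ := by rw [← Real.exp_add]; congr 2; ring
  have hcont : ∀ p, 0 < p → Continuous (g p) := by
    intro p hp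
    have h1 : Continuous fun t => powBelow (dipCurve κ p t) μ := by
      rw [continuous_iff_continuousAt]
      exact fun t => ContinuousAt.comp (f := dipCurve κ p) (g := fun w => powBelow w μ)
        (continuousAt_powBelow (dipCurve_mem hκ hp t) μ) (continuous_dipCurve κ p).continuousAt
    have h2 := continuous_dipCurve κ p
    have h3 := continuous_dipVel κ hp
    simp only [hg]
    fun_prop
  have hIoc : ∀ᶠ p in 𝓝[>] (0 : ℝ), p ∈ Set.Ioc (0 : ℝ) 1 := Ioc_mem_nhdsGT one_pos
  have hlim : ∀ u : ℝ, u ≠ 0 → Tendsto (fun p => g p u) (𝓝[>] 0) (𝓝 (gV u)) := by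
    intro u hu
    have hc : ContinuousAt (fun p : ℝ => dipCurve κ p u) 0 := by
      unfold dipCurve dip; fun_prop
    have hc0 : dipCurve κ 0 u = vee u := by simp [dipCurve, dip, hvee, Real.sqrt_sq_eq_abs]
    have hv : ContinuousAt (fun p : ℝ => dipVel κ p u) 0 := by
      unfold dipVel dipSlope
      have : √((0 : ℝ) ^ 2 + u ^ 2) ≠ 0 := by
        rw [zero_pow two_ne_zero, zero_add, Real.sqrt_sq_eq_abs]; exact abs_ne_zero.2 hu
      have : ContinuousAt (fun p : ℝ => u / √(p ^ 2 + u ^ 2)) 0 :=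
        continuousAt_const.div (by fun_prop) this
      fun_prop
    have hv0 : dipVel κ 0 u = 1 + Complex.I * ((κ * (u / |u|) : ℝ) : ℂ) := by
      simp [dipVel, dipSlope, Real.sqrt_sq_eq_abs]
    have hmem : dipCurve κ 0 u ∈ belowPlane := fun h => by simp at h; exact absurd h hu
    have hpow : ContinuousAt (fun p : ℝ => powBelow (dipCurve κ p u) μ) 0 :=
      ContinuousAt.comp (f := fun p => dipCurve κ p u) (g := fun w => powBelow w μ)
        (continuousAt_powBelow hmem μ) hc
    have : ContinuousAt (fun p => g p u) 0 := by
      simp only [hg]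
      fun_prop
    have h2 : g 0 u = gV u := by simp only [hg, hgV, hc0, hv0]
    rw [← h2]
    exact this.tendsto.mono_left nhdsWithin_le_nhds
  -- The limiting curve passes through the origin at `u = 0`, so the pointwise limit is used almost
  -- everywhere.
  have hne : ∀ᵐ u : ℝ, u ≠ 0 := by
    rw [ae_iff]; simp
  have hmeas : ∀ᶠ p in 𝓝[>] (0 : ℝ), AEStronglyMeasurable (g p) volume := by
    filter_upwards [hIoc] with p hp using (hcont p hp.1).aestronglyMeasurable
  have htend : Tendsto (fun p => ∫ u, g p u) (𝓝[>] 0) (𝓝 (∫ u, gV u)) :=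
    tendsto_integral_filter_of_dominated_convergence (fun u => B * Real.exp (-(κ / 2 * |u|))) hmeas
      (by filter_upwards [hIoc] with p hp using Eventually.of_forall (hbound p hp))
      ((integrable_exp_neg_mul_abs (by positivity)).const_mul B)
      (by filter_upwards [hne] with u hu using hlim u hu)
  have hval : hankel κ 1 μ = ∫ u, gV u := by
    refine tendsto_nhds_unique (tendsto_const_nhds.congr' ?_) htend
    filter_upwards [self_mem_nhdsWithin] with p hp using (hscale p hp).symm
  have hgVint : Integrable gV := by
    have hm : AEStronglyMeasurable gV volume := by
      refine aestronglyMeasurable_of_tendsto_ae (atTop : Filter ℕ)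
        (f := fun n => g (1 / ((n : ℝ) + 1)))
        (fun n => (hcont _ (by positivity)).aestronglyMeasurable) ?_
      filter_upwards [hne] with u hu
      refine (hlim u hu).comp ?_
      rw [tendsto_nhdsWithin_iff]
      exact ⟨tendsto_one_div_add_atTop_nhds_zero_nat,
        Eventually.of_forall fun n => by simp only [Set.mem_Ioi]; positivity⟩
    refine ((integrable_exp_neg_mul_abs (c := κ / 2) (by positivity)).const_mul B).mono' hm ?_
    filter_upwards [hne] with u hu
    refine le_of_tendsto (hlim u hu).norm ?_
    filter_upwards [hIoc] with p hp using hbound p hp u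
  -- On the two rays `log (i b)` and `log (-i b)` differ by `π i` and `-π i` respectively. These are
  -- the only places where the chosen branch of the power enters; the difference of the two results
  -- produces the factor `1 - exp (-2π i μ)`.
  have hright : ∫ u in Set.Ioi (0 : ℝ), gV u =
      Complex.exp ((μ + 1) * (Complex.I * Real.pi / 2)) * Complex.Gamma (μ + 1) := by
    have h := integral_ray (b := 1 + Complex.I * κ) hμ (by simpa using hκ)
    have e : Complex.I * (1 + Complex.I * κ) = -((κ : ℂ) - Complex.I) := by
      linear_combination (κ : ℂ) * Complex.I_mul_I
    rw [e, neg_neg, log_neg_of_im_neg (by simp)] at h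
    rw [← setIntegral_congr_fun measurableSet_Ioi (fun t ht => ?_)] at h
    · rw [h]; congr 2; ring
    have ht : (0 : ℝ) < t := ht
    have e2 : vee t = t * (1 + Complex.I * κ) := by
      simp only [hvee, abs_of_pos ht]; push_cast; ring
    simp only [hgV, e2, abs_of_pos ht, div_self ht.ne']
    push_cast
    ring_nf
  have hleft : ∫ u in Set.Iic (0 : ℝ), gV u =
      -(Complex.exp ((μ + 1) * (-(3 * Complex.I * Real.pi / 2))) * Complex.Gamma (μ + 1)) := by
    have h := integral_ray (b := -1 + Complex.I * κ) hμ (by simpa using hκ)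
    have e : Complex.I * (-1 + Complex.I * κ) = -((κ : ℂ) + Complex.I) := by
      linear_combination (κ : ℂ) * Complex.I_mul_I
    rw [e, neg_neg, log_neg_of_im_pos (by simp)] at h
    have h2 := integral_comp_neg_Ioi (0 : ℝ) gV
    rw [neg_zero] at h2
    rw [← h2]
    have h3 : ∀ t ∈ Set.Ioi (0 : ℝ), gV (-t) = -(powBelow (t * (-1 + Complex.I * κ)) μ *
        Complex.exp (Complex.I * (t * (-1 + Complex.I * κ))) * (-1 + Complex.I * κ)) := by
      intro t ht
      have ht : (0 : ℝ) < t := ht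
      have e2 : vee (-t) = t * (-1 + Complex.I * κ) := by
        simp only [hvee, abs_neg, abs_of_pos ht]; push_cast; ring
      have e3 : -t / t = -1 := by field_simp
      simp only [hgV, e2, abs_neg, abs_of_pos ht, e3]
      push_cast
      ring_nf
    rw [setIntegral_congr_fun measurableSet_Ioi h3, integral_neg, h]
    congr 3; ring
  rw [hval, ← intervalIntegral.integral_Iic_add_Ioi hgVint.integrableOn hgVint.integrableOn (b := 0),
    hright, hleft, hankelValue, add_comm 1 μ]
  have e1 : Complex.exp ((μ + 1) * (-(3 * Complex.I * Real.pi / 2))) =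
      Complex.exp (Real.pi * Complex.I * (μ + 1) / 2) *
        Complex.exp (-(2 * Real.pi * Complex.I * μ)) := by
    rw [← Complex.exp_add, ← Complex.exp_periodic ((μ + 1) * (-(3 * Complex.I * Real.pi / 2)))]
    congr 1; ring
  have e2 : (μ + 1) * (Complex.I * Real.pi / 2) = Real.pi * Complex.I * (μ + 1) / 2 := by ring
  rw [e1, e2]
  ring

/-- The relation of `hankel_recurrence` at `p = 1`, obtained here from the functional equation of
the Gamma function. -/
theorem hankelValue_recurrence {μ : ℂ} (hμ : μ + 1 ≠ 0) :
    hankelValue (μ + 1) = Complex.I * (μ + 1) * hankelValue μ := by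
  unfold hankelValue
  have h1 : Complex.exp (Real.pi * Complex.I * (μ + 1 + 1) / 2)
      = Complex.I * Complex.exp (Real.pi * Complex.I * (μ + 1) / 2) := by
    have : Real.pi * Complex.I * (μ + 1 + 1) / 2
        = Real.pi / 2 * Complex.I + Real.pi * Complex.I * (μ + 1) / 2 := by ring
    rw [this, Complex.exp_add, Complex.exp_pi_div_two_mul_I]
  have h2 : Complex.exp (-(2 * Real.pi * Complex.I * (μ + 1)))
      = Complex.exp (-(2 * Real.pi * Complex.I * μ)) := by
    have : -(2 * Real.pi * Complex.I * (μ + 1))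
        = -(2 * Real.pi * Complex.I * μ) - 2 * Real.pi * Complex.I := by ring
    rw [this, Complex.exp_periodic.sub_eq]
  have h3 : Complex.Gamma (1 + (μ + 1)) = (1 + μ) * Complex.Gamma (1 + μ) := by
    have := Complex.Gamma_add_one (1 + μ) (by rwa [add_comm] at hμ)
    rw [← this]; ring_nf
  rw [h1, h2, h3]; ring

/-- Both sides satisfy the same recurrence, which can be run downwards from `Re μ ≥ 0`: dividing by
`μ + 1` is possible as no integer is met. The induction is on a natural number `n` with `-n ≤ Re μ`.
-/
theorem hankel_of_ne_int {κ : ℝ} (hκ : 0 < κ) {μ : ℂ} (hμ : ∀ n : ℤ, μ ≠ n) :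
    hankel κ 1 μ = hankelValue μ := by
  have key : ∀ n : ℕ, ∀ μ : ℂ, (∀ n : ℤ, μ ≠ n) → -(n : ℝ) ≤ μ.re →
      hankel κ 1 μ = hankelValue μ := by
    intro n
    induction n with
    | zero => intro μ _ h; exact hankel_of_re_nonneg hκ (by simpa using h)
    | succ n ih =>
      intro μ hμ h
      have h1 : μ + 1 ≠ 0 := fun h0 => hμ (-1) (by push_cast; linear_combination h0)
      have h2 := ih (μ + 1) (fun m hm => hμ (m - 1) (by push_cast; linear_combination hm)) (by
        push_cast at h; simp; linarith)
      have h3 := hankel_recurrence hκ one_pos μ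
      rw [h2, hankelValue_recurrence h1] at h3
      have h4 : (μ + 1) * (hankel κ 1 μ - hankelValue μ) = 0 := by
        push_cast at h3
        linear_combination h3 - (μ + 1) * hankelValue μ * Complex.I_mul_I
      exact sub_eq_zero.1 ((mul_eq_zero.1 h4).resolve_left h1)
  obtain ⟨n, hn⟩ := exists_nat_ge (-μ.re)
  exact key n μ hμ (by linarith)

theorem continuous_hankel {κ : ℝ} (hκ : 0 < κ) : Continuous (hankel κ 1) := by
  rw [continuous_iff_continuousAt]
  intro μ
  obtain ⟨M, hM, hb⟩ := exists_norm_hankelIntegrand_le hκ (‖μ‖ + 1) (p₀ := 1) (p₁ := 1) one_pos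
  refine continuousAt_of_dominated (F := fun μ t => hankelIntegrand κ 1 μ t)
    (bound := fun t => M * Real.exp (-(1 * κ / 2 * |t|)))
    (Eventually.of_forall fun ν => (continuous_hankelIntegrand hκ 1 ν).aestronglyMeasurable) ?_
    ((integrable_exp_neg_mul_abs (by positivity)).const_mul M) (Eventually.of_forall fun t => ?_)
  · filter_upwards [Metric.ball_mem_nhds μ one_pos] with ν hν
    refine Eventually.of_forall fun t => hb ν ?_ 1 (by simp) t
    rw [mem_ball_iff_norm] at hν
    have := norm_le_norm_add_norm_sub' ν μ
    linarith
  · unfold hankelIntegrand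
    exact ((continuous_powBelow_exponent _).mul continuous_const).mul continuous_const |>.continuousAt

/-- The integral is continuous in the exponent, while the formula for non-integral exponents has a
removable singularity at `-1`. Along `μ = -1 + s` the vanishing factor `1 - exp (-2π i s)` meets the
pole of `Γ(s) = Γ(1 + s) / s`, and the product tends to `2π i`. -/
theorem hankel_neg_one {κ : ℝ} (hκ : 0 < κ) : hankel κ 1 (-1) = 2 * Real.pi * Complex.I := by
  set z : ℝ → ℂ := fun s => ((s : ℝ) : ℂ) with hz
  have h1 : Tendsto (fun s : ℝ => hankel κ 1 (-1 + s)) (𝓝[>] 0) (𝓝 (hankel κ 1 (-1))) := by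
    have : ContinuousAt (fun s : ℝ => hankel κ 1 (-1 + s)) 0 :=
      ((continuous_hankel hκ).comp (by fun_prop)).continuousAt
    have h := this.tendsto.mono_left (nhdsWithin_le_nhds (s := Set.Ioi 0))
    simpa using h
  have hslope : Tendsto (fun s : ℝ => (1 - Complex.exp (-(2 * Real.pi * Complex.I * s))) / s)
      (𝓝[>] 0) (𝓝 (2 * Real.pi * Complex.I)) := by
    have hd : HasDerivAt (fun s : ℝ => 1 - Complex.exp (-(2 * Real.pi * Complex.I * s)))
        (2 * Real.pi * Complex.I) 0 := by
      have h2 : HasDerivAt (fun s : ℝ => -(2 * Real.pi * Complex.I * (s : ℂ)))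
          (-(2 * Real.pi * Complex.I)) 0 := by
        simpa using! ((Complex.ofRealCLM.hasDerivAt (x := 0)).const_mul
          (2 * Real.pi * Complex.I)).neg
      refine (h2.cexp.const_sub 1).congr_deriv ?_
      simp
    have := hd.tendsto_slope_zero_right
    refine this.congr fun s => ?_
    simp [div_eq_inv_mul]
  have hG : Tendsto (fun s : ℝ => Complex.Gamma (1 + s)) (𝓝[>] 0) (𝓝 1) := by
    have h3 : ContinuousAt Complex.Gamma 1 :=
      (Complex.differentiableAt_Gamma 1 (fun m h => by
        have := congrArg Complex.re h
        simp at this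
        linarith [(Nat.cast_nonneg m : (0:ℝ) ≤ m)])).continuousAt
    have h4 : ContinuousAt (fun s : ℝ => Complex.Gamma (1 + s)) 0 :=
      ContinuousAt.comp (f := fun s : ℝ => (1 : ℂ) + s) (g := Complex.Gamma) (by simpa using h3)
        (by fun_prop)
    have := h4.tendsto.mono_left (nhdsWithin_le_nhds (s := Set.Ioi 0))
    simpa [Complex.Gamma_one] using this
  have hE : Tendsto (fun s : ℝ => Complex.exp (Real.pi * Complex.I * s / 2)) (𝓝[>] 0) (𝓝 1) := by
    have : Continuous fun s : ℝ => Complex.exp (Real.pi * Complex.I * s / 2) := by fun_prop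
    have h := (this.tendsto 0).mono_left (nhdsWithin_le_nhds (s := Set.Ioi 0))
    simpa using h
  have h2 : Tendsto (fun s : ℝ => hankel κ 1 (-1 + s)) (𝓝[>] 0) (𝓝 (2 * Real.pi * Complex.I)) := by
    have := (hE.mul hslope).mul hG
    rw [one_mul, mul_one] at this
    refine this.congr' ?_
    filter_upwards [Ioo_mem_nhdsGT one_pos] with s hs
    have hs0 : (s : ℂ) ≠ 0 := by exact_mod_cast hs.1.ne'
    rw [hankel_of_ne_int hκ]
    · unfold hankelValue
      have e1 : Complex.Gamma (1 + s) = s * Complex.Gamma (1 + (-1 + s)) := by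
        have := Complex.Gamma_add_one (s : ℂ) hs0
        rw [add_comm 1 (s : ℂ), this]; congr 2; ring
      have e2 : Complex.exp (-(2 * Real.pi * Complex.I * (-1 + s)))
          = Complex.exp (-(2 * Real.pi * Complex.I * s)) := by
        have : -(2 * Real.pi * Complex.I * (-1 + s))
            = -(2 * Real.pi * Complex.I * s) + 2 * Real.pi * Complex.I := by ring
        rw [this, Complex.exp_periodic]
      rw [e1, e2]
      have e3 : (-1 + s + 1 : ℂ) = s := by ring
      rw [e3]
      field_simp
    · intro n hn
      have := congrArg Complex.re hn
      simp at this
      have h5 : ((-1 : ℤ) : ℝ) < n := by push_cast; linarith [hs.1]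
      have h6 : (n : ℝ) < ((0 : ℤ) : ℝ) := by push_cast; linarith [hs.2]
      have := Int.cast_lt.1 h5
      have := Int.cast_lt.1 h6
      omega
  exact tendsto_nhds_unique h1 h2

/-- The Hankel integral along `dipCurve κ 1`. -/
theorem hankel_eq_Iconst {κ : ℝ} (hκ : 0 < κ) {μ : ℂ} (hμ : IsPoleOrBranchExponent μ) :
    hankel κ 1 μ = Iconst μ := by
  unfold Iconst
  split_ifs with h
  · rw [h, hankel_neg_one hκ]
  · exact hankel_of_ne_int hκ (hμ.resolve_left h)

/-- Needed because an asymptotic equivalence with zero would carry no information. Off the integers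
the factor `1 - exp (-2π i μ)` does not vanish, and the Gamma function has neither poles nor zeros.
-/
theorem Iconst_ne_zero {μ : ℂ} (hμ : IsPoleOrBranchExponent μ) : Iconst μ ≠ 0 := by
  unfold Iconst
  split_ifs with h
  · exact mul_ne_zero (mul_ne_zero two_ne_zero (by exact_mod_cast Real.pi_ne_zero)) Complex.I_ne_zero
  · have hn := hμ.resolve_left h
    refine mul_ne_zero (mul_ne_zero (Complex.exp_ne_zero _) ?_) (Complex.Gamma_ne_zero ?_)
    · intro h0
      obtain ⟨n, h1⟩ := Complex.exp_eq_one_iff.1 (sub_eq_zero.1 h0).symm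
      have hp : (2 * Real.pi * Complex.I : ℂ) ≠ 0 :=
        mul_ne_zero (mul_ne_zero two_ne_zero (by exact_mod_cast Real.pi_ne_zero)) Complex.I_ne_zero
      refine hn (-n) (mul_left_cancel₀ hp ?_)
      push_cast
      linear_combination -h1
    · intro m hm
      exact hn (-m - 1) (by push_cast; linear_combination hm)


/-! ### Displaced chains in the cut domain and their homotopies -/

/-- The space cut along `{Re w₁ = 0, a₁ Im w₁ ≤ 0}` and `{Re w₂ = 0, a₂ Im w₂ ≤ 0}`. -/
def cutSpace (a₁ a₂ : ℝ) : Set C3 :=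
  {w | ((w 0).re = 0 → 0 < a₁ * (w 0).im) ∧ ((w 1).re = 0 → 0 < a₂ * (w 1).im)}

/-- The function `max |f| g` is positive on the compact set, hence at least some `m > 0`; half of
`m` is a margin. A sign condition on the singularity itself thereby holds uniformly near it. -/
theorem exists_margin {X : Type*} [TopologicalSpace X] {E : Set X} (hE : IsCompact E) {f g : X → ℝ}
    (hf : ContinuousOn f E) (hg : ContinuousOn g E) (h : ∀ y ∈ E, f y = 0 → 0 < g y) :
    ∃ ρ > 0, ∀ y ∈ E, |f y| ≤ ρ → ρ ≤ g y := by
  rcases E.eq_empty_or_nonempty with rfl | hne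
  · exact ⟨1, one_pos, by simp⟩
  obtain ⟨y₀, hy₀, hmin⟩ := hE.exists_isMinOn hne (hf.abs.sup hg)
  set m := max |f y₀| (g y₀) with hm
  have hmpos : 0 < m := by
    by_cases h0 : f y₀ = 0
    · exact lt_max_of_lt_right (h y₀ hy₀ h0)
    · exact lt_max_of_lt_left (abs_pos.2 h0)
  refine ⟨m / 2, by positivity, fun y hy hfy => ?_⟩
  have : m ≤ max |f y| (g y) := hmin hy
  rcases le_max_iff.1 this with h1 | h1 <;> linarith

theorem exists_pos_le_of_pos {X : Type*} [TopologicalSpace X] {E : Set X} (hE : IsCompact E)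
    {g : X → ℝ} (hg : ContinuousOn g E) (h : ∀ y ∈ E, 0 < g y) : ∃ c > 0, ∀ y ∈ E, c ≤ g y := by
  obtain ⟨ρ, hρ, hh⟩ := exists_margin hE (f := fun _ => 0) continuousOn_const hg
    fun y hy _ => h y hy
  exact ⟨ρ, hρ, fun y hy => hh y hy (by simpa using hρ.le)⟩

theorem exists_norm_le_of_continuousOn {X V : Type*} [TopologicalSpace X] [NormedAddCommGroup V]
    {E : Set X} (hE : IsCompact E) {g : X → V} (hg : ContinuousOn g E) :
    ∃ c ≥ 0, ∀ y ∈ E, ‖g y‖ ≤ c := by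
  obtain ⟨c, hc⟩ := hE.exists_bound_of_continuousOn hg
  exact ⟨max c 0, le_max_right _ _, fun y hy => (hc y hy).trans (le_max_left _ _)⟩

/-- Points near the displaced points `y + i ε u(y)` lie on the prescribed sides. -/
theorem exists_mem_cut_of_margin {E : Set R3} (hE : IsCompact E) {v θ : R3 → R3}
    (hv : ContinuousOn v E) (hθ : ContinuousOn θ E) (a : ℝ) (k : Fin 3)
    (hav : ∀ y ∈ E, y k = 0 → 0 < a * v y k) (haθ : ∀ y ∈ E, y k = 0 → 0 < a * θ y k) (M : ℝ) :
    ∀ᶠ ε : ℝ in 𝓝[>] (0 : ℝ), ∀ y ∈ E, ∀ s ∈ Set.Icc (0 : ℝ) 1, ∀ w : C3,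
      ‖w - (toC3 y + (ε * Complex.I : ℂ) • toC3 (v y + s • (θ y - v y)))‖ ≤ M * ε ^ 2 →
      (w k).re = 0 → 0 < a * (w k).im := by
  have hk : ContinuousOn (fun y : R3 => y k) E := (continuous_apply k).continuousOn
  obtain ⟨ρ₁, hρ₁, h₁⟩ := exists_margin hE hk (g := fun y => a * v y k)
    (continuousOn_const.mul ((continuous_apply k).comp_continuousOn hv)) hav
  obtain ⟨ρ₂, hρ₂, h₂⟩ := exists_margin hE hk (g := fun y => a * θ y k)
    (continuousOn_const.mul ((continuous_apply k).comp_continuousOn hθ)) haθ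
  have t1 : Tendsto (fun ε : ℝ => M * ε ^ 2) (𝓝[>] 0) (𝓝 0) := by
    have : Continuous fun ε : ℝ => M * ε ^ 2 := by fun_prop
    simpa using (this.tendsto 0).mono_left (nhdsWithin_le_nhds (s := Set.Ioi 0))
  have t2 : Tendsto (fun ε : ℝ => |a| * M * ε) (𝓝[>] 0) (𝓝 0) := by
    have : Continuous fun ε : ℝ => |a| * M * ε := by fun_prop
    simpa using (this.tendsto 0).mono_left (nhdsWithin_le_nhds (s := Set.Ioi 0))
  have hρ : 0 < min ρ₁ ρ₂ := lt_min hρ₁ hρ₂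
  filter_upwards [t1.eventually (gt_mem_nhds hρ), t2.eventually (gt_mem_nhds hρ),
    self_mem_nhdsWithin] with ε e1 e2 hε y hy s hs w hw hre
  have hε : 0 < ε := hε
  have hc := (norm_le_pi_norm _ k).trans hw
  simp only [Pi.sub_apply, Pi.add_apply, Pi.smul_apply, toC3_apply, smul_eq_mul] at hc
  set u := v y k + s * (θ y k - v y k) with hu
  have hcr := (Complex.abs_re_le_norm _).trans hc
  have hci := (Complex.abs_im_le_norm _).trans hc
  simp [hre] at hcr
  simp at hci
  have hyk : |y k| ≤ min ρ₁ ρ₂ := hcr.trans e1.le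
  have b1 := h₁ y hy (hyk.trans (min_le_left _ _))
  have b2 := h₂ y hy (hyk.trans (min_le_right _ _))
  -- Fields on the prescribed side form a convex set, so all interpolations have the same margin.
  have b3 : min ρ₁ ρ₂ ≤ a * u := by
    have c1 := (min_le_left ρ₁ ρ₂).trans b1
    have c2 := (min_le_right ρ₁ ρ₂).trans b2
    have : a * u = (1 - s) * (a * v y k) + s * (a * θ y k) := by rw [hu]; ring
    rw [this]
    nlinarith [mul_le_mul_of_nonneg_left c1 (sub_nonneg.2 hs.2), mul_le_mul_of_nonneg_left c2 hs.1]
  have h3 : |a * ((w k).im - ε * u)| ≤ |a| * (M * ε ^ 2) := by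
    rw [abs_mul]; exact mul_le_mul_of_nonneg_left hci (abs_nonneg a)
  have h4 := (abs_le.1 h3).1
  have h5 : |a| * (M * ε ^ 2) = ε * (|a| * M * ε) := by ring
  -- The displacement across the singularity is of order `ε`, the deviation from it of order `ε²`
  -- only.
  have h6 : ε * (|a| * M * ε) < ε * min ρ₁ ρ₂ := by gcongr
  have h7 : ε * min ρ₁ ρ₂ ≤ ε * (a * u) := by gcongr
  nlinarith

/-- Taylor's formula of first order with a quadratic remainder. -/
theorem norm_taylor_le {V : Type*} [NormedAddCommGroup V] [NormedSpace ℂ V] {G : C3 → V} {S : Set C3}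
    (hS : Convex ℝ S) {L : NNReal}
    (hG : ∀ w ∈ S, DifferentiableAt ℂ G w) (hL : LipschitzOnWith L (fderiv ℂ G) S) {x w : C3}
    (hx : x ∈ S) (hw : w ∈ S) :
    ‖G w - G x - fderiv ℂ G x (w - x)‖ ≤ L * ‖w - x‖ ^ 2 := by
  have hseg : segment ℝ x w ⊆ S := hS.segment_subset hx hw
  have h := (convex_segment x w).norm_image_sub_le_of_norm_hasFDerivWithin_le' (𝕜 := ℂ) (f := G)
    (f' := fderiv ℂ G) (φ := fderiv ℂ G x) (C := L * ‖w - x‖)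
    (fun z hz => (hG z (hseg hz)).hasFDerivAt.hasFDerivWithinAt)
    (fun z hz => (hL.norm_sub_le (hseg hz) hx).trans (by
      gcongr
      exact norm_sub_le_of_mem_segment hz)) (left_mem_segment ℝ x w) (right_mem_segment ℝ x w)
  refine h.trans (le_of_eq ?_)
  ring

theorem gradDot_add (f : C3 → ℂ) (x u v : R3) : gradDot f x (u + v) = gradDot f x u + gradDot f x v := by
  have : toC3 (u + v) = toC3 u + toC3 v := (toC3L.map_add u v)
  simp [gradDot, this]

theorem toC3_smul (s : ℝ) (v : R3) : toC3 (s • v) = (s : ℂ) • toC3 v := by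
  ext i; simp

theorem toC3_sub (u v : R3) : toC3 (u - v) = toC3 u - toC3 v := toC3L.map_sub u v

theorem gradDot_smul (f : C3 → ℂ) (x v : R3) (s : ℝ) : gradDot f x (s • v) = s * gradDot f x v := by
  simp [gradDot, toC3_smul]

theorem gradDot_sub (f : C3 → ℂ) (x u v : R3) : gradDot f x (u - v) = gradDot f x u - gradDot f x v := by
  simp [gradDot, toC3_sub]

/-- Uniform lower bound of the imaginary part of the phase at points displaced in desired
directions. -/
theorem exists_im_phase_lower {G : C3 → ℂ} {R : ℝ} {L : NNReal}
    (hG : AnalyticOnNhd ℂ G (Metric.ball 0 R)) (hL : LipschitzOnWith L (fderiv ℂ G) (Metric.ball 0 R))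
    {E : Set R3} (hE : IsCompact E) (hER : ∀ y ∈ E, ‖y‖ < R)
    (hreal : ∀ y ∈ E, (G (toC3 y)).im = 0) {u : R3 → R3} (hu : ContinuousOn u E)
    (hpos : ∀ y ∈ E, 0 < gradDot G y (u y)) {M : ℝ} (hM : 0 ≤ M) :
    ∀ᶠ ε : ℝ in 𝓝[>] (0 : ℝ), ∃ ζ > 0, ∀ y ∈ E, ∀ w ∈ Metric.ball (0 : C3) R,
      ‖w - (toC3 y + (ε * Complex.I : ℂ) • toC3 (u y))‖ ≤ M * ε ^ 2 → ζ ≤ (G w).im := by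
  have hm : ∀ y ∈ E, toC3 y ∈ Metric.ball (0 : C3) R := fun y hy => by
    rw [mem_ball_zero_iff, norm_toC3]; exact hER y hy
  have cfd : ContinuousOn (fun y => fderiv ℂ G (toC3 y)) E :=
    hG.fderiv.continuousOn.comp continuous_toC3.continuousOn hm
  have cgd : ContinuousOn (fun y => gradDot G y (u y)) E :=
    Complex.continuous_re.comp_continuousOn (cfd.clm_apply (continuous_toC3.comp_continuousOn hu))
  obtain ⟨c, hc, hcE⟩ := exists_pos_le_of_pos hE cgd hpos
  obtain ⟨B, hB, hBE⟩ := exists_norm_le_of_continuousOn hE cfd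
  obtain ⟨V, hV, hVE⟩ := exists_norm_le_of_continuousOn hE hu
  -- All errors of order `ε²`: the deviation of `w` seen through the differential, and the Taylor
  -- remainder.
  set A := B * M + L * (V + M) ^ 2 with hA
  have t1 : Tendsto (fun ε : ℝ => A * ε) (𝓝[>] 0) (𝓝 0) := by
    have : Continuous fun ε : ℝ => A * ε := by fun_prop
    simpa using (this.tendsto 0).mono_left (nhdsWithin_le_nhds (s := Set.Ioi 0))
  filter_upwards [t1.eventually (gt_mem_nhds (half_pos hc)), Ioc_mem_nhdsGT one_pos] with ε e1 hε
  have hε0 : 0 < ε := hε.1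
  refine ⟨ε * (c / 2), by positivity, fun y hy w hw hwy => ?_⟩
  set q := w - (toC3 y + (ε * Complex.I : ℂ) • toC3 (u y)) with hq
  have hwx : w - toC3 y = (ε * Complex.I : ℂ) • toC3 (u y) + q := by rw [hq]; abel
  have htay := norm_taylor_le (convex_ball 0 R) (fun z hz => (hG z hz).differentiableAt) hL (hm y hy) hw
  have hn : ‖w - toC3 y‖ ≤ ε * (V + M) := by
    rw [hwx]
    refine (norm_add_le _ _).trans ?_
    rw [norm_smul, norm_toC3]
    simp only [norm_mul, Complex.norm_real, Complex.norm_I, mul_one, Real.norm_eq_abs, abs_of_pos hε0]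
    have h1 := mul_le_mul_of_nonneg_left (hVE y hy) hε0.le
    have h2 : M * ε ^ 2 ≤ ε * M := by nlinarith [mul_nonneg hM hε0.le, hε.2]
    linarith
  have him := (Complex.abs_im_le_norm _).trans htay
  rw [hwx, map_add, map_smul] at him
  have e2 : ((ε * Complex.I : ℂ) • fderiv ℂ G (toC3 y) (toC3 (u y))).im = ε * gradDot G y (u y) := by
    simp [gradDot]
  have h3 : |(fderiv ℂ G (toC3 y) q).im| ≤ B * (M * ε ^ 2) :=
    (Complex.abs_im_le_norm _).trans ((ContinuousLinearMap.le_opNorm _ _).trans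
      (mul_le_mul (hBE y hy) hwy (norm_nonneg _) hB))
  simp only [Complex.sub_im, Complex.add_im, e2, hreal y hy] at him
  have h4 : (L : ℝ) * ‖w - toC3 y‖ ^ 2 ≤ L * (ε * (V + M)) ^ 2 := by gcongr
  rw [hwx] at h4
  have h5 := mul_le_mul_of_nonneg_left (hcE y hy) hε0.le
  have h6 : B * (M * ε ^ 2) + L * (ε * (V + M)) ^ 2 = ε * (A * ε) := by rw [hA]; ring
  have h7 : ε * (A * ε) ≤ ε * (c / 2) := by gcongr
  have h8 := (abs_le.1 him).1
  have h9 := (abs_le.1 h3).1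
  linarith

/-- The chain `Φ`, replaced by the displaced points `y + i ε θ(y)` where `χ = 1`. -/
def patch (χ : R3 → ℝ) (θ : R3 → R3) (ε : ℝ) (Φ : R3 → C3) (y : R3) : C3 :=
  Φ y + χ y • (toC3 y + (ε * Complex.I : ℂ) • toC3 (θ y) - Φ y)

/-- Deformation of a chain of displaced points into another one that is displaced in desired
directions. -/
theorem eventually_patch {G : C3 → ℂ} {R : ℝ} {L : NNReal}
    (hG : AnalyticOnNhd ℂ G (Metric.ball 0 R)) (hL : LipschitzOnWith L (fderiv ℂ G) (Metric.ball 0 R))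
    {E K N : Set R3} (hE : IsCompact E) (hN : IsOpen N) (hER : ∀ y ∈ E, ‖y‖ < R)
    (hreal : ∀ y ∈ E, (G (toC3 y)).im = 0) {v θ : R3 → R3}
    (hv : ContinuousOn v E) (hθ : ContinuousOn θ E) {a₁ a₂ : ℝ}
    (hv₁ : ∀ y ∈ E, y 0 = 0 → 0 < a₁ * v y 0) (hv₂ : ∀ y ∈ E, y 1 = 0 → 0 < a₂ * v y 1)
    (hθ₁ : ∀ y ∈ E, y 0 = 0 → 0 < a₁ * θ y 0) (hθ₂ : ∀ y ∈ E, y 1 = 0 → 0 < a₂ * θ y 1)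
    (hvd : ∀ y ∈ E \ K, 0 < gradDot G y (v y)) (hθd : ∀ y ∈ E \ N, 0 < gradDot G y (θ y))
    {χ : R3 → ℝ} (hχc : Continuous χ) (hχ : ∀ y, χ y ∈ Set.Icc (0 : ℝ) 1) (hχK : ∀ y ∈ K, χ y = 1)
    {Φ : ℝ → R3 → C3} {M : ℝ} (hM : 0 ≤ M)
    (hΦ : ∀ᶠ ε : ℝ in 𝓝[>] (0 : ℝ), ∀ y ∈ E,
      ‖Φ ε y - (toC3 y + (ε * Complex.I : ℂ) • toC3 (v y))‖ ≤ M * ε ^ 2) :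
    ∀ᶠ ε : ℝ in 𝓝[>] (0 : ℝ),
      (∀ y ∈ E, ∀ t ∈ Set.Icc (0 : ℝ) 1, Φ ε y + t • (patch χ θ ε (Φ ε) y - Φ ε y) ∈
        Metric.ball 0 R ∩ cutSpace a₁ a₂) ∧
      ∃ ζ > 0, ∀ y ∈ E \ N, ζ ≤ (G (patch χ θ ε (Φ ε) y)).im := by
  -- the points of the homotopy
  have hpt : ∀ ε y t, ‖Φ ε y - (toC3 y + (ε * Complex.I : ℂ) • toC3 (v y))‖ ≤ M * ε ^ 2 →
      t ∈ Set.Icc (0 : ℝ) 1 →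
      ‖Φ ε y + t • (patch χ θ ε (Φ ε) y - Φ ε y) -
        (toC3 y + (ε * Complex.I : ℂ) • toC3 (v y + (t * χ y) • (θ y - v y)))‖ ≤ M * ε ^ 2 := by
    intro ε y t h ht
    have hs : t * χ y ∈ Set.Icc (0 : ℝ) 1 :=
      ⟨mul_nonneg ht.1 (hχ y).1, mul_le_one₀ ht.2 (hχ y).1 (hχ y).2⟩
    -- The patched homotopy stays as close to displaced points as the original chain, since only the
    -- deviation of `Φ` remains and it is multiplied by a number in `[0, 1]`.
    have e : Φ ε y + t • (patch χ θ ε (Φ ε) y - Φ ε y) -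
        (toC3 y + (ε * Complex.I : ℂ) • toC3 (v y + (t * χ y) • (θ y - v y)))
        = (1 - t * χ y) • (Φ ε y - (toC3 y + (ε * Complex.I : ℂ) • toC3 (v y))) := by
      ext i
      simp [patch]
      ring
    rw [e, norm_smul, Real.norm_of_nonneg (by linarith [hs.2])]
    calc _ ≤ 1 * (M * ε ^ 2) := by gcongr; linarith [hs.1]
      _ = _ := one_mul _
  have hu : ContinuousOn (fun y => v y + χ y • (θ y - v y)) E :=
    hv.add (hχc.continuousOn.smul (hθ.sub hv))
  have hball : ∀ᶠ ε : ℝ in 𝓝[>] (0 : ℝ), ∀ y ∈ E, ∀ s ∈ Set.Icc (0 : ℝ) 1, ∀ w : C3,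
      ‖w - (toC3 y + (ε * Complex.I : ℂ) • toC3 (v y + s • (θ y - v y)))‖ ≤ M * ε ^ 2 →
      w ∈ Metric.ball 0 R := by
    obtain ⟨c, hc, hcE⟩ := exists_pos_le_of_pos hE (g := fun y => R - ‖y‖)
      (continuous_const.sub continuous_norm).continuousOn fun y hy => sub_pos.2 (hER y hy)
    obtain ⟨V, hV, hVE⟩ := exists_norm_le_of_continuousOn hE hv
    obtain ⟨T, hT, hTE⟩ := exists_norm_le_of_continuousOn hE (hθ.sub hv)
    have t1 : Tendsto (fun ε : ℝ => ε * (V + T) + M * ε ^ 2) (𝓝[>] 0) (𝓝 0) := by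
      have : Continuous fun ε : ℝ => ε * (V + T) + M * ε ^ 2 := by fun_prop
      simpa using (this.tendsto 0).mono_left (nhdsWithin_le_nhds (s := Set.Ioi 0))
    filter_upwards [t1.eventually (gt_mem_nhds hc), self_mem_nhdsWithin] with ε e1 hε y hy s hs w hw
    have hε : 0 < ε := hε
    rw [mem_ball_zero_iff]
    have h1 : ‖(ε * Complex.I : ℂ) • toC3 (v y + s • (θ y - v y))‖ ≤ ε * (V + T) := by
      rw [norm_smul, norm_toC3]
      simp only [norm_mul, Complex.norm_real, Complex.norm_I, mul_one, Real.norm_eq_abs,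
        abs_of_pos hε]
      gcongr
      refine (norm_add_le _ _).trans (add_le_add (hVE y hy) ?_)
      rw [norm_smul, Real.norm_of_nonneg hs.1]
      exact (mul_le_of_le_one_left (norm_nonneg _) hs.2).trans (hTE y hy)
    have h2 : ‖w‖ ≤ ‖toC3 y + (ε * Complex.I : ℂ) • toC3 (v y + s • (θ y - v y))‖ +
        ‖w - (toC3 y + (ε * Complex.I : ℂ) • toC3 (v y + s • (θ y - v y)))‖ :=
      norm_le_norm_add_norm_sub' _ _
    have h3 := norm_add_le (toC3 y) ((ε * Complex.I : ℂ) • toC3 (v y + s • (θ y - v y)))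
    rw [norm_toC3] at h3
    have h4 := hcE y hy
    linarith
  -- The interpolated field is desired off `N`: where `χ = 1` it is `θ`, and where `χ < 1` the point
  -- lies outside `K`, so that `v` is desired as well.
  have hphase := exists_im_phase_lower hG hL (hE.diff hN) (fun y hy => hER y hy.1)
    (fun y hy => hreal y hy.1) (hu.mono Set.sdiff_subset) (fun y hy => by
      rw [gradDot_add, gradDot_smul, gradDot_sub]
      have h2 := hθd y hy
      have hc := hχ y
      rcases eq_or_lt_of_le hc.2 with h1 | h1
      · rw [h1]; linarith
      · have h3 : 0 < gradDot G y (v y) := hvd y ⟨hy.1, fun hK => h1.ne (hχK y hK)⟩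
        nlinarith [mul_nonneg hc.1 h2.le, mul_pos (sub_pos.2 h1) h3]) hM
  filter_upwards [hΦ, hball, hphase, exists_mem_cut_of_margin hE hv hθ a₁ 0 hv₁ hθ₁ M,
    exists_mem_cut_of_margin hE hv hθ a₂ 1 hv₂ hθ₂ M] with ε h1 h2 h3 h4 h5
  have hs : ∀ y, ∀ t ∈ Set.Icc (0 : ℝ) 1, t * χ y ∈ Set.Icc (0 : ℝ) 1 := fun y t ht =>
      ⟨mul_nonneg ht.1 (hχ y).1, mul_le_one₀ ht.2 (hχ y).1 (hχ y).2⟩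
  refine ⟨fun y hy t ht => ?_, ?_⟩
  · have hp := hpt ε y t (h1 y hy) ht
    exact ⟨h2 y hy _ (hs y t ht) _ hp, h4 y hy _ (hs y t ht) _ hp, h5 y hy _ (hs y t ht) _ hp⟩
  · obtain ⟨ζ, hζ, hb⟩ := h3
    refine ⟨ζ, hζ, fun y hy => ?_⟩
    have h1I : (1 : ℝ) ∈ Set.Icc (0 : ℝ) 1 := by simp
    have hp := hpt ε y 1 (h1 y hy.1) h1I
    have e : Φ ε y + (1 : ℝ) • (patch χ θ ε (Φ ε) y - Φ ε y) = patch χ θ ε (Φ ε) y := by simp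
    have hbm := h2 y hy.1 _ (hs y 1 h1I) _ hp
    rw [e] at hp hbm
    rw [one_mul] at hp
    exact hb y hy _ hbm hp


/-! ### Anisotropic scaling and the Gaussian integral -/

theorem integral_comp_diagonal (s : Fin 3 → ℝ) (hs : ∀ i, 0 < s i) (f : R3 → ℂ) :
    ∫ y, f y = ((∏ i, s i : ℝ) : ℂ) * ∫ z : R3, f (fun i => s i * z i) := by
  have hdet : (Matrix.diagonal s).det = ∏ i, s i := Matrix.det_diagonal
  have hpos : 0 < ∏ i, s i := Finset.prod_pos fun i _ => hs i
  have h := Real.smul_map_diagonal_volume_pi (D := s) (by rw [hdet]; exact hpos.ne')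
  have hap : ∀ z : R3, Matrix.toLin' (Matrix.diagonal s) z = fun i => s i * z i := by
    intro z; ext i; simp [Matrix.mulVec_diagonal]
  have hemb : MeasurableEmbedding (Matrix.toLin' (Matrix.diagonal s)) := by
    refine (LinearMap.isClosedEmbedding_of_injective (𝕜 := ℝ) ?_).measurableEmbedding
    rw [LinearMap.ker_eq_bot]
    intro a b hab
    rw [hap, hap] at hab
    ext i
    exact mul_left_cancel₀ (hs i).ne' (congrFun hab i)
  conv_lhs => rw [← h]
  rw [integral_smul_measure, hemb.integral_map, hdet, abs_of_pos hpos,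
    ENNReal.toReal_ofReal hpos.le, Complex.real_smul]
  simp only [hap]

theorem exp_I_mul_pi_div_four_mul_sign {β : ℝ} (hβ : β ≠ 0) :
    Complex.exp (Complex.I * (Real.pi / 4) * Real.sign β) =
      ((√2 / 2 : ℝ) : ℂ) * (1 + Real.sign β * Complex.I) := by
  have h : ∀ x : ℝ, Complex.exp (Complex.I * (Real.pi / 4) * x) =
      Real.cos (Real.pi / 4 * x) + Real.sin (Real.pi / 4 * x) * Complex.I := by
    intro x
    have : Complex.I * (Real.pi / 4) * x = ((Real.pi / 4 * x : ℝ) : ℂ) * Complex.I := by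
      push_cast; ring
    rw [this, Complex.exp_mul_I, Complex.ofReal_cos, Complex.ofReal_sin]
  rw [h]
  rcases lt_or_gt_of_ne hβ with hb | hb
  · rw [Real.sign_of_neg hb, mul_neg, mul_one, Real.cos_neg, Real.sin_neg, Real.cos_pi_div_four,
      Real.sin_pi_div_four]
    push_cast; ring
  · rw [Real.sign_of_pos hb, mul_one, Real.cos_pi_div_four, Real.sin_pi_div_four]
    push_cast; ring

theorem sign_sq {β : ℝ} (hβ : β ≠ 0) : Real.sign β * Real.sign β = 1 := by
  rcases lt_or_gt_of_ne hβ with hb | hb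
  · rw [Real.sign_of_neg hb]; norm_num
  · rw [Real.sign_of_pos hb]; norm_num

/-- The exponent of the Gaussian integral along the line `t ↦ (1 + i ε sign β) t`. -/
def gaussIntegrand (β ε t : ℝ) : ℂ :=
  Complex.exp (Complex.I * ((β : ℂ) / 2 * ((1 + Complex.I * ε * Real.sign β) * t) ^ 2)) *
    (1 + Complex.I * ε * Real.sign β)

theorem gaussIntegrand_eq (β ε t : ℝ) :
    gaussIntegrand β ε t = Complex.exp (-(-(Complex.I * β / 2) *
      (1 + Complex.I * ε * Real.sign β) ^ 2) * (t : ℂ) ^ 2) * (1 + Complex.I * ε * Real.sign β) := by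
  unfold gaussIntegrand; congr 2; ring

/-- Tilting the line towards `sign β` makes the oscillatory Gaussian absolutely convergent. -/
theorem gauss_re {β ε : ℝ} : (-(Complex.I * β / 2) *
    (1 + Complex.I * ε * Real.sign β) ^ 2 : ℂ).re = |β| * ε := by
  rw [← sign_mul_self_eq_abs]
  simp [pow_two]
  ring

theorem integral_gaussIntegrand {β ε : ℝ} (hβ : β ≠ 0) (hε : 0 < ε) :
    ∫ t, gaussIntegrand β ε t =
      (√(2 * Real.pi) / √|β| : ℝ) * Complex.exp (Complex.I * (Real.pi / 4) * Real.sign β) := by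
  have hb : 0 < |β| := abs_pos.2 hβ
  have hs := sign_sq hβ
  have hsC : (Real.sign β : ℂ) * Real.sign β = 1 := by exact_mod_cast hs
  set σ := Real.sign β with hσ
  set z : ℂ := 1 + Complex.I * ε * σ with hz
  have hz0 : z ≠ 0 := fun h => by
    have := congrArg Complex.re h
    simp [hz] at this
  -- `q` is the expected value divided by the direction of the line. It is shown to be the square
  -- root of `π / b` with positive real part, which is the root given by the principal branch.
  set q : ℂ := (√(2 * Real.pi) / √|β| : ℝ) * Complex.exp (Complex.I * (Real.pi / 4) * σ) / z with hq
  have hsq : (((√(2 * Real.pi) / √|β| : ℝ) : ℂ)) ^ 2 = 2 * Real.pi / |β| := by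
    rw [← Complex.ofReal_pow, div_pow, Real.sq_sqrt (by positivity), Real.sq_sqrt hb.le]
    push_cast; ring
  have hexp2 : Complex.exp (Complex.I * (Real.pi / 4) * σ) ^ 2 = σ * Complex.I := by
    rw [exp_I_mul_pi_div_four_mul_sign hβ, mul_pow, ← Complex.ofReal_pow, div_pow,
      Real.sq_sqrt (by norm_num)]
    push_cast
    linear_combination (1 / 2 : ℂ) * (σ * σ * Complex.I_sq - hsC)
  have habs : (σ : ℂ) * β = |β| := by exact_mod_cast sign_mul_self_eq_abs β
  have hβC : (β : ℂ) ≠ 0 := by exact_mod_cast hβ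
  have habsC : ((|β| : ℝ) : ℂ) ≠ 0 := by exact_mod_cast hb.ne'
  have hq2 : q ^ 2 = Real.pi / (-(Complex.I * β / 2) * z ^ 2) := by
    rw [hq, div_pow, mul_pow, hsq, hexp2]
    have hI := Complex.I_ne_zero
    field_simp
    rw [← habs]
    linear_combination (σ : ℂ) * β * Complex.I_sq
  -- Up to a positive factor, `q` is `(1 + i sign β) / (1 + i ε sign β)`, whose real part has
  -- numerator `1 + ε`.
  have hqre : 0 < q.re := by
    rw [hq, exp_I_mul_pi_div_four_mul_sign hβ, ← mul_assoc, ← Complex.ofReal_mul, mul_div_assoc,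
      Complex.re_ofReal_mul]
    refine mul_pos (by positivity) ?_
    rw [Complex.div_re]
    have hn : 0 < Complex.normSq z := Complex.normSq_pos.2 hz0
    rw [← add_div]
    refine div_pos ?_ hn
    simp [hz]
    nlinarith
  have key := integral_gaussian_complex (b := -(Complex.I * β / 2) * z ^ 2) (by
    rw [gauss_re]; positivity)
  simp only [gaussIntegrand_eq]
  rw [integral_mul_const, key, ← hq2, one_div, Complex.sq_cpow_two_inv hqre, hq]
  exact div_mul_cancel₀ _ hz0


/-! ### The integral over a small ball about the crossing -/

/-- The displacement field that passes below both singularities at the scale `δ`. -/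
def dipField (β δ : ℝ) (y : R3) : R3 := ![dip δ (y 0), dip δ (y 1), Real.sign β * y 2]

/-- The chain of the points `y + i ε dipField(y)`. -/
def dipChain (β ε δ : ℝ) (y : R3) : C3 := toC3 y + (ε * Complex.I : ℂ) • toC3 (dipField β δ y)

@[simp] theorem dipChain_zero (β ε δ : ℝ) (y : R3) : dipChain β ε δ y 0 = dipCurve ε δ (y 0) := by
  simp [dipChain, dipField, dipCurve]; ring

@[simp] theorem dipChain_one (β ε δ : ℝ) (y : R3) : dipChain β ε δ y 1 = dipCurve ε δ (y 1) := by
  simp [dipChain, dipField, dipCurve]; ring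

@[simp] theorem dipChain_two (β ε δ : ℝ) (y : R3) :
    dipChain β ε δ y 2 = (1 + Complex.I * ε * Real.sign β) * y 2 := by
  simp [dipChain, dipField]; ring

theorem isLift_dipField (β : ℝ) {δ : ℝ} (hδ : 0 ≤ δ) (y : R3) :
    IsLift β δ y (dipField β δ y) where
  lower₀ := dip_lower _ _
  upper₀ := (dip_upper hδ _).trans (by linarith)
  lower₁ := dip_lower _ _
  upper₁ := (dip_upper hδ _).trans (by linarith)
  third := rfl

/-- The space cut for chains that pass below both singularities. -/
abbrev lowerSpace : Set C3 := cutSpace (-1) (-1)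

theorem mem_lowerSpace {w : C3} : w ∈ lowerSpace ↔ w 0 ∈ belowPlane ∧ w 1 ∈ belowPlane := by
  simp [cutSpace, belowPlane]

theorem dipChain_mem (β : ℝ) {ε δ : ℝ} (hε : 0 < ε) (hδ : 0 < δ) (y : R3) :
    dipChain β ε δ y ∈ lowerSpace := by
  rw [mem_lowerSpace, dipChain_zero, dipChain_one]
  exact ⟨dipCurve_mem hε hδ _, dipCurve_mem hε hδ _⟩

theorem abs_sign_le_one (β : ℝ) : |Real.sign β| ≤ 1 := by
  rcases lt_trichotomy β 0 with h | h | h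
  · simp [Real.sign_of_neg h]
  · simp [h]
  · simp [Real.sign_of_pos h]

theorem norm_one_add_sign_le (β : ℝ) {ε : ℝ} (hε : 0 ≤ ε) :
    ‖(1 + Complex.I * ε * Real.sign β : ℂ)‖ ≤ 1 + ε := by
  refine (norm_add_le _ _).trans ?_
  rw [norm_one, norm_mul, norm_mul, Complex.norm_I, one_mul, Complex.norm_real, Complex.norm_real,
    Real.norm_of_nonneg hε, Real.norm_eq_abs]
  nlinarith [abs_sign_le_one β]

theorem norm_dipField_le {β δ : ℝ} (hδ : 0 ≤ δ) (y : R3) : ‖dipField β δ y‖ ≤ ‖y‖ + 2 * δ := by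
  rw [pi_norm_le_iff_of_nonneg (by positivity)]
  intro i
  have h0 := norm_le_pi_norm y 0
  have h1 := norm_le_pi_norm y 1
  have h2 := norm_le_pi_norm y 2
  rw [Real.norm_eq_abs] at h0 h1 h2
  fin_cases i
  · simpa [dipField] using (abs_dip_le hδ (y 0)).trans (by linarith)
  · simpa [dipField] using (abs_dip_le hδ (y 1)).trans (by linarith)
  · simp [dipField]
    nlinarith [abs_sign_le_one β, abs_nonneg (y 2)]

theorem norm_displaced_le {ε : ℝ} (hε : ε ∈ Set.Icc (0 : ℝ) 1) (y v : R3) :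
    ‖toC3 y + (ε * Complex.I : ℂ) • toC3 v‖ ≤ ‖y‖ + ‖v‖ := by
  refine (norm_add_le _ _).trans ?_
  rw [norm_smul, norm_toC3, norm_toC3]
  simp only [norm_mul, Complex.norm_real, Complex.norm_I, mul_one, Real.norm_of_nonneg hε.1]
  have := mul_le_of_le_one_left (norm_nonneg v) hε.2
  linarith

theorem norm_dipChain_le {β ε δ : ℝ} (hε : ε ∈ Set.Icc (0 : ℝ) 1) (hδ : 0 ≤ δ) (y : R3) :
    ‖dipChain β ε δ y‖ ≤ 2 * ‖y‖ + 2 * δ :=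
  (norm_displaced_le hε _ _).trans (by linarith [norm_dipField_le (β := β) hδ y])

theorem continuous_dipField (β δ : ℝ) : Continuous (dipField β δ) := by
  unfold dipField dip
  refine continuous_pi fun i => ?_
  fin_cases i <;> simp <;> fun_prop

theorem continuous_dipChain (β ε δ : ℝ) : Continuous (dipChain β ε δ) := by
  have := continuous_dipField β δ
  unfold dipChain
  fun_prop

/-- The model `w₁ ^ μ₁ w₂ ^ μ₂` of the amplitude. -/
def modelPow (μ₁ μ₂ : ℂ) (w : C3) : ℂ := powBelow (w 0) μ₁ * powBelow (w 1) μ₂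

/-- The Jacobian of `dipChain`. -/
def dipJac (β ε δ : ℝ) (y : R3) : ℂ :=
  dipVel ε δ (y 0) * dipVel ε δ (y 1) * (1 + Complex.I * ε * Real.sign β)

/-- The scaling of the coordinates at the frequency `Λ`. -/
def scaleVec (Λ : ℝ) : Fin 3 → ℝ := ![Λ⁻¹, Λ⁻¹, (√Λ)⁻¹]

theorem scaleVec_pos {Λ : ℝ} (hΛ : 0 < Λ) (i : Fin 3) : 0 < scaleVec Λ i := by
  fin_cases i <;> simp [scaleVec, hΛ]

/-- The scaled model integrand. -/
def modelIntegrand (β ε : ℝ) (μ₁ μ₂ : ℂ) (z : R3) : ℂ :=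
  hankelIntegrand ε 1 μ₁ (z 0) * hankelIntegrand ε 1 μ₂ (z 1) * gaussIntegrand β ε (z 2)

theorem integral_modelIntegrand {β ε : ℝ} {μ₁ μ₂ : ℂ} (hβ : β ≠ 0) (hε : 0 < ε)
    (hμ₁ : IsPoleOrBranchExponent μ₁) (hμ₂ : IsPoleOrBranchExponent μ₂) :
    ∫ z, modelIntegrand β ε μ₁ μ₂ z = Iconst μ₁ * Iconst μ₂ *
      ((√(2 * Real.pi) / √|β| : ℝ) * Complex.exp (Complex.I * (Real.pi / 4) * Real.sign β)) := by
  have h := integral_fintype_prod_volume_eq_prod (𝕜 := ℂ)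
    (f := (![hankelIntegrand ε 1 μ₁, hankelIntegrand ε 1 μ₂, gaussIntegrand β ε] :
      Fin 3 → ℝ → ℂ))
  simp only [Fin.prod_univ_three, Matrix.cons_val_zero, Matrix.cons_val_one, Matrix.cons_val] at h
  rw [← integral_gaussIntegrand hβ hε, ← hankel_eq_Iconst hε hμ₁, ← hankel_eq_Iconst hε hμ₂]
  exact h

theorem modelPow_scale {Λ : ℝ} (hΛ : 0 < Λ) (μ₁ μ₂ : ℂ) {w u : C3} (h0 : u 0 ≠ 0) (h1 : u 1 ≠ 0)
    (e0 : w 0 = (Λ⁻¹ : ℝ) * u 0) (e1 : w 1 = (Λ⁻¹ : ℝ) * u 1) :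
    (Λ : ℂ) ^ (μ₁ + μ₂) * modelPow μ₁ μ₂ w = modelPow μ₁ μ₂ u := by
  have hΛ0 : (Λ : ℂ) ≠ 0 := by exact_mod_cast hΛ.ne'
  have hinv : ∀ μ : ℂ, ((Λ⁻¹ : ℝ) : ℂ) ^ μ = ((Λ : ℂ) ^ μ)⁻¹ := by
    intro μ
    rw [Complex.ofReal_inv, Complex.inv_cpow]
    rw [Complex.arg_ofReal_of_nonneg hΛ.le]
    exact Real.pi_pos.ne
  have hp1 : (Λ : ℂ) ^ μ₁ ≠ 0 := by simp [Complex.cpow_eq_zero_iff, hΛ0]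
  have hp2 : (Λ : ℂ) ^ μ₂ ≠ 0 := by simp [Complex.cpow_eq_zero_iff, hΛ0]
  unfold modelPow
  rw [e0, e1, powBelow_ofReal_mul (inv_pos.2 hΛ) h0, powBelow_ofReal_mul (inv_pos.2 hΛ) h1, hinv,
    hinv, Complex.cpow_add _ _ hΛ0]
  field_simp

theorem modelPow_ne_zero (μ₁ μ₂ : ℂ) (w : C3) : modelPow μ₁ μ₂ w ≠ 0 :=
  mul_ne_zero (powBelow_ne_zero _ _) (powBelow_ne_zero _ _)

theorem dipChain_scale (β ε : ℝ) {Λ : ℝ} (hΛ : 0 < Λ) (z : R3) :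
    dipChain β ε Λ⁻¹ (fun i => scaleVec Λ i * z i) 0 = (Λ⁻¹ : ℝ) * dipCurve ε 1 (z 0) ∧
    dipChain β ε Λ⁻¹ (fun i => scaleVec Λ i * z i) 1 = (Λ⁻¹ : ℝ) * dipCurve ε 1 (z 1) ∧
    dipChain β ε Λ⁻¹ (fun i => scaleVec Λ i * z i) 2 =
      ((√Λ)⁻¹ : ℝ) * ((1 + Complex.I * ε * Real.sign β) * z 2) := by
  refine ⟨?_, ?_, ?_⟩
  · rw [dipChain_zero]; exact dipCurve_scale ε (inv_pos.2 hΛ) (z 0)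
  · rw [dipChain_one]; exact dipCurve_scale ε (inv_pos.2 hΛ) (z 1)
  · rw [dipChain_two]; simp [scaleVec]; ring

/-- The integrand near the crossing. -/
def innerIntegrand (H G : C3 → ℂ) (G₀ : ℂ) (β ε Λ : ℝ) (y : R3) : ℂ :=
  H (dipChain β ε Λ⁻¹ y) * Complex.exp (Complex.I * Λ * (G (dipChain β ε Λ⁻¹ y) - G₀)) *
    dipJac β ε Λ⁻¹ y

/-- After scaling, the amplitude occurs only through its quotient by the model power, which is
bounded and has a limit; all other factors of the amplitude live on the fixed chain of scale `1`. -/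
theorem innerIntegrand_scale (H G : C3 → ℂ) (G₀ : ℂ) (β : ℝ) {ε Λ : ℝ} (hε : 0 < ε) (hΛ : 0 < Λ)
    (μ₁ μ₂ : ℂ) (z : R3) :
    (Λ : ℂ) ^ (μ₁ + μ₂) * innerIntegrand H G G₀ β ε Λ (fun i => scaleVec Λ i * z i) =
      H (dipChain β ε Λ⁻¹ (fun i => scaleVec Λ i * z i)) /
        modelPow μ₁ μ₂ (dipChain β ε Λ⁻¹ (fun i => scaleVec Λ i * z i)) *
      (powBelow (dipCurve ε 1 (z 0)) μ₁ * powBelow (dipCurve ε 1 (z 1)) μ₂) *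
      Complex.exp (Complex.I * Λ * (G (dipChain β ε Λ⁻¹ (fun i => scaleVec Λ i * z i)) - G₀)) *
      dipJac β ε 1 z := by
  set w := dipChain β ε Λ⁻¹ (fun i => scaleVec Λ i * z i) with hw
  obtain ⟨e0, e1, e2⟩ := dipChain_scale β ε hΛ z
  have h0 := ne_zero_of_mem_belowPlane (dipCurve_mem hε one_pos (z 0))
  have h1 := ne_zero_of_mem_belowPlane (dipCurve_mem hε one_pos (z 1))
  have hm := modelPow_scale hΛ μ₁ μ₂ (w := w)
    (u := ![dipCurve ε 1 (z 0), dipCurve ε 1 (z 1), 0]) (by simpa using h0) (by simpa using h1)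
    e0 e1
  have hm' : powBelow (dipCurve ε 1 (z 0)) μ₁ * powBelow (dipCurve ε 1 (z 1)) μ₂ =
      (Λ : ℂ) ^ (μ₁ + μ₂) * modelPow μ₁ μ₂ w := by rw [hm]; simp [modelPow]
  have hj : dipJac β ε Λ⁻¹ (fun i => scaleVec Λ i * z i) = dipJac β ε 1 z := by
    have hp := inv_pos.2 hΛ
    simp [dipJac, dipVel, scaleVec, dipSlope_scale hp]
  have hne := modelPow_ne_zero μ₁ μ₂ w
  rw [hm', innerIntegrand, hj, ← hw]
  field_simp

/-- The quadratic normal form is invariant under the scaling, so `Λ` survives only in front of the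
further terms. -/
theorem exp_phase_scale (G : C3 → ℂ) (G₀ : ℂ) (β ε : ℝ) {Λ : ℝ} (hΛ : 0 < Λ) (z : R3) :
    Complex.exp (Complex.I * Λ * (G (dipChain β ε Λ⁻¹ (fun i => scaleVec Λ i * z i)) - G₀)) =
      Complex.exp (Complex.I * (Λ * remainder G G₀ β
        (dipChain β ε Λ⁻¹ (fun i => scaleVec Λ i * z i)))) *
      (Complex.exp (Complex.I * (1 : ℝ) * dipCurve ε 1 (z 0)) *
        Complex.exp (Complex.I * (1 : ℝ) * dipCurve ε 1 (z 1)) *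
        Complex.exp (Complex.I * ((β : ℂ) / 2 *
          ((1 + Complex.I * ε * Real.sign β) * z 2) ^ 2))) := by
  obtain ⟨e0, e1, e2⟩ := dipChain_scale β ε hΛ z
  set w := dipChain β ε Λ⁻¹ (fun i => scaleVec Λ i * z i) with hw
  have hΛ0 : (Λ : ℂ) ≠ 0 := by exact_mod_cast hΛ.ne'
  have hsq : ((√Λ : ℝ) : ℂ) ^ 2 = Λ := by
    rw [← Complex.ofReal_pow, Real.sq_sqrt hΛ.le]
  have hs0 : ((√Λ : ℝ) : ℂ) ≠ 0 := by
    exact_mod_cast (Real.sqrt_pos.2 hΛ).ne'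
  rw [← Complex.exp_add, ← Complex.exp_add, ← Complex.exp_add]
  congr 1
  have hG : G w - G₀ = remainder G G₀ β w + (w 0 + w 1 + (β : ℂ) / 2 * w 2 ^ 2) := by
    unfold remainder; ring
  rw [hG, e0, e1, e2, mul_pow, Complex.ofReal_inv, Complex.ofReal_inv, inv_pow, hsq]
  push_cast
  field_simp

/-- The leading asymptotics of the integral over a small cube. -/
theorem tendsto_inner {G H : C3 → ℂ} {G₀ c μ₁ μ₂ : ℂ} {β ε ρ r₀ r₁ B : ℝ} (hβ : β ≠ 0)
    (hμ₁ : IsPoleOrBranchExponent μ₁) (hμ₂ : IsPoleOrBranchExponent μ₂) (hε : ε ∈ Set.Ioc (0 : ℝ) 1)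
    (hnf : remainder G G₀ β =O[𝓝 0] fun w => ‖w‖ * (‖w 0‖ + ‖w 1‖) + ‖w 2‖ ^ 3)
    (hGim : G₀.im = 0) (hr₀ : 0 < r₀)
    (hphase : ∀ y v : R3, ∀ d : ℝ, 0 ≤ d → d ≤ r₀ → ‖y‖ ≤ r₀ → IsLift β d y v →
      ε * ((|y 0| + |y 1|) / 2 + |β| / 2 * y 2 ^ 2 - 6 * d)
        ≤ (G (toC3 y + (ε * Complex.I : ℂ) • toC3 v)).im)
    (hG : ContinuousOn G (Metric.ball 0 r₁)) (hH : ContinuousOn H (Metric.ball 0 r₁ ∩ lowerSpace))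
    (hlim : Tendsto (fun w => H w / modelPow μ₁ μ₂ w) (𝓝[lowerSpace] 0) (𝓝 c))
    (hB : ∀ w ∈ Metric.ball (0 : C3) r₁ ∩ lowerSpace, ‖H w / modelPow μ₁ μ₂ w‖ ≤ B)
    (hρ : 0 < ρ) (hρ₀ : ρ ≤ r₀) (hρ₁ : 4 * ρ ≤ r₁) :
    Tendsto (fun Λ : ℝ => (Λ : ℂ) ^ (μ₁ + μ₂ + 2) * (√Λ : ℝ) *
        ∫ y in Metric.ball (0 : R3) ρ, innerIntegrand H G G₀ β ε Λ y) atTop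
      (𝓝 (c * (Iconst μ₁ * Iconst μ₂ *
        ((√(2 * Real.pi) / √|β| : ℝ) *
          Complex.exp (Complex.I * (Real.pi / 4) * Real.sign β))))) := by
  have hεI : ε ∈ Set.Icc (0 : ℝ) 1 := ⟨hε.1.le, hε.2⟩
  set y : ℝ → R3 → R3 := fun Λ z i => scaleVec Λ i * z i with hy
  set w : ℝ → R3 → C3 := fun Λ z => dipChain β ε Λ⁻¹ (y Λ z) with hw
  -- The scaled integrand is extended by zero to all of `ℝ³`, so that the expanding domains do not
  -- appear in the limit.
  set F : ℝ → R3 → ℂ := fun Λ z => (Λ : ℂ) ^ (μ₁ + μ₂) *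
    (Metric.ball (0 : R3) ρ).indicator (innerIntegrand H G G₀ β ε Λ) (y Λ z) with hF
  have hBpos : 0 ≤ B := by
    have hδ : 0 < min 1 (r₁ / 4) := lt_min one_pos (by linarith)
    have h1 := hB (dipChain β ε (min 1 (r₁ / 4)) 0) ⟨by
      rw [mem_ball_zero_iff]
      have := norm_dipChain_le (β := β) hεI hδ.le 0
      have h2 : min 1 (r₁ / 4) ≤ r₁ / 4 := min_le_right _ _
      rw [norm_zero] at this
      linarith, dipChain_mem β hε.1 hδ 0⟩
    exact (norm_nonneg _).trans h1
  have hint : ∀ Λ : ℝ, 0 < Λ → (Λ : ℂ) ^ (μ₁ + μ₂ + 2) * (√Λ : ℝ) *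
      ∫ y in Metric.ball (0 : R3) ρ, innerIntegrand H G G₀ β ε Λ y = ∫ z, F Λ z := by
    intro Λ hΛ
    have hΛ0 : (Λ : ℂ) ≠ 0 := by exact_mod_cast hΛ.ne'
    have hs0 : ((√Λ : ℝ) : ℂ) ≠ 0 := by exact_mod_cast (Real.sqrt_pos.2 hΛ).ne'
    -- The Jacobian of the scaling is `Λ⁻² Λ^(-1/2)`; it accounts for the factor `Λ² √Λ` in the
    -- normalization.
    rw [← integral_indicator measurableSet_ball, integral_comp_diagonal _ (scaleVec_pos hΛ),
      integral_const_mul, Complex.cpow_add _ _ hΛ0, ← mul_assoc]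
    congr 1
    simp [scaleVec, Fin.prod_univ_three]
    field_simp
  rw [← integral_modelIntegrand hβ hε.1 hμ₁ hμ₂, ← integral_const_mul]
  obtain ⟨M₁, hM₁, hb₁⟩ := exists_norm_powBelow_dipCurve_le ‖μ₁‖ (κ₀ := ε) (κ₁ := ε) (c := ε / 4)
    hε.1 (by linarith [hε.1])
  obtain ⟨M₂, hM₂, hb₂⟩ := exists_norm_powBelow_dipCurve_le ‖μ₂‖ (κ₀ := ε) (κ₁ := ε) (c := ε / 4)
    hε.1 (by linarith [hε.1])
  -- The powers cost `exp (ε |z_k| / 4)` against the decay `exp (-ε |z_k| / 2)` of the exponential.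
  set bd : R3 → ℝ := fun z => B * M₁ * M₂ * (1 + ε) ^ 3 * Real.exp (6 * ε) *
    (Real.exp (-(ε / 4 * |z 0|)) * Real.exp (-(ε / 4 * |z 1|)) *
      Real.exp (-(ε * (|β| / 2)) * z 2 ^ 2)) with hbd
  have hlarge : ∀ᶠ Λ : ℝ in atTop, 0 < Λ ∧ Λ⁻¹ ≤ r₀ ∧ Λ⁻¹ ≤ ρ / 2 := by
    have t := tendsto_inv_atTop_zero (𝕜 := ℝ)
    filter_upwards [eventually_gt_atTop 0, t.eventually (gt_mem_nhds hr₀),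
      t.eventually (gt_mem_nhds (half_pos hρ))] with Λ h1 h2 h3 using ⟨h1, h2.le, h3.le⟩
  have hwball : ∀ Λ : ℝ, 0 < Λ → Λ⁻¹ ≤ ρ / 2 → ∀ u ∈ Metric.ball (0 : R3) ρ,
      dipChain β ε Λ⁻¹ u ∈ Metric.ball 0 r₁ ∩ lowerSpace := by
    intro Λ hΛ h2 u hu
    rw [mem_ball_zero_iff] at hu
    refine ⟨?_, dipChain_mem β hε.1 (inv_pos.2 hΛ) _⟩
    rw [mem_ball_zero_iff]
    have := norm_dipChain_le (β := β) hεI (inv_pos.2 hΛ).le u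
    linarith
  have main : Tendsto (fun Λ => ∫ z, F Λ z) atTop (𝓝 (∫ z, c * modelIntegrand β ε μ₁ μ₂ z)) := by
    refine tendsto_integral_filter_of_dominated_convergence bd ?_ ?_ ?_ ?_
    · filter_upwards [hlarge] with Λ hΛ
      have hcont : ContinuousOn (innerIntegrand H G G₀ β ε Λ) (Metric.ball 0 ρ) := by
        have hc := (continuous_dipChain β ε Λ⁻¹).continuousOn (s := Metric.ball 0 ρ)
        have hmp : Set.MapsTo (dipChain β ε Λ⁻¹) (Metric.ball 0 ρ) (Metric.ball 0 r₁ ∩ lowerSpace) :=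
          fun u hu => hwball Λ hΛ.1 hΛ.2.2 u hu
        have hv := continuous_dipVel ε (inv_pos.2 hΛ.1)
        have hj : Continuous (dipJac β ε Λ⁻¹) := by unfold dipJac; fun_prop
        have hGc : ContinuousOn (fun u => G (dipChain β ε Λ⁻¹ u)) (Metric.ball 0 ρ) :=
          hG.comp hc fun u hu => (hmp hu).1
        exact ((hH.comp hc hmp).mul (Complex.continuous_exp.comp_continuousOn
          (continuousOn_const.mul (hGc.sub continuousOn_const)))).mul hj.continuousOn
      have hm : AEStronglyMeasurable
          ((Metric.ball (0 : R3) ρ).indicator (innerIntegrand H G G₀ β ε Λ)) volume :=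
        (aestronglyMeasurable_indicator_iff measurableSet_ball).2
          (hcont.aestronglyMeasurable measurableSet_ball)
      have hy1 : Continuous (y Λ) := by simp only [hy]; fun_prop
      have hpre : MeasurableSet (y Λ ⁻¹' Metric.ball 0 ρ) :=
        (Metric.isOpen_ball.preimage hy1).measurableSet
      have hcomp : F Λ = fun z => (Λ : ℂ) ^ (μ₁ + μ₂) *
          (y Λ ⁻¹' Metric.ball 0 ρ).indicator (fun z => innerIntegrand H G G₀ β ε Λ (y Λ z)) z := by
        ext z
        simp only [hF, Set.indicator, Set.mem_preimage]
        rfl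
      rw [hcomp]
      refine AEStronglyMeasurable.const_mul ?_ _
      refine (aestronglyMeasurable_indicator_iff hpre).2 ?_
      exact (hcont.comp hy1.continuousOn fun z hz => hz).aestronglyMeasurable hpre
    · filter_upwards [hlarge] with Λ hΛ
      refine Eventually.of_forall fun z => ?_
      by_cases hz : y Λ z ∈ Metric.ball (0 : R3) ρ
      · simp only [hF, Set.indicator_of_mem hz]
        rw [innerIntegrand_scale H G G₀ β hε.1 hΛ.1]
        have hzn : ‖y Λ z‖ ≤ r₀ := (mem_ball_zero_iff.1 hz).le.trans hρ₀
        have h1 := hB _ (hwball Λ hΛ.1 hΛ.2.2 _ hz)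
        have h2 := hb₁ _ le_rfl ε (by simp) (z 0)
        have h3 := hb₂ _ le_rfl ε (by simp) (z 1)
        have h4 : ‖dipJac β ε 1 z‖ ≤ (1 + ε) ^ 3 := by
          unfold dipJac
          rw [norm_mul, norm_mul]
          have a1 := norm_dipVel_le hε.1.le 1 (z 0)
          have a2 := norm_dipVel_le hε.1.le 1 (z 1)
          have a3 := norm_one_add_sign_le β hε.1.le
          have : 0 ≤ 1 + ε := by linarith [hε.1]
          calc _ ≤ (1 + ε) * (1 + ε) * (1 + ε) := by gcongr
            _ = _ := by ring
        have h5 : ‖Complex.exp (Complex.I * Λ * (G (w Λ z) - G₀))‖ ≤ Real.exp (6 * ε) *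
            (Real.exp (-(ε / 2 * |z 0|)) * Real.exp (-(ε / 2 * |z 1|)) *
              Real.exp (-(ε * (|β| / 2)) * z 2 ^ 2)) := by
          -- Applied at the scale `d = Λ⁻¹`, the loss `6 d` in the phase estimate becomes the
          -- constant `6` after multiplication by `Λ`.
          have h6 := hphase (y Λ z) _ Λ⁻¹ (inv_pos.2 hΛ.1).le hΛ.2.1 hzn
            (isLift_dipField β (inv_pos.2 hΛ.1).le _)
          change _ ≤ (G (w Λ z)).im at h6
          rw [norm_exp_I_mul, ← Real.exp_add, ← Real.exp_add, ← Real.exp_add, Real.exp_le_exp,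
            Complex.sub_im, hGim, sub_zero]
          have h7 := mul_le_mul_of_nonneg_left h6 hΛ.1.le
          have e0 : |y Λ z 0| = Λ⁻¹ * |z 0| := by
            simp [hy, scaleVec, abs_mul, abs_of_pos hΛ.1]
          have e1 : |y Λ z 1| = Λ⁻¹ * |z 1| := by
            simp [hy, scaleVec, abs_mul, abs_of_pos hΛ.1]
          have e2 : y Λ z 2 ^ 2 = Λ⁻¹ * z 2 ^ 2 := by
            simp [hy, scaleVec, mul_pow, Real.sq_sqrt hΛ.1.le]
          rw [e0, e1, e2] at h7
          have e3 : Λ * (ε * ((Λ⁻¹ * |z 0| + Λ⁻¹ * |z 1|) / 2 + |β| / 2 * (Λ⁻¹ * z 2 ^ 2) - 6 * Λ⁻¹))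
              = ε * ((|z 0| + |z 1|) / 2 + |β| / 2 * z 2 ^ 2 - 6) := by
            have := hΛ.1.ne'
            field_simp
          rw [e3] at h7
          linarith
        rw [norm_mul, norm_mul, norm_mul, norm_mul]
        calc _ ≤ B * ((M₁ * Real.exp (ε / 4 * |z 0|)) * (M₂ * Real.exp (ε / 4 * |z 1|))) *
              (Real.exp (6 * ε) * (Real.exp (-(ε / 2 * |z 0|)) * Real.exp (-(ε / 2 * |z 1|)) *
              Real.exp (-(ε * (|β| / 2)) * z 2 ^ 2))) * (1 + ε) ^ 3 := by
              gcongr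
          _ = B * M₁ * M₂ * (1 + ε) ^ 3 * Real.exp (6 * ε) *
              ((Real.exp (ε / 4 * |z 0|) * Real.exp (-(ε / 2 * |z 0|))) *
               (Real.exp (ε / 4 * |z 1|) * Real.exp (-(ε / 2 * |z 1|))) *
              Real.exp (-(ε * (|β| / 2)) * z 2 ^ 2)) := by ring
          _ = bd z := by
              rw [← Real.exp_add, ← Real.exp_add, hbd]
              congr 4 <;> ring
      · simp only [hF, Set.indicator_of_notMem hz, mul_zero, norm_zero, hbd]
        have : 0 ≤ 1 + ε := by linarith [hε.1]
        positivity
    · refine Integrable.const_mul ?_ _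
      have h := Integrable.fintype_prod (𝕜 := ℝ) (ι := Fin 3) (μ := fun _ => (volume : Measure ℝ))
        (f := ![fun t => Real.exp (-(ε / 4 * |t|)), fun t => Real.exp (-(ε / 4 * |t|)),
          fun t => Real.exp (-(ε * (|β| / 2)) * t ^ 2)]) (fun i => by
          have h1 := integrable_exp_neg_mul_abs (c := ε / 4) (by linarith [hε.1])
          have h2 := integrable_exp_neg_mul_sq (b := ε * (|β| / 2))
            (mul_pos hε.1 (half_pos (abs_pos.2 hβ)))
          fin_cases i
          · exact h1
          · exact h1
          · exact h2)
      simpa only [Fin.prod_univ_three] using! h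
    · refine Eventually.of_forall fun z => ?_
      -- the points of the chain tend to the origin
      have tinv := tendsto_inv_atTop_zero (𝕜 := ℝ)
      have tsq : Tendsto (fun Λ : ℝ => (√Λ)⁻¹) atTop (𝓝 0) :=
        tinv.comp Real.tendsto_sqrt_atTop
      have ty : Tendsto (fun Λ => y Λ z) atTop (𝓝 0) := by
        rw [tendsto_pi_nhds]
        intro i
        fin_cases i
        · simpa [hy, scaleVec] using tinv.mul_const (z 0)
        · simpa [hy, scaleVec] using tinv.mul_const (z 1)
        · simpa [hy, scaleVec] using tsq.mul_const (z 2)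
      have tw0 : Tendsto (fun Λ => w Λ z) atTop (𝓝 0) := by
        have hb : ∀ᶠ Λ : ℝ in atTop, ‖w Λ z‖ ≤ 2 * ‖y Λ z‖ + 2 * Λ⁻¹ := by
          filter_upwards [eventually_gt_atTop 0] with Λ hΛ
          exact norm_dipChain_le hεI (inv_pos.2 hΛ).le _
        refine squeeze_zero_norm' hb ?_
        simpa using (ty.norm.const_mul 2).add (tinv.const_mul 2)
      have tw : Tendsto (fun Λ => w Λ z) atTop (𝓝[lowerSpace] 0) := by
        refine tendsto_nhdsWithin_iff.2 ⟨tw0, ?_⟩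
        filter_upwards [eventually_gt_atTop 0] with Λ hΛ
        exact dipChain_mem β hε.1 (inv_pos.2 hΛ) _
      have tq := hlim.comp tw
      -- the remainder does not contribute
      have tR : Tendsto (fun Λ : ℝ => (Λ : ℂ) * remainder G G₀ β (w Λ z)) atTop (𝓝 0) := by
        obtain ⟨A, hA⟩ := hnf.bound
        set a0 := ‖dipCurve ε 1 (z 0)‖
        set a1 := ‖dipCurve ε 1 (z 1)‖
        set a2 := ‖(1 + Complex.I * ε * Real.sign β) * z 2‖
        -- Each further term contains either a factor of order `Λ⁻¹` times a vanishing norm, or a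
        -- cube of order `Λ^(-3/2)`; both are `o(Λ⁻¹)`.
        have hb : ∀ᶠ Λ : ℝ in atTop, ‖(Λ : ℂ) * remainder G G₀ β (w Λ z)‖ ≤
            A * (‖w Λ z‖ * (a0 + a1) + a2 ^ 3 * (√Λ)⁻¹) := by
          filter_upwards [tw0.eventually hA, eventually_gt_atTop 0] with Λ h1 hΛ
          obtain ⟨e0, e1, e2⟩ := dipChain_scale β ε hΛ z
          have f0 : ‖w Λ z 0‖ = Λ⁻¹ * a0 := by
            simp only [hw, hy, e0, norm_mul, Complex.norm_real, a0,
              Real.norm_of_nonneg (inv_pos.2 hΛ).le]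
          have f1 : ‖w Λ z 1‖ = Λ⁻¹ * a1 := by
            simp only [hw, hy, e1, norm_mul, Complex.norm_real, a1,
              Real.norm_of_nonneg (inv_pos.2 hΛ).le]
          have f2 : ‖w Λ z 2‖ = (√Λ)⁻¹ * a2 := by
            have : 0 ≤ (√Λ)⁻¹ := by positivity
            simp only [hw, hy, e2, a2]
            rw [norm_mul, Complex.norm_real, Real.norm_of_nonneg this]
          rw [Real.norm_of_nonneg (by positivity), f0, f1, f2] at h1
          rw [norm_mul, Complex.norm_real, Real.norm_of_nonneg hΛ.le]
          calc Λ * ‖remainder G G₀ β (w Λ z)‖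
              ≤ Λ * (A * (‖w Λ z‖ * (Λ⁻¹ * a0 + Λ⁻¹ * a1) + ((√Λ)⁻¹ * a2) ^ 3)) := by gcongr
            _ = A * (‖w Λ z‖ * (a0 + a1) + a2 ^ 3 * (√Λ)⁻¹) := by
              have hs : √Λ ^ 2 = Λ := Real.sq_sqrt hΛ.le
              have hs0 : √Λ ≠ 0 := (Real.sqrt_pos.2 hΛ).ne'
              have e : ((√Λ)⁻¹ * a2) ^ 3 = Λ⁻¹ * (a2 ^ 3 * (√Λ)⁻¹) := by
                have e' : Λ⁻¹ = (√Λ)⁻¹ ^ 2 := by rw [inv_pow, hs]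
                rw [e']; ring
              rw [e]
              have := hΛ.ne'
              field_simp
        refine squeeze_zero_norm' hb ?_
        simpa using ((tw0.norm.mul_const (a0 + a1)).add (tsq.const_mul (a2 ^ 3))).const_mul A
      have tE : Tendsto (fun Λ : ℝ => Complex.exp (Complex.I * (Λ * remainder G G₀ β (w Λ z))))
          atTop (𝓝 1) := by
        have := (tR.const_mul Complex.I).cexp
        simpa using this
      have := (tq.mul tE).mul_const (modelIntegrand β ε μ₁ μ₂ z)
      rw [mul_one] at this
      refine this.congr' ?_
      filter_upwards [hlarge, ty.eventually (Metric.ball_mem_nhds 0 hρ)] with Λ hΛ hz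
      have hz' : y Λ z ∈ Metric.ball (0 : R3) ρ := hz
      simp only [hF, Function.comp_apply]
      rw [Set.indicator_of_mem hz', innerIntegrand_scale H G G₀ β hε.1 hΛ.1, exp_phase_scale G G₀ β ε hΛ.1]
      simp only [modelIntegrand, hankelIntegrand, gaussIntegrand, dipJac]
      ring
  refine main.congr' ?_
  filter_upwards [eventually_gt_atTop 0] with Λ hΛ using (hint Λ hΛ).symm


/-! ### Shrinking the scale of the chain to `1 / Λ` -/

theorem norm_det3_le (a b c : C3) : ‖det3 a b c‖ ≤ 6 * (‖a‖ * ‖b‖ * ‖c‖) := by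
  have h : ∀ i j k : Fin 3, ‖a i * (b j * c k)‖ ≤ ‖a‖ * ‖b‖ * ‖c‖ := fun i j k => by
    rw [norm_mul, norm_mul, mul_assoc]
    gcongr <;> exact norm_le_pi_norm _ _
  have e : det3 a b c = a 0 * (b 1 * c 2) - a 0 * (b 2 * c 1) - a 1 * (b 0 * c 2) +
      a 2 * (b 0 * c 1) + a 1 * (b 2 * c 0) - a 2 * (b 1 * c 0) := by unfold det3; ring
  rw [e]
  refine (norm_sub_le _ _).trans ?_
  have h1 := norm_add_le (a 0 * (b 1 * c 2) - a 0 * (b 2 * c 1) - a 1 * (b 0 * c 2) +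
      a 2 * (b 0 * c 1)) (a 1 * (b 2 * c 0))
  have h2 := norm_add_le (a 0 * (b 1 * c 2) - a 0 * (b 2 * c 1) - a 1 * (b 0 * c 2))
      (a 2 * (b 0 * c 1))
  have h3 := norm_sub_le (a 0 * (b 1 * c 2) - a 0 * (b 2 * c 1)) (a 1 * (b 0 * c 2))
  have h4 := norm_sub_le (a 0 * (b 1 * c 2)) (a 0 * (b 2 * c 1))
  linarith [h 0 1 2, h 0 2 1, h 1 0 2, h 2 0 1, h 1 2 0, h 2 1 0]

theorem norm_chainDet_le {φ : R3 → C3} {x : R3} {C : ℝ} (hC : ‖fderiv ℝ φ x‖ ≤ C) :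
    ‖chainDet φ x‖ ≤ 6 * C ^ 3 := by
  have hp : ∀ j, ‖pderiv φ j x‖ ≤ C := fun j => by
    refine ((fderiv ℝ φ x).le_opNorm _).trans ?_
    rw [Pi.norm_single, norm_one, mul_one]
    exact hC
  have h0 : 0 ≤ C := (norm_nonneg _).trans hC
  refine (norm_det3_le _ _ _).trans ?_
  have : ‖pderiv φ 0 x‖ * ‖pderiv φ 1 x‖ * ‖pderiv φ 2 x‖ ≤ C * C * C := by
    gcongr <;> exact hp _
  calc _ ≤ 6 * (C * C * C) := by gcongr
    _ = _ := by ring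

theorem contDiff_dipField (β : ℝ) {δ : ℝ} (hδ : 0 < δ) {n : WithTop ℕ∞} :
    ContDiff ℝ n (dipField β δ) := by
  rw [contDiff_pi]
  intro i
  have h := contDiff_dip hδ (n := n)
  fin_cases i
  · exact h.comp (contDiff_apply ℝ ℝ 0)
  · exact h.comp (contDiff_apply ℝ ℝ 1)
  · exact contDiff_const.mul (contDiff_apply ℝ ℝ 2)

theorem abs_dip_sub_le {δ : ℝ} (hδ : 0 < δ) (s t : ℝ) : |dip δ s - dip δ t| ≤ |s - t| := by
  have h := (convex_univ (𝕜 := ℝ)).norm_image_sub_le_of_norm_hasDerivWithin_le (f := dip δ)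
    (f' := dipSlope δ) (C := 1) (x := t) (y := s) (fun u _ => (hasDerivAt_dip hδ u).hasDerivWithinAt)
    (fun u _ => abs_dipSlope_le δ u) trivial trivial
  simpa using h

/-- The constant does not depend on `δ`, so the Jacobians of the chains stay bounded while the scale
tends to zero. -/
theorem lipschitzWith_dipField (β : ℝ) {δ : ℝ} (hδ : 0 < δ) : LipschitzWith 1 (dipField β δ) := by
  refine LipschitzWith.of_dist_le_mul fun x y => ?_
  rw [NNReal.coe_one, one_mul, dist_pi_le_iff dist_nonneg]
  intro i
  have h := fun i => dist_le_pi_dist x y i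
  have h2 := h 2
  rw [Real.dist_eq] at h2
  fin_cases i
  · exact (abs_dip_sub_le hδ _ _).trans (h 0)
  · exact (abs_dip_sub_le hδ _ _).trans (h 1)
  · simp only [dipField, Real.dist_eq]
    simp only [Fin.reduceFinMk, Matrix.cons_val, ← mul_sub, abs_mul]
    exact (mul_le_of_le_one_left (abs_nonneg _) (abs_sign_le_one β)).trans h2

theorem contDiff_displaced {u : R3 → R3} {n : WithTop ℕ∞} {x : R3} (hu : ContDiffAt ℝ n u x) (ε : ℝ) :
    ContDiffAt ℝ n (fun y => toC3 y + (ε * Complex.I : ℂ) • toC3 (u y)) x :=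
  (toC3L.contDiff.contDiffAt).add ((toC3L.contDiff.contDiffAt.comp x hu).const_smul _)

theorem fderiv_displaced {u : R3 → R3} {x : R3} (hu : DifferentiableAt ℝ u x) (ε : ℝ) (h : R3) :
    fderiv ℝ (fun y => toC3 y + (ε * Complex.I : ℂ) • toC3 (u y)) x h =
      toC3 h + (ε * Complex.I : ℂ) • toC3 (fderiv ℝ u x h) := by
  have h0 : HasFDerivAt (fun y => (ε * Complex.I : ℂ) • toC3 (u y))
      ((ε * Complex.I : ℂ) • toC3L.comp (fderiv ℝ u x)) x :=
    (toC3L.hasFDerivAt.comp x hu.hasFDerivAt).const_smul (ε * Complex.I : ℂ)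
  have h1 := (toC3L.hasFDerivAt (x := x)).add h0
  have e : fderiv ℝ (fun y => toC3 y + (ε * Complex.I : ℂ) • toC3 (u y)) x = _ := h1.fderiv
  rw [e]
  rfl

theorem norm_fderiv_displaced_le {u : R3 → R3} {x : R3} (hu : DifferentiableAt ℝ u x) {ε C : ℝ}
    (hε : ε ∈ Set.Icc (0 : ℝ) 1) (hC : ‖fderiv ℝ u x‖ ≤ C) :
    ‖fderiv ℝ (fun y => toC3 y + (ε * Complex.I : ℂ) • toC3 (u y)) x‖ ≤ 1 + C := by
  refine ContinuousLinearMap.opNorm_le_bound _ (by linarith [norm_nonneg (fderiv ℝ u x)]) fun h => ?_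
  rw [fderiv_displaced hu]
  refine (norm_displaced_le hε _ _).trans ?_
  have := (fderiv ℝ u x).le_of_opNorm_le hC h
  linarith

theorem chainDet_dipChain (β ε : ℝ) {δ : ℝ} (hδ : 0 < δ) (y : R3) :
    chainDet (dipChain β ε δ) y = dipJac β ε δ y := by
  have hd : HasFDerivAt (dipField β δ)
      (ContinuousLinearMap.pi ![dipSlope δ (y 0) • (ContinuousLinearMap.proj 0 : R3 →L[ℝ] ℝ),
        dipSlope δ (y 1) • (ContinuousLinearMap.proj 1 : R3 →L[ℝ] ℝ),
        Real.sign β • (ContinuousLinearMap.proj 2 : R3 →L[ℝ] ℝ)]) y := by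
    rw [hasFDerivAt_pi']
    intro i
    have p : ∀ j, HasFDerivAt (fun x : R3 => x j) (ContinuousLinearMap.proj (R := ℝ) j) y :=
      fun j => hasFDerivAt_apply j y
    fin_cases i
    · exact (hasDerivAt_dip hδ (y 0)).comp_hasFDerivAt y (p 0)
    · exact (hasDerivAt_dip hδ (y 1)).comp_hasFDerivAt y (p 1)
    · exact (p 2).const_mul (Real.sign β)
  have e : ∀ j, pderiv (dipChain β ε δ) j y = toC3 (Pi.single j 1) + (ε * Complex.I : ℂ) •
      toC3 (fderiv ℝ (dipField β δ) y (Pi.single j 1)) := fun j =>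
    fderiv_displaced hd.differentiableAt ε _
  simp only [chainDet, e, hd.fderiv]
  simp [det3, dipJac, dipVel]
  ring

/-- The interpolation between the dip fields of two scales. -/
def blendField (χ : R3 → ℝ) (β δ₀ δ : ℝ) (y : R3) : R3 :=
  dipField β δ₀ y + χ y • (dipField β δ y - dipField β δ₀ y)

theorem blendField_zero (χ : R3 → ℝ) (β δ₀ δ : ℝ) (y : R3) :
    blendField χ β δ₀ δ y 0 = (1 - χ y) * dip δ₀ (y 0) + χ y * dip δ (y 0) := by
  simp [blendField, dipField]; ring

theorem blendField_one (χ : R3 → ℝ) (β δ₀ δ : ℝ) (y : R3) :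
    blendField χ β δ₀ δ y 1 = (1 - χ y) * dip δ₀ (y 1) + χ y * dip δ (y 1) := by
  simp [blendField, dipField]; ring

/-- The conditions are convex, and both dip fields satisfy them with the larger parameter `δ₀`. Thus
the phase is controlled during the blending by an estimate that does not depend on the smaller
scale. -/
theorem isLift_blendField {χ : R3 → ℝ} {β δ₀ δ : ℝ} {y : R3} (hχ : χ y ∈ Set.Icc (0 : ℝ) 1)
    (hδ : 0 ≤ δ) (hδ₀ : δ ≤ δ₀) : IsLift β δ₀ y (blendField χ β δ₀ δ y) := by
  have h0 : 0 ≤ 1 - χ y := by linarith [hχ.2]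
  have l : ∀ t, |t| - 2 * δ₀ ≤ (1 - χ y) * dip δ₀ t + χ y * dip δ t := fun t => by
    have h1 := mul_le_mul_of_nonneg_left (dip_lower δ₀ t) h0
    have h2 := mul_le_mul_of_nonneg_left
      ((by linarith [dip_lower δ t] : |t| - 2 * δ₀ ≤ dip δ t)) hχ.1
    linarith
  have u : ∀ t, (1 - χ y) * dip δ₀ t + χ y * dip δ t ≤ |t| := fun t => by
    have h1 := mul_le_mul_of_nonneg_left
      ((by linarith [dip_upper (hδ.trans hδ₀) t] : dip δ₀ t ≤ |t|)) h0
    have h2 := mul_le_mul_of_nonneg_left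
      ((by linarith [dip_upper hδ t] : dip δ t ≤ |t|)) hχ.1
    linarith
  refine ⟨?_, ?_, ?_, ?_, ?_⟩
  · rw [blendField_zero]; exact l _
  · rw [blendField_zero]; exact u _
  · rw [blendField_one]; exact l _
  · rw [blendField_one]; exact u _
  · simp [blendField, dipField]

theorem IsLift.norm_le {β d : ℝ} {y v : R3} (h : IsLift β d y v) (hd : 0 ≤ d) :
    ‖v‖ ≤ ‖y‖ + 2 * d := by
  rw [pi_norm_le_iff_of_nonneg (by positivity)]
  intro i
  have h0 := norm_le_pi_norm y 0
  have h1 := norm_le_pi_norm y 1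
  have h2 := norm_le_pi_norm y 2
  rw [Real.norm_eq_abs] at h0 h1 h2
  have l0 := h.lower₀
  have l1 := h.lower₁
  have u0 := h.upper₀
  have u1 := h.upper₁
  have a0 := abs_nonneg (y 0)
  have a1 := abs_nonneg (y 1)
  rw [Real.norm_eq_abs]
  fin_cases i
  · exact abs_le.2 ⟨by simp only [Fin.zero_eta]; linarith, by simp only [Fin.zero_eta]; linarith⟩
  · exact abs_le.2 ⟨by simp only [Fin.mk_one]; linarith, by simp only [Fin.mk_one]; linarith⟩
  · simp only [Fin.reduceFinMk, h.third, abs_mul]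
    have := mul_le_of_le_one_left (abs_nonneg (y 2)) (abs_sign_le_one β)
    linarith

/-- On the smaller interval both dips are negative, the wider one even more so. -/
theorem blend_le_of_abs_le {s δ₀ δ t : ℝ} (hs : s ∈ Set.Icc (0 : ℝ) 1) (hδ : 0 ≤ δ) (hδ₀ : δ ≤ δ₀)
    (ht : |t| ≤ δ) : (1 - s) * dip δ₀ t + s * dip δ t ≤ -(δ / 2) := by
  have h1 := mul_le_mul_of_nonneg_left ((dip_le_of_abs_le (hδ.trans hδ₀) (ht.trans hδ₀)).trans
    (by linarith : -(δ₀ / 2) ≤ -(δ / 2))) (sub_nonneg.2 hs.2)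
  have h2 := mul_le_mul_of_nonneg_left (dip_le_of_abs_le hδ ht) hs.1
  linarith

/-- A displaced point below both singularities, with a lower bound of the distances. -/
theorem displaced_below {ε δ : ℝ} (hε : 0 < ε) (hδ : 0 < δ) {y v : R3}
    (h0 : |y 0| ≤ δ → v 0 ≤ -(δ / 2)) (h1 : |y 1| ≤ δ → v 1 ≤ -(δ / 2)) :
    toC3 y + (ε * Complex.I : ℂ) • toC3 v ∈ lowerSpace ∧
    min 1 (ε / 2) * δ ≤ ‖(toC3 y + (ε * Complex.I : ℂ) • toC3 v) 0‖ ∧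
    min 1 (ε / 2) * δ ≤ ‖(toC3 y + (ε * Complex.I : ℂ) • toC3 v) 1‖ := by
  have re : ∀ k, ((toC3 y + (ε * Complex.I : ℂ) • toC3 v) k).re = y k := fun k => by simp
  have im : ∀ k, ((toC3 y + (ε * Complex.I : ℂ) • toC3 v) k).im = ε * v k := fun k => by simp
  have key : ∀ k, (|y k| ≤ δ → v k ≤ -(δ / 2)) →
      (toC3 y + (ε * Complex.I : ℂ) • toC3 v) k ∈ belowPlane ∧
      min 1 (ε / 2) * δ ≤ ‖(toC3 y + (ε * Complex.I : ℂ) • toC3 v) k‖ := fun k hk => by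
    refine ⟨fun h => ?_, le_norm_of_dip hε hδ fun h => ?_⟩
    · rw [re] at h
      rw [im]
      have := hk (by rw [h, abs_zero]; exact hδ.le)
      exact mul_neg_of_pos_of_neg hε (by linarith)
    · rw [re] at h
      rw [im]
      have := mul_le_mul_of_nonneg_left (hk h) hε.le
      linarith
  exact ⟨mem_lowerSpace.2 ⟨(key 0 h0).1, (key 1 h1).1⟩, (key 0 h0).2, (key 1 h1).2⟩

/-- With `b` of order `δ = 1 / Λ`, this bounds the model amplitude on the blended chains by a power
of `Λ`. -/
theorem norm_modelPow_le {μ₁ μ₂ : ℂ} {w : C3} {b B : ℝ} (hb : 0 < b) (hB : 1 ≤ B) (hbB : b⁻¹ ≤ B)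
    (h0 : b ≤ ‖w 0‖) (h1 : b ≤ ‖w 1‖) (hw : ‖w‖ ≤ B) :
    ‖modelPow μ₁ μ₂ w‖ ≤ Real.exp (2 * Real.pi * (|μ₁.im| + |μ₂.im|)) *
      B ^ (|μ₁.re| + |μ₂.re|) := by
  have key : ∀ (μ : ℂ) k, b ≤ ‖w k‖ →
      ‖powBelow (w k) μ‖ ≤ Real.exp (2 * Real.pi * |μ.im|) * B ^ |μ.re| := fun μ k hk => by
    have hpos := hb.trans_le hk
    refine (norm_powBelow_le (norm_pos_iff.1 hpos) μ).trans ?_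
    refine mul_le_mul_of_nonneg_left ?_ (Real.exp_pos _).le
    exact rpow_le_of_two_sided hpos ((norm_le_pi_norm w k).trans hw)
      (((inv_le_inv₀ hpos hb).2 hk).trans hbB) hB le_rfl
  unfold modelPow
  rw [norm_mul, mul_add, Real.exp_add, Real.rpow_add (by linarith)]
  calc _ ≤ (Real.exp (2 * Real.pi * |μ₁.im|) * B ^ |μ₁.re|) *
        (Real.exp (2 * Real.pi * |μ₂.im|) * B ^ |μ₂.re|) :=
        mul_le_mul (key μ₁ 0 h0) (key μ₂ 1 h1) (norm_nonneg _) (by positivity)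
    _ = _ := by ring

/-- One unit comes from the fixed dip field, two from the difference of the two dip fields, and the
rest from the cutoff function. No term involves `1 / δ`. -/
theorem norm_fderiv_blendField_le {χ : R3 → ℝ} (hχ : ∀ y, χ y ∈ Set.Icc (0 : ℝ) 1)
    (hχd : Differentiable ℝ χ) {β δ₀ δ A : ℝ} (hδ : 0 < δ) (hδ₀ : δ ≤ δ₀) {y : R3}
    (hA : ‖fderiv ℝ χ y‖ ≤ A) :
    ‖fderiv ℝ (blendField χ β δ₀ δ) y‖ ≤ 3 + A * (2 * ‖y‖ + 4 * δ₀) := by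
  have hδ₀' := hδ.trans_le hδ₀
  have d : DifferentiableAt ℝ (dipField β δ) y :=
    (contDiff_dipField β hδ (n := 1)).differentiable one_ne_zero y
  have d₀ : DifferentiableAt ℝ (dipField β δ₀) y :=
    (contDiff_dipField β hδ₀' (n := 1)).differentiable one_ne_zero y
  have n := norm_fderiv_le_of_lipschitz ℝ (x₀ := y) (lipschitzWith_dipField β hδ)
  have n₀ := norm_fderiv_le_of_lipschitz ℝ (x₀ := y) (lipschitzWith_dipField β hδ₀')
  rw [NNReal.coe_one] at n n₀
  have e : fderiv ℝ (blendField χ β δ₀ δ) y = fderiv ℝ (dipField β δ₀) y +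
      (χ y • (fderiv ℝ (dipField β δ) y - fderiv ℝ (dipField β δ₀) y) +
        (fderiv ℝ χ y).smulRight (dipField β δ y - dipField β δ₀ y)) :=
    (d₀.hasFDerivAt.add ((hχd y).hasFDerivAt.smul (d.hasFDerivAt.sub d₀.hasFDerivAt))).fderiv
  rw [e]
  refine (norm_add_le _ _).trans ?_
  have h1 := norm_add_le (χ y • (fderiv ℝ (dipField β δ) y - fderiv ℝ (dipField β δ₀) y))
    ((fderiv ℝ χ y).smulRight (dipField β δ y - dipField β δ₀ y))
  have h2 := norm_sub_le (fderiv ℝ (dipField β δ) y) (fderiv ℝ (dipField β δ₀) y)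
  have h3 := norm_sub_le (dipField β δ y) (dipField β δ₀ y)
  have h4 := norm_dipField_le (β := β) hδ.le y
  have h5 := norm_dipField_le (β := β) hδ₀'.le y
  rw [norm_smul, Real.norm_of_nonneg (hχ y).1, ContinuousLinearMap.norm_smulRight_apply] at h1
  have h6 : χ y * ‖fderiv ℝ (dipField β δ) y - fderiv ℝ (dipField β δ₀) y‖ ≤ 1 * 2 :=
    mul_le_mul (hχ y).2 (by linarith) (norm_nonneg _) zero_le_one
  have h7 : ‖fderiv ℝ χ y‖ * ‖dipField β δ y - dipField β δ₀ y‖ ≤ A * (2 * ‖y‖ + 4 * δ₀) :=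
    mul_le_mul hA (by linarith) (norm_nonneg _) ((norm_nonneg _).trans hA)
  linarith


theorem chainDet_congr {φ ψ : R3 → C3} {x : R3} (h : φ =ᶠ[𝓝 x] ψ) : chainDet φ x = chainDet ψ x := by
  simp only [chainDet, pderiv, h.fderiv_eq]

/-- The phase along the part of the blended chains off the crossing. -/
theorem phase_lower_of_large {β ρ δ₀ : ℝ} {y : R3} (hy : ρ / 2 ≤ ‖y‖)
    (hδ₁ : 12 * δ₀ ≤ ρ / 4) (hδ₂ : 12 * δ₀ ≤ |β| / 8 * ρ ^ 2) (hρ : 0 < ρ) :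
    6 * δ₀ ≤ (|y 0| + |y 1|) / 2 + |β| / 2 * y 2 ^ 2 - 6 * δ₀ := by
  have h : ∃ i, ρ / 2 ≤ |y i| := by
    by_contra! h
    exact absurd hy (not_le.2 ((pi_norm_lt_iff (half_pos hρ)).2 h))
  obtain ⟨i, hi⟩ := h
  have a0 := abs_nonneg (y 0)
  have a1 := abs_nonneg (y 1)
  have a2 : 0 ≤ |β| / 2 * y 2 ^ 2 := by positivity
  fin_cases i
  · simp only [Fin.zero_eta] at hi; linarith
  · simp only [Fin.mk_one] at hi; linarith
  · simp only [Fin.reduceFinMk] at hi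
    have h2 : (ρ / 2) ^ 2 ≤ y 2 ^ 2 := by rw [← sq_abs (y 2)]; gcongr
    have := mul_le_mul_of_nonneg_left h2 (by positivity : 0 ≤ |β| / 2)
    linarith

/-- Exponential decay beats both the normalization and polynomial growth; this disposes of
everything away from the crossing. -/
theorem tendsto_cpow_mul_zero {s : ℂ} {g : ℝ → ℂ} {A m ζ : ℝ} (hζ : 0 < ζ)
    (hg : ∀ᶠ Λ : ℝ in atTop, ‖g Λ‖ ≤ A * Λ ^ m * Real.exp (-ζ * Λ)) :
    Tendsto (fun Λ : ℝ => (Λ : ℂ) ^ s * (√Λ : ℝ) * g Λ) atTop (𝓝 0) := by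
  have h := (tendsto_rpow_mul_exp_neg_mul_atTop_nhds_zero (s.re + 1 / 2 + m) ζ hζ).const_mul A
  rw [mul_zero] at h
  refine squeeze_zero_norm' ?_ h
  filter_upwards [hg, eventually_gt_atTop 0] with Λ h1 hΛ
  rw [norm_mul, norm_mul, Complex.norm_cpow_eq_rpow_re_of_pos hΛ, Complex.norm_real,
    Real.norm_of_nonneg (Real.sqrt_nonneg _), Real.sqrt_eq_rpow]
  calc _ ≤ Λ ^ s.re * Λ ^ (1 / 2 : ℝ) * (A * Λ ^ m * Real.exp (-ζ * Λ)) := by gcongr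
    _ = A * (Λ ^ (s.re + 1 / 2 + m) * Real.exp (-ζ * Λ)) := by
      rw [Real.rpow_add hΛ, Real.rpow_add hΛ]; ring

/-- The contribution of a chain that passes below both singularities. -/
theorem tendsto_below {G H : C3 → ℂ} {G₀ c μ₁ μ₂ : ℂ} {β ε ρ r₀ r₁ B R δ₀ ζ : ℝ} {D : Set R3}
    {Φ : R3 → C3} (hβ : β ≠ 0)
    (hμ₁ : IsPoleOrBranchExponent μ₁) (hμ₂ : IsPoleOrBranchExponent μ₂) (hε : ε ∈ Set.Ioc (0 : ℝ) 1)
    (hnf : remainder G G₀ β =O[𝓝 0] fun w => ‖w‖ * (‖w 0‖ + ‖w 1‖) + ‖w 2‖ ^ 3)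
    (hGim : G₀.im = 0)
    (hphase : ∀ y v : R3, ∀ d : ℝ, 0 ≤ d → d ≤ r₀ → ‖y‖ ≤ r₀ → IsLift β d y v →
      ε * ((|y 0| + |y 1|) / 2 + |β| / 2 * y 2 ^ 2 - 6 * d)
        ≤ (G (toC3 y + (ε * Complex.I : ℂ) • toC3 v)).im)
    (hG : AnalyticOnNhd ℂ G (Metric.ball 0 R))
    (hH : AnalyticOnNhd ℂ H (Metric.ball 0 R ∩ lowerSpace))
    (hlim : Tendsto (fun w => H w / modelPow μ₁ μ₂ w) (𝓝[lowerSpace] 0) (𝓝 c))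
    (hB : ∀ w ∈ Metric.ball (0 : C3) r₁ ∩ lowerSpace, ‖H w / modelPow μ₁ μ₂ w‖ ≤ B)
    (hρ : 0 < ρ) (hρ₀ : ρ ≤ r₀) (hρ₁ : 4 * ρ ≤ r₁) (hr₁ : r₁ ≤ R)
    (hδ₀ : 0 < δ₀) (hδ₁ : 12 * δ₀ ≤ ρ / 4) (hδ₂ : 12 * δ₀ ≤ |β| / 8 * ρ ^ 2)
    (hD : IsOpen D) (hρD : Metric.ball 0 ρ ⊆ D) (hΦ : ∀ y ∈ D, ContDiffAt ℝ 2 Φ y)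
    (hΦW : ∀ y ∈ D, Φ y ∈ Metric.ball 0 R ∩ lowerSpace)
    (hΦρ : ∀ y ∈ Metric.ball 0 ρ, Φ y = dipChain β ε δ₀ y)
    (hζ : 0 < ζ) (hΦζ : ∀ y ∈ D \ Metric.ball 0 (ρ / 2), ζ ≤ (G (Φ y)).im)
    (hint : ∀ Λ : ℝ, IntegrableOn
      (fun y => H (Φ y) * Complex.exp (Complex.I * Λ * (G (Φ y) - G₀)) * chainDet Φ y) D) :
    Tendsto (fun Λ : ℝ => (Λ : ℂ) ^ (μ₁ + μ₂ + 2) * (√Λ : ℝ) *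
        ∫ y in D, H (Φ y) * Complex.exp (Complex.I * Λ * (G (Φ y) - G₀)) * chainDet Φ y) atTop
      (𝓝 (c * (Iconst μ₁ * Iconst μ₂ *
        ((√(2 * Real.pi) / √|β| : ℝ) *
          Complex.exp (Complex.I * (Real.pi / 4) * Real.sign β))))) := by
  have hεI : ε ∈ Set.Icc (0 : ℝ) 1 := ⟨hε.1.le, hε.2⟩
  have hε0 : 0 < ε := hε.1
  -- the cutoff function
  let bump : ContDiffBump (0 : R3) := ⟨ρ / 2, 3 * ρ / 4, by linarith, by linarith⟩
  set χ : R3 → ℝ := fun y => bump y with hχdef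
  have hχ : ∀ y, χ y ∈ Set.Icc (0 : ℝ) 1 := fun y => ⟨bump.nonneg, bump.le_one⟩
  have hχs : ContDiff ℝ 2 χ := bump.contDiff
  have hχd : Differentiable ℝ χ := hχs.differentiable (by norm_num)
  have hχ1 : ∀ y ∈ Metric.closedBall (0 : R3) (ρ / 2), χ y = 1 := fun y hy =>
    bump.one_of_mem_closedBall hy
  have hχ0 : ∀ y, y ∉ Metric.ball (0 : R3) (3 * ρ / 4) → χ y = 0 := fun y hy =>
    bump.zero_of_le_dist (by simpa using hy)
  obtain ⟨A, hA⟩ : ∃ A, ∀ y, ‖fderiv ℝ χ y‖ ≤ A :=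
    (bump.hasCompactSupport.fderiv (𝕜 := ℝ)).exists_bound_of_continuous
      (hχs.continuous_fderiv (by norm_num))
  have hA0 : 0 ≤ A := (norm_nonneg _).trans (hA 0)
  -- the blended chains
  set Ψ : ℝ → R3 → C3 := fun δ y => toC3 y + (ε * Complex.I : ℂ) • toC3 (blendField χ β δ₀ δ y)
    with hΨ
  -- `φ δ` is the dip chain of scale `δ` on the ball of radius `ρ / 2`, a blended chain up to `3 ρ /
  -- 4`, and `Φ` farther out.
  set φ : ℝ → R3 → C3 := fun δ y => Φ y + χ y • (dipChain β ε δ y - dipChain β ε δ₀ y) with hφ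
  have hΨφ : ∀ δ, ∀ y ∈ Metric.ball (0 : R3) ρ, φ δ y = Ψ δ y := by
    intro δ y hy
    simp only [hφ, hΨ, hΦρ y hy]
    ext i
    simp [dipChain, blendField]
    ring
  have hball : ∀ y v : R3, ‖y‖ < ρ → IsLift β δ₀ y v →
      ‖toC3 y + (ε * Complex.I : ℂ) • toC3 v‖ < r₁ := by
    intro y v hy hv
    have h1 := norm_displaced_le hεI y v
    have h2 := hv.norm_le hδ₀.le
    linarith
  have hblend : ∀ δ, 0 < δ → δ ≤ δ₀ → ∀ χ' : R3 → ℝ, ∀ y, χ' y ∈ Set.Icc (0 : ℝ) 1 →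
      ‖y‖ < ρ →
      toC3 y + (ε * Complex.I : ℂ) • toC3 (blendField χ' β δ₀ δ y) ∈ Metric.ball 0 r₁ ∩ lowerSpace ∧
      min 1 (ε / 2) * δ ≤ ‖(toC3 y + (ε * Complex.I : ℂ) • toC3 (blendField χ' β δ₀ δ y)) 0‖ ∧
      min 1 (ε / 2) * δ ≤ ‖(toC3 y + (ε * Complex.I : ℂ) • toC3 (blendField χ' β δ₀ δ y)) 1‖ := by
    intro δ hδ hδ' χ' y hs hy
    obtain ⟨b0, b1, b2⟩ := displaced_below (y := y) (v := blendField χ' β δ₀ δ y) hε0 hδ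
      (fun h => by rw [blendField_zero]; exact blend_le_of_abs_le hs hδ.le hδ' h)
      (fun h => by rw [blendField_one]; exact blend_le_of_abs_le hs hδ.le hδ' h)
    refine ⟨⟨?_, b0⟩, b1, b2⟩
    rw [mem_ball_zero_iff]
    exact hball y _ hy (isLift_blendField hs hδ.le hδ')
  set f : ℝ → C3 → ℂ := fun Λ w => H w * Complex.exp (Complex.I * Λ * (G w - G₀)) with hf
  have hfan : ∀ Λ, AnalyticOnNhd ℂ (f Λ) (Metric.ball 0 R ∩ lowerSpace) := fun Λ w hw =>
    (hH w hw).mul ((analyticAt_const.mul ((hG w hw.1).sub analyticAt_const)).cexp)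
  have hdip2 : ∀ δ, 0 < δ → ContDiff ℝ 2 (dipChain β ε δ) := fun δ hδ =>
    contDiff_iff_contDiffAt.2 fun y =>
      contDiff_displaced (contDiff_dipField β hδ).contDiffAt ε
  have hφ2 : ∀ δ, 0 < δ → ∀ y ∈ D, ContDiffAt ℝ 2 (φ δ) y := fun δ hδ y hy =>
    (hΦ y hy).add (hχs.contDiffAt.smul
      ((hdip2 δ hδ).contDiffAt.sub (hdip2 δ₀ hδ₀).contDiffAt))
  have hshift : ∀ Λ : ℝ, 0 < Λ → Λ⁻¹ ≤ δ₀ →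
      IntegrableOn (fun y => f Λ (φ Λ⁻¹ y) * chainDet (φ Λ⁻¹) y) D ∧
      ∫ y in D, f Λ (φ Λ⁻¹ y) * chainDet (φ Λ⁻¹) y = ∫ y in D, f Λ (Φ y) * chainDet Φ y := by
    intro Λ hΛ hΛδ
    have hδ := inv_pos.2 hΛ
    refine chainIntegral_eq_of_homotopy (K := Metric.closedBall 0 (3 * ρ / 4)) hD
      (isCompact_closedBall _ _)
      ((Metric.closedBall_subset_ball (by linarith)).trans hρD) (hfan Λ) hΦ (hφ2 _ hδ) ?_ ?_ (hint Λ)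
    · intro y hy hyK
      have : χ y = 0 := hχ0 y fun h => hyK (Metric.ball_subset_closedBall h)
      simp [hφ, this]
    · intro t ht y hy
      by_cases hyρ : y ∈ Metric.ball (0 : R3) ρ
      -- Every stage of the homotopy is again a blended chain, with the cutoff multiplied by `t`.
      · have hts : t * χ y ∈ Set.Icc (0 : ℝ) 1 :=
          ⟨mul_nonneg ht.1 (hχ y).1, mul_le_one₀ ht.2 (hχ y).1 (hχ y).2⟩
        have e : Φ y + t • (φ Λ⁻¹ y - Φ y) = toC3 y + (ε * Complex.I : ℂ) •
            toC3 (blendField (fun y => t * χ y) β δ₀ Λ⁻¹ y) := by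
          simp only [hφ, hΦρ y hyρ]
          ext i
          simp [dipChain, blendField]
          ring
        rw [e]
        have := (hblend Λ⁻¹ hδ hΛδ (fun y => t * χ y) y hts (by simpa using hyρ)).1
        exact ⟨Metric.ball_subset_ball hr₁ this.1, this.2⟩
      · have : χ y = 0 := hχ0 y fun h => hyρ (Metric.ball_subset_ball (by linarith) h)
        simpa [hφ, this] using hΦW y hy
  -- the three parts of the integral
  set S := Metric.ball (0 : R3) (ρ / 2) with hS
  set T := Metric.ball (0 : R3) ρ \ Metric.ball 0 (ρ / 2) with hT
  set Q := D \ Metric.ball (0 : R3) ρ with hQ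
  have hsplit : ∀ g : R3 → ℂ, IntegrableOn g D →
      ∫ y in D, g y = (∫ y in S, g y) + (∫ y in T, g y) + ∫ y in Q, g y := by
    intro g hg
    have hST : S ⊆ Metric.ball (0 : R3) ρ := Metric.ball_subset_ball (by linarith)
    have hgρ := hg.mono_set hρD
    rw [← integral_inter_add_sdiff (s := D) measurableSet_ball hg, Set.inter_eq_right.2 hρD,
      ← integral_inter_add_sdiff (s := Metric.ball (0 : R3) ρ) (t := S) measurableSet_ball hgρ,
      Set.inter_eq_right.2 hST]
  have hinner := tendsto_inner hβ hμ₁ hμ₂ hε hnf hGim (hρ.trans_le hρ₀) hphase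
    (hG.continuousOn.mono (Metric.ball_subset_ball hr₁))
    (hH.continuousOn.mono (Set.inter_subset_inter_left _ (Metric.ball_subset_ball hr₁))) hlim hB
    (half_pos hρ) (by linarith) (by linarith)
  -- the inner part
  have hSeq : ∀ Λ : ℝ, 0 < Λ → ∫ y in S, f Λ (φ Λ⁻¹ y) * chainDet (φ Λ⁻¹) y =
      ∫ y in S, innerIntegrand H G G₀ β ε Λ y := by
    intro Λ hΛ
    refine setIntegral_congr_fun measurableSet_ball fun y hy => ?_
    have hev : φ Λ⁻¹ =ᶠ[𝓝 y] dipChain β ε Λ⁻¹ := by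
      filter_upwards [Metric.isOpen_ball.mem_nhds hy] with u hu
      have h1 : χ u = 1 := hχ1 u (Metric.ball_subset_closedBall hu)
      simp only [hφ, h1, one_smul, hΦρ u (Metric.ball_subset_ball (by linarith) hu)]
      abel
    simp only [hf, innerIntegrand]
    rw [chainDet_congr hev, chainDet_dipChain β ε (inv_pos.2 hΛ), hev.self_of_nhds]
  -- the outer part
  have hQb : ∀ᶠ Λ : ℝ in atTop, ‖∫ y in Q, f Λ (φ Λ⁻¹ y) * chainDet (φ Λ⁻¹) y‖ ≤
      (∫ y in Q, ‖H (Φ y) * chainDet Φ y‖) * Λ ^ (0 : ℝ) * Real.exp (-ζ * Λ) := by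
    filter_upwards [eventually_gt_atTop 0] with Λ hΛ
    have hQm : MeasurableSet Q := hD.measurableSet.diff measurableSet_ball
    have hi0 : IntegrableOn (fun y => ‖H (Φ y) * chainDet Φ y‖) Q := by
      -- At `Λ = 0` the exponential disappears, which leaves the integrability of the amplitude
      -- itself.
      have := (hint 0).mono_set (Set.sdiff_subset : Q ⊆ D)
      simpa [IntegrableOn, hQ] using this.norm
    rw [Real.rpow_zero, mul_one, mul_comm, ← integral_const_mul]
    refine norm_integral_le_of_norm_le (hi0.const_mul _) ?_
    refine (ae_restrict_iff' hQm).2 (Eventually.of_forall fun y hy => ?_)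
    have hev : φ Λ⁻¹ =ᶠ[𝓝 y] Φ := by
      have hmem : (Metric.closedBall (0 : R3) (3 * ρ / 4))ᶜ ∈ 𝓝 y :=
        Metric.isClosed_closedBall.isOpen_compl.mem_nhds fun h =>
          hy.2 (Metric.closedBall_subset_ball (by linarith) h)
      filter_upwards [hmem] with u hu
      have h1 : χ u = 0 := hχ0 u fun h => hu (Metric.ball_subset_closedBall h)
      simp [hφ, h1]
    have hz := hΦζ y ⟨hy.1, fun h => hy.2 (Metric.ball_subset_ball (by linarith) h)⟩
    rw [chainDet_congr hev, hev.self_of_nhds]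
    simp only [hf]
    rw [norm_mul, norm_mul, norm_mul, norm_exp_I_mul, Complex.sub_im, hGim, sub_zero]
    have : Real.exp (-(Λ * (G (Φ y)).im)) ≤ Real.exp (-ζ * Λ) := by
      rw [Real.exp_le_exp]; nlinarith
    calc _ ≤ ‖H (Φ y)‖ * Real.exp (-ζ * Λ) * ‖chainDet Φ y‖ := by gcongr
      _ = _ := by ring
  -- the intermediate part
  set b := min 1 (ε / 2) with hb
  have hbpos : 0 < b := by positivity
  -- For `Λ ≥ 1`, `P Λ` bounds the norm of the points of the transition zone and the inverses of
  -- their distances to both singularities.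
  set P := max (max 1 R) b⁻¹ with hP
  set m := |μ₁.re| + |μ₂.re| with hm
  set E := Real.exp (2 * Real.pi * (|μ₁.im| + |μ₂.im|)) with hE
  set J := 6 * (1 + (3 + A * (2 * ρ + 4 * δ₀))) ^ 3 with hJ
  have hTb : ∀ᶠ Λ : ℝ in atTop, ‖∫ y in T, f Λ (φ Λ⁻¹ y) * chainDet (φ Λ⁻¹) y‖ ≤
      (B * (E * P ^ m) * J * volume.real T) * Λ ^ m * Real.exp (-(6 * ε * δ₀) * Λ) := by
    filter_upwards [eventually_ge_atTop 1, tendsto_inv_atTop_zero.eventually (gt_mem_nhds hδ₀)]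
      with Λ hΛ1 hΛδ
    have hΛ : 0 < Λ := by linarith
    have hδ := inv_pos.2 hΛ
    have hTfin : volume T < ⊤ :=
      (measure_mono Set.sdiff_subset).trans_lt measure_ball_lt_top
    have key : ∀ y ∈ T, ‖f Λ (φ Λ⁻¹ y) * chainDet (φ Λ⁻¹) y‖ ≤
        B * (E * (P * Λ) ^ m) * Real.exp (-(6 * ε * δ₀) * Λ) * J := by
      intro y hy
      have hyn : ‖y‖ < ρ := by simpa using hy.1
      have hyl : ρ / 2 ≤ ‖y‖ := by simpa using hy.2
      have hev : φ Λ⁻¹ =ᶠ[𝓝 y] Ψ Λ⁻¹ := by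
        filter_upwards [Metric.isOpen_ball.mem_nhds hy.1] with u hu using hΨφ _ u hu
      rw [chainDet_congr hev, hev.self_of_nhds]
      obtain ⟨b0, b1, b2⟩ := hblend Λ⁻¹ hδ hΛδ.le χ y (hχ y) hyn
      have hdb : DifferentiableAt ℝ (blendField χ β δ₀ Λ⁻¹) y := by
        have d := (contDiff_dipField β hδ (n := 1)).differentiable one_ne_zero y
        have d₀ := (contDiff_dipField β hδ₀ (n := 1)).differentiable one_ne_zero y
        exact d₀.add ((hχd y).smul (d.sub d₀))
      have hj : ‖chainDet (Ψ Λ⁻¹) y‖ ≤ J := by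
        refine norm_chainDet_le (norm_fderiv_displaced_le hdb hεI ?_)
        refine (norm_fderiv_blendField_le hχ hχd hδ hΛδ.le (hA y)).trans ?_
        have := mul_le_mul_of_nonneg_left hyn.le hA0
        nlinarith
      -- The estimate is used with `δ₀` in place of `1 / Λ`: the smallness conditions on `δ₀` then
      -- leave at least `6 ε δ₀` for `Im G` in the whole transition zone.
      have hph := hphase y _ δ₀ hδ₀.le (by linarith) (hyn.le.trans hρ₀)
        (isLift_blendField (hχ y) hδ.le hΛδ.le)
      have hlow := mul_le_mul_of_nonneg_left (phase_lower_of_large hyl hδ₁ hδ₂ hρ) hε0.le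
      have hex : ‖Complex.exp (Complex.I * Λ * (G (Ψ Λ⁻¹ y) - G₀))‖ ≤
          Real.exp (-(6 * ε * δ₀) * Λ) := by
        rw [norm_exp_I_mul, Complex.sub_im, hGim, sub_zero, Real.exp_le_exp]
        have := mul_le_mul_of_nonneg_left (hlow.trans hph) hΛ.le
        linarith
      have hP1 : 1 ≤ P := (le_max_left _ _).trans (le_max_left _ _)
      have hPΛ : P ≤ P * Λ := le_mul_of_one_le_right (by linarith) hΛ1
      have hmod : ‖modelPow μ₁ μ₂ (Ψ Λ⁻¹ y)‖ ≤ E * (P * Λ) ^ m := by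
        refine norm_modelPow_le (b := b * Λ⁻¹) (by positivity) (hP1.trans hPΛ) ?_ b1 b2 ?_
        · rw [mul_inv, inv_inv]
          exact mul_le_mul_of_nonneg_right (le_max_right _ _) hΛ.le
        · have h1 : ‖Ψ Λ⁻¹ y‖ < r₁ := by simpa using b0.1
          have h2 : R ≤ P := (le_max_right _ _).trans (le_max_left _ _)
          linarith
      have hHb : ‖H (Ψ Λ⁻¹ y)‖ ≤ B * (E * (P * Λ) ^ m) := by
        have h1 := hB _ b0
        rw [norm_div, div_le_iff₀ (norm_pos_iff.2 (modelPow_ne_zero _ _ _))] at h1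
        have hB0 : 0 ≤ B := (norm_nonneg _).trans (hB _ b0)
        exact h1.trans (mul_le_mul_of_nonneg_left hmod hB0)
      simp only [hf]
      rw [norm_mul, norm_mul]
      have := (norm_nonneg _).trans hHb
      gcongr
    refine (norm_setIntegral_le_of_norm_le_const hTfin key).trans (le_of_eq ?_)
    rw [Real.mul_rpow (by positivity) hΛ.le]
    ring
  have hz1 := tendsto_cpow_mul_zero (s := μ₁ + μ₂ + 2) hζ hQb
  have hz2 := tendsto_cpow_mul_zero (s := μ₁ + μ₂ + 2) (by positivity) hTb
  have htot := (hinner.add hz2).add hz1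
  rw [add_zero, add_zero] at htot
  refine htot.congr' ?_
  filter_upwards [eventually_gt_atTop 0, tendsto_inv_atTop_zero.eventually (gt_mem_nhds hδ₀)]
    with Λ hΛ hΛδ
  obtain ⟨h1, h2⟩ := hshift Λ hΛ hΛδ.le
  have h3 := hsplit _ h1
  rw [h2, hSeq Λ hΛ] at h3
  simp only [hf] at h3
  rw [h3]
  ring


/-! ### Jacobians of chains and of real maps -/

theorem det3_mulVec (M : Matrix (Fin 3) (Fin 3) ℂ) (a b c : C3) :
    det3 (M.mulVec a) (M.mulVec b) (M.mulVec c) = M.det * det3 a b c := by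
  simp only [det3, Matrix.det_fin_three, Matrix.mulVec, dotProduct, Fin.sum_univ_three]
  ring

theorem det3_map (A : C3 →L[ℂ] C3) (a b c : C3) : det3 (A a) (A b) (A c) = A.det * det3 a b c := by
  have e : ∀ v, A v = (LinearMap.toMatrix' A.toLinearMap).mulVec v := fun v => by
    rw [LinearMap.toMatrix'_mulVec]; rfl
  rw [e, e, e, det3_mulVec, LinearMap.det_toMatrix']

theorem det3_real (L : R3 →L[ℝ] R3) :
    det3 (toC3 (L (Pi.single 0 1))) (toC3 (L (Pi.single 1 1))) (toC3 (L (Pi.single 2 1))) =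
      (L.det : ℂ) := by
  have h : L.det = (LinearMap.toMatrix' L.toLinearMap).det := (LinearMap.det_toMatrix' _).symm
  rw [h, Matrix.det_fin_three]
  simp [det3, LinearMap.toMatrix'_apply]
  ring

/-- Real coordinate vectors are a basis of `ℂ³` as well, so the real matrix also represents the
complex map. -/
theorem det_eq_ofReal_det {A : C3 →L[ℂ] C3} {L : R3 →L[ℝ] R3}
    (h : ∀ v, A (toC3 v) = toC3 (L v)) : A.det = (L.det : ℂ) := by
  have e := det3_map A (toC3 (Pi.single 0 1)) (toC3 (Pi.single 1 1)) (toC3 (Pi.single 2 1))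
  have e1 : det3 (toC3 (Pi.single 0 1)) (toC3 (Pi.single 1 1)) (toC3 (Pi.single 2 1)) = 1 := by
    simp [det3]
  rw [e1, mul_one, h, h, h, det3_real] at e
  exact e.symm

/-- The real part of complex points as a continuous real-linear map. -/
def reL : C3 →L[ℝ] R3 :=
  ContinuousLinearMap.pi fun i => Complex.reCLM.comp (ContinuousLinearMap.proj i)

@[simp] theorem reL_apply (w : C3) (i : Fin 3) : reL w i = (w i).re := rfl

theorem reL_toC3 (x : R3) : reL (toC3 x) = x := by ext i; simp

theorem toC3_reL {w : C3} (h : ∀ i, (w i).im = 0) : toC3 (reL w) = w := by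
  ext i
  exact Complex.ext (by simp) (by simp [h i])

/-- The map of real points induced by a map of complex points. -/
def realMap (Θ : C3 → C3) (x : R3) : R3 := reL (Θ (toC3 x))

theorem hasFDerivAt_comp_toC3 {V : Type*} [NormedAddCommGroup V] [NormedSpace ℂ V] {Θ : C3 → V}
    {x : R3} (hΘ : DifferentiableAt ℂ Θ (toC3 x)) :
    HasFDerivAt (fun x => Θ (toC3 x)) (((fderiv ℂ Θ (toC3 x)).restrictScalars ℝ).comp toC3L) x :=
  HasFDerivAt.comp x (hΘ.hasFDerivAt.restrictScalars ℝ) toC3L.hasFDerivAt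

theorem contDiffAt_realMap {Θ : C3 → C3} {x : R3} (hΘ : AnalyticAt ℂ Θ (toC3 x)) {n : WithTop ℕ∞} :
    ContDiffAt ℝ n (realMap Θ) x :=
  reL.contDiff.contDiffAt.comp x
    ((hΘ.contDiffAt.restrict_scalars ℝ).comp x toC3L.contDiff.contDiffAt)

/-- Near `x` the holomorphic map and the induced real map agree on real points, so their derivatives
agree on real vectors. -/
theorem toC3_fderiv_realMap {Θ : C3 → C3} {x : R3} (hΘ : AnalyticAt ℂ Θ (toC3 x))
    (hreal : ∀ᶠ z in 𝓝 x, ∀ i, (Θ (toC3 z) i).im = 0) (h : R3) :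
    fderiv ℂ Θ (toC3 x) (toC3 h) = toC3 (fderiv ℝ (realMap Θ) x h) := by
  have h1 := hasFDerivAt_comp_toC3 hΘ.differentiableAt
  have h2 : HasFDerivAt (fun z => toC3L (realMap Θ z)) (toC3L.comp (fderiv ℝ (realMap Θ) x)) x :=
    toC3L.hasFDerivAt.comp x
      ((contDiffAt_realMap hΘ (n := 1)).differentiableAt one_ne_zero).hasFDerivAt
  have e : (fun z => toC3L (realMap Θ z)) =ᶠ[𝓝 x] fun z => Θ (toC3 z) := by
    filter_upwards [hreal] with z hz using toC3_reL hz
  have := h1.unique (h2.congr_of_eventuallyEq e.symm)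
  exact DFunLike.congr_fun this h

/-- The Jacobian of the image of a displaced chain under a map. -/
theorem chainDet_image {Θ : C3 → C3} {X η : R3 → R3} {y : R3} {ε : ℝ}
    (hΘ : DifferentiableAt ℂ Θ (shifted η ε (X y))) (hη : DifferentiableAt ℝ η (X y))
    (hX : DifferentiableAt ℝ X y) :
    chainDet (fun y => Θ (shifted η ε (X y))) y = (fderiv ℂ Θ (shifted η ε (X y))).det *
      ((1 : Matrix (Fin 3) (Fin 3) ℂ) + (ε * Complex.I : ℂ) •
      (LinearMap.toMatrix' (fderiv ℝ η (X y)).toLinearMap).map Complex.ofReal).det *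
      ((fderiv ℝ X y).det : ℂ) := by
  have hs : DifferentiableAt ℝ (shifted η ε) (X y) := by
    have : DifferentiableAt ℝ (fun x => toC3L x + (ε * Complex.I : ℂ) • toC3L (η x)) (X y) :=
      toC3L.differentiableAt.add
        ((toC3L.differentiableAt.comp (X y) hη).const_smul (ε * Complex.I : ℂ))
    exact this
  have h1 : HasFDerivAt (fun y => Θ (shifted η ε (X y)))
      (((fderiv ℂ Θ (shifted η ε (X y))).restrictScalars ℝ).comp
        ((fderiv ℝ (shifted η ε) (X y)).comp (fderiv ℝ X y))) y :=
    HasFDerivAt.comp y (hΘ.hasFDerivAt.restrictScalars ℝ)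
      (hs.hasFDerivAt.comp y hX.hasFDerivAt)
  have e2 : ∀ v, fderiv ℝ (shifted η ε) (X y) v = ((1 : Matrix (Fin 3) (Fin 3) ℂ) +
      (ε * Complex.I : ℂ) •
      (LinearMap.toMatrix' (fderiv ℝ η (X y)).toLinearMap).map Complex.ofReal).mulVec (toC3 v) := by
    intro v
    have e3 := fderiv_displaced hη ε v
    have e4 : fderiv ℝ η (X y) v = (LinearMap.toMatrix' (fderiv ℝ η (X y)).toLinearMap).mulVec v := by
      rw [LinearMap.toMatrix'_mulVec]; rfl
    change fderiv ℝ (shifted η ε) (X y) v = _ at e3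
    rw [e3, e4, Matrix.add_mulVec, Matrix.one_mulVec, Matrix.smul_mulVec]
    congr 2
    ext i
    simp only [toC3_apply, Matrix.mulVec, dotProduct, Complex.ofReal_sum, Complex.ofReal_mul,
      Matrix.map_apply]
  simp only [chainDet, pderiv, h1.fderiv, ContinuousLinearMap.comp_apply,
    ContinuousLinearMap.coe_restrictScalars', det3_map, e2, det3_mulVec, det3_real]
  ring

/-- A cutoff function that is `1` on a compact set and has compact support in an open set. -/
theorem exists_cutoff {D K : Set R3} (hD : IsOpen D) (hK : IsCompact K) (hKD : K ⊆ D) :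
    ∃ χ : R3 → ℝ, ContDiff ℝ 2 χ ∧ (∀ y, χ y ∈ Set.Icc (0 : ℝ) 1) ∧ (∀ y ∈ K, χ y = 1) ∧
      ∃ S, IsCompact S ∧ S ⊆ D ∧ ∀ y, y ∉ S → χ y = 0 := by
  obtain ⟨S, hS, hKS, hSD⟩ := exists_compact_between hK hD hKD
  obtain ⟨f, hf1, hf0, hf⟩ := exists_contMDiffMap_one_nhds_of_subset_interior (n := 2)
    (modelWithCornersSelf ℝ R3) hK.isClosed hKS
  refine ⟨f, f.contMDiff.contDiff, hf, fun y hy => ?_, S, hS, hSD, hf0⟩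
  exact hf1.self_of_nhdsSet y hy


/-! ### The data in normalized coordinates -/

variable {F G g₁ g₂ : C3 → ℂ} {x₀ : R3} {η₀ : R3 → R3} {Ψ : OpenPartialHomeomorph C3 C3}
  {α₁ α₂ β R σ : ℝ} {U : Set R3}

/-- A neighbourhood of the crossing on which the data behave uniformly well in the coordinates
given by `Ψ`, which range over the ball of radius `R`. -/
structure IsGoodNbhd (F G g₁ g₂ : C3 → ℂ) (x₀ : R3) (η₀ : R3 → R3)
    (Ψ : OpenPartialHomeomorph C3 C3) (α₁ α₂ R σ : ℝ) (U : Set R3) : Prop where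
  pos : 0 < R
  target : Metric.ball 0 R ⊆ Ψ.target
  phase_analytic : AnalyticOnNhd ℂ (fun w => G (Ψ.symm w)) (Metric.ball 0 R)
  phase_lipschitz : ∃ L : NNReal,
    LipschitzOnWith L (fderiv ℂ fun w => G (Ψ.symm w)) (Metric.ball 0 R)
  phase_real : ∀ y : R3, ‖y‖ < R → (G (Ψ.symm (toC3 y))).im = 0
  phase_near : ∀ y : R3, ‖y‖ < R → ‖fderiv ℂ (fun w => G (Ψ.symm w)) (toC3 y) -
    fderiv ℂ (fun w => G (Ψ.symm w)) 0‖ ≤ 1 / 4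
  amplitude : AnalyticOnNhd ℂ (fun w => F (Ψ.symm w)) (Metric.ball 0 R ∩
    cutSpace (α₁ * gradDot g₁ x₀ (η₀ x₀)) (α₂ * gradDot g₂ x₀ (η₀ x₀)))
  abs_sign : |σ| = 1
  orient : ∀ y : R3, ‖y‖ < R → 0 < σ * (fderiv ℝ (realMap Ψ.symm) y).det
  source : ∀ x ∈ U, toC3 x ∈ Ψ.source
  maps : ∀ x ∈ U, ‖Ψ (toC3 x)‖ < R
  taylor : ∃ r : ℝ, ∃ L : NNReal, Metric.ball (toC3 x₀) r ⊆ Ψ.source ∧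
    LipschitzOnWith L (fderiv ℂ Ψ) (Metric.ball (toC3 x₀) r) ∧
    ∀ x ∈ U, toC3 x ∈ Metric.ball (toC3 x₀) r
  side₁ : ∀ x ∈ U, 0 < gradDot g₁ x₀ (η₀ x₀) * gradDot g₁ x (η₀ x)
  side₂ : ∀ x ∈ U, 0 < gradDot g₂ x₀ (η₀ x₀) * gradDot g₂ x (η₀ x)

theorem toC3_injective {x y : R3} (h : toC3 x = toC3 y) : x = y := by
  ext i
  have := congr_fun h i
  simpa using this

namespace IsNormalizedChart

theorem zero_mem_target (hc : IsNormalizedChart G g₁ g₂ x₀ Ψ α₁ α₂ β) : (0 : C3) ∈ Ψ.target := by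
  rw [← hc.map_center]; exact Ψ.map_source hc.mem_source

theorem symm_zero (hc : IsNormalizedChart G g₁ g₂ x₀ Ψ α₁ α₂ β) : Ψ.symm 0 = toC3 x₀ := by
  rw [← hc.map_center]; exact Ψ.left_inv hc.mem_source

theorem g₁_symm (hc : IsNormalizedChart G g₁ g₂ x₀ Ψ α₁ α₂ β) {w : C3} (hw : w ∈ Ψ.target) :
    w 0 = α₁ * g₁ (Ψ.symm w) := by
  rw [← hc.coord₁ _ (Ψ.map_target hw), Ψ.right_inv hw]

theorem g₂_symm (hc : IsNormalizedChart G g₁ g₂ x₀ Ψ α₁ α₂ β) {w : C3} (hw : w ∈ Ψ.target) :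
    w 1 = α₂ * g₂ (Ψ.symm w) := by
  rw [← hc.coord₂ _ (Ψ.map_target hw), Ψ.right_inv hw]

theorem real_symm (hc : IsNormalizedChart G g₁ g₂ x₀ Ψ α₁ α₂ β) {y : R3} (hy : toC3 y ∈ Ψ.target) :
    ∀ i, (Ψ.symm (toC3 y) i).im = 0 := by
  rw [hc.real_iff _ (Ψ.map_target hy), Ψ.right_inv hy]
  simp

theorem toC3_realMap_symm (hc : IsNormalizedChart G g₁ g₂ x₀ Ψ α₁ α₂ β) {y : R3}
    (hy : toC3 y ∈ Ψ.target) : toC3 (realMap Ψ.symm y) = Ψ.symm (toC3 y) :=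
  toC3_reL (hc.real_symm hy)

theorem toC3_realMap (hc : IsNormalizedChart G g₁ g₂ x₀ Ψ α₁ α₂ β) {x : R3}
    (hx : toC3 x ∈ Ψ.source) : toC3 (realMap Ψ x) = Ψ (toC3 x) :=
  toC3_reL ((hc.real_iff _ hx).1 (by simp))

theorem realMap_symm_realMap (hc : IsNormalizedChart G g₁ g₂ x₀ Ψ α₁ α₂ β) {x : R3}
    (hx : toC3 x ∈ Ψ.source) : realMap Ψ.symm (realMap Ψ x) = x := by
  apply toC3_injective
  have h := hc.toC3_realMap hx
  rw [hc.toC3_realMap_symm (by rw [h]; exact Ψ.map_source hx), h, Ψ.left_inv hx]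

theorem realMap_realMap_symm (hc : IsNormalizedChart G g₁ g₂ x₀ Ψ α₁ α₂ β) {y : R3}
    (hy : toC3 y ∈ Ψ.target) : realMap Ψ (realMap Ψ.symm y) = y := by
  apply toC3_injective
  have h := hc.toC3_realMap_symm hy
  rw [hc.toC3_realMap (by rw [h]; exact Ψ.map_target hy), h, Ψ.right_inv hy]

theorem realMap_center (hc : IsNormalizedChart G g₁ g₂ x₀ Ψ α₁ α₂ β) : realMap Ψ x₀ = 0 := by
  apply toC3_injective
  rw [hc.toC3_realMap hc.mem_source, hc.map_center, toC3_zero]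

theorem realMap_symm_zero (hc : IsNormalizedChart G g₁ g₂ x₀ Ψ α₁ α₂ β) :
    realMap Ψ.symm 0 = x₀ := by
  rw [← hc.realMap_center, hc.realMap_symm_realMap hc.mem_source]

theorem toC3_fderiv (hc : IsNormalizedChart G g₁ g₂ x₀ Ψ α₁ α₂ β) {x : R3} (hx : toC3 x ∈ Ψ.source)
    (h : R3) : fderiv ℂ Ψ (toC3 x) (toC3 h) = toC3 (fderiv ℝ (realMap Ψ) x h) := by
  refine toC3_fderiv_realMap (hc.analytic _ hx) ?_ h
  filter_upwards [(Ψ.open_source.preimage continuous_toC3).mem_nhds hx] with z hz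
  exact (hc.real_iff _ hz).1 (by simp)

theorem toC3_fderiv_symm (hc : IsNormalizedChart G g₁ g₂ x₀ Ψ α₁ α₂ β) {y : R3}
    (hy : toC3 y ∈ Ψ.target) (h : R3) :
    fderiv ℂ Ψ.symm (toC3 y) (toC3 h) = toC3 (fderiv ℝ (realMap Ψ.symm) y h) := by
  refine toC3_fderiv_realMap (hc.analytic_symm _ hy) ?_ h
  filter_upwards [(Ψ.open_target.preimage continuous_toC3).mem_nhds hy] with z hz
  exact hc.real_symm hz

theorem det_symm (hc : IsNormalizedChart G g₁ g₂ x₀ Ψ α₁ α₂ β) {y : R3} (hy : toC3 y ∈ Ψ.target) :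
    (fderiv ℂ Ψ.symm (toC3 y)).det = ((fderiv ℝ (realMap Ψ.symm) y).det : ℂ) :=
  det_eq_ofReal_det (hc.toC3_fderiv_symm hy)

theorem fderiv_symm_comp (hc : IsNormalizedChart G g₁ g₂ x₀ Ψ α₁ α₂ β) {ξ : C3}
    (hξ : ξ ∈ Ψ.source) :
    (fderiv ℂ Ψ.symm (Ψ ξ)).comp (fderiv ℂ Ψ ξ) = ContinuousLinearMap.id ℂ C3 := by
  have h1 := (hc.analytic _ hξ).differentiableAt.hasFDerivAt
  have h2 := (hc.analytic_symm _ (Ψ.map_source hξ)).differentiableAt.hasFDerivAt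
  refine (h2.comp ξ h1).unique ((hasFDerivAt_id ξ).congr_of_eventuallyEq ?_)
  filter_upwards [Ψ.open_source.mem_nhds hξ] with z hz using Ψ.left_inv hz

theorem det_mul_det (hc : IsNormalizedChart G g₁ g₂ x₀ Ψ α₁ α₂ β) {ξ : C3} (hξ : ξ ∈ Ψ.source) :
    (fderiv ℂ Ψ.symm (Ψ ξ)).det * (fderiv ℂ Ψ ξ).det = 1 := by
  have h := congr_arg (fun A : C3 →L[ℂ] C3 => A.det) (hc.fderiv_symm_comp hξ)
  simp only [ContinuousLinearMap.det] at h ⊢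
  rw [ContinuousLinearMap.toLinearMap_comp, LinearMap.det_comp] at h
  simpa using h

theorem gradDot_eq (hc : IsNormalizedChart G g₁ g₂ x₀ Ψ α₁ α₂ β) {f : C3 → ℂ} {x : R3}
    (hx : toC3 x ∈ Ψ.source)
    (hf : DifferentiableAt ℂ (fun w => f (Ψ.symm w)) (Ψ (toC3 x))) (v : R3) :
    gradDot f x v = gradDot (fun w => f (Ψ.symm w)) (realMap Ψ x) (fderiv ℝ (realMap Ψ) x v) := by
  have h1 := (hc.analytic _ hx).differentiableAt.hasFDerivAt
  have h2 : HasFDerivAt f ((fderiv ℂ (fun w => f (Ψ.symm w)) (Ψ (toC3 x))).comp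
      (fderiv ℂ Ψ (toC3 x))) (toC3 x) := by
    refine (hf.hasFDerivAt.comp _ h1).congr_of_eventuallyEq ?_
    filter_upwards [Ψ.open_source.mem_nhds hx] with z hz
    simp [Ψ.left_inv hz]
  unfold gradDot
  rw [h2.fderiv, ContinuousLinearMap.comp_apply, hc.toC3_fderiv hx, hc.toC3_realMap hx]

/-- As `w₁ = α₁ g₁`, the sides of the singularity are read off from the first component of a
displacement in the coordinates `w`. -/
theorem gradDot_g₁ (hc : IsNormalizedChart G g₁ g₂ x₀ Ψ α₁ α₂ β) {x : R3}
    (hx : toC3 x ∈ Ψ.source) (v : R3) :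
    α₁ * gradDot g₁ x v = fderiv ℝ (realMap Ψ) x v 0 := by
  have h1 := hasFDerivAt_pi'.1 (hc.analytic _ hx).differentiableAt.hasFDerivAt 0
  have h2 : HasFDerivAt g₁ ((α₁ : ℂ)⁻¹ • (ContinuousLinearMap.proj 0).comp
      (fderiv ℂ Ψ (toC3 x))) (toC3 x) := by
    refine (h1.const_mul (α₁ : ℂ)⁻¹).congr_of_eventuallyEq ?_
    filter_upwards [Ψ.open_source.mem_nhds hx] with z hz
    rw [hc.coord₁ z hz, inv_mul_cancel_left₀ (Complex.ofReal_ne_zero.2 hc.alpha₁_ne)]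
  unfold gradDot
  have := hc.alpha₁_ne
  rw [h2.fderiv, smul_apply, ContinuousLinearMap.comp_apply, hc.toC3_fderiv hx,
    ← Complex.ofReal_inv]
  simp
  field_simp

theorem gradDot_g₂ (hc : IsNormalizedChart G g₁ g₂ x₀ Ψ α₁ α₂ β) {x : R3}
    (hx : toC3 x ∈ Ψ.source) (v : R3) :
    α₂ * gradDot g₂ x v = fderiv ℝ (realMap Ψ) x v 1 := by
  have h1 := hasFDerivAt_pi'.1 (hc.analytic _ hx).differentiableAt.hasFDerivAt 1
  have h2 : HasFDerivAt g₂ ((α₂ : ℂ)⁻¹ • (ContinuousLinearMap.proj 1).comp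
      (fderiv ℂ Ψ (toC3 x))) (toC3 x) := by
    refine (h1.const_mul (α₂ : ℂ)⁻¹).congr_of_eventuallyEq ?_
    filter_upwards [Ψ.open_source.mem_nhds hx] with z hz
    rw [hc.coord₂ z hz, inv_mul_cancel_left₀ (Complex.ofReal_ne_zero.2 hc.alpha₂_ne)]
  unfold gradDot
  have := hc.alpha₂_ne
  rw [h2.fderiv, smul_apply, ContinuousLinearMap.comp_apply, hc.toC3_fderiv hx,
    ← Complex.ofReal_inv]
  simp
  field_simp

theorem phase_analyticAt (hc : IsNormalizedChart G g₁ g₂ x₀ Ψ α₁ α₂ β)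
    (hG : AnalyticAt ℂ G (toC3 x₀)) : AnalyticAt ℂ (fun w => G (Ψ.symm w)) 0 :=
  AnalyticAt.fun_comp (by rw [hc.symm_zero]; exact hG) (hc.analytic_symm _ hc.zero_mem_target)

theorem eventually_phase_real (hc : IsNormalizedChart G g₁ g₂ x₀ Ψ α₁ α₂ β)
    (hreal : RealNear G x₀) : ∀ᶠ y : R3 in 𝓝 0, (G (Ψ.symm (toC3 y))).im = 0 := by
  have h0 : toC3 0 ∈ Ψ.target := by rw [toC3_zero]; exact hc.zero_mem_target
  have hcont : ContinuousAt (realMap Ψ.symm) 0 :=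
    (contDiffAt_realMap (hc.analytic_symm _ h0) (n := 0)).continuousAt
  have h1 : Tendsto (realMap Ψ.symm) (𝓝 0) (𝓝 x₀) := by
    have := hcont.tendsto
    rwa [hc.realMap_symm_zero] at this
  filter_upwards [h1.eventually hreal, (Ψ.open_target.preimage continuous_toC3).mem_nhds h0]
    with y hy hyt
  rwa [hc.toC3_realMap_symm hyt] at hy

/-- With `w_k = α_k g_k`, the two cut conditions differ by the positive factor `α_k²`. -/
theorem symm_mem_sides (hc : IsNormalizedChart G g₁ g₂ x₀ Ψ α₁ α₂ β) {w : C3}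
    (hwt : w ∈ Ψ.target) {s₁ s₂ : ℝ} (hw : w ∈ cutSpace (α₁ * s₁) (α₂ * s₂)) :
    Ψ.symm w ∈ sideDomain g₁ s₁ ∩ sideDomain g₂ s₂ := by
  have key : ∀ (α s : ℝ) (z ω : ℂ), α ≠ 0 → ω = α * z →
      (ω.re = 0 → 0 < α * s * ω.im) → z.re = 0 → 0 < s * z.im := by
    intro α s z ω hα e h hz
    rw [e] at h
    simp only [Complex.re_ofReal_mul, Complex.im_ofReal_mul, hz, mul_zero, true_imp_iff] at h
    have h2 : 0 < α ^ 2 := by positivity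
    have h3 : α * s * (α * z.im) = α ^ 2 * (s * z.im) := by ring
    rw [h3] at h
    exact pos_of_mul_pos_right h h2.le
  exact ⟨key α₁ _ _ _ hc.alpha₁_ne (hc.g₁_symm hwt) hw.1,
    key α₂ _ _ _ hc.alpha₂_ne (hc.g₂_symm hwt) hw.2⟩

/-- Each requirement is an open condition that holds at the crossing. The radius `R` is chosen
first, below a prescribed bound, and `U` afterwards so small that its image lies in the ball of
radius `R`. -/
theorem exists_isGoodNbhd (hc : IsNormalizedChart G g₁ g₂ x₀ Ψ α₁ α₂ β)
    (hG : AnalyticAt ℂ G (toC3 x₀)) (hGreal : RealNear G x₀)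
    (hg₁ : AnalyticAt ℂ g₁ (toC3 x₀)) (hg₂ : AnalyticAt ℂ g₂ (toC3 x₀))
    (hη₀ : Continuous η₀)
    (hside₁ : gradDot g₁ x₀ (η₀ x₀) ≠ 0) (hside₂ : gradDot g₂ x₀ (η₀ x₀) ≠ 0)
    (hF : ∃ V ∈ 𝓝 (toC3 x₀), AnalyticOnNhd ℂ F
      (V ∩ (sideDomain g₁ (gradDot g₁ x₀ (η₀ x₀)) ∩ sideDomain g₂ (gradDot g₂ x₀ (η₀ x₀)))))
    {R₁ : ℝ} (hR₁ : 0 < R₁) :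
    ∃ R ≤ R₁, ∃ σ, ∃ U ∈ 𝓝 x₀, IsGoodNbhd F G g₁ g₂ x₀ η₀ Ψ α₁ α₂ R σ U := by
  set Gt : C3 → ℂ := fun w => G (Ψ.symm w) with hGt
  have hGa : AnalyticAt ℂ Gt 0 := hc.phase_analyticAt hG
  have h0 : toC3 0 ∈ Ψ.target := by rw [toC3_zero]; exact hc.zero_mem_target
  obtain ⟨V, hV, hFV⟩ := hF
  have cs : ContinuousAt Ψ.symm 0 := (hc.analytic_symm _ hc.zero_mem_target).continuousAt
  have eV : ∀ᶠ w in 𝓝 (0 : C3), Ψ.symm w ∈ V := cs.eventually (by rw [hc.symm_zero]; exact hV)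
  obtain ⟨L, t, ht, hL⟩ := (hGa.fderiv.contDiffAt (n := 1)).exists_lipschitzOnWith
  have enear : ∀ᶠ w in 𝓝 (0 : C3), ‖fderiv ℂ Gt w - fderiv ℂ Gt 0‖ ≤ 1 / 4 := by
    have := hGa.fderiv.continuousAt.tendsto.eventually
      (Metric.closedBall_mem_nhds (fderiv ℂ Gt 0) (by norm_num : (0 : ℝ) < 1 / 4))
    filter_upwards [this] with w hw
    rwa [← dist_eq_norm]
  -- the orientation
  set d : R3 → ℝ := fun y => (fderiv ℝ (realMap Ψ.symm) y).det with hd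
  have hd0 : d 0 ≠ 0 := by
    have h1 := hc.det_mul_det hc.mem_source
    rw [hc.map_center, ← toC3_zero, hc.det_symm h0] at h1
    intro h
    simp only [hd] at h
    simp [h] at h1
  have cd : ContinuousAt d 0 := by
    have h1 := (contDiffAt_realMap (hc.analytic_symm _ h0) (n := 1)).fderiv_right (m := 0) (by norm_num)
    exact (ContinuousLinearMap.continuous_det).continuousAt.comp h1.continuousAt
  -- The orientation `σ` is the sign of the real Jacobian at the origin, which is nonzero and keeps
  -- its sign nearby.
  have eor : ∀ᶠ y in 𝓝 (0 : R3), 0 < Real.sign (d 0) * d y := by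
    refine (continuousAt_const.mul cd).eventually (lt_mem_nhds ?_)
    change 0 < Real.sign (d 0) * d 0
    rw [sign_mul_self_eq_abs]
    exact abs_pos.2 hd0
  obtain ⟨R₂, hR₂, hb₂⟩ := Metric.eventually_nhds_iff_ball.1
    ((Ψ.open_target.eventually_mem hc.zero_mem_target).and
      (hGa.eventually_analyticAt.and (eV.and (enear.and ht))))
  obtain ⟨R₃, hR₃, hb₃⟩ := Metric.eventually_nhds_iff_ball.1
    ((hc.eventually_phase_real hGreal).and eor)
  set R := min R₁ (min R₂ R₃) with hR
  have hRpos : 0 < R := by positivity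
  have hRR₂ : R ≤ R₂ := (min_le_right _ _).trans (min_le_left _ _)
  have hRR₃ : R ≤ R₃ := (min_le_right _ _).trans (min_le_right _ _)
  have m₂ : ∀ w ∈ Metric.ball (0 : C3) R, w ∈ Metric.ball (0 : C3) R₂ :=
    fun w hw => Metric.ball_subset_ball hRR₂ hw
  have m₃ : ∀ y : R3, ‖y‖ < R → y ∈ Metric.ball (0 : R3) R₃ := fun y hy => by
    rw [mem_ball_zero_iff]; linarith
  have m₂' : ∀ y : R3, ‖y‖ < R → toC3 y ∈ Metric.ball (0 : C3) R₂ := fun y hy => by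
    rw [mem_ball_zero_iff, norm_toC3]; linarith
  -- the real neighbourhood
  have hΨa := hc.analytic _ hc.mem_source
  obtain ⟨L', t', ht', hL'⟩ := (hΨa.fderiv.contDiffAt (n := 1)).exists_lipschitzOnWith
  obtain ⟨r, hr, hbr⟩ := Metric.eventually_nhds_iff_ball.1
    ((Ψ.open_source.eventually_mem hc.mem_source).and ht')
  have ct : ContinuousAt toC3 x₀ := continuous_toC3.continuousAt
  have e1 : ∀ᶠ x in 𝓝 x₀, toC3 x ∈ Metric.ball (toC3 x₀) r :=
    ct.eventually (Metric.ball_mem_nhds _ hr)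
  have e2 : ∀ᶠ x in 𝓝 x₀, ‖Ψ (toC3 x)‖ < R := by
    have h1 : ContinuousAt (fun x => ‖Ψ (toC3 x)‖) x₀ :=
      (ContinuousAt.comp (f := toC3) hΨa.continuousAt ct).norm
    refine h1.eventually (gt_mem_nhds ?_)
    change ‖Ψ (toC3 x₀)‖ < R
    rw [hc.map_center, norm_zero]
    exact hRpos
  have eside : ∀ g : C3 → ℂ, AnalyticAt ℂ g (toC3 x₀) → gradDot g x₀ (η₀ x₀) ≠ 0 →
      ∀ᶠ x in 𝓝 x₀, 0 < gradDot g x₀ (η₀ x₀) * gradDot g x (η₀ x) := by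
    intro g hg hne
    have h1 : ContinuousAt (fun x => fderiv ℂ g (toC3 x)) x₀ :=
      ContinuousAt.comp (f := toC3) hg.fderiv.continuousAt ct
    have h2 : ContinuousAt (fun x => gradDot g x (η₀ x)) x₀ :=
      Complex.continuous_re.continuousAt.comp
        (h1.clm_apply (continuous_toC3.comp hη₀).continuousAt)
    exact (continuousAt_const.mul h2).eventually (lt_mem_nhds (mul_self_pos.2 hne))
  have eU := e1.and (e2.and ((eside g₁ hg₁ hside₁).and (eside g₂ hg₂ hside₂)))
  refine ⟨R, min_le_left _ _, Real.sign (d 0), _, eU, ?_⟩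
  exact
    { pos := hRpos
      target := fun w hw => (hb₂ w (m₂ w hw)).1
      phase_analytic := fun w hw => (hb₂ w (m₂ w hw)).2.1
      phase_lipschitz := ⟨L, hL.mono fun w hw => (hb₂ w (m₂ w hw)).2.2.2.2⟩
      phase_real := fun y hy => (hb₃ y (m₃ y hy)).1
      phase_near := fun y hy => (hb₂ _ (m₂' y hy)).2.2.2.1
      amplitude := by
        intro w hw
        have hwt : w ∈ Ψ.target := (hb₂ w (m₂ w hw.1)).1
        exact AnalyticAt.fun_comp (hFV _ ⟨(hb₂ w (m₂ w hw.1)).2.2.1, hc.symm_mem_sides hwt hw.2⟩)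
          (hc.analytic_symm _ hwt)
      abs_sign := by
        rcases lt_or_gt_of_ne hd0 with h | h
        · simp [Real.sign_of_neg h]
        · simp [Real.sign_of_pos h]
      orient := fun y hy => (hb₃ y (m₃ y hy)).2
      source := fun x hx => (hbr _ hx.1).1
      maps := fun x hx => hx.2.1
      taylor := ⟨r, L', fun z hz => (hbr z hz).1, hL'.mono fun z hz => (hbr z hz).2,
        fun x hx => hx.1⟩
      side₁ := fun x hx => hx.2.2.1
      side₂ := fun x hx => hx.2.2.2 }

end IsNormalizedChart

/-- Along an allowed deformation the side on which a singularity is passed does not change. -/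
theorem side_of_deformation {g : C3 → ℂ} {D : Set R3} {h : ℝ → R3 → R3} {x : R3} {s : ℝ}
    (hc : ContinuousOn (Function.uncurry h) (Set.Icc (0 : ℝ) 1 ×ˢ closure D))
    (hx : x ∈ closure D) (hav : ∀ τ ∈ Set.Icc (0 : ℝ) 1, gradDot g x (h τ x) ≠ 0)
    (h0 : 0 < s * gradDot g x (h 0 x)) : 0 < s * gradDot g x (h 1 x) := by
  by_contra! hneg
  have c1 : ContinuousOn (fun τ => h τ x) (Set.Icc (0 : ℝ) 1) :=
    hc.comp (f := fun τ => (τ, x)) (by fun_prop) fun τ hτ => ⟨hτ, hx⟩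
  have c2 : ContinuousOn (fun τ => s * gradDot g x (h τ x)) (Set.Icc (0 : ℝ) 1) := by
    refine continuousOn_const.mul (Complex.continuous_re.comp_continuousOn ?_)
    -- A continuous scalar product that never vanishes along the deformation cannot change its sign.
    exact (fderiv ℂ g (toC3 x)).continuous.comp_continuousOn (continuous_toC3.comp_continuousOn c1)
  obtain ⟨τ, hτ, e⟩ := intermediate_value_Icc' zero_le_one c2 ⟨hneg, h0.le⟩
  rcases mul_eq_zero.1 e with h1 | h1
  · simp [h1] at h0
  · exact hav τ hτ h1

theorem det_eq_det3 (A : C3 →L[ℂ] C3) :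
    A.det = det3 (A (toC3 (Pi.single 0 1))) (A (toC3 (Pi.single 1 1))) (A (toC3 (Pi.single 2 1))) := by
  rw [det3_map]
  simp [det3]

theorem analyticAt_det_fderiv {Θ : C3 → C3} {w : C3} (h : AnalyticAt ℂ Θ w) :
    AnalyticAt ℂ (fun w => (fderiv ℂ Θ w).det) w := by
  have p : ∀ (v : C3) (i : Fin 3), AnalyticAt ℂ (fun w => fderiv ℂ Θ w v i) w := fun v i =>
    (ContinuousLinearMap.proj (R := ℂ) (φ := fun _ : Fin 3 => ℂ) i).analyticAt _ |>.fun_comp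
      (((ContinuousLinearMap.apply ℂ C3 v).analyticAt _).fun_comp h.fderiv)
  simp only [det_eq_det3, det3]
  exact (((p _ 0).mul (((p _ 1).mul (p _ 2)).sub ((p _ 1).mul (p _ 2)))).sub
    ((p _ 0).mul (((p _ 1).mul (p _ 2)).sub ((p _ 1).mul (p _ 2))))).add
    ((p _ 0).mul (((p _ 1).mul (p _ 2)).sub ((p _ 1).mul (p _ 2))))

/-- The amplitude in the coordinates `w`, including the Jacobian of the change of variables. -/
def pulledAmplitude (F : C3 → ℂ) (Ψ : OpenPartialHomeomorph C3 C3) (w : C3) : ℂ :=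
  F (Ψ.symm w) * (fderiv ℂ Ψ.symm w).det

variable {F G g₁ g₂ : C3 → ℂ} {x₀ : R3} {η₀ η : R3 → R3} {Ψ : OpenPartialHomeomorph C3 C3}
  {α₁ α₂ β R σ : ℝ} {U D K : Set R3}

namespace IsGoodNbhd

theorem toC3_mem_target (hN : IsGoodNbhd F G g₁ g₂ x₀ η₀ Ψ α₁ α₂ R σ U) {y : R3} (hy : ‖y‖ < R) :
    toC3 y ∈ Ψ.target := hN.target (by rwa [mem_ball_zero_iff, norm_toC3])

theorem norm_realMap_lt (hN : IsGoodNbhd F G g₁ g₂ x₀ η₀ Ψ α₁ α₂ R σ U)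
    (hc : IsNormalizedChart G g₁ g₂ x₀ Ψ α₁ α₂ β) {x : R3} (hx : x ∈ U) : ‖realMap Ψ x‖ < R := by
  rw [← norm_toC3, hc.toC3_realMap (hN.source x hx)]
  exact hN.maps x hx

/-- Describing the image as a preimage under the inverse map shows that it is open. -/
theorem image_eq (hN : IsGoodNbhd F G g₁ g₂ x₀ η₀ Ψ α₁ α₂ R σ U)
    (hc : IsNormalizedChart G g₁ g₂ x₀ Ψ α₁ α₂ β) (hDU : D ⊆ U) :
    realMap Ψ '' D = Metric.ball 0 R ∩ realMap Ψ.symm ⁻¹' D := by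
  ext y
  constructor
  · rintro ⟨x, hx, rfl⟩
    refine ⟨by simpa using hN.norm_realMap_lt hc (hDU hx), ?_⟩
    rw [Set.mem_preimage, hc.realMap_symm_realMap (hN.source x (hDU hx))]
    exact hx
  · rintro ⟨hy, hyD⟩
    exact ⟨_, hyD, hc.realMap_realMap_symm (hN.toC3_mem_target (by simpa using hy))⟩

theorem isOpen_image (hN : IsGoodNbhd F G g₁ g₂ x₀ η₀ Ψ α₁ α₂ R σ U)
    (hc : IsNormalizedChart G g₁ g₂ x₀ Ψ α₁ α₂ β) (hDU : D ⊆ U) (hD : IsOpen D) :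
    IsOpen (realMap Ψ '' D) := by
  rw [hN.image_eq hc hDU]
  refine ContinuousOn.isOpen_inter_preimage (fun y hy => ?_) Metric.isOpen_ball hD
  exact (contDiffAt_realMap (hc.analytic_symm _ (hN.toC3_mem_target (by simpa using hy)))
    (n := 0)).continuousAt.continuousWithinAt

/-- `U` lies in a ball on which the chart has a Lipschitz derivative, so `closure D` is bounded.
Compactness makes all later choices of `ε` uniform. -/
theorem isCompact_closure (hN : IsGoodNbhd F G g₁ g₂ x₀ η₀ Ψ α₁ α₂ R σ U) (hDU : closure D ⊆ U) :
    IsCompact (closure D) := by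
  obtain ⟨r, L, -, -, h⟩ := hN.taylor
  refine Metric.isCompact_of_isClosed_isBounded isClosed_closure
    ((Metric.isBounded_ball (x := x₀) (r := r)).subset fun x hx => ?_)
  have := h x (hDU hx)
  rwa [Metric.mem_ball, dist_eq_norm, ← toC3_sub, norm_toC3, ← dist_eq_norm] at this

/-- In the coordinates `w`, the displacement `v` of a deformed field lies on the same sides as
the initial field. -/
theorem side_image₁ (hN : IsGoodNbhd F G g₁ g₂ x₀ η₀ Ψ α₁ α₂ R σ U)
    (hc : IsNormalizedChart G g₁ g₂ x₀ Ψ α₁ α₂ β) (hDU : closure D ⊆ U)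
    (ha : AllowedDeformation g₁ g₂ D η₀ η) {x : R3} (hx : x ∈ closure D) (h0 : realMap Ψ x 0 = 0) :
    0 < α₁ * gradDot g₁ x₀ (η₀ x₀) * fderiv ℝ (realMap Ψ) x (η x) 0 := by
  obtain ⟨h, hcont, hh0, hh1, hav⟩ := ha
  have hxs := hN.source x (hDU hx)
  have hα : (α₁ : ℂ) ≠ 0 := Complex.ofReal_ne_zero.2 hc.alpha₁_ne
  have hg : g₁ (toC3 x) = 0 := by
    have e := congr_fun (hc.toC3_realMap hxs) 0
    rw [toC3_apply, h0, hc.coord₁ _ hxs] at e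
    exact (mul_eq_zero.1 e.symm).resolve_left hα
  have h2 := side_of_deformation (s := gradDot g₁ x₀ (η₀ x₀)) hcont hx
    (fun τ hτ => (hav τ hτ x hx).1 hg) (by rw [hh0 x hx]; exact hN.side₁ x (hDU hx))
  rw [hh1 x hx] at h2
  rw [← hc.gradDot_g₁ hxs]
  -- One factor `α₁` belongs to the reference side, the other to the component of the displacement.
  have := mul_pos (pow_pos (abs_pos.2 hc.alpha₁_ne) 2) h2
  rw [sq_abs] at this
  linarith

theorem side_image₂ (hN : IsGoodNbhd F G g₁ g₂ x₀ η₀ Ψ α₁ α₂ R σ U)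
    (hc : IsNormalizedChart G g₁ g₂ x₀ Ψ α₁ α₂ β) (hDU : closure D ⊆ U)
    (ha : AllowedDeformation g₁ g₂ D η₀ η) {x : R3} (hx : x ∈ closure D) (h0 : realMap Ψ x 1 = 0) :
    0 < α₂ * gradDot g₂ x₀ (η₀ x₀) * fderiv ℝ (realMap Ψ) x (η x) 1 := by
  obtain ⟨h, hcont, hh0, hh1, hav⟩ := ha
  have hxs := hN.source x (hDU hx)
  have hα : (α₂ : ℂ) ≠ 0 := Complex.ofReal_ne_zero.2 hc.alpha₂_ne
  have hg : g₂ (toC3 x) = 0 := by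
    have e := congr_fun (hc.toC3_realMap hxs) 1
    rw [toC3_apply, h0, hc.coord₂ _ hxs] at e
    exact (mul_eq_zero.1 e.symm).resolve_left hα
  have h2 := side_of_deformation (s := gradDot g₂ x₀ (η₀ x₀)) hcont hx
    (fun τ hτ => (hav τ hτ x hx).2 hg) (by rw [hh0 x hx]; exact hN.side₂ x (hDU hx))
  rw [hh1 x hx] at h2
  rw [← hc.gradDot_g₂ hxs]
  have := mul_pos (pow_pos (abs_pos.2 hc.alpha₂_ne) 2) h2
  rw [sq_abs] at this
  linarith

theorem gradDot_phase (hN : IsGoodNbhd F G g₁ g₂ x₀ η₀ Ψ α₁ α₂ R σ U)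
    (hc : IsNormalizedChart G g₁ g₂ x₀ Ψ α₁ α₂ β) {x : R3} (hx : x ∈ U) (v : R3) :
    gradDot G x v = gradDot (fun w => G (Ψ.symm w)) (realMap Ψ x) (fderiv ℝ (realMap Ψ) x v) :=
  hc.gradDot_eq (hN.source x hx)
    (hN.phase_analytic _ (by simpa using hN.maps x hx)).differentiableAt v

/-- Taylor expansion of the displaced points in the coordinates `w`. -/
theorem eventually_image_near (hN : IsGoodNbhd F G g₁ g₂ x₀ η₀ Ψ α₁ α₂ R σ U)
    (hc : IsNormalizedChart G g₁ g₂ x₀ Ψ α₁ α₂ β) (hDU : closure D ⊆ U) (hη : Continuous η) :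
    ∃ M ≥ 0, ∀ᶠ ε : ℝ in 𝓝[>] (0 : ℝ), ∀ x ∈ closure D, shifted η ε x ∈ Ψ.source ∧
      ‖Ψ (shifted η ε x) - (toC3 (realMap Ψ x) + (ε * Complex.I : ℂ) •
        toC3 (fderiv ℝ (realMap Ψ) x (η x)))‖ ≤ M * ε ^ 2 := by
  obtain ⟨r, L, hrs, hL, hrU⟩ := hN.taylor
  have hcomp := hN.isCompact_closure hDU
  obtain ⟨B, hB, hBE⟩ := exists_norm_le_of_continuousOn hcomp hη.continuousOn
  obtain ⟨c, hc0, hcE⟩ := exists_pos_le_of_pos hcomp (g := fun x => r - dist (toC3 x) (toC3 x₀))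
    (continuous_const.sub (continuous_toC3.dist continuous_const)).continuousOn
    fun x hx => sub_pos.2 (hrU x (hDU hx))
  have t1 : Tendsto (fun ε : ℝ => ε * B) (𝓝[>] 0) (𝓝 0) := by
    have : Continuous fun ε : ℝ => ε * B := by fun_prop
    simpa using (this.tendsto 0).mono_left (nhdsWithin_le_nhds (s := Set.Ioi 0))
  -- The displacement has length at most `ε B`, and the chart has a derivative with Lipschitz
  -- constant `L`.
  refine ⟨L * B ^ 2, by positivity, ?_⟩
  filter_upwards [t1.eventually (gt_mem_nhds hc0), self_mem_nhdsWithin] with ε e1 hε x hx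
  have hε : 0 < ε := hε
  have hxb := hrU x (hDU hx)
  have hn : ‖shifted η ε x - toC3 x‖ ≤ ε * B := by
    rw [shifted, add_sub_cancel_left, norm_smul, norm_toC3]
    simp only [norm_mul, Complex.norm_real, Complex.norm_I, mul_one, Real.norm_of_nonneg hε.le]
    exact mul_le_mul_of_nonneg_left (hBE x hx) hε.le
  have hsb : shifted η ε x ∈ Metric.ball (toC3 x₀) r := by
    rw [Metric.mem_ball]
    have h1 := dist_triangle (shifted η ε x) (toC3 x) (toC3 x₀)
    rw [dist_eq_norm (shifted η ε x) (toC3 x)] at h1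
    have h2 := hcE x hx
    linarith
  refine ⟨hrs hsb, ?_⟩
  have h := norm_taylor_le (convex_ball (toC3 x₀) r)
    (fun z hz => (hc.analytic z (hrs hz)).differentiableAt) hL hxb hsb
  have e : shifted η ε x - toC3 x = (ε * Complex.I : ℂ) • toC3 (η x) := by simp [shifted]
  rw [hc.toC3_realMap (hrs hxb), ← hc.toC3_fderiv (hrs hxb), ← map_smul, ← e, ← sub_sub]
  refine h.trans ?_
  calc (L : ℝ) * ‖shifted η ε x - toC3 x‖ ^ 2 ≤ L * (ε * B) ^ 2 := by gcongr
    _ = _ := by ring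

theorem analyticOnNhd_pulledAmplitude (hN : IsGoodNbhd F G g₁ g₂ x₀ η₀ Ψ α₁ α₂ R σ U)
    (hc : IsNormalizedChart G g₁ g₂ x₀ Ψ α₁ α₂ β) :
    AnalyticOnNhd ℂ (pulledAmplitude F Ψ) (Metric.ball 0 R ∩
      cutSpace (α₁ * gradDot g₁ x₀ (η₀ x₀)) (α₂ * gradDot g₂ x₀ (η₀ x₀))) := fun w hw =>
  (hN.amplitude w hw).mul (analyticAt_det_fderiv (hc.analytic_symm w (hN.target hw.1)))

/-- `F` and `G` are known to be regular in the coordinates `w`; applying the chart and its inverse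
transfers continuity to the displaced points. -/
theorem continuousOn_density (hN : IsGoodNbhd F G g₁ g₂ x₀ η₀ Ψ α₁ α₂ R σ U)
    (hη : ContDiff ℝ (⊤ : ℕ∞) η) {S : Set R3} {ε : ℝ}
    (hS : ∀ x ∈ S, shifted η ε x ∈ Ψ.source ∧ Ψ (shifted η ε x) ∈ Metric.ball 0 R ∩
      cutSpace (α₁ * gradDot g₁ x₀ (η₀ x₀)) (α₂ * gradDot g₂ x₀ (η₀ x₀))) (Λ : ℝ) :
    ContinuousOn (density F G η ε Λ) S := by
  have cη := hη.continuous
  have cs : Continuous (shifted η ε) := by unfold shifted; fun_prop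
  have cΨ : ContinuousOn (fun x => Ψ (shifted η ε x)) S :=
    Ψ.continuousOn.comp cs.continuousOn fun x hx => (hS x hx).1
  have cF : ContinuousOn (fun x => F (shifted η ε x)) S := by
    refine (hN.amplitude.continuousOn.comp cΨ fun x hx => (hS x hx).2).congr fun x hx => ?_
    simp [Ψ.left_inv (hS x hx).1]
  have cG : ContinuousOn (fun x => G (shifted η ε x)) S := by
    refine (hN.phase_analytic.continuousOn.comp cΨ fun x hx => (hS x hx).2.1).congr fun x hx => ?_
    simp [Ψ.left_inv (hS x hx).1]
  have cd : Continuous (fun x => fderiv ℝ η x) := hη.continuous_fderiv (by norm_num)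
  have cm : Continuous fun x => ((1 : Matrix (Fin 3) (Fin 3) ℂ) + (ε * Complex.I : ℂ) •
      (LinearMap.toMatrix' (fderiv ℝ η x).toLinearMap).map Complex.ofReal).det := by
    refine Continuous.matrix_det (continuous_matrix fun i j => ?_)
    simp only [Matrix.add_apply, Matrix.smul_apply, Matrix.map_apply, LinearMap.toMatrix'_apply]
    have ce : Continuous fun x => (fderiv ℝ η x (Pi.single j 1) i : ℂ) :=
      Complex.continuous_ofReal.comp
        ((continuous_apply i).comp (cd.clm_apply continuous_const))
    exact continuous_const.add (ce.const_smul (ε * Complex.I : ℂ))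
  exact (cF.mul (Complex.continuous_exp.comp_continuousOn (continuousOn_const.mul cG))).mul
    cm.continuousOn

/-- The local integral in the coordinates `w`. -/
theorem localIntegral_eq (hN : IsGoodNbhd F G g₁ g₂ x₀ η₀ Ψ α₁ α₂ R σ U)
    (hc : IsNormalizedChart G g₁ g₂ x₀ Ψ α₁ α₂ β) (hDU : D ⊆ U) (hD : IsOpen D)
    (hη : ContDiff ℝ (⊤ : ℕ∞) η) {ε : ℝ} (hs : ∀ x ∈ D, shifted η ε x ∈ Ψ.source) (Λ : ℝ) :
    let f : R3 → ℂ := fun y => pulledAmplitude F Ψ (Ψ (shifted η ε (realMap Ψ.symm y))) *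
      Complex.exp (Complex.I * Λ * G (Ψ.symm (Ψ (shifted η ε (realMap Ψ.symm y))))) *
      chainDet (fun y => Ψ (shifted η ε (realMap Ψ.symm y))) y
    (IntegrableOn (density F G η ε Λ) D → IntegrableOn f (realMap Ψ '' D)) ∧
    localIntegral F G η ε D Λ = σ * ∫ y in realMap Ψ '' D, f y := by
  intro f
  have hD' := hN.isOpen_image hc hDU hD
  have hXD : realMap Ψ.symm '' (realMap Ψ '' D) = D := by
    rw [← Set.image_comp]
    refine (Set.image_congr fun x hx => ?_).trans (Set.image_id D)
    exact hc.realMap_symm_realMap (hN.source x (hDU hx))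
  have hnorm : ∀ y ∈ realMap Ψ '' D, ‖y‖ < R := by
    rintro _ ⟨x, hx, rfl⟩
    exact hN.norm_realMap_lt hc (hDU hx)
  have hXd : ∀ y ∈ realMap Ψ '' D, DifferentiableAt ℝ (realMap Ψ.symm) y := fun y hy =>
    (contDiffAt_realMap (hc.analytic_symm _ (hN.toC3_mem_target (hnorm y hy)))
      (n := 1)).differentiableAt one_ne_zero
  have hXinj : Set.InjOn (realMap Ψ.symm) (realMap Ψ '' D) := by
    rintro _ ⟨x, hx, rfl⟩ _ ⟨z, hz, rfl⟩ e
    rw [hc.realMap_symm_realMap (hN.source x (hDU hx)),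
      hc.realMap_symm_realMap (hN.source z (hDU hz))] at e
    rw [e]
  have hσ : σ * σ = 1 := by rw [← abs_mul_abs_self, hN.abs_sign, one_mul]
  -- In the change of variables the Jacobian of the chart and that of its inverse, taken at the same
  -- complex point, cancel. What remains is the real Jacobian, whose absolute value is `σ` times
  -- itself.
  have key : ∀ y ∈ realMap Ψ '' D, |(fderiv ℝ (realMap Ψ.symm) y).det| •
      density F G η ε Λ (realMap Ψ.symm y) = σ * f y := by
    intro y hy
    have hxD : realMap Ψ.symm y ∈ D := by
      rw [← hXD]; exact Set.mem_image_of_mem _ hy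
    have hsrc := hs _ hxD
    have ho := hN.orient y (hnorm y hy)
    have habs : |(fderiv ℝ (realMap Ψ.symm) y).det| = σ * (fderiv ℝ (realMap Ψ.symm) y).det := by
      rw [← abs_of_pos ho, abs_mul, hN.abs_sign, one_mul]
    have hdd := hc.det_mul_det hsrc
    simp only [f, pulledAmplitude, density]
    rw [chainDet_image (hc.analytic _ hsrc).differentiableAt
      (hη.differentiable (by simp) _) (hXd y hy), Ψ.left_inv hsrc, habs]
    simp only [Complex.real_smul, Complex.ofReal_mul]
    linear_combination (-σ * F (shifted η ε (realMap Ψ.symm y)) *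
      Complex.exp (Complex.I * Λ * G (shifted η ε (realMap Ψ.symm y))) *
      ((1 : Matrix (Fin 3) (Fin 3) ℂ) + (ε * Complex.I : ℂ) •
      (LinearMap.toMatrix' (fderiv ℝ η (realMap Ψ.symm y)).toLinearMap).map Complex.ofReal).det *
      ((fderiv ℝ (realMap Ψ.symm) y).det : ℂ)) * hdd
  have hfd : ∀ y ∈ realMap Ψ '' D, HasFDerivWithinAt (realMap Ψ.symm)
      (fderiv ℝ (realMap Ψ.symm) y) (realMap Ψ '' D) y :=
    fun y hy => (hXd y hy).hasFDerivAt.hasFDerivWithinAt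
  constructor
  · intro hi
    rw [← hXD, integrableOn_image_iff_integrableOn_abs_det_fderiv_smul volume hD'.measurableSet
      hfd hXinj] at hi
    have h2 : IntegrableOn (fun y => (σ : ℂ) * f y) (realMap Ψ '' D) :=
      hi.congr_fun key hD'.measurableSet
    -- Since `σ² = 1`, multiplying by `σ` once more removes it.
    have h3 : IntegrableOn (fun y => (σ : ℂ) * (σ * f y)) (realMap Ψ '' D) := h2.const_mul _
    refine h3.congr_fun (fun y _ => ?_) hD'.measurableSet
    simp only
    rw [← mul_assoc, ← Complex.ofReal_mul, hσ, Complex.ofReal_one, one_mul]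
  · rw [localIntegral]
    conv_lhs => rw [← hXD]
    rw [integral_image_eq_integral_abs_det_fderiv_smul volume hD'.measurableSet hfd hXinj,
      setIntegral_congr_fun hD'.measurableSet key, integral_const_mul]

end IsGoodNbhd

/-! ### Deformation of a representative to a prescribed displacement -/

variable {F G g₁ g₂ : C3 → ℂ} {x₀ : R3} {η₀ η : R3 → R3} {Ψ : OpenPartialHomeomorph C3 C3}
  {α₁ α₂ β R σ : ℝ} {U D K : Set R3}

/-- Each representative of the contribution is an integral over a chain in the coordinates `w`
that is displaced along a given field near a given compact set. -/
theorem IsGoodNbhd.eventually_deform (hN : IsGoodNbhd F G g₁ g₂ x₀ η₀ Ψ α₁ α₂ R σ U)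
    (hc : IsNormalizedChart G g₁ g₂ x₀ Ψ α₁ α₂ β) (hD : IsLocalPiece x₀ U D) (hK : IsCompact K)
    (hKD : K ⊆ D) (hη : IsDeformedField G g₁ g₂ η₀ D K η) {θ : R3 → R3} (hθ : ContDiff ℝ 2 θ)
    {N Q : Set R3} (hNo : IsOpen N) (hQ : IsCompact Q) (hQD : Q ⊆ realMap Ψ '' D)
    (hθ₁ : ∀ y, y 0 = 0 → 0 < α₁ * gradDot g₁ x₀ (η₀ x₀) * θ y 0)
    (hθ₂ : ∀ y, y 1 = 0 → 0 < α₂ * gradDot g₂ x₀ (η₀ x₀) * θ y 1)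
    (hθd : ∀ y, ‖y‖ < R → y ∉ N → 0 < gradDot (fun w => G (Ψ.symm w)) y (θ y)) :
    ∀ᶠ ε : ℝ in 𝓝[>] (0 : ℝ), (∀ Λ : ℝ, IntegrableOn (density F G η ε Λ) D) ∧ ∃ Φ : R3 → C3,
      (∀ y ∈ realMap Ψ '' D, ContDiffAt ℝ 2 Φ y) ∧
      (∀ y ∈ realMap Ψ '' D, Φ y ∈ Metric.ball 0 R ∩
        cutSpace (α₁ * gradDot g₁ x₀ (η₀ x₀)) (α₂ * gradDot g₂ x₀ (η₀ x₀))) ∧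
      (∀ y ∈ Q, Φ y = toC3 y + (ε * Complex.I : ℂ) • toC3 (θ y)) ∧
      (∃ ζ > 0, ∀ y ∈ realMap Ψ '' D \ N, ζ ≤ (G (Ψ.symm (Φ y))).im) ∧
      ∀ Λ : ℝ, IntegrableOn (fun y => pulledAmplitude F Ψ (Φ y) *
          Complex.exp (Complex.I * Λ * G (Ψ.symm (Φ y))) * chainDet Φ y) (realMap Ψ '' D) ∧
        localIntegral F G η ε D Λ = σ * ∫ y in realMap Ψ '' D, pulledAmplitude F Ψ (Φ y) *
          Complex.exp (Complex.I * Λ * G (Ψ.symm (Φ y))) * chainDet Φ y := by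
  have hDU : D ⊆ U := subset_closure.trans hD.subset
  have hD' := hN.isOpen_image hc hDU hD.isOpen
  have hcomp := hN.isCompact_closure hD.subset
  have hsrcU := fun x hx => hN.source x (hD.subset hx)
  have cont : ContinuousOn (realMap Ψ) (closure D) := fun x hx =>
    (contDiffAt_realMap (hc.analytic _ (hsrcU x hx)) (n := 0)).continuousAt.continuousWithinAt
  have hE : IsCompact (realMap Ψ '' closure D) := hcomp.image_of_continuousOn cont
  have hKc : IsCompact (realMap Ψ '' K) :=
    hK.image_of_continuousOn (cont.mono (hKD.trans subset_closure))
  have hKD' : realMap Ψ '' K ⊆ realMap Ψ '' D := Set.image_mono hKD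
  -- The cutoff is `1` on the image of `K`, where the given field may fail to be desired, and on
  -- `Q`, where the new displacement has to be exactly `θ`. Its compact support keeps the chain
  -- fixed near the boundary of the piece.
  obtain ⟨χ, hχs, hχ, hχ1, S, hS, hSD, hχ0⟩ :=
    exists_cutoff hD' (hKc.union hQ) (Set.union_subset hKD' hQD)
  obtain ⟨L, hL⟩ := hN.phase_lipschitz
  have hEinv : ∀ y ∈ realMap Ψ '' closure D, ‖y‖ < R ∧ realMap Ψ.symm y ∈ closure D ∧
      realMap Ψ (realMap Ψ.symm y) = y := by
    rintro _ ⟨x, hx, rfl⟩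
    have e := hc.realMap_symm_realMap (hsrcU x hx)
    exact ⟨hN.norm_realMap_lt hc (hD.subset hx), by rwa [e], by rw [e]⟩
  -- The given field in the coordinates `w`. The image of the displaced chain follows it up to
  -- `O(ε²)`.
  set v : R3 → R3 := fun y => fderiv ℝ (realMap Ψ) (realMap Ψ.symm y) (η (realMap Ψ.symm y)) with hv
  have hXs : ∀ y ∈ realMap Ψ '' closure D, ContDiffAt ℝ 2 (realMap Ψ.symm) y := fun y hy =>
    contDiffAt_realMap (hc.analytic_symm _ (hN.toC3_mem_target (hEinv y hy).1))
  have cv : ContinuousOn v (realMap Ψ '' closure D) := fun y hy => by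
    have h1 := (contDiffAt_realMap (hc.analytic _ (hsrcU _ (hEinv y hy).2.1)) (n := 1)).fderiv_right
      (m := 0) (by norm_num)
    have h2 := (hXs y hy).continuousAt
    exact ((ContinuousAt.comp (f := realMap Ψ.symm) h1.continuousAt h2).clm_apply
      (hη.smooth.continuous.continuousAt.comp h2)).continuousWithinAt
  obtain ⟨M, hM, hnear⟩ := hN.eventually_image_near hc hD.subset hη.smooth.continuous
  set Φ : ℝ → R3 → C3 := fun ε y => Ψ (shifted η ε (realMap Ψ.symm y)) with hΦ
  have hpatch := eventually_patch (G := fun w => G (Ψ.symm w)) (K := realMap Ψ '' K) (N := N)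
    hN.phase_analytic hL hE hNo (fun y hy => (hEinv y hy).1)
    (fun y hy => hN.phase_real y (hEinv y hy).1) cv hθ.continuous.continuousOn
    (a₁ := α₁ * gradDot g₁ x₀ (η₀ x₀)) (a₂ := α₂ * gradDot g₂ x₀ (η₀ x₀))
    (fun y hy h0 => hN.side_image₁ hc hD.subset hη.allowed (hEinv y hy).2.1
      (by rw [(hEinv y hy).2.2]; exact h0))
    (fun y hy h0 => hN.side_image₂ hc hD.subset hη.allowed (hEinv y hy).2.1
      (by rw [(hEinv y hy).2.2]; exact h0))
    (fun y _ => hθ₁ y) (fun y _ => hθ₂ y)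
    (by
      rintro y ⟨hy, hyK⟩
      obtain ⟨-, hxD, e⟩ := hEinv y hy
      have h1 := hη.desired _ ⟨hxD, fun h => hyK ⟨_, h, e⟩⟩
      rwa [hN.gradDot_phase hc (hD.subset hxD), e] at h1)
    (fun y hy => hθd y (hEinv y hy.1).1 hy.2) hχs.continuous hχ
    (fun y hy => hχ1 y (Or.inl hy)) (Φ := Φ) hM
    (by
      filter_upwards [hnear] with ε h y hy
      obtain ⟨-, hxD, e⟩ := hEinv y hy
      have := (h _ hxD).2
      rwa [e] at this)
  filter_upwards [hnear, hpatch] with ε h1 h2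
  obtain ⟨hW, ζ, hζ, hζb⟩ := h2
  have hshift : ∀ x ∈ closure D, shifted η ε x ∈ Ψ.source ∧
      Ψ (shifted η ε x) ∈ Metric.ball 0 R ∩
        cutSpace (α₁ * gradDot g₁ x₀ (η₀ x₀)) (α₂ * gradDot g₂ x₀ (η₀ x₀)) := by
    intro x hx
    refine ⟨(h1 x hx).1, ?_⟩
    -- The initial stage of the homotopy is the original chain, so this chain avoids the cuts too,
    -- even over the closed piece.
    have := hW _ (Set.mem_image_of_mem _ hx) 0 (by simp)
    rw [zero_smul, add_zero] at this
    simpa only [hΦ, hc.realMap_symm_realMap (hsrcU x hx)] using this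
  have hdens : ∀ Λ : ℝ, IntegrableOn (density F G η ε Λ) D := fun Λ =>
    ((hN.continuousOn_density hη.smooth hshift Λ).integrableOn_compact hcomp).mono_set subset_closure
  have hsub : realMap Ψ '' D ⊆ realMap Ψ '' closure D := Set.image_mono subset_closure
  have hΦ2 : ∀ y ∈ realMap Ψ '' D, ContDiffAt ℝ 2 (Φ ε) y := by
    intro y hy
    have hy' := hsub hy
    have a1 := (hc.analytic _ (hshift _ (hEinv y hy').2.1).1).contDiffAt.restrict_scalars ℝ (n := 2)
    have a2 : ContDiffAt ℝ 2 (shifted η ε) (realMap Ψ.symm y) :=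
      contDiff_displaced (hη.smooth.contDiffAt.of_le (by norm_cast)) ε
    exact ContDiffAt.comp y a1 (a2.comp y (hXs y hy'))
  have hP2 : ∀ y ∈ realMap Ψ '' D, ContDiffAt ℝ 2 (patch χ θ ε (Φ ε)) y := fun y hy =>
    (hΦ2 y hy).add (hχs.contDiffAt.smul
      ((contDiff_displaced hθ.contDiffAt ε).sub (hΦ2 y hy)))
  refine ⟨hdens, patch χ θ ε (Φ ε), hP2, fun y hy => ?_, fun y hy => ?_,
    ⟨ζ, hζ, fun y hy => hζb y ⟨hsub hy.1, hy.2⟩⟩, fun Λ => ?_⟩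
  · have := hW y (hsub hy) 1 (by simp)
    rwa [one_smul, add_sub_cancel] at this
  · simp [patch, hχ1 y (Or.inr hy)]
  · obtain ⟨i1, i2⟩ := hN.localIntegral_eq hc hDU hD.isOpen hη.smooth
      (fun x hx => (hshift x (subset_closure hx)).1) Λ
    rw [i2]
    have hfan : AnalyticOnNhd ℂ (fun w => pulledAmplitude F Ψ w *
        Complex.exp (Complex.I * Λ * G (Ψ.symm w))) (Metric.ball 0 R ∩
        cutSpace (α₁ * gradDot g₁ x₀ (η₀ x₀)) (α₂ * gradDot g₂ x₀ (η₀ x₀))) := fun w hw =>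
      (hN.analyticOnNhd_pulledAmplitude hc w hw).mul
        ((analyticAt_const.mul (hN.phase_analytic w hw.1)).cexp)
    -- The homotopy stays where the amplitude is holomorphic and is constant off the support of the
    -- cutoff.
    obtain ⟨j1, j2⟩ := chainIntegral_eq_of_homotopy hD' hS hSD hfan hΦ2 hP2
      (fun y _ hyS => by simp [patch, hχ0 y hyS])
      (fun t ht y hy => hW y (hsub hy) t ht) (i1 (hdens Λ))
    exact ⟨j1, by rw [← j2]⟩

/-- If the displacement can be made desired everywhere, the integral decays exponentially. -/
theorem IsGoodNbhd.eventually_isBigO (hN : IsGoodNbhd F G g₁ g₂ x₀ η₀ Ψ α₁ α₂ R σ U)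
    (hc : IsNormalizedChart G g₁ g₂ x₀ Ψ α₁ α₂ β) (hD : IsLocalPiece x₀ U D) (hK : IsCompact K)
    (hKD : K ⊆ D) (hη : IsDeformedField G g₁ g₂ η₀ D K η) {θ : R3}
    (hθ₁ : 0 < α₁ * gradDot g₁ x₀ (η₀ x₀) * θ 0) (hθ₂ : 0 < α₂ * gradDot g₂ x₀ (η₀ x₀) * θ 1)
    (hθd : ∀ y, ‖y‖ < R → 0 < gradDot (fun w => G (Ψ.symm w)) y θ) :
    ∀ᶠ ε : ℝ in 𝓝[>] (0 : ℝ), (∀ Λ : ℝ, IntegrableOn (density F G η ε Λ) D) ∧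
      ∃ ζ > 0, (fun Λ : ℝ => localIntegral F G η ε D Λ) =O[atTop] fun Λ : ℝ => Real.exp (-ζ * Λ) := by
  have hD' := hN.isOpen_image hc (subset_closure.trans hD.subset) hD.isOpen
  -- A field that is desired everywhere needs no exceptional set `N`, and no place `Q` has to be
  -- prescribed.
  filter_upwards [hN.eventually_deform hc hD hK hKD hη (θ := fun _ => θ) contDiff_const
    (N := ∅) (Q := ∅) isOpen_empty isCompact_empty (Set.empty_subset _) (fun _ _ => hθ₁)
    (fun _ _ => hθ₂) fun y hy _ => hθd y hy] with ε h
  obtain ⟨h1, Φ, -, -, -, ⟨ζ, hζ, hζb⟩, hI⟩ := h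
  refine ⟨h1, ζ, hζ, ?_⟩
  refine IsBigO.of_bound (|σ| * ∫ y in realMap Ψ '' D, ‖pulledAmplitude F Ψ (Φ y) * chainDet Φ y‖) ?_
  filter_upwards [eventually_ge_atTop 0] with Λ hΛ
  rw [(hI Λ).2, norm_mul, Complex.norm_real, Real.norm_eq_abs, mul_assoc,
    Real.norm_of_nonneg (Real.exp_pos _).le, ← integral_mul_const]
  refine mul_le_mul_of_nonneg_left ?_ (abs_nonneg σ)
  have hi0 : Integrable (fun y => ‖pulledAmplitude F Ψ (Φ y) * chainDet Φ y‖)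
      (volume.restrict (realMap Ψ '' D)) := by
    -- At `Λ = 0` the integrand is the amplitude times the Jacobian; its absolute integral gives the
    -- constant.
    have := (hI 0).1.norm
    simpa using this
  refine norm_integral_le_of_norm_le (hi0.mul_const _) ?_
  refine (ae_restrict_iff' hD'.measurableSet).2 (Eventually.of_forall fun y hy => ?_)
  rw [norm_mul, norm_mul, norm_mul, norm_exp_I_mul]
  have hz := hζb y ⟨hy, by simp⟩
  have : Real.exp (-(Λ * (G (Ψ.symm (Φ y))).im)) ≤ Real.exp (-ζ * Λ) := by
    rw [Real.exp_le_exp]; nlinarith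
  calc _ ≤ ‖pulledAmplitude F Ψ (Φ y)‖ * Real.exp (-ζ * Λ) * ‖chainDet Φ y‖ := by gcongr
    _ = _ := by ring


/-! ### Construction of desired fields -/

variable {F G g₁ g₂ : C3 → ℂ} {x₀ : R3} {η₀ η : R3 → R3} {Ψ : OpenPartialHomeomorph C3 C3}
  {α₁ α₂ β R σ : ℝ} {U D K : Set R3}

theorem fderiv_normal_form_zero {G : C3 → ℂ} {G₀ : ℂ} (hG : AnalyticAt ℂ G 0)
    (hnf : remainder G G₀ β =O[𝓝 0] fun w => ‖w‖ * (‖w 0‖ + ‖w 1‖) + ‖w 2‖ ^ 3) (v : C3) :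
    fderiv ℂ G 0 v = v 0 + v 1 := by
  obtain ⟨A, -, r, hr, h⟩ := exists_fderiv_remainder_le hG hnf
  have h1 := (h 0 (by simpa using hr)).2 v
  have h2 : fderiv ℂ (remainder G G₀ β) 0 v = 0 := by simpa using h1
  have h3 : HasFDerivAt (remainder G G₀ β) _ 0 :=
    hG.differentiableAt.hasFDerivAt.sub (hasFDerivAt_quadratic G₀ β 0)
  rw [h3.fderiv] at h2
  rw [← sub_eq_zero]
  simpa using h2

theorem IsNormalizedChart.fderiv_realMap_symm (hc : IsNormalizedChart G g₁ g₂ x₀ Ψ α₁ α₂ β) {x : R3}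
    (hx : toC3 x ∈ Ψ.source) (h : R3) :
    fderiv ℝ (realMap Ψ) x (fderiv ℝ (realMap Ψ.symm) (realMap Ψ x) h) = h := by
  have hy : toC3 (realMap Ψ x) ∈ Ψ.target := by
    rw [hc.toC3_realMap hx]; exact Ψ.map_source hx
  have e := hc.realMap_symm_realMap hx
  have h1 := ((contDiffAt_realMap (hc.analytic _ hx) (n := 1)).differentiableAt
    one_ne_zero).hasFDerivAt
  have h2 := ((contDiffAt_realMap (hc.analytic_symm _ hy) (n := 1)).differentiableAt
    one_ne_zero).hasFDerivAt
  rw [← e] at h1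
  have h3 := (h1.comp _ h2).unique ((hasFDerivAt_id _).congr_of_eventuallyEq (by
    filter_upwards [(Ψ.open_target.preimage continuous_toC3).mem_nhds hy] with z hz
      using hc.realMap_realMap_symm hz))
  rw [e] at h3
  exact DFunLike.congr_fun h3 h

/-- The segment between two displacement fields on the same sides is an allowed deformation. -/
theorem allowed_of_sides {S : Set R3} (hDS : closure D ⊆ S) (hη₀ : ContinuousOn η₀ S)
    (hη : ContinuousOn η S)
    (h₁ : ∀ x ∈ S, g₁ (toC3 x) = 0 → ∃ s : ℝ, 0 < s * gradDot g₁ x (η₀ x) ∧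
      0 < s * gradDot g₁ x (η x))
    (h₂ : ∀ x ∈ S, g₂ (toC3 x) = 0 → ∃ s : ℝ, 0 < s * gradDot g₂ x (η₀ x) ∧
      0 < s * gradDot g₂ x (η x)) : AllowedDeformation g₁ g₂ D η₀ η := by
  have key : ∀ (g : C3 → ℂ) (x : R3) (τ : ℝ), τ ∈ Set.Icc (0 : ℝ) 1 →
      (∃ s : ℝ, 0 < s * gradDot g x (η₀ x) ∧ 0 < s * gradDot g x (η x)) →
      gradDot g x ((1 - τ) • η₀ x + τ • η x) ≠ 0 := by
    rintro g x τ hτ ⟨s, h0, h1⟩ h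
    rw [gradDot_add, gradDot_smul, gradDot_smul] at h
    have e : (1 - τ) * (s * gradDot g x (η₀ x)) + τ * (s * gradDot g x (η x)) = 0 := by
      linear_combination s * h
    rcases eq_or_lt_of_le hτ.1 with h2 | h2
    · rw [← h2] at e; linarith
    · have := mul_pos h2 h1
      have := mul_nonneg (sub_nonneg.2 hτ.2) h0.le
      linarith
  refine ⟨fun τ x => (1 - τ) • η₀ x + τ • η x, ?_, fun x _ => by simp, fun x _ => by simp,
    fun τ hτ x hx => ⟨fun h => key g₁ x τ hτ (h₁ x (hDS hx) h),
      fun h => key g₂ x τ hτ (h₂ x (hDS hx) h)⟩⟩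
  have c0 : ContinuousOn (fun p : ℝ × R3 => η₀ p.2) (Set.Icc (0 : ℝ) 1 ×ˢ closure D) :=
    (hη₀.mono hDS).comp continuousOn_snd fun p hp => hp.2
  have c1 : ContinuousOn (fun p : ℝ × R3 => η p.2) (Set.Icc (0 : ℝ) 1 ×ˢ closure D) :=
    (hη.mono hDS).comp continuousOn_snd fun p hp => hp.2
  exact ((continuousOn_const.sub continuousOn_fst).smul c0).add (continuousOn_fst.smul c1)

/-- Displacement fields prescribed in the coordinates `w`. -/
theorem IsGoodNbhd.exists_localPiece (hN : IsGoodNbhd F G g₁ g₂ x₀ η₀ Ψ α₁ α₂ R σ U)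
    (hc : IsNormalizedChart G g₁ g₂ x₀ Ψ α₁ α₂ β) (hU : U ∈ 𝓝 x₀) (hη₀ : Continuous η₀) :
    ∃ D, IsLocalPiece x₀ U D ∧ ∀ θ : R3 → R3, ContDiff ℝ (⊤ : ℕ∞) θ →
      (∀ y, y 0 = 0 → 0 < α₁ * gradDot g₁ x₀ (η₀ x₀) * θ y 0) →
      (∀ y, y 1 = 0 → 0 < α₂ * gradDot g₂ x₀ (η₀ x₀) * θ y 1) → ∀ N : Set R3,
      (∀ y, ‖y‖ < R → y ∉ N → 0 < gradDot (fun w => G (Ψ.symm w)) y (θ y)) →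
      ∃ η, IsDeformedField G g₁ g₂ η₀ D (realMap Ψ ⁻¹' N) η := by
  obtain ⟨d, hd, hdU⟩ := Metric.mem_nhds_iff.1 hU
  let bump : ContDiffBump x₀ := ⟨d / 3, d / 2, by positivity, by linarith⟩
  have hcl : closure (Metric.ball x₀ (d / 3)) ⊆ Metric.closedBall x₀ (d / 3) :=
    Metric.closure_ball_subset_closedBall
  have hbU : Metric.closedBall x₀ (d / 3) ⊆ U :=
    (Metric.closedBall_subset_ball (by linarith)).trans hdU
  refine ⟨Metric.ball x₀ (d / 3), ⟨Metric.isOpen_ball, Metric.mem_ball_self (by positivity),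
    hcl.trans hbU⟩, fun θ hθ hθ₁ hθ₂ N hθN => ?_⟩
  -- The field whose push-forward under the chart is `θ`. Multiplied by a bump function that equals
  -- `1` over the closed piece, it becomes smooth on all of `ℝ³`.
  set ω : R3 → R3 := fun x => fderiv ℝ (realMap Ψ.symm) (realMap Ψ x) (θ (realMap Ψ x)) with hω
  set η : R3 → R3 := fun x => bump x • ω x with hη
  have hηω : ∀ x ∈ Metric.closedBall x₀ (d / 3), η x = ω x := fun x hx => by
    have : bump x = 1 := bump.one_of_mem_closedBall hx
    simp [hη, this]
  have hfd : ∀ x ∈ Metric.closedBall x₀ (d / 3),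
      fderiv ℝ (realMap Ψ) x (η x) = θ (realMap Ψ x) := fun x hx => by
    rw [hηω x hx, hω]
    exact hc.fderiv_realMap_symm (hN.source x (hbU hx)) _
  have hsmooth : ContDiff ℝ (⊤ : ℕ∞) η := by
    refine contDiff_iff_contDiffAt.2 fun x => ?_
    by_cases hx : x ∈ Metric.ball x₀ d
    · have hxU := hdU hx
      have hxs := hN.source x hxU
      have hy : toC3 (realMap Ψ x) ∈ Ψ.target := by
        rw [hc.toC3_realMap hxs]; exact Ψ.map_source hxs
      have a1 : ContDiffAt ℝ (⊤ : ℕ∞) (realMap Ψ) x := contDiffAt_realMap (hc.analytic _ hxs)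
      have a2 : ContDiffAt ℝ (⊤ : ℕ∞) (fderiv ℝ (realMap Ψ.symm)) (realMap Ψ x) :=
        (contDiffAt_realMap (hc.analytic_symm _ hy) (n := (⊤ : ℕ∞))).fderiv_right (by norm_cast)
      exact bump.contDiff.contDiffAt.smul ((a2.comp x a1).clm_apply (hθ.contDiffAt.comp x a1))
    · have hmem : (Metric.closedBall x₀ (d / 2))ᶜ ∈ 𝓝 x :=
        Metric.isClosed_closedBall.isOpen_compl.mem_nhds fun h =>
          hx (Metric.closedBall_subset_ball (by linarith) h)
      refine (contDiffAt_const (c := (0 : R3))).congr_of_eventuallyEq ?_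
      filter_upwards [hmem] with z hz
      have : bump z = 0 := bump.zero_of_le_dist (by
        simp only [Set.mem_compl_iff, Metric.mem_closedBall, not_le] at hz
        exact hz.le)
      simp [hη, this]
  refine ⟨η, hsmooth, ?_, fun x hx => ?_⟩
  · refine allowed_of_sides hcl hη₀.continuousOn hsmooth.continuous.continuousOn
      (fun x hx hg => ⟨_, hN.side₁ x (hbU hx), ?_⟩) (fun x hx hg => ⟨_, hN.side₂ x (hbU hx), ?_⟩)
    · have hxs := hN.source x (hbU hx)
      have h0 : realMap Ψ x 0 = 0 := by
        have e := congr_fun (hc.toC3_realMap hxs) 0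
        rw [toC3_apply, hc.coord₁ _ hxs, hg, mul_zero] at e
        exact_mod_cast e
      have h1 := hθ₁ _ h0
      rw [← hfd x hx, ← hc.gradDot_g₁ hxs] at h1
      -- The side of `η` is that of `θ`, because the push-forward of `η` is `θ`; the square of `α₁`
      -- does not affect the sign.
      have h2 : 0 < α₁ ^ 2 * (gradDot g₁ x₀ (η₀ x₀) * gradDot g₁ x (η x)) := by linarith
      exact pos_of_mul_pos_right h2 (sq_nonneg _)
    · have hxs := hN.source x (hbU hx)
      have h0 : realMap Ψ x 1 = 0 := by
        have e := congr_fun (hc.toC3_realMap hxs) 1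
        rw [toC3_apply, hc.coord₂ _ hxs, hg, mul_zero] at e
        exact_mod_cast e
      have h1 := hθ₂ _ h0
      rw [← hfd x hx, ← hc.gradDot_g₂ hxs] at h1
      have h2 : 0 < α₂ ^ 2 * (gradDot g₂ x₀ (η₀ x₀) * gradDot g₂ x (η x)) := by linarith
      exact pos_of_mul_pos_right h2 (sq_nonneg _)
  · have hxb := hcl hx.1
    have hxU := hbU hxb
    rw [hN.gradDot_phase hc hxU, hfd x hxb]
    exact hθN _ (hN.norm_realMap_lt hc hxU) hx.2

theorem gradDot_zero_of_normal_form (hc : IsNormalizedChart G g₁ g₂ x₀ Ψ α₁ α₂ β)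
    (hG : AnalyticAt ℂ G (toC3 x₀)) (v : R3) :
    gradDot (fun w => G (Ψ.symm w)) 0 v = v 0 + v 1 := by
  unfold gradDot
  rw [toC3_zero, fderiv_normal_form_zero (hc.phase_analyticAt hG) hc.normal_form]
  simp

/-- At the origin the differential of the phase gives `θ 0 + θ 1 ≥ 1`. Within the good neighbourhood
it varies by at most `1 / 4`, which changes the value by at most `2 / 4`. -/
theorem IsGoodNbhd.gradDot_const_pos (hN : IsGoodNbhd F G g₁ g₂ x₀ η₀ Ψ α₁ α₂ R σ U)
    (hc : IsNormalizedChart G g₁ g₂ x₀ Ψ α₁ α₂ β) (hG : AnalyticAt ℂ G (toC3 x₀)) {θ : R3}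
    (hθ : ‖θ‖ ≤ 2) (hθp : 1 ≤ θ 0 + θ 1) {y : R3} (hy : ‖y‖ < R) :
    0 < gradDot (fun w => G (Ψ.symm w)) y θ := by
  set Gt : C3 → ℂ := fun w => G (Ψ.symm w)
  have h0 := gradDot_zero_of_normal_form hc hG θ
  have h1 : |gradDot Gt y θ - gradDot Gt 0 θ| ≤ 1 / 4 * 2 := by
    unfold gradDot
    rw [← Complex.sub_re, toC3_zero, ← sub_apply]
    refine (Complex.abs_re_le_norm _).trans ?_
    refine (ContinuousLinearMap.le_of_opNorm_le _ (hN.phase_near y hy) _).trans ?_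
    rw [norm_toC3]
    gcongr
  have := (abs_le.1 h1).1
  linarith

/-- If one of the singularities is bypassed above, there is a constant direction that is desired
and lies on the prescribed sides. -/
theorem IsGoodNbhd.exists_desired_direction (hN : IsGoodNbhd F G g₁ g₂ x₀ η₀ Ψ α₁ α₂ R σ U)
    (hc : IsNormalizedChart G g₁ g₂ x₀ Ψ α₁ α₂ β) (hG : AnalyticAt ℂ G (toC3 x₀))
    (hside₁ : gradDot g₁ x₀ (η₀ x₀) ≠ 0) (hside₂ : gradDot g₂ x₀ (η₀ x₀) ≠ 0)
    (h : BypassesAbove α₁ g₁ x₀ η₀ ∨ BypassesAbove α₂ g₂ x₀ η₀) :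
    ∃ θ : R3, 0 < α₁ * gradDot g₁ x₀ (η₀ x₀) * θ 0 ∧ 0 < α₂ * gradDot g₂ x₀ (η₀ x₀) * θ 1 ∧
      ∀ y, ‖y‖ < R → 0 < gradDot (fun w => G (Ψ.symm w)) y θ := by
  have hs : ∀ a : ℝ, a ≠ 0 → 0 < a * Real.sign a := fun a ha => by
    rw [mul_comm, sign_mul_self_eq_abs]; exact abs_pos.2 ha
  have hb : ∀ p q : ℝ, |p| ≤ 2 → |q| ≤ 2 → ‖(![p, q, 0] : R3)‖ ≤ 2 := fun p q hp hq => by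
    rw [pi_norm_le_iff_of_nonneg (by norm_num)]
    intro i
    fin_cases i <;> simp [hp, hq]
  have h2 : |(2 : ℝ)| ≤ 2 := by norm_num
  rcases h with h | h
  · set t := Real.sign (α₂ * gradDot g₂ x₀ (η₀ x₀))
    have ht : |t| ≤ 1 := abs_sign_le_one _
    -- The component along the singularity bypassed above is `2`, the other one is `1` in absolute
    -- value with the sign of its side, so the sum is at least `1`.
    refine ⟨![2, t, 0], ?_, ?_, fun y hy => hN.gradDot_const_pos hc hG (hb _ _ h2 (by linarith)) ?_ hy⟩
    · exact mul_pos h (by norm_num)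
    · exact hs _ (mul_ne_zero hc.alpha₂_ne hside₂)
    · have := (abs_le.1 ht).1
      simp
      linarith
  · set t := Real.sign (α₁ * gradDot g₁ x₀ (η₀ x₀))
    have ht : |t| ≤ 1 := abs_sign_le_one _
    refine ⟨![t, 2, 0], ?_, ?_, fun y hy => hN.gradDot_const_pos hc hG (hb _ _ (by linarith) h2) ?_ hy⟩
    · exact hs _ (mul_ne_zero hc.alpha₁_ne hside₁)
    · exact mul_pos h (by norm_num)
    · have := (abs_le.1 ht).1
      simp
      linarith


/-! ### Both singularities bypassed below -/

variable {F G g₁ g₂ : C3 → ℂ} {x₀ : R3} {η₀ η : R3 → R3} {Ψ : OpenPartialHomeomorph C3 C3}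
  {α₁ α₂ β R σ : ℝ} {U D K : Set R3} {μ₁ μ₂ : ℂ} {C : ℂ → ℂ}

theorem neg_of_mul_pos_of_neg {a x : ℝ} (ha : a < 0) (h : 0 < a * x) : x < 0 := by
  by_contra! hx
  exact absurd h (not_lt.2 (mul_nonpos_of_nonpos_of_nonneg ha.le hx))

/-- Only the signs of the parameters matter, so the cuts become those of the branch `powBelow`. -/
theorem cutSpace_eq_lowerSpace {a₁ a₂ : ℝ} (h₁ : a₁ < 0) (h₂ : a₂ < 0) :
    cutSpace a₁ a₂ = lowerSpace := by
  have h : ∀ a x : ℝ, a < 0 → (0 < a * x ↔ 0 < -1 * x) := fun a x ha => by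
    refine ⟨fun h => ?_, fun h => mul_pos_of_neg_of_neg ha (by linarith)⟩
    linarith [neg_of_mul_pos_of_neg ha h]
  ext w
  simp only [cutSpace, Set.mem_ofPred_eq, h a₁ _ h₁, h a₂ _ h₂]

theorem mul_dip_pos {a δ : ℝ} (ha : a < 0) (hδ : 0 < δ) {t : ℝ} (ht : t = 0) : 0 < a * dip δ t := by
  have h := dip_le_of_abs_le hδ.le (t := t) (by rw [ht, abs_zero]; exact hδ.le)
  exact mul_pos_of_neg_of_neg ha (by linarith)

/-- If both singularities are bypassed below, no allowed deformation is desired at the crossing. -/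
theorem IsGoodNbhd.center_mem (hN : IsGoodNbhd F G g₁ g₂ x₀ η₀ Ψ α₁ α₂ R σ U)
    (hc : IsNormalizedChart G g₁ g₂ x₀ Ψ α₁ α₂ β) (hG : AnalyticAt ℂ G (toC3 x₀))
    (hb₁ : BypassesBelow α₁ g₁ x₀ η₀) (hb₂ : BypassesBelow α₂ g₂ x₀ η₀)
    (hD : IsLocalPiece x₀ U D) (hη : IsDeformedField G g₁ g₂ η₀ D K η) : x₀ ∈ K := by
  by_contra hK
  have hx := subset_closure hD.mem
  have h := hη.desired x₀ ⟨hx, hK⟩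
  have e := hc.realMap_center
  rw [hN.gradDot_phase hc (hD.subset hx), e, gradDot_zero_of_normal_form hc hG] at h
  -- Both components are negative at the crossing, whereas desiredness asks for a positive sum.
  have h1 := hN.side_image₁ hc hD.subset hη.allowed hx (by rw [e]; rfl)
  have h2 := hN.side_image₂ hc hD.subset hη.allowed hx (by rw [e]; rfl)
  linarith [neg_of_mul_pos_of_neg hb₁ h1, neg_of_mul_pos_of_neg hb₂ h2]

/-- If both singularities are bypassed below, there are deformations that are desired off
arbitrarily small neighbourhoods of the crossing. -/
theorem IsGoodNbhd.exists_deformed_below (hN : IsGoodNbhd F G g₁ g₂ x₀ η₀ Ψ α₁ α₂ R σ U)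
    (hc : IsNormalizedChart G g₁ g₂ x₀ Ψ α₁ α₂ β) (hU : U ∈ 𝓝 x₀) (hη₀ : Continuous η₀)
    (hb₁ : BypassesBelow α₁ g₁ x₀ η₀) (hb₂ : BypassesBelow α₂ g₂ x₀ η₀) {r₀ : ℝ} (hR : R ≤ r₀)
    (hphase : ∀ y v : R3, ∀ d : ℝ, 0 ≤ d → d ≤ r₀ → ‖y‖ ≤ r₀ → IsLift β d y v →
      (|y 0| + |y 1|) / 2 + |β| / 2 * y 2 ^ 2 - 6 * d ≤ gradDot (fun w => G (Ψ.symm w)) y v) :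
    ∃ D, IsLocalPiece x₀ U D ∧ ∀ N ∈ 𝓝 x₀, ∃ η, IsDeformedField G g₁ g₂ η₀ D N η := by
  obtain ⟨D, hD, h⟩ := hN.exists_localPiece hc hU hη₀
  refine ⟨D, hD, fun N hNx => ?_⟩
  have hβ := abs_pos.2 hc.beta_ne
  have h0 : toC3 0 ∈ Ψ.target := by rw [toC3_zero]; exact hc.zero_mem_target
  have hcont : ContinuousAt (realMap Ψ.symm) 0 :=
    (contDiffAt_realMap (hc.analytic_symm _ h0) (n := 0)).continuousAt
  have hpre : ∀ᶠ y in 𝓝 (0 : R3), realMap Ψ.symm y ∈ N :=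
    hcont.eventually (by rw [hc.realMap_symm_zero]; exact hNx)
  obtain ⟨ρ, hρ, hb⟩ := Metric.eventually_nhds_iff_ball.1 hpre
  -- The denominators come from the conditions `12 δ ≤ ρ / 4` and `12 δ ≤ |β| ρ² / 8` of
  -- `phase_lower_of_large`.
  set δ := min r₀ (min (ρ / 48) (|β| / 96 * ρ ^ 2)) with hδ
  have hr₀ := hN.pos.trans_le hR
  have hδpos : 0 < δ := by positivity
  have hδ1 : δ ≤ ρ / 48 := (min_le_right _ _).trans (min_le_left _ _)
  have hδ2 : δ ≤ |β| / 96 * ρ ^ 2 := (min_le_right _ _).trans (min_le_right _ _)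
  obtain ⟨η, hη⟩ := h (dipField β δ) (contDiff_dipField β hδpos)
    (fun y hy => mul_dip_pos hb₁ hδpos hy) (fun y hy => mul_dip_pos hb₂ hδpos hy)
    (Metric.ball 0 (ρ / 2)) fun y hyR hy => by
      have h1 := hphase y _ δ hδpos.le (min_le_left _ _) (hyR.le.trans hR)
        (isLift_dipField β hδpos.le y)
      have h2 := phase_lower_of_large (β := β) (δ₀ := δ) (by simpa using hy) (by linarith)
        (by linarith) hρ
      linarith
  refine ⟨η, hη.smooth, hη.allowed, fun x hx => hη.desired x ⟨hx.1, fun hxρ => hx.2 ?_⟩⟩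
  have := hb _ (Metric.ball_subset_ball (by linarith : ρ / 2 ≤ ρ) hxρ)
  rwa [hc.realMap_symm_realMap (hN.source x (hD.subset hx.1))] at this

/-- The leading term of the amplitude in the coordinates `w`. -/
theorem tendsto_amplitude (hc : IsNormalizedChart G g₁ g₂ x₀ Ψ α₁ α₂ β)
    (hb₁ : BypassesBelow α₁ g₁ x₀ η₀) (hb₂ : BypassesBelow α₂ g₂ x₀ η₀)
    (hC : AnalyticAt ℂ C 0) (hC0 : C 0 ≠ 0)
    (hF : F ~[𝓝[sideDomain g₁ (gradDot g₁ x₀ (η₀ x₀)) ∩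
        sideDomain g₂ (gradDot g₂ x₀ (η₀ x₀))] (toC3 x₀)]
      fun ξ => C (Ψ ξ 2) * powBelow (Ψ ξ 0) μ₁ * powBelow (Ψ ξ 1) μ₂) :
    Tendsto (fun w => F (Ψ.symm w) / modelPow μ₁ μ₂ w) (𝓝[lowerSpace] 0) (𝓝 (C 0)) := by
  have ht : ∀ᶠ w in 𝓝[lowerSpace] (0 : C3), w ∈ Ψ.target :=
    nhdsWithin_le_nhds (Ψ.open_target.mem_nhds hc.zero_mem_target)
  have hcs : Tendsto Ψ.symm (𝓝[lowerSpace] 0) (𝓝[sideDomain g₁ (gradDot g₁ x₀ (η₀ x₀)) ∩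
      sideDomain g₂ (gradDot g₂ x₀ (η₀ x₀))] (toC3 x₀)) := by
    refine tendsto_nhdsWithin_iff.2 ⟨?_, ?_⟩
    · have := (hc.analytic_symm _ hc.zero_mem_target).continuousAt.tendsto
      rw [hc.symm_zero] at this
      exact this.mono_left nhdsWithin_le_nhds
    · filter_upwards [ht, self_mem_nhdsWithin] with w hwt hw
      exact hc.symm_mem_sides hwt (by rwa [cutSpace_eq_lowerSpace hb₁ hb₂])
  have hp : Tendsto (fun w : C3 => C (w 2)) (𝓝[lowerSpace] 0) (𝓝 (C 0)) := by
    have h1 : Tendsto (fun w : C3 => w 2) (𝓝 0) (𝓝 0) := (continuous_apply 2).tendsto 0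
    exact (hC.continuousAt.tendsto.comp h1).mono_left nhdsWithin_le_nhds
  have h1 := hF.comp_tendsto hcs
  have h2 : (fun w => F (Ψ.symm w)) ~[𝓝[lowerSpace] (0 : C3)]
      fun w => C (w 2) * modelPow μ₁ μ₂ w := by
    refine h1.congr_right ?_
    filter_upwards [ht] with w hw
    simp [Ψ.right_inv hw, modelPow, mul_assoc]
  have hne : ∀ᶠ w in 𝓝[lowerSpace] (0 : C3), C (w 2) * modelPow μ₁ μ₂ w ≠ 0 := by
    filter_upwards [hp.eventually_ne hC0] with w hw using mul_ne_zero hw (modelPow_ne_zero _ _ _)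
  have h3 := ((isEquivalent_iff_tendsto_one hne).1 h2).mul hp
  rw [one_mul] at h3
  refine h3.congr' ?_
  filter_upwards [hp.eventually_ne hC0] with w hw
  have := modelPow_ne_zero μ₁ μ₂ w
  simp only [Pi.div_apply]
  field_simp

theorem exp_I_mul_sub (Λ a b : ℂ) : Complex.exp (Complex.I * Λ * (a - b)) =
    Complex.exp (-(Complex.I * Λ * b)) * Complex.exp (Complex.I * Λ * a) := by
  rw [← Complex.exp_add]; ring_nf

/-- Two functions are equivalent if a common normalizing factor sends both to the same nonzero
limit; the factor is then automatically nonzero for large arguments. -/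
theorem isEquivalent_of_tendsto_mul {u v m : ℝ → ℂ} {L : ℂ} (hL : L ≠ 0)
    (hu : Tendsto (fun x => m x * u x) atTop (𝓝 L)) (hv : ∀ᶠ x in atTop, m x * v x = L) :
    u ~[atTop] v := by
  refine isEquivalent_of_tendsto_one ?_
  have h := hu.div_const L
  rw [div_self hL] at h
  refine h.congr' ?_
  filter_upwards [hv] with x hx
  have : m x ≠ 0 := fun h0 => hL (by rw [← hx, h0, zero_mul])
  rw [Pi.div_apply, ← hx, mul_div_mul_left _ _ this]

/-- Under the normalization of `tendsto_below`, times the phase at the crossing, all dependence on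
`Λ` cancels. -/
theorem mul_leadingTerm (G : C3 → ℂ) (x₀ : R3) (Ψ : OpenPartialHomeomorph C3 C3) {β : ℝ} (hβ : β ≠ 0)
    (C : ℂ → ℂ) (μ₁ μ₂ : ℂ) {Λ : ℝ} (hΛ : 0 < Λ) :
    ((Λ : ℂ) ^ (μ₁ + μ₂ + 2) * (√Λ : ℝ) * Complex.exp (-(Complex.I * Λ * G (toC3 x₀)))) *
      leadingTerm G x₀ Ψ β C μ₁ μ₂ Λ = C 0 * (‖(fderiv ℂ Ψ.symm 0).det‖ : ℝ) *
        (Iconst μ₁ * Iconst μ₂ * ((√(2 * Real.pi) / √|β| : ℝ) *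
          Complex.exp (Complex.I * (Real.pi / 4) * Real.sign β))) := by
  have hΛ0 : (Λ : ℂ) ≠ 0 := by exact_mod_cast hΛ.ne'
  have hs0 : ((√Λ : ℝ) : ℂ) ≠ 0 := by exact_mod_cast (Real.sqrt_pos.2 hΛ).ne'
  have hb0 : ((√|β| : ℝ) : ℂ) ≠ 0 := by
    exact_mod_cast (Real.sqrt_pos.2 (abs_pos.2 hβ)).ne'
  have e1 : (Λ : ℂ) ^ (μ₁ + μ₂ + 2) * (Λ : ℂ) ^ (-μ₁ - μ₂ - 2) = 1 := by
    rw [← Complex.cpow_add _ _ hΛ0]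
    ring_nf
    simp
  have e2 : Complex.exp (-(Complex.I * Λ * G (toC3 x₀))) *
      Complex.exp (Complex.I * Λ * G (toC3 x₀)) = 1 := by
    rw [← Complex.exp_add, neg_add_cancel, Complex.exp_zero]
  unfold leadingTerm Phi
  rw [Complex.exp_add, Real.sqrt_mul hΛ.le]
  push_cast
  field_simp
  linear_combination (C 0 * Iconst μ₁ * Iconst μ₂ * ‖(fderiv ℂ Ψ.symm 0).det‖) *
    (e1 * (Complex.exp (-(Complex.I * Λ * G (toC3 x₀))) *
      Complex.exp (Complex.I * Λ * G (toC3 x₀))) + e2)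

/-- The leading asymptotics of the contribution if both singularities are bypassed below. -/
theorem IsGoodNbhd.eventually_isEquivalent (hN : IsGoodNbhd F G g₁ g₂ x₀ η₀ Ψ α₁ α₂ R σ U)
    (hc : IsNormalizedChart G g₁ g₂ x₀ Ψ α₁ α₂ β)
    (hb₁ : BypassesBelow α₁ g₁ x₀ η₀) (hb₂ : BypassesBelow α₂ g₂ x₀ η₀) {r₀ : ℝ} (hR : R ≤ r₀)
    (hphase : ∀ y v : R3, ∀ d : ℝ, 0 ≤ d → d ≤ r₀ → ‖y‖ ≤ r₀ → IsLift β d y v →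
      (∀ ε ∈ Set.Icc (0 : ℝ) 1, ε * ((|y 0| + |y 1|) / 2 + |β| / 2 * y 2 ^ 2 - 6 * d)
        ≤ (G (Ψ.symm (toC3 y + (ε * Complex.I : ℂ) • toC3 v))).im) ∧
      (|y 0| + |y 1|) / 2 + |β| / 2 * y 2 ^ 2 - 6 * d ≤ gradDot (fun w => G (Ψ.symm w)) y v)
    (hμ₁ : IsPoleOrBranchExponent μ₁) (hμ₂ : IsPoleOrBranchExponent μ₂)
    (hC0 : C 0 ≠ 0)
    (hlim : Tendsto (fun w => F (Ψ.symm w) / modelPow μ₁ μ₂ w) (𝓝[lowerSpace] 0) (𝓝 (C 0)))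
    (hD : IsLocalPiece x₀ U D) (hK : IsCompact K) (hKD : K ⊆ D)
    (hη : IsDeformedField G g₁ g₂ η₀ D K η) :
    ∀ᶠ ε : ℝ in 𝓝[>] (0 : ℝ), (∀ Λ : ℝ, IntegrableOn (density F G η ε Λ) D) ∧
      (fun Λ : ℝ => localIntegral F G η ε D Λ)
        ~[atTop] fun Λ : ℝ => leadingTerm G x₀ Ψ β C μ₁ μ₂ Λ := by
  have hβ := abs_pos.2 hc.beta_ne
  have hr₀ := hN.pos.trans_le hR
  have h0t : toC3 0 ∈ Ψ.target := by rw [toC3_zero]; exact hc.zero_mem_target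
  have hcut := cutSpace_eq_lowerSpace hb₁ hb₂
  have hDU : D ⊆ U := subset_closure.trans hD.subset
  have hD' := hN.isOpen_image hc hDU hD.isOpen
  have h0D : (0 : R3) ∈ realMap Ψ '' D := ⟨x₀, hD.mem, hc.realMap_center⟩
  set J : ℂ := (fderiv ℂ Ψ.symm 0).det with hJ
  have hHlim : Tendsto (fun w => pulledAmplitude F Ψ w / modelPow μ₁ μ₂ w) (𝓝[lowerSpace] 0)
      (𝓝 (C 0 * J)) := by
    have h1 := (analyticAt_det_fderiv (hc.analytic_symm _ hc.zero_mem_target)).continuousAt.tendsto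
    refine (hlim.mul (h1.mono_left nhdsWithin_le_nhds)).congr fun w => ?_
    simp only [pulledAmplitude]
    ring
  -- the radii
  obtain ⟨B, hB⟩ : ∃ B : ℝ, ∀ᶠ w in 𝓝[lowerSpace] (0 : C3),
      ‖pulledAmplitude F Ψ w / modelPow μ₁ μ₂ w‖ ≤ B :=
    ⟨‖C 0 * J‖ + 1, hHlim.norm.eventually_le_const (by linarith)⟩
  -- `r₂` is a radius on which the amplitude is comparable to its model; `r₃` keeps the ball inside
  -- the image of the piece. Both are needed before the scale `δ₀` is fixed.
  obtain ⟨r₂, hr₂, hb₂'⟩ := Metric.eventually_nhds_iff_ball.1 (eventually_nhdsWithin_iff.1 hB)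
  obtain ⟨r₃, hr₃, hb₃⟩ := Metric.isOpen_iff.1 hD' 0 h0D
  set r₁ := min r₂ R with hr₁
  have hRp := hN.pos
  have hr₁p : 0 < r₁ := by positivity
  set ρ := min (r₁ / 4) (r₃ / 2) with hρ
  have hρp : 0 < ρ := by positivity
  have hρ1 : ρ ≤ r₁ / 4 := min_le_left _ _
  have hρ3 : ρ ≤ r₃ / 2 := min_le_right _ _
  have hr₁R : r₁ ≤ R := min_le_right _ _
  set δ₀ := min r₀ (min (ρ / 48) (|β| / 96 * ρ ^ 2)) with hδ
  have hδpos : 0 < δ₀ := by positivity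
  have hδ1 : δ₀ ≤ ρ / 48 := (min_le_right _ _).trans (min_le_left _ _)
  have hδ2 : δ₀ ≤ |β| / 96 * ρ ^ 2 := (min_le_right _ _).trans (min_le_right _ _)
  have hδr : δ₀ ≤ r₀ := min_le_left _ _
  have hG0 : (G (toC3 x₀)).im = 0 := by
    have := hN.phase_real 0 (by simpa using hRp)
    rwa [toC3_zero, hc.symm_zero] at this
  -- The prescribed displacement is the dip field of scale `δ₀`, exactly on the closed ball of
  -- radius `ρ` and with growing phase off the ball of radius `ρ / 2`.
  have hdef := hN.eventually_deform hc hD hK hKD hη (θ := dipField β δ₀)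
    (contDiff_dipField β hδpos) (N := Metric.ball 0 (ρ / 2)) (Q := Metric.closedBall 0 ρ)
    Metric.isOpen_ball (isCompact_closedBall _ _)
    ((Metric.closedBall_subset_ball (by linarith)).trans hb₃)
    (fun y hy => mul_dip_pos hb₁ hδpos hy) (fun y hy => mul_dip_pos hb₂ hδpos hy)
    (fun y hyR hy => by
      have h1 := (hphase y _ δ₀ hδpos.le hδr (hyR.le.trans hR) (isLift_dipField β hδpos.le y)).2
      have h2 := phase_lower_of_large (β := β) (δ₀ := δ₀) (by simpa using hy) (by linarith)
        (by linarith) hρp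
      linarith)
  filter_upwards [hdef, Ioc_mem_nhdsGT one_pos] with ε h hε
  obtain ⟨h1, Φ, hΦ2, hΦW, hΦQ, ⟨ζ, hζ, hζb⟩, hI⟩ := h
  refine ⟨h1, ?_⟩
  have hmain := tendsto_below (G := fun w => G (Ψ.symm w)) (H := pulledAmplitude F Ψ)
    (G₀ := G (toC3 x₀)) (D := realMap Ψ '' D) (Φ := Φ) (R := R) (r₁ := r₁) (B := B)
    hc.beta_ne hμ₁ hμ₂ hε hc.normal_form hG0
    (fun y v d a1 a2 a3 a4 => (hphase y v d a1 a2 a3 a4).1 ε ⟨hε.1.le, hε.2⟩)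
    hN.phase_analytic (by rw [← hcut]; exact hN.analyticOnNhd_pulledAmplitude hc) hHlim
    (fun w hw => hb₂' w (Metric.ball_subset_ball (min_le_left _ _) hw.1) hw.2)
    hρp (by linarith) (by linarith) hr₁R hδpos (by linarith) (by linarith) hD'
    ((Metric.ball_subset_ball (by linarith)).trans hb₃) hΦ2
    (by rw [← hcut]; exact hΦW)
    (fun y hy => hΦQ y (Metric.ball_subset_closedBall hy)) hζ hζb (fun Λ => by
      refine ((hI Λ).1.const_mul (Complex.exp (-(Complex.I * Λ * G (toC3 x₀))))).congr
        (Eventually.of_forall fun y => ?_)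
      simp only [exp_I_mul_sub]
      ring)
  have hor := hN.orient 0 (by simpa using hRp)
  -- The orientation sign turns the Jacobian determinant into its absolute value.
  have hJσ : (σ : ℂ) * J = (‖J‖ : ℝ) := by
    have e : J = ((fderiv ℝ (realMap Ψ.symm) 0).det : ℂ) := by
      rw [hJ, ← toC3_zero, hc.det_symm h0t]
    rw [e, Complex.norm_real, Real.norm_eq_abs, ← Complex.ofReal_mul, ← abs_of_pos hor, abs_mul,
      hN.abs_sign, one_mul]
  have hJ0 : J ≠ 0 := by
    intro h
    have e := hc.det_mul_det hc.mem_source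
    rw [hc.map_center, ← hJ, h, zero_mul] at e
    exact zero_ne_one e
  refine isEquivalent_of_tendsto_mul (m := fun Λ : ℝ => (Λ : ℂ) ^ (μ₁ + μ₂ + 2) * (√Λ : ℝ) *
    Complex.exp (-(Complex.I * Λ * G (toC3 x₀)))) (L := C 0 * (‖J‖ : ℝ) *
        (Iconst μ₁ * Iconst μ₂ * ((√(2 * Real.pi) / √|β| : ℝ) *
          Complex.exp (Complex.I * (Real.pi / 4) * Real.sign β)))) ?_ ?_ ?_
  · refine mul_ne_zero (mul_ne_zero hC0 (by simpa using hJ0))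
      (mul_ne_zero (mul_ne_zero (Iconst_ne_zero hμ₁) (Iconst_ne_zero hμ₂))
        (mul_ne_zero ?_ (Complex.exp_ne_zero _)))
    have : 0 < √(2 * Real.pi) / √|β| := by positivity
    exact_mod_cast this.ne'
  · have h2 := hmain.const_mul (σ : ℂ)
    have e : (σ : ℂ) * (C 0 * J * (Iconst μ₁ * Iconst μ₂ * ((√(2 * Real.pi) / √|β| : ℝ) *
        Complex.exp (Complex.I * (Real.pi / 4) * Real.sign β)))) = C 0 * (‖J‖ : ℝ) *
        (Iconst μ₁ * Iconst μ₂ * ((√(2 * Real.pi) / √|β| : ℝ) *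
          Complex.exp (Complex.I * (Real.pi / 4) * Real.sign β))) := by
      rw [← hJσ]; ring
    rw [e] at h2
    refine h2.congr fun Λ => ?_
    rw [(hI Λ).2]
    have e2 : ∀ y, pulledAmplitude F Ψ (Φ y) * Complex.exp (Complex.I * Λ *
        (G (Ψ.symm (Φ y)) - G (toC3 x₀))) * chainDet Φ y =
        Complex.exp (-(Complex.I * Λ * G (toC3 x₀))) * (pulledAmplitude F Ψ (Φ y) *
          Complex.exp (Complex.I * Λ * G (Ψ.symm (Φ y))) * chainDet Φ y) := fun y => by
      simp only [exp_I_mul_sub]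
      ring
    simp only [e2]
    rw [integral_const_mul]
    ring
  · filter_upwards [eventually_gt_atTop 0] with Λ hΛ
    exact mul_leadingTerm G x₀ Ψ hc.beta_ne C μ₁ μ₂ hΛ


/-! ### The two-dimensional integral `Φ'` -/

theorem intervalIntegral_swap_of_continuousOn {g : ℝ × ℝ → ℂ} {a b c d : ℝ} (hab : a ≤ b) (hcd : c ≤ d)
    (hg : ContinuousOn g (Set.Icc a b ×ˢ Set.Icc c d)) :
    ∫ x in a..b, ∫ y in c..d, g (x, y) = ∫ y in c..d, ∫ x in a..b, g (x, y) := by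
  simp only [intervalIntegral.integral_of_le hab, intervalIntegral.integral_of_le hcd]
  refine integral_integral_swap (f := fun x y => g (x, y)) ?_
  have h := (hg.integrableOn_compact (μ := volume) (isCompact_Icc.prod isCompact_Icc)).mono_set
    (Set.prod_mono Set.Ioc_subset_Icc_self Set.Ioc_subset_Icc_self)
  rw [IntegrableOn, Measure.volume_eq_prod, ← Measure.prod_restrict] at h
  exact h

/-- Cauchy's theorem for the linear homotopy between two curves with the same ends. -/
theorem integral_curve_eq_of_homotopy {f : ℂ → ℂ} {W : Set ℂ} {c₀ c₁ c₀' c₁' : ℝ → ℂ} {r : ℝ}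
    (hr : 0 ≤ r) (hf : AnalyticOnNhd ℂ f W) (h₀ : ∀ t, HasDerivAt c₀ (c₀' t) t)
    (h₁ : ∀ t, HasDerivAt c₁ (c₁' t) t) (h₀' : Continuous c₀') (h₁' : Continuous c₁')
    (hl : c₁ (-r) = c₀ (-r)) (hrr : c₁ r = c₀ r)
    (hW : ∀ s ∈ Set.Icc (0 : ℝ) 1, ∀ t ∈ Set.Icc (-r) r, c₀ t + s * (c₁ t - c₀ t) ∈ W) :
    ∫ t in (-r)..r, f (c₀ t) * c₀' t = ∫ t in (-r)..r, f (c₁ t) * c₁' t := by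
  have hrr' : -r ≤ r := by linarith
  set v : ℝ → ℂ := fun t => c₁ t - c₀ t with hv
  set v' : ℝ → ℂ := fun t => c₁' t - c₀' t with hv'
  set c : ℝ × ℝ → ℂ := fun p => c₀ p.1 + p.2 * v p.1 with hc
  set c' : ℝ × ℝ → ℂ := fun p => c₀' p.1 + p.2 * v' p.1 with hc'
  set T : ℝ × ℝ → ℂ := fun p => deriv f (c p) * v p.1 * c' p + f (c p) * v' p.1 with hT
  have cc₀ : Continuous c₀ := continuous_iff_continuousAt.2 fun t => (h₀ t).continuousAt
  have cc₁ : Continuous c₁ := continuous_iff_continuousAt.2 fun t => (h₁ t).continuousAt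
  have cc : Continuous c := by fun_prop
  have cc' : Continuous c' := by fun_prop
  have cv : Continuous v := by fun_prop
  have cv' : Continuous v' := by fun_prop
  have hm : Set.MapsTo c (Set.Icc (-r) r ×ˢ Set.Icc 0 1) W := fun p hp => hW p.2 hp.2 p.1 hp.1
  have cT : ContinuousOn T (Set.Icc (-r) r ×ˢ Set.Icc 0 1) :=
    (((hf.deriv.continuousOn.comp cc.continuousOn hm).mul
      (cv.comp continuous_fst).continuousOn).mul cc'.continuousOn).add
      ((hf.continuousOn.comp cc.continuousOn hm).mul (cv'.comp continuous_fst).continuousOn)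
  have d1 : ∀ t ∈ Set.Icc (-r) r, ∫ s in (0 : ℝ)..1, T (t, s) =
      f (c₁ t) * c₁' t - f (c₀ t) * c₀' t := by
    intro t ht
    rw [intervalIntegral.integral_eq_sub_of_hasDerivAt (f := fun s : ℝ => f (c (t, s)) * c' (t, s))]
    · simp [hc, hc', hv, hv']
    · intro s hs
      rw [Set.uIcc_of_le zero_le_one] at hs
      have e1 : HasDerivAt (fun s : ℝ => c (t, s)) (v t) s :=
        (((Complex.ofRealCLM.hasDerivAt (x := s)).mul_const (v t)).const_add (c₀ t)).congr_deriv
          (by simp)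
      have e2 : HasDerivAt (fun s : ℝ => c' (t, s)) (v' t) s :=
        (((Complex.ofRealCLM.hasDerivAt (x := s)).mul_const (v' t)).const_add (c₀' t)).congr_deriv
          (by simp)
      have e3 := (hf _ (hm (x := (t, s)) ⟨ht, hs⟩)).differentiableAt.hasDerivAt.comp s e1
      exact e3.mul e2
    · refine ContinuousOn.intervalIntegrable ?_
      rw [Set.uIcc_of_le zero_le_one]
      exact cT.comp (by fun_prop) fun s hs => ⟨ht, hs⟩
  -- For fixed `s` the variation of the integrand is the `t`-derivative of `f(c) v`, and `v`
  -- vanishes at both ends.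
  have d2 : ∀ s ∈ Set.Icc (0 : ℝ) 1, ∫ t in (-r)..r, T (t, s) = 0 := by
    intro s hs
    rw [intervalIntegral.integral_eq_sub_of_hasDerivAt (f := fun t : ℝ => f (c (t, s)) * v t)]
    · simp [hv, hl, hrr]
    · intro t ht
      rw [Set.uIcc_of_le hrr'] at ht
      have e0 : HasDerivAt v (v' t) t := (h₁ t).sub (h₀ t)
      have e1 : HasDerivAt (fun t : ℝ => c (t, s)) (c' (t, s)) t :=
        (h₀ t).add (e0.const_mul (s : ℂ))
      have e3 := (hf _ (hm (x := (t, s)) ⟨ht, hs⟩)).differentiableAt.hasDerivAt.comp t e1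
      refine (e3.mul e0).congr_deriv ?_
      simp only [hT, Function.comp_apply]
      ring
    · refine ContinuousOn.intervalIntegrable ?_
      rw [Set.uIcc_of_le hrr']
      exact cT.comp (by fun_prop) fun t ht => ⟨ht, hs⟩
  have hi : ∀ {u u' : ℝ → ℂ}, Continuous u → Continuous u' → (∀ t ∈ Set.Icc (-r) r, u t ∈ W) →
      IntervalIntegrable (fun t => f (u t) * u' t) volume (-r) r := by
    intro u u' hu hu' hm
    refine ContinuousOn.intervalIntegrable ?_
    rw [Set.uIcc_of_le hrr']
    exact (hf.continuousOn.comp hu.continuousOn hm).mul hu'.continuousOn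
  have i0 := hi cc₀ h₀' fun t ht => by simpa using hW 0 (by simp) t ht
  have i1 := hi cc₁ h₁' fun t ht => by simpa using hW 1 (by simp) t ht
  rw [eq_comm, ← sub_eq_zero, ← intervalIntegral.integral_sub i1 i0]
  rw [intervalIntegral.integral_congr (g := fun t => ∫ s in (0 : ℝ)..1, T (t, s)) (fun t ht => by
      rw [Set.uIcc_of_le hrr'] at ht
      exact (d1 t ht).symm),
    intervalIntegral_swap_of_continuousOn hrr' zero_le_one cT,
    intervalIntegral.integral_congr (g := fun _ => (0 : ℂ)) (fun s hs => by
      rw [Set.uIcc_of_le zero_le_one] at hs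
      exact d2 s hs)]
  simp

theorem hasDerivAt_contourBelow (a t : ℝ) :
    HasDerivAt (contourBelow a) (1 + Complex.I * ((2 * t : ℝ) : ℂ)) t := by
  have h1 : HasDerivAt (fun t : ℝ => (t : ℂ)) 1 t := Complex.ofRealCLM.hasDerivAt
  have h2 := h1.add (((h1.pow 2).sub_const (a : ℂ)).const_mul Complex.I)
  refine h2.congr_deriv ?_
  push_cast
  ring

theorem vec3_mem {w₁ w₂ : ℂ} {R : ℝ} (h₁ : w₁ ∈ belowPlane ∩ Metric.ball 0 R)
    (h₂ : w₂ ∈ belowPlane ∩ Metric.ball 0 R) :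
    (![w₁, w₂, 0] : C3) ∈ Metric.ball 0 R ∩ lowerSpace := by
  have n1 := mem_ball_zero_iff.1 h₁.2
  have n2 := mem_ball_zero_iff.1 h₂.2
  have hR : 0 < R := (norm_nonneg _).trans_lt n1
  refine ⟨?_, mem_lowerSpace.2 ⟨h₁.1, h₂.1⟩⟩
  rw [mem_ball_zero_iff, pi_norm_lt_iff hR]
  intro i
  fin_cases i <;> simp [n1, n2, hR]

/-- Replacing the contour in both variables. -/
theorem integral_contour_eq {A : C3 → ℂ} {R r : ℝ} {c₀ c₁ c₀' c₁' : ℝ → ℂ} (hr : 0 ≤ r)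
    (hA : AnalyticOnNhd ℂ A (Metric.ball 0 R ∩ lowerSpace)) (h₀ : ∀ t, HasDerivAt c₀ (c₀' t) t)
    (h₁ : ∀ t, HasDerivAt c₁ (c₁' t) t) (h₀' : Continuous c₀') (h₁' : Continuous c₁')
    (hl : c₁ (-r) = c₀ (-r)) (hrr : c₁ r = c₀ r)
    (hW : ∀ s ∈ Set.Icc (0 : ℝ) 1, ∀ t ∈ Set.Icc (-r) r,
      c₀ t + s * (c₁ t - c₀ t) ∈ belowPlane ∩ Metric.ball 0 R) (Λ : ℝ) :
    ∫ t₁ in (-r)..r, ∫ t₂ in (-r)..r, A ![c₀ t₁, c₀ t₂, 0] *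
        Complex.exp (Complex.I * Λ * (c₀ t₁ + c₀ t₂)) * c₀' t₁ * c₀' t₂ =
      ∫ t₁ in (-r)..r, ∫ t₂ in (-r)..r, A ![c₁ t₁, c₁ t₂, 0] *
        Complex.exp (Complex.I * Λ * (c₁ t₁ + c₁ t₂)) * c₁' t₁ * c₁' t₂ := by
  have hrr' : -r ≤ r := by linarith
  set P : ℂ → ℂ → ℂ := fun w z => A ![w, z, 0] * Complex.exp (Complex.I * Λ * (w + z)) with hP
  set W : Set ℂ := belowPlane ∩ Metric.ball 0 R with hWdef
  have m0 : ∀ t ∈ Set.Icc (-r) r, c₀ t ∈ W := fun t ht => by simpa using hW 0 (by simp) t ht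
  have m1 : ∀ t ∈ Set.Icc (-r) r, c₁ t ∈ W := fun t ht => by simpa using hW 1 (by simp) t ht
  have cc₀ : Continuous c₀ := continuous_iff_continuousAt.2 fun t => (h₀ t).continuousAt
  have cc₁ : Continuous c₁ := continuous_iff_continuousAt.2 fun t => (h₁ t).continuousAt
  have vecan : ∀ (u v : ℂ → ℂ) (z : ℂ), AnalyticAt ℂ u z → AnalyticAt ℂ v z →
      AnalyticAt ℂ (fun z => (![u z, v z, 0] : C3)) z := by
    intro u v z hu hv
    rw [analyticAt_pi_iff]
    intro i
    fin_cases i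
    · exact hu
    · exact hv
    · exact analyticAt_const
  have an1 : ∀ w ∈ W, AnalyticOnNhd ℂ (fun z => P w z) W := fun w hw z hz =>
    (AnalyticAt.fun_comp (f := fun z => (![w, z, 0] : C3)) (hA _ (vec3_mem hw hz)) (vecan _ _ z analyticAt_const analyticAt_id)).mul
      ((analyticAt_const.mul (analyticAt_const.add analyticAt_id)).cexp)
  have an2 : ∀ w ∈ W, AnalyticOnNhd ℂ (fun z => P z w) W := fun w hw z hz =>
    (AnalyticAt.fun_comp (f := fun z => (![z, w, 0] : C3)) (hA _ (vec3_mem hz hw)) (vecan _ _ z analyticAt_id analyticAt_const)).mul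
      ((analyticAt_const.mul (analyticAt_id.add analyticAt_const)).cexp)
  have cont : ∀ {u v u' v' : ℝ → ℂ}, Continuous u → Continuous v → Continuous u' → Continuous v' →
      (∀ t ∈ Set.Icc (-r) r, u t ∈ W) → (∀ t ∈ Set.Icc (-r) r, v t ∈ W) →
      ContinuousOn (fun p : ℝ × ℝ => P (u p.1) (v p.2) * u' p.1 * v' p.2)
        (Set.Icc (-r) r ×ˢ Set.Icc (-r) r) := by
    intro u v u' v' hu hv hu' hv' mu mv
    have hvec : Continuous fun p : ℝ × ℝ => (![u p.1, v p.2, 0] : C3) := by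
      refine continuous_pi fun i => ?_
      fin_cases i <;> simp <;> fun_prop
    have h1 : ContinuousOn (fun p : ℝ × ℝ => A ![u p.1, v p.2, 0])
        (Set.Icc (-r) r ×ˢ Set.Icc (-r) r) :=
      hA.continuousOn.comp hvec.continuousOn fun p hp => vec3_mem (mu _ hp.1) (mv _ hp.2)
    have h2 : Continuous fun p : ℝ × ℝ => Complex.exp (Complex.I * Λ * (u p.1 + v p.2)) := by
      fun_prop
    exact ((h1.mul h2.continuousOn).mul (by fun_prop)).mul (by fun_prop)
  -- The contour is replaced in the second variable, the order of integration is exchanged, and then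
  -- the first variable is treated with the second one already on the new contour.
  calc ∫ t₁ in (-r)..r, ∫ t₂ in (-r)..r, P (c₀ t₁) (c₀ t₂) * c₀' t₁ * c₀' t₂
      = ∫ t₁ in (-r)..r, ∫ t₂ in (-r)..r, P (c₀ t₁) (c₁ t₂) * c₀' t₁ * c₁' t₂ := by
        refine intervalIntegral.integral_congr fun t₁ ht₁ => ?_
        rw [Set.uIcc_of_le hrr'] at ht₁
        have := integral_curve_eq_of_homotopy hr (an1 _ (m0 t₁ ht₁)) h₀ h₁ h₀' h₁' hl hrr hW
        have e := congr_arg (fun z => c₀' t₁ * z) this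
        simp only [← intervalIntegral.integral_const_mul] at e
        refine Eq.trans ?_ (e.trans ?_) <;>
        · refine intervalIntegral.integral_congr fun t₂ _ => ?_
          ring
    _ = ∫ t₂ in (-r)..r, ∫ t₁ in (-r)..r, P (c₀ t₁) (c₁ t₂) * c₀' t₁ * c₁' t₂ :=
        intervalIntegral_swap_of_continuousOn hrr' hrr' (cont cc₀ cc₁ h₀' h₁' m0 m1)
    _ = ∫ t₂ in (-r)..r, ∫ t₁ in (-r)..r, P (c₁ t₁) (c₁ t₂) * c₁' t₁ * c₁' t₂ := by
        refine intervalIntegral.integral_congr fun t₂ ht₂ => ?_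
        rw [Set.uIcc_of_le hrr'] at ht₂
        have := integral_curve_eq_of_homotopy hr (an2 _ (m1 t₂ ht₂)) h₀ h₁ h₀' h₁' hl hrr hW
        simp only [intervalIntegral.integral_mul_const]
        rw [this]
    _ = _ := (intervalIntegral_swap_of_continuousOn hrr' hrr' (cont cc₁ cc₁ h₁' h₁' m1 m1)).symm


/-- The slope has to vary with `Λ` in order to match the ends of the contours, so a dominating
function uniform in the slope is needed. -/
theorem exists_norm_hankelIntegrand_le_of_mem (μ : ℂ) {κ₀ κ₁ : ℝ} (hκ₀ : 0 < κ₀) :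
    ∃ M : ℝ, 0 ≤ M ∧ ∀ κ ∈ Set.Icc κ₀ κ₁, ∀ t,
      ‖hankelIntegrand κ 1 μ t‖ ≤ M * Real.exp (-(κ₀ / 2 * |t|)) := by
  obtain ⟨M, hM, h⟩ := exists_norm_powBelow_dipCurve_le ‖μ‖ (κ₁ := κ₁) hκ₀ (half_pos hκ₀)
  refine ⟨M * Real.exp (2 * κ₁) * (1 + |κ₁|), by positivity, fun κ hκ t => ?_⟩
  have hκ0 : 0 ≤ κ := hκ₀.le.trans hκ.1
  have h1 := h μ le_rfl κ hκ t
  have h2 := norm_exp_dipCurve_le (δ := 1) hκ0 zero_le_one t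
  have h3 := norm_dipVel_le hκ0 1 t
  have h4 : ‖Complex.exp (Complex.I * (1 : ℝ) * dipCurve κ 1 t)‖ ≤
      Real.exp (2 * κ₁) * Real.exp (-(κ₀ * |t|)) := by
    refine h2.trans (mul_le_mul (Real.exp_le_exp.2 ?_) (Real.exp_le_exp.2 ?_)
      (Real.exp_pos _).le (Real.exp_pos _).le)
    · linarith [hκ.2]
    · nlinarith [hκ.1, abs_nonneg t]
  have h5 : ‖dipVel κ 1 t‖ ≤ 1 + |κ₁| := h3.trans (by linarith [hκ.2, le_abs_self κ₁])
  rw [hankelIntegrand, norm_mul, norm_mul]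
  calc ‖powBelow (dipCurve κ 1 t) μ‖ * ‖Complex.exp (Complex.I * (1 : ℝ) * dipCurve κ 1 t)‖ *
        ‖dipVel κ 1 t‖
      ≤ M * Real.exp (κ₀ / 2 * |t|) * (Real.exp (2 * κ₁) * Real.exp (-(κ₀ * |t|))) *
          (1 + |κ₁|) := by gcongr
    _ = M * Real.exp (2 * κ₁) * (1 + |κ₁|) *
          (Real.exp (κ₀ / 2 * |t|) * Real.exp (-(κ₀ * |t|))) := by ring
    _ = _ := by
        rw [← Real.exp_add]
        ring_nf

theorem continuousAt_hankelIntegrand_slope {κ : ℝ} (hκ : 0 < κ) (p : ℝ) (μ : ℂ) (t : ℝ) :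
    ContinuousAt (fun κ => hankelIntegrand κ p μ t) κ := by
  have h1 : Continuous fun κ : ℝ => dipCurve κ 1 t := by
    unfold dipCurve
    fun_prop
  have h2 : Continuous fun κ : ℝ => dipVel κ 1 t := by
    unfold dipVel
    fun_prop
  have h3 : ContinuousAt (fun κ : ℝ => powBelow (dipCurve κ 1 t) μ) κ :=
    ContinuousAt.comp (f := fun κ : ℝ => dipCurve κ 1 t)
      (continuousAt_powBelow (dipCurve_mem hκ one_pos t) μ) h1.continuousAt
  have h4 : Continuous fun κ : ℝ => Complex.exp (Complex.I * p * dipCurve κ 1 t) := by fun_prop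
  exact (h3.mul h4.continuousAt).mul h2.continuousAt

theorem ofReal_mul_mem_belowPlane {s : ℝ} (hs : 0 < s) {w : ℂ} (hw : w ∈ belowPlane) :
    (s : ℂ) * w ∈ belowPlane := by
  intro h
  rw [Complex.re_ofReal_mul] at h
  rw [Complex.im_ofReal_mul]
  exact mul_neg_of_pos_of_neg hs (hw ((mul_eq_zero.1 h).resolve_left hs.ne'))

/-- Dominated convergence on an expanding square. The condition on `R` keeps the rescaled points in
the ball, because their norm is at most `(1 + κ) r + 2 κ / Λ`. -/
theorem tendsto_integral_hankel_prod {Q : C3 → ℂ} {c μ₁ μ₂ : ℂ} {κ : ℝ → ℝ} {κ' r R B : ℝ}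
    (hκ' : 0 < κ') (hκ : Tendsto κ atTop (𝓝 κ')) (hr : 0 < r) (hR : (1 + κ') * r < R)
    (hQ : ContinuousOn Q (Metric.ball 0 R ∩ lowerSpace))
    (hlim : Tendsto Q (𝓝[lowerSpace] 0) (𝓝 c))
    (hB : ∀ w ∈ Metric.ball 0 R ∩ lowerSpace, ‖Q w‖ ≤ B) :
    Tendsto (fun Λ : ℝ => ∫ z in Set.Ioc (-(Λ * r)) (Λ * r) ×ˢ Set.Ioc (-(Λ * r)) (Λ * r),
      Q ![(Λ⁻¹ : ℝ) * dipCurve (κ Λ) 1 z.1, (Λ⁻¹ : ℝ) * dipCurve (κ Λ) 1 z.2, 0] *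
        (hankelIntegrand (κ Λ) 1 μ₁ z.1 * hankelIntegrand (κ Λ) 1 μ₂ z.2)) atTop
      (𝓝 (c * (hankel κ' 1 μ₁ * hankel κ' 1 μ₂))) := by
  obtain ⟨M₁, hM₁, b₁⟩ := exists_norm_hankelIntegrand_le_of_mem μ₁ (κ₁ := 2 * κ') (half_pos hκ')
  obtain ⟨M₂, hM₂, b₂⟩ := exists_norm_hankelIntegrand_le_of_mem μ₂ (κ₁ := 2 * κ') (half_pos hκ')
  have hκmem : ∀ᶠ Λ in atTop, κ Λ ∈ Set.Icc (κ' / 2) (2 * κ') :=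
    hκ (Icc_mem_nhds (by linarith) (by linarith))
  have hRΛ : ∀ᶠ Λ : ℝ in atTop, (1 + κ Λ) * r + 2 * κ Λ * Λ⁻¹ < R := by
    have h : Tendsto (fun Λ : ℝ => (1 + κ Λ) * r + 2 * κ Λ * Λ⁻¹) atTop
        (𝓝 ((1 + κ') * r + 2 * κ' * 0)) :=
      ((hκ.const_add 1).mul_const r).add ((hκ.const_mul 2).mul tendsto_inv_atTop_zero)
    exact h.eventually_lt_const (by simpa using hR)
  set pt : ℝ → ℝ × ℝ → C3 := fun Λ z =>
    ![(Λ⁻¹ : ℝ) * dipCurve (κ Λ) 1 z.1, (Λ⁻¹ : ℝ) * dipCurve (κ Λ) 1 z.2, 0] with hpt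
  set S : ℝ → Set (ℝ × ℝ) := fun Λ =>
    Set.Ioc (-(Λ * r)) (Λ * r) ×ˢ Set.Ioc (-(Λ * r)) (Λ * r) with hS
  have hSm : ∀ Λ, MeasurableSet (S Λ) := fun Λ => measurableSet_Ioc.prod measurableSet_Ioc
  have hmem : ∀ᶠ Λ : ℝ in atTop, ∀ z ∈ S Λ, pt Λ z ∈ Metric.ball 0 R ∩ lowerSpace := by
    filter_upwards [hκmem, hRΛ, eventually_gt_atTop 0] with Λ h1 h2 h3 z hz
    have hκ0 : 0 < κ Λ := (half_pos hκ').trans_le h1.1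
    have key : ∀ t ∈ Set.Ioc (-(Λ * r)) (Λ * r),
        ((Λ⁻¹ : ℝ) : ℂ) * dipCurve (κ Λ) 1 t ∈ belowPlane ∩ Metric.ball 0 R := by
      intro t ht
      refine ⟨ofReal_mul_mem_belowPlane (inv_pos.2 h3) (dipCurve_mem hκ0 one_pos t), ?_⟩
      rw [← dipCurve_scale _ (inv_pos.2 h3), mem_ball_zero_iff]
      refine (norm_dipCurve_le hκ0.le (inv_pos.2 h3).le _).trans_lt (lt_of_le_of_lt ?_ h2)
      have : |Λ⁻¹ * t| ≤ r := by
        rw [abs_mul, abs_of_pos (inv_pos.2 h3), inv_mul_le_iff₀ h3]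
        exact abs_le.2 ⟨ht.1.le, ht.2⟩
      gcongr
    exact vec3_mem (key _ hz.1) (key _ hz.2)
  have hcont : ∀ Λ, Continuous (pt Λ) := by
    intro Λ
    have := continuous_dipCurve (κ Λ) 1
    refine continuous_pi fun i => ?_
    fin_cases i <;> simp [hpt] <;> fun_prop
  set T : ℝ → ℝ × ℝ → ℂ := fun Λ z =>
    Q (pt Λ z) * (hankelIntegrand (κ Λ) 1 μ₁ z.1 * hankelIntegrand (κ Λ) 1 μ₂ z.2) with hT
  have e1 : ∀ Λ, ∫ z in S Λ, T Λ z = ∫ z, (S Λ).indicator (T Λ) z :=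
    fun Λ => (integral_indicator (hSm Λ)).symm
  have e2 : c * (hankel κ' 1 μ₁ * hankel κ' 1 μ₂) =
      ∫ z : ℝ × ℝ, c * (hankelIntegrand κ' 1 μ₁ z.1 * hankelIntegrand κ' 1 μ₂ z.2) := by
    rw [integral_const_mul, Measure.volume_eq_prod, integral_prod_mul]
    rfl
  change Tendsto (fun Λ => ∫ z in S Λ, T Λ z) atTop _
  simp only [e1]
  rw [e2]
  have i₀ := integrable_exp_neg_mul_abs (half_pos (half_pos hκ'))
  refine tendsto_integral_filter_of_dominated_convergence
    (fun z => |B| * (M₁ * Real.exp (-(κ' / 2 / 2 * |z.1|)) *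
      (M₂ * Real.exp (-(κ' / 2 / 2 * |z.2|))))) ?_ ?_ ?_ ?_
  · filter_upwards [hmem, hκmem] with Λ h1 h2
    have hκ0 : 0 < κ Λ := (half_pos hκ').trans_le h2.1
    rw [aestronglyMeasurable_indicator_iff (hSm Λ)]
    refine ContinuousOn.aestronglyMeasurable ?_ (hSm Λ)
    refine (hQ.comp (hcont Λ).continuousOn h1).mul ?_
    exact (((continuous_hankelIntegrand hκ0 1 μ₁).comp continuous_fst).mul
      ((continuous_hankelIntegrand hκ0 1 μ₂).comp continuous_snd)).continuousOn
  · filter_upwards [hmem, hκmem] with Λ h1 h2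
    refine ae_of_all _ fun z => ?_
    by_cases hz : z ∈ S Λ
    · rw [Set.indicator_of_mem hz]
      simp only [hT, norm_mul]
      have := (hB _ (h1 z hz)).trans (le_abs_self B)
      have := b₁ _ h2 z.1
      have := b₂ _ h2 z.2
      gcongr
    · rw [Set.indicator_of_notMem hz, norm_zero]
      positivity
  · rw [Measure.volume_eq_prod]
    exact ((i₀.const_mul M₁).mul_prod (i₀.const_mul M₂)).const_mul _
  · refine ae_of_all _ fun z => ?_
    have hz : ∀ᶠ Λ : ℝ in atTop, z ∈ S Λ := by
      filter_upwards [eventually_gt_atTop (|z.1| / r), eventually_gt_atTop (|z.2| / r)] with Λ h1 h2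
      rw [div_lt_iff₀ hr, abs_lt] at h1 h2
      exact ⟨⟨h1.1, h1.2.le⟩, ⟨h2.1, h2.2.le⟩⟩
    have hd : ∀ t, Tendsto (fun Λ : ℝ => ((Λ⁻¹ : ℝ) : ℂ) * dipCurve (κ Λ) 1 t) atTop (𝓝 0) := by
      intro t
      have h1 : Continuous fun κ : ℝ => dipCurve κ 1 t := by
        unfold dipCurve
        fun_prop
      have h2 := ((Complex.continuous_ofReal.tendsto 0).comp tendsto_inv_atTop_zero).mul
        ((h1.tendsto κ').comp hκ)
      simpa using h2
    have hp : Tendsto (fun Λ => pt Λ z) atTop (𝓝[lowerSpace] 0) := by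
      refine tendsto_nhdsWithin_iff.2 ⟨tendsto_pi_nhds.2 fun i => ?_, ?_⟩
      · fin_cases i
        · exact hd z.1
        · exact hd z.2
        · exact tendsto_const_nhds
      · filter_upwards [hz, hmem] with Λ h1 h2 using (h2 z h1).2
    refine Tendsto.congr' (f₁ := fun Λ => T Λ z) ?_ ?_
    · filter_upwards [hz] with Λ h1 using (Set.indicator_of_mem h1 _).symm
    · exact (hlim.comp hp).mul
        (((continuousAt_hankelIntegrand_slope hκ' 1 μ₁ z.1).tendsto.comp hκ).mul
          ((continuousAt_hankelIntegrand_slope hκ' 1 μ₂ z.2).tendsto.comp hκ))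

/-- Both curves have abscissa `t`, hence so does the segment between corresponding points. It meets
the imaginary axis at `t = 0` only, where both ordinates are negative. -/
theorem contourBelow_homotopy_mem {κ δ r a s t R : ℝ} (hr : 0 < r) (hr₁ : r ≤ 1) (hR : 8 * r ≤ R)
    (ha : a ∈ Set.Ioo 0 (r ^ 2)) (hδ : 0 < δ) (hδr : δ ≤ r) (hκ : 0 < κ) (hκr : κ ≤ 2 * r)
    (hs : s ∈ Set.Icc (0 : ℝ) 1) (ht : t ∈ Set.Icc (-r) r) :
    contourBelow a t + s * (dipCurve κ δ t - contourBelow a t) ∈ belowPlane ∩ Metric.ball 0 R := by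
  have e : contourBelow a t + s * (dipCurve κ δ t - contourBelow a t) =
      (t : ℂ) + (((1 - s) * (t ^ 2 - a) + s * (κ * dip δ t) : ℝ) : ℂ) * Complex.I := by
    simp only [contourBelow, dipCurve]
    push_cast
    ring
  rw [e]
  have ht' : |t| ≤ r := abs_le.2 ht
  constructor
  · intro h
    have ht0 : t = 0 := by
      simpa only [Complex.add_re, Complex.re_ofReal_mul, Complex.I_re, mul_zero, add_zero,
        Complex.ofReal_re] using h
    have hd := dip_le_of_abs_le (t := t) hδ.le (by simp [ht0, hδ.le])
    have hκd : κ * dip δ t < 0 := mul_neg_of_pos_of_neg hκ (by linarith)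
    have hta : t ^ 2 - a < 0 := by
      rw [ht0]
      linarith [ha.1]
    simp only [Complex.add_im, Complex.ofReal_im, Complex.mul_im, Complex.ofReal_re, Complex.I_im,
      Complex.I_re, mul_one, mul_zero, add_zero, zero_add]
    rcases hs.2.lt_or_eq with h1 | h1
    · nlinarith [hs.1, hs.2]
    · rw [h1]
      linarith
  · rw [mem_ball_zero_iff]
    refine (norm_add_le _ _).trans_lt ?_
    rw [norm_mul, Complex.norm_I, mul_one, Complex.norm_real, Complex.norm_real, Real.norm_eq_abs,
      Real.norm_eq_abs]
    have h1 : |t ^ 2 - a| ≤ r := by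
      have : t ^ 2 ≤ r ^ 2 := sq_le_sq' ht.1 ht.2
      rw [abs_le]
      constructor <;> nlinarith [ha.1, ha.2, sq_nonneg t]
    have h2 : |κ * dip δ t| ≤ 6 * r := by
      rw [abs_mul, abs_of_pos hκ]
      have := abs_dip_le hδ.le t
      have h3 : |dip δ t| ≤ 3 * r := by linarith
      have h4 : κ ≤ 2 := by linarith
      nlinarith [abs_nonneg (dip δ t)]
    have h3 : |(1 - s) * (t ^ 2 - a) + s * (κ * dip δ t)| ≤ 6 * r := by
      refine (abs_add_le _ _).trans ?_
      rw [abs_mul (1 - s), abs_mul s, abs_of_nonneg hs.1, abs_of_nonneg (sub_nonneg.2 hs.2)]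
      nlinarith [hs.1, hs.2]
    linarith

theorem intervalIntegral_scale {E : Type*} [NormedAddCommGroup E] [NormedSpace ℝ E] (f : ℝ → E)
    {Λ : ℝ} (hΛ : 0 < Λ) (r : ℝ) :
    ∫ t in (-r)..r, f t = Λ⁻¹ • ∫ z in (-(Λ * r))..(Λ * r), f (Λ⁻¹ * z) := by
  rw [intervalIntegral.integral_comp_mul_left f (inv_pos.2 hΛ).ne', inv_inv, smul_smul,
    inv_mul_cancel₀ hΛ.ne', one_smul, mul_neg, inv_mul_cancel_left₀ hΛ.ne']


/-- The relation `hend` says that the dip curve ends at the same points as the parabola; both are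
even in the ordinate, so one equation serves both ends. -/
theorem PhiPrime_eq_dip {F : C3 → ℂ} {Ψ : OpenPartialHomeomorph C3 C3} {κ δ r a R : ℝ}
    (hA : AnalyticOnNhd ℂ (fun w => F (Ψ.symm w)) (Metric.ball 0 R ∩ lowerSpace))
    (hr : 0 < r) (hr₁ : r ≤ 1) (hR : 8 * r ≤ R) (ha : a ∈ Set.Ioo 0 (r ^ 2)) (hδ : 0 < δ)
    (hδr : δ ≤ r) (hκ : 0 < κ) (hκr : κ ≤ 2 * r) (hend : κ * dip δ r = r ^ 2 - a) (Λ : ℝ) :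
    PhiPrime F Ψ r a Λ = ∫ t₁ in (-r)..r, ∫ t₂ in (-r)..r,
      F (Ψ.symm ![dipCurve κ δ t₁, dipCurve κ δ t₂, 0]) *
        Complex.exp (Complex.I * Λ * (dipCurve κ δ t₁ + dipCurve κ δ t₂)) *
        dipVel κ δ t₁ * dipVel κ δ t₂ := by
  have hd : ∀ t, deriv (contourBelow a) t = 1 + Complex.I * ((2 * t : ℝ) : ℂ) :=
    fun t => (hasDerivAt_contourBelow a t).deriv
  have he : ∀ t : ℝ, t ^ 2 = r ^ 2 → dipCurve κ δ t = contourBelow a t := by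
    intro t ht
    have : κ * dip δ t = r ^ 2 - a := by rw [← hend, dip, dip, ht]
    rw [dipCurve, contourBelow, this, ← ht]
    push_cast
    ring
  rw [PhiPrime]
  simp only [hd]
  exact integral_contour_eq (A := fun w => F (Ψ.symm w)) hr.le hA (hasDerivAt_contourBelow a)
    (hasDerivAt_dipCurve κ hδ) (by fun_prop) (continuous_dipVel κ hδ) (he _ (by ring)) (he _ rfl)
    (fun s hs t ht => contourBelow_homotopy_mem hr hr₁ hR ha hδ hδr hκ hκr hs ht) Λ

/-- Of the normalizing power, `Λ²` is absorbed by the scaling of the two variables and `Λ ^ (μ₁ +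
μ₂)` by the homogeneity of the model. -/
theorem cpow_mul_integral_dip {A : C3 → ℂ} {μ₁ μ₂ : ℂ} {κ Λ r R : ℝ} (hκ : 0 < κ) (hΛ : 0 < Λ)
    (hr : 0 < r) (hA : ContinuousOn A (Metric.ball 0 R ∩ lowerSpace))
    (hmem : ∀ t ∈ Set.Icc (-r) r, dipCurve κ Λ⁻¹ t ∈ belowPlane ∩ Metric.ball 0 R) :
    (Λ : ℂ) ^ (μ₁ + μ₂ + 2) * (∫ t₁ in (-r)..r, ∫ t₂ in (-r)..r,
      A ![dipCurve κ Λ⁻¹ t₁, dipCurve κ Λ⁻¹ t₂, 0] *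
        Complex.exp (Complex.I * Λ * (dipCurve κ Λ⁻¹ t₁ + dipCurve κ Λ⁻¹ t₂)) *
        dipVel κ Λ⁻¹ t₁ * dipVel κ Λ⁻¹ t₂) =
      ∫ z in Set.Ioc (-(Λ * r)) (Λ * r) ×ˢ Set.Ioc (-(Λ * r)) (Λ * r),
        A ![(Λ⁻¹ : ℝ) * dipCurve κ 1 z.1, (Λ⁻¹ : ℝ) * dipCurve κ 1 z.2, 0] /
          modelPow μ₁ μ₂ ![(Λ⁻¹ : ℝ) * dipCurve κ 1 z.1, (Λ⁻¹ : ℝ) * dipCurve κ 1 z.2, 0] *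
        (hankelIntegrand κ 1 μ₁ z.1 * hankelIntegrand κ 1 μ₂ z.2) := by
  have hδ := inv_pos.2 hΛ
  have hΛc : (Λ : ℂ) ≠ 0 := Complex.ofReal_ne_zero.2 hΛ.ne'
  have hle : -(Λ * r) ≤ Λ * r := by nlinarith
  set pt : ℝ × ℝ → C3 := fun z =>
    ![(Λ⁻¹ : ℝ) * dipCurve κ 1 z.1, (Λ⁻¹ : ℝ) * dipCurve κ 1 z.2, 0] with hpt
  set E : ℝ × ℝ → ℂ := fun z => A (pt z) *
    (Complex.exp (Complex.I * (dipCurve κ 1 z.1 + dipCurve κ 1 z.2)) *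
      dipVel κ 1 z.1 * dipVel κ 1 z.2) with hE
  have hmod : ∀ z, A (pt z) / modelPow μ₁ μ₂ (pt z) *
      (hankelIntegrand κ 1 μ₁ z.1 * hankelIntegrand κ 1 μ₂ z.2) = (Λ : ℂ) ^ (μ₁ + μ₂) * E z := by
    intro z
    have n1 := ne_zero_of_mem_belowPlane (dipCurve_mem hκ one_pos z.1)
    have n2 := ne_zero_of_mem_belowPlane (dipCurve_mem hκ one_pos z.2)
    have h := modelPow_scale hΛ μ₁ μ₂ (w := pt z) (u := ![dipCurve κ 1 z.1, dipCurve κ 1 z.2, 0])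
      n1 n2 rfl rfl
    have h0 := modelPow_ne_zero μ₁ μ₂ (pt z)
    have h1 : hankelIntegrand κ 1 μ₁ z.1 * hankelIntegrand κ 1 μ₂ z.2 =
        modelPow μ₁ μ₂ ![dipCurve κ 1 z.1, dipCurve κ 1 z.2, 0] *
          (Complex.exp (Complex.I * (dipCurve κ 1 z.1 + dipCurve κ 1 z.2)) *
            dipVel κ 1 z.1 * dipVel κ 1 z.2) := by
      rw [mul_add, Complex.exp_add]
      simp only [hankelIntegrand, modelPow, Matrix.cons_val_zero, Matrix.cons_val_one,
        Complex.ofReal_one, mul_one]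
      ring
    rw [h1, ← h, hE]
    field_simp
  have hcont : ContinuousOn E (Set.Icc (-(Λ * r)) (Λ * r) ×ˢ Set.Icc (-(Λ * r)) (Λ * r)) := by
    have c1 := continuous_dipCurve κ 1
    have c2 := continuous_dipVel κ one_pos
    have c3 : Continuous pt := by
      refine continuous_pi fun i => ?_
      fin_cases i <;> simp [hpt] <;> fun_prop
    have key : ∀ t ∈ Set.Icc (-(Λ * r)) (Λ * r),
        ((Λ⁻¹ : ℝ) : ℂ) * dipCurve κ 1 t ∈ belowPlane ∩ Metric.ball 0 R := by
      intro t ht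
      rw [← dipCurve_scale κ hδ]
      refine hmem _ (abs_le.1 ?_)
      rw [abs_mul, abs_of_pos hδ, inv_mul_le_iff₀ hΛ]
      exact abs_le.2 ht
    have c4 : ContinuousOn (fun z => A (pt z))
        (Set.Icc (-(Λ * r)) (Λ * r) ×ˢ Set.Icc (-(Λ * r)) (Λ * r)) :=
      hA.comp c3.continuousOn fun z hz => vec3_mem (key _ hz.1) (key _ hz.2)
    exact c4.mul (by fun_prop)
  have hint : IntegrableOn E (Set.Ioc (-(Λ * r)) (Λ * r) ×ˢ Set.Ioc (-(Λ * r)) (Λ * r))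
      ((volume : Measure ℝ).prod volume) :=
    (hcont.integrableOn_compact (μ := (volume : Measure ℝ).prod volume)
      (isCompact_Icc.prod isCompact_Icc)).mono_set
      (Set.prod_mono Set.Ioc_subset_Icc_self Set.Ioc_subset_Icc_self)
  have hscale : ∀ z₁ z₂ : ℝ, A ![dipCurve κ Λ⁻¹ (Λ⁻¹ * z₁), dipCurve κ Λ⁻¹ (Λ⁻¹ * z₂), 0] *
        Complex.exp (Complex.I * Λ * (dipCurve κ Λ⁻¹ (Λ⁻¹ * z₁) + dipCurve κ Λ⁻¹ (Λ⁻¹ * z₂))) *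
        dipVel κ Λ⁻¹ (Λ⁻¹ * z₁) * dipVel κ Λ⁻¹ (Λ⁻¹ * z₂) = E (z₁, z₂) := by
    intro z₁ z₂
    have hv : ∀ z, dipVel κ Λ⁻¹ (Λ⁻¹ * z) = dipVel κ 1 z := fun z => by
      rw [dipVel, dipVel, dipSlope_scale hδ]
    have he : Complex.I * Λ * (((Λ⁻¹ : ℝ) : ℂ) * dipCurve κ 1 z₁ +
        ((Λ⁻¹ : ℝ) : ℂ) * dipCurve κ 1 z₂) =
        Complex.I * (dipCurve κ 1 z₁ + dipCurve κ 1 z₂) := by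
      push_cast
      field_simp
    rw [hv, hv, dipCurve_scale κ hδ, dipCurve_scale κ hδ, he, hE]
    ring
  have hpow : (Λ : ℂ) ^ (μ₁ + μ₂ + 2) = (Λ : ℂ) ^ (μ₁ + μ₂) * Λ ^ 2 := by
    rw [Complex.cpow_add _ _ hΛc]
    norm_cast
  change _ = ∫ z in _, A (pt z) / modelPow μ₁ μ₂ (pt z) *
      (hankelIntegrand κ 1 μ₁ z.1 * hankelIntegrand κ 1 μ₂ z.2)
  simp only [hmod]
  rw [integral_const_mul, Measure.volume_eq_prod, setIntegral_prod _ hint]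
  rw [intervalIntegral_scale _ hΛ]
  simp only [intervalIntegral_scale _ hΛ r, hscale]
  rw [intervalIntegral.integral_smul, smul_smul]
  simp only [intervalIntegral.integral_of_le hle]
  rw [hpow, Complex.real_smul]
  push_cast
  field_simp

/-- For each `Λ` the parabola is replaced by the dip curve of scale `1 / Λ` with the same ends. Its
slope converges to `(r² - a) / r > 0`, and the limiting Hankel integrals do not depend on the slope.
-/
theorem isEquivalent_PhiPrime {F : C3 → ℂ} {Ψ : OpenPartialHomeomorph C3 C3} {R : ℝ}
    {C : ℂ → ℂ} {μ₁ μ₂ : ℂ} (hR : 0 < R)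
    (hA : AnalyticOnNhd ℂ (fun w => F (Ψ.symm w)) (Metric.ball 0 R ∩ lowerSpace))
    (hlim : Tendsto (fun w => F (Ψ.symm w) / modelPow μ₁ μ₂ w) (𝓝[lowerSpace] 0) (𝓝 (C 0)))
    (hμ₁ : IsPoleOrBranchExponent μ₁) (hμ₂ : IsPoleOrBranchExponent μ₂) (hC0 : C 0 ≠ 0) :
    ∀ᶠ r in 𝓝[>] (0 : ℝ), ∀ a ∈ Set.Ioo 0 (r ^ 2),
      (fun Λ : ℝ => PhiPrime F Ψ r a Λ) ~[atTop] fun Λ : ℝ => Phi C μ₁ μ₂ Λ := by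
  obtain ⟨r₁, hr₁, hr₁R, hB⟩ : ∃ r₁ > 0, r₁ ≤ R ∧ ∀ w ∈ Metric.ball 0 r₁ ∩ lowerSpace,
      ‖F (Ψ.symm w) / modelPow μ₁ μ₂ w‖ ≤ ‖C 0‖ + 1 := by
    have h := hlim.norm.eventually_le_const (lt_add_one ‖C 0‖)
    obtain ⟨s, hs, hsub⟩ := Metric.mem_nhdsWithin_iff.1 h
    refine ⟨min s R, lt_min hs hR, min_le_right _ _, fun w hw => hsub ⟨?_, hw.2⟩⟩
    exact Metric.ball_subset_ball (min_le_left _ _) hw.1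
  have hA' := hA.mono (Set.inter_subset_inter_left lowerSpace (Metric.ball_subset_ball hr₁R))
  have hcm : ContinuousOn (fun w => F (Ψ.symm w) / modelPow μ₁ μ₂ w)
      (Metric.ball 0 r₁ ∩ lowerSpace) := by
    refine hA'.continuousOn.div (fun w hw => ContinuousAt.continuousWithinAt ?_)
      fun w _ => modelPow_ne_zero μ₁ μ₂ w
    have := mem_lowerSpace.1 hw.2
    exact (ContinuousAt.comp (f := fun w : C3 => w 0) (continuousAt_powBelow this.1 μ₁)
      (continuous_apply 0).continuousAt).mul (ContinuousAt.comp (f := fun w : C3 => w 1)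
      (continuousAt_powBelow this.2 μ₂) (continuous_apply 1).continuousAt)
  -- `r ≤ 1` and `8 r ≤ r₁` keep the whole homotopy in the ball where the quotient by the model is
  -- bounded.
  filter_upwards [Ioo_mem_nhdsGT (show (0 : ℝ) < min 1 (r₁ / 8) by positivity)] with r hr a ha
  have hr0 := hr.1
  have hr1 : r ≤ 1 := hr.2.le.trans (min_le_left _ _)
  have hr8 : 8 * r ≤ r₁ := by linarith [hr.2.le.trans (min_le_right _ _)]
  have hpos : 0 < r ^ 2 - a := sub_pos.2 ha.2
  set κ : ℝ → ℝ := fun Λ => (r ^ 2 - a) / dip Λ⁻¹ r with hκdef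
  have hdip : Tendsto (fun Λ : ℝ => dip Λ⁻¹ r) atTop (𝓝 r) := by
    have h1 : Continuous fun δ : ℝ => dip δ r := continuous_dip.comp (continuous_id.prodMk continuous_const)
    have h2 : dip 0 r = r := by simp [dip, Real.sqrt_sq hr0.le]
    simpa [h2, Function.comp_def] using (h1.tendsto 0).comp tendsto_inv_atTop_zero
  have hκ' : 0 < (r ^ 2 - a) / r := div_pos hpos hr0
  have hκr : (r ^ 2 - a) / r < r := by
    rw [div_lt_iff₀ hr0]
    nlinarith [ha.1]
  have hκ : Tendsto κ atTop (𝓝 ((r ^ 2 - a) / r)) := tendsto_const_nhds.div hdip hr0.ne'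
  have hT := tendsto_integral_hankel_prod (μ₁ := μ₁) (μ₂ := μ₂) hκ' hκ hr0
    (show (1 + (r ^ 2 - a) / r) * r < r₁ by nlinarith) hcm hlim hB
  rw [hankel_eq_Iconst hκ' hμ₁, hankel_eq_Iconst hκ' hμ₂] at hT
  refine isEquivalent_of_tendsto_mul (m := fun Λ : ℝ => (Λ : ℂ) ^ (μ₁ + μ₂ + 2))
    (mul_ne_zero hC0 (mul_ne_zero (Iconst_ne_zero hμ₁) (Iconst_ne_zero hμ₂))) (hT.congr' ?_) ?_
  · filter_upwards [hdip.eventually_const_lt hr0,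
      hκ.eventually_lt_const (show (r ^ 2 - a) / r < 2 * r by linarith), eventually_gt_atTop 0,
      tendsto_inv_atTop_zero.eventually_le_const hr0] with Λ h1 h3 h4 h5
    have h2 : 0 < κ Λ := div_pos hpos h1
    have hδ := inv_pos.2 h4
    rw [PhiPrime_eq_dip hA' hr0 hr1 hr8 ha hδ h5 h2 h3.le (div_mul_cancel₀ _ h1.ne')]
    refine (cpow_mul_integral_dip (A := fun w => F (Ψ.symm w)) h2 h4 hr0 hA'.continuousOn
      fun t ht => ?_).symm
    simpa using contourBelow_homotopy_mem hr0 hr1 hr8 ha hδ h5 h2 h3.le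
      (Set.right_mem_Icc.2 zero_le_one) ht
  · filter_upwards [eventually_gt_atTop 0] with Λ hΛ
    have hΛc : (Λ : ℂ) ≠ 0 := Complex.ofReal_ne_zero.2 hΛ.ne'
    have : (Λ : ℂ) ^ (μ₁ + μ₂ + 2) * (Λ : ℂ) ^ (-μ₁ - μ₂ - 2) = 1 := by
      rw [← Complex.cpow_add _ _ hΛc]
      ring_nf
      exact Complex.cpow_zero _
    rw [Phi]
    linear_combination (C 0 * Iconst μ₁ * Iconst μ₂) * this


/-! ### Existence of normalized coordinates -/

theorem im_fderiv_toC3 {f : C3 → ℂ} {x₀ : R3} (hf : DifferentiableAt ℂ f (toC3 x₀))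
    (hreal : RealNear f x₀) (v : R3) : (fderiv ℂ f (toC3 x₀) (toC3 v)).im = 0 := by
  have h1 := Complex.imCLM.hasFDerivAt.comp x₀ (hasFDerivAt_comp_toC3 hf)
  have h2 : HasFDerivAt (fun _ : R3 => (0 : ℝ)) (0 : R3 →L[ℝ] ℝ) x₀ := hasFDerivAt_const 0 x₀
  have h3 := h1.unique (h2.congr_of_eventuallyEq (by
    filter_upwards [hreal] with x hx using hx))
  exact DFunLike.congr_fun h3 v

theorem clm_ext_single {f h : C3 →L[ℂ] ℂ}
    (hfh : ∀ i, f (Pi.single i 1) = h (Pi.single i 1)) : f = h := by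
  refine ContinuousLinearMap.coe_injective (LinearMap.pi_ext' fun i => LinearMap.ext_ring ?_)
  simpa using hfh i

theorem clm_ext_toC3 {f h : C3 →L[ℂ] ℂ} (hfh : ∀ v : R3, f (toC3 v) = h (toC3 v)) : f = h := by
  refine clm_ext_single fun i => ?_
  have e : toC3 (Pi.single i 1) = Pi.single i 1 := by
    ext j
    rcases eq_or_ne j i with rfl | hj <;> simp [toC3, *]
  rw [← e]
  exact hfh _

/-- The functional `v ↦ e · v`. -/
def dotL (e : R3) : C3 →L[ℂ] ℂ := ∑ i, (e i : ℂ) • ContinuousLinearMap.proj (R := ℂ) i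

theorem dotL_apply (e : R3) (v : C3) : dotL e v = ∑ i, (e i : ℂ) * v i := by
  simp [dotL]

theorem dotL_toC3 (e v : R3) : dotL e (toC3 v) = ((∑ i, e i * v i : ℝ) : ℂ) := by
  simp [dotL_apply, toC3]

theorem dotL_self_ne_zero {e : R3} (he : e ≠ 0) : dotL e (toC3 e) ≠ 0 := by
  rw [dotL_toC3, Complex.ofReal_ne_zero]
  intro h
  refine he (funext fun i => ?_)
  have := (Finset.sum_eq_zero_iff_of_nonneg fun i _ => mul_self_nonneg (e i)).1 h i
    (Finset.mem_univ i)
  exact mul_self_eq_zero.1 this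

/-- Lagrange multipliers. `L₁`, `L₂` and the scalar product with `e` form a basis of the dual space,
because the last one is nonzero on `e` while the others vanish there. As `M` vanishes on `e`, it has
no component along the last one. -/
theorem exists_real_multipliers {L₁ L₂ M : C3 →L[ℂ] ℂ} {e : R3}
    (hL : LinearIndependent ℂ ![L₁, L₂]) (he : e ≠ 0) (h₁ : L₁ (toC3 e) = 0)
    (h₂ : L₂ (toC3 e) = 0) (hM : M (toC3 e) = 0) (r₁ : ∀ v : R3, (L₁ (toC3 v)).im = 0)
    (r₂ : ∀ v : R3, (L₂ (toC3 v)).im = 0) (rM : ∀ v : R3, (M (toC3 v)).im = 0) :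
    (∀ v, L₁ v = 0 → L₂ v = 0 → dotL e v = 0 → v = 0) ∧
      ∃ a b : ℝ, M = (a : ℂ) • L₁ + (b : ℂ) • L₂ := by
  set f : Fin 3 → C3 →L[ℂ] ℂ := ![L₁, L₂, dotL e] with hf
  set A : Matrix (Fin 3) (Fin 3) ℂ := fun i j => f i (Pi.single j 1) with hA
  have hpair := LinearIndependent.pair_iff.1 hL
  have hse := dotL_self_ne_zero he
  have hli : ∀ a b c : ℂ, a • L₁ + b • L₂ + c • dotL e = 0 → a = 0 ∧ b = 0 ∧ c = 0 := by
    intro a b c h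
    have hc : c = 0 := by
      have := DFunLike.congr_fun h (toC3 e)
      simpa [h₁, h₂, hse] using this
    have := hpair a b (by
      ext v
      have := DFunLike.congr_fun h v
      simpa [hc] using this)
    exact ⟨this.1, this.2, hc⟩
  have hunit : IsUnit A := by
    rw [← Matrix.linearIndependent_rows_iff_isUnit, Fintype.linearIndependent_iff]
    intro c hc
    have h0 : c 0 • L₁ + c 1 • L₂ + c 2 • dotL e = 0 := by
      refine clm_ext_single fun j => ?_
      have := congr_fun hc j
      simpa [Fin.sum_univ_three, Matrix.row, hA, hf] using this
    obtain ⟨q0, q1, q2⟩ := hli _ _ _ h0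
    intro i
    fin_cases i
    · exact q0
    · exact q1
    · exact q2
  have hAv : ∀ v i, A.mulVec v i = f i v := by
    intro v i
    have : v = ∑ j, v j • (Pi.single j 1 : C3) := by
      ext k
      simp [Finset.sum_apply, Pi.single_apply]
    conv_rhs => rw [this]
    simp [Matrix.mulVec, dotProduct, hA, mul_comm]
  refine ⟨fun v v1 v2 v3 => Matrix.mulVec_injective_iff_isUnit.2 hunit ?_, ?_⟩
  · ext i
    rw [hAv, Matrix.mulVec_zero]
    fin_cases i
    · exact v1
    · exact v2
    · exact v3
  · obtain ⟨c, hc⟩ := Matrix.vecMul_surjective_iff_isUnit.2 hunit fun j => M (Pi.single j 1)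
    have hMc : M = c 0 • L₁ + c 1 • L₂ + c 2 • dotL e := by
      refine clm_ext_single fun j => ?_
      have := congr_fun hc j
      simp only [Matrix.vecMul, dotProduct, Fin.sum_univ_three, hA, hf] at this
      simpa using this.symm
    have hc2 : c 2 = 0 := by
      have := DFunLike.congr_fun hMc (toC3 e)
      simpa [h₁, h₂, hM, hse] using this
    replace hMc : M = c 0 • L₁ + c 1 • L₂ := by
      ext v
      have := DFunLike.congr_fun hMc v
      simpa [hc2] using this
    -- On real vectors everything is real, so the imaginary parts of the multipliers give a linear
    -- relation between `L₁` and `L₂`, which must be trivial.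
    have him : ((c 0).im : ℂ) • L₁ + ((c 1).im : ℂ) • L₂ = 0 := by
      refine clm_ext_toC3 fun v => ?_
      have h := congr_arg Complex.im (DFunLike.congr_fun hMc (toC3 v))
      simp only [add_apply, smul_apply, smul_eq_mul, Complex.add_im, Complex.mul_im, rM, r₁, r₂,
        mul_zero, zero_add] at h
      apply Complex.ext
      · simpa [r₁, r₂] using h.symm
      · simp [r₁, r₂]
    obtain ⟨q0, q1⟩ := hpair _ _ him
    refine ⟨(c 0).re, (c 1).re, ?_⟩
    have p0 : ((c 0).re : ℂ) = c 0 := Complex.ext rfl (by simpa using (Complex.ofReal_eq_zero.1 q0).symm)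
    have p1 : ((c 1).re : ℂ) = c 1 := Complex.ext rfl (by simpa using (Complex.ofReal_eq_zero.1 q1).symm)
    rw [p0, p1, hMc]


theorem taylor_two_isBigO {k : ℂ → ℂ} (hk : AnalyticAt ℂ k 0) :
    (fun s => k s - (k 0 + deriv k 0 * s + deriv (deriv k) 0 / 2 * s ^ 2)) =O[𝓝 0]
      fun s => ‖s‖ ^ 3 := by
  have h := hk.hasFPowerSeriesAt.isBigO_sub_partialSum_pow 3
  refine h.congr_left fun s => ?_
  have e : iteratedDeriv 2 k 0 = deriv (deriv k) 0 := by
    rw [iteratedDeriv_succ, iteratedDeriv_one]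
  simp only [FormalMultilinearSeries.partialSum, Finset.sum_range_succ, Finset.sum_range_zero,
    FormalMultilinearSeries.ofScalars_apply_eq, e]
  simp

theorem eventually_im_deriv_eq_zero {k : ℂ → ℂ} (hk : AnalyticAt ℂ k 0)
    (hreal : ∀ᶠ s : ℝ in 𝓝 0, (k s).im = 0) : ∀ᶠ s : ℝ in 𝓝 0, (deriv k s).im = 0 := by
  have h0 : Tendsto (fun s : ℝ => (s : ℂ)) (𝓝 0) (𝓝 0) :=
    Complex.continuous_ofReal.tendsto' 0 0 Complex.ofReal_zero
  filter_upwards [hreal.eventually_nhds, h0.eventually hk.eventually_analyticAt] with s h1 h2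
  have h3 : HasDerivAt (fun t : ℝ => k t) (deriv k s) s :=
    h2.differentiableAt.hasDerivAt.comp_ofReal
  have h4 := Complex.imCLM.hasFDerivAt.comp_hasDerivAt s h3
  have h5 : HasDerivAt (fun _ : ℝ => (0 : ℝ)) 0 s := hasDerivAt_const s 0
  exact h4.unique (h5.congr_of_eventuallyEq (by filter_upwards [h1] with t ht using ht))

/-- As `k' (0) = 0`, the second derivative of the composition at `0` is the real part of `k'' (0) s'
(0)²`. This transfers nondegeneracy from the given parametrization of the crossing line to the third
coordinate. -/
theorem deriv_deriv_ne_zero_of_comp {k : ℂ → ℂ} {s φ : ℝ → ℝ} (hk : AnalyticAt ℂ k 0)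
    (hk0 : deriv k 0 = 0) (hs : ContDiffAt ℝ 2 s 0) (hs0 : s 0 = 0)
    (hφ : φ =ᶠ[𝓝 0] fun t => (k (s t)).re) (hne : deriv (deriv φ) 0 ≠ 0) :
    deriv (deriv k) 0 ≠ 0 := by
  intro h0
  have t0 : Tendsto (fun t => (s t : ℂ)) (𝓝 0) (𝓝 0) :=
    (Complex.continuous_ofReal.tendsto' 0 0 Complex.ofReal_zero).comp
      (by simpa only [hs0] using hs.continuousAt.tendsto)
  have hsd : ∀ᶠ t in 𝓝 0, HasDerivAt s (deriv s t) t := by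
    filter_upwards [hs.eventually (by simp)] with t ht
    exact (ht.differentiableAt two_ne_zero).hasDerivAt
  have h1 : deriv φ =ᶠ[𝓝 0] fun t => (deriv k (s t) * ((deriv s t : ℝ) : ℂ)).re := by
    filter_upwards [hφ.eventuallyEq_nhds, hsd, t0.eventually hk.eventually_analyticAt]
      with t e1 e2 e3
    rw [e1.deriv_eq]
    have e4 := HasDerivAt.comp t (e3.differentiableAt.hasDerivAt) e2.ofReal_comp
    exact (Complex.reCLM.hasFDerivAt.comp_hasDerivAt t e4).deriv
  have h2 : HasDerivAt (deriv s) (deriv (deriv s) 0) 0 := by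
    have : ContDiffAt ℝ 1 (deriv s) 0 := 
      (hs.fderiv_right (m := 1) (by norm_num)).clm_apply contDiffAt_const
    exact (this.differentiableAt one_ne_zero).hasDerivAt
  have h3 : HasDerivAt (fun t => deriv k (s t)) (deriv (deriv k) (s 0) * ((deriv s 0 : ℝ) : ℂ)) 0 := by
    have e : HasDerivAt (deriv k) (deriv (deriv k) (s 0)) (s 0 : ℂ) := by
      rw [hs0, Complex.ofReal_zero]
      exact hk.deriv.differentiableAt.hasDerivAt
    exact HasDerivAt.comp (h := fun t => (s t : ℂ)) (0 : ℝ) e hsd.self_of_nhds.ofReal_comp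
  have h4 := Complex.reCLM.hasFDerivAt.comp_hasDerivAt (0 : ℝ) (h3.mul h2.ofReal_comp)
  refine hne ?_
  rw [h1.deriv_eq]
  refine h4.deriv.trans ?_
  simp [hs0, h0, hk0]

/-- After the linear part is removed, the derivative is `O(‖w‖)`; moving from `w` to its projection
on the third axis therefore costs `O(‖w‖ (‖w 0‖ + ‖w 1‖))`. On the axis, Taylor's formula in one
variable leaves a cubic error. -/
theorem phase_normal_form {H : C3 → ℂ} (hH : AnalyticAt ℂ H 0)
    (hd : ∀ w, fderiv ℂ H 0 w = w 0 + w 1) {β : ℂ}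
    (hβ : deriv (deriv fun s : ℂ => H (s • Pi.single 2 1)) 0 = β) :
    (fun w => H w - (H 0 + w 0 + w 1 + β / 2 * w 2 ^ 2)) =O[𝓝 0]
      fun w => ‖w‖ * (‖w 0‖ + ‖w 1‖) + ‖w 2‖ ^ 3 := by
  set k : ℂ → ℂ := fun s => H (s • Pi.single 2 1) with hk
  set ℓ : C3 →L[ℂ] ℂ := 
    ContinuousLinearMap.proj (R := ℂ) (φ := fun _ : Fin 3 => ℂ) 0 +
      ContinuousLinearMap.proj (R := ℂ) (φ := fun _ : Fin 3 => ℂ) 1 with hℓ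
  have hlin : HasDerivAt (fun s : ℂ => s • (Pi.single 2 1 : C3)) (Pi.single 2 1) 0 := by
    simpa using (hasDerivAt_id (0 : ℂ)).smul_const (f := (Pi.single 2 1 : C3))
  have hH' : AnalyticAt ℂ H ((0 : ℂ) • (Pi.single 2 1 : C3)) := by rwa [zero_smul]
  have hka : AnalyticAt ℂ k 0 := AnalyticAt.fun_comp (f := fun s : ℂ => s • (Pi.single 2 1 : C3)) hH'
    (analyticAt_id.smul analyticAt_const)
  have hk0 : deriv k 0 = 0 := by
    have := (hH'.differentiableAt.hasFDerivAt.comp_hasDerivAt (0 : ℂ) hlin).deriv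
    rw [zero_smul, hd] at this
    simpa [hk, Function.comp_def] using this
  set D : C3 → ℂ := fun w => H w - ℓ w with hD
  have hDa : AnalyticAt ℂ D 0 := hH.sub (ℓ.analyticAt 0)
  have hD0 : fderiv ℂ D 0 = 0 := by
    rw [hD, fderiv_fun_sub hH.differentiableAt ℓ.differentiableAt, ℓ.fderiv, sub_eq_zero]
    ext1 w
    simpa [hℓ] using hd w
  obtain ⟨K, hK⟩ := (hDa.fderiv.differentiableAt.isBigO_sub).bound
  obtain ⟨δ, hδ, hball⟩ := Metric.eventually_nhds_iff_ball.1 (hK.and hDa.eventually_analyticAt)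
  have hmean : (fun w => D w - D (w 2 • Pi.single 2 1)) =O[𝓝 0]
      fun w => ‖w‖ * (‖w 0‖ + ‖w 1‖) + ‖w 2‖ ^ 3 := by
    refine IsBigO.of_bound |K| ?_
    filter_upwards [Metric.ball_mem_nhds (0 : C3) hδ] with w hw
    rw [mem_ball_zero_iff] at hw
    have hsub : Metric.closedBall (0 : C3) ‖w‖ ⊆ Metric.ball 0 δ :=
      Metric.closedBall_subset_ball hw
    have hw' : w 2 • (Pi.single 2 1 : C3) ∈ Metric.closedBall (0 : C3) ‖w‖ := by
      rw [mem_closedBall_zero_iff, norm_smul]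
      have : ‖(Pi.single 2 1 : C3)‖ = 1 := by
        rw [Pi.norm_single, norm_one]
      rw [this, mul_one]
      exact norm_le_pi_norm w 2
    have hmv := Convex.norm_image_sub_le_of_norm_fderiv_le (𝕜 := ℂ) (f := D) (C := |K| * ‖w‖)
      (fun x hx => (hball x (hsub hx)).2.differentiableAt) (fun x hx => by
        have h1 := (hball x (hsub hx)).1
        rw [hD0, sub_zero, sub_zero] at h1
        have h2 := mem_closedBall_zero_iff.1 hx
        calc _ ≤ K * ‖x‖ := h1
          _ ≤ |K| * ‖w‖ := by gcongr; exact le_abs_self K)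
      (convex_closedBall _ _) hw' (mem_closedBall_zero_iff.2 le_rfl)
    have hdist : ‖w - w 2 • (Pi.single 2 1 : C3)‖ ≤ ‖w 0‖ + ‖w 1‖ := by
      rw [pi_norm_le_iff_of_nonneg (by positivity)]
      intro i
      fin_cases i <;> simp
      positivity
    have hnn : 0 ≤ ‖w‖ * (‖w 0‖ + ‖w 1‖) + ‖w 2‖ ^ 3 := by positivity
    rw [Real.norm_of_nonneg hnn]
    calc ‖D w - D (w 2 • Pi.single 2 1)‖ ≤ |K| * ‖w‖ * ‖w - w 2 • (Pi.single 2 1 : C3)‖ := hmv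
      _ ≤ |K| * ‖w‖ * (‖w 0‖ + ‖w 1‖) := by gcongr
      _ = |K| * (‖w‖ * (‖w 0‖ + ‖w 1‖)) := by ring
      _ ≤ _ := by
        gcongr
        exact le_add_of_nonneg_right (by positivity)
  have htay : (fun w : C3 => k (w 2) - (k 0 + deriv k 0 * w 2 + deriv (deriv k) 0 / 2 * w 2 ^ 2))
      =O[𝓝 0] fun w => ‖w‖ * (‖w 0‖ + ‖w 1‖) + ‖w 2‖ ^ 3 := by
    have h2 : Tendsto (fun w : C3 => w 2) (𝓝 0) (𝓝 0) := (continuous_apply 2).tendsto' 0 0 rfl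
    refine ((taylor_two_isBigO hka).comp_tendsto h2).trans (IsBigO.of_bound 1 (Eventually.of_forall
      fun w => ?_))
    have hnn : 0 ≤ ‖w‖ * (‖w 0‖ + ‖w 1‖) := by positivity
    simp only [Function.comp_apply, one_mul]
    rw [Real.norm_of_nonneg (by positivity), Real.norm_of_nonneg (by positivity)]
    linarith
  refine (hmean.add htay).congr_left fun w => ?_
  rw [hk0, hβ]
  simp [hD, hk, hℓ]
  ring


/-- The inverse function theorem for holomorphic maps that are real at real points. -/
theorem exists_real_biholomorphism {Φ : C3 → C3} {x₀ : R3} (hΦ : AnalyticAt ℂ Φ (toC3 x₀))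
    (h0 : Φ (toC3 x₀) = 0) (hinj : ∀ v, fderiv ℂ Φ (toC3 x₀) v = 0 → v = 0)
    (hreal : ∀ᶠ x in 𝓝 x₀, ∀ i, (Φ (toC3 x) i).im = 0) :
    ∃ Ψ : OpenPartialHomeomorph C3 C3, (Ψ : C3 → C3) = Φ ∧ toC3 x₀ ∈ Ψ.source ∧
      AnalyticOnNhd ℂ Ψ Ψ.source ∧ AnalyticOnNhd ℂ Ψ.symm Ψ.target ∧
      ∀ ξ ∈ Ψ.source, (∀ i, (ξ i).im = 0) ↔ ∀ i, (Ψ ξ i).im = 0 := by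
  have hinj' : Function.Injective (fderiv ℂ Φ (toC3 x₀)).toLinearMap :=
    (injective_iff_map_eq_zero _).2 hinj
  set T : C3 ≃L[ℂ] C3 := (LinearEquiv.ofInjectiveEndo _ hinj').toContinuousLinearEquiv with hT
  have hTe : fderiv ℂ Φ (toC3 x₀) = (T : C3 →L[ℂ] C3) := by
    ext1 v
    rfl
  have hs : HasStrictFDerivAt Φ (T : C3 →L[ℂ] C3) (toC3 x₀) := hTe ▸ hΦ.hasStrictFDerivAt
  set P := hs.toOpenPartialHomeomorph Φ with hP
  have hPc : (P : C3 → C3) = Φ := hs.toOpenPartialHomeomorph_coe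
  have hPm : toC3 x₀ ∈ P.source := hs.mem_toOpenPartialHomeomorph_source
  have hsymm : AnalyticAt ℂ P.symm (Φ (toC3 x₀)) := by
    have := P.analyticAt_symm' (i := T) hPm (by rwa [hPc]) (by rw [hPc, hTe])
    rwa [hPc] at this
  have hct : Continuous toC3 := toC3L.continuous
  have hre : reL (toC3 x₀) = x₀ := reL_toC3 x₀
  set φ : R3 → R3 := realMap Φ with hφ
  have hφ0 : φ x₀ = 0 := by rw [hφ, realMap, h0, map_zero]
  -- The complex derivative extends the real one, so the real derivative is injective too, and the
  -- real inverse function theorem applies.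
  have hinjr : Function.Injective (fderiv ℝ φ x₀).toLinearMap := by
    refine (injective_iff_map_eq_zero _).2 fun v hv => ?_
    have h1 := toC3_fderiv_realMap hΦ hreal v
    have h2 : fderiv ℝ (realMap Φ) x₀ v = 0 := hv
    rw [h2] at h1
    have h3 := hinj _ (h1.trans (by ext; simp [toC3]))
    exact toC3_injective (h3.trans (by ext; simp [toC3]))
  set S : R3 ≃L[ℝ] R3 := (LinearEquiv.ofInjectiveEndo _ hinjr).toContinuousLinearEquiv with hS
  have hSe : fderiv ℝ φ x₀ = (S : R3 →L[ℝ] R3) := by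
    ext1 v
    rfl
  have hsr : HasStrictFDerivAt φ (S : R3 →L[ℝ] R3) x₀ :=
    hSe ▸ (contDiffAt_realMap hΦ (n := 1)).hasStrictFDerivAt one_ne_zero
  have hmap := hsr.map_nhds_eq_of_equiv
  rw [hφ0] at hmap
  have hX : ∀ᶠ x in 𝓝 x₀, (∀ i, (Φ (toC3 x) i).im = 0) ∧ toC3 x ∈ P.source :=
    hreal.and (hct.continuousAt.eventually_mem (P.open_source.mem_nhds hPm))
  -- Every real point of a small ball is the value of `Φ` at a real point of the source.
  obtain ⟨δ, hδ, hball⟩ := Metric.mem_nhds_iff.1 (hmap ▸ image_mem_map hX)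
  have hW : ∀ᶠ ξ in 𝓝 (toC3 x₀), AnalyticAt ℂ Φ ξ ∧ AnalyticAt ℂ P.symm (Φ ξ) ∧ ‖Φ ξ‖ < δ ∧
      ∀ i, (Φ (toC3 (reL ξ)) i).im = 0 := by
    refine hΦ.eventually_analyticAt.and ((hΦ.continuousAt.eventually
      hsymm.eventually_analyticAt).and (((hΦ.continuousAt.norm).eventually_lt_const
        (by simpa [h0] using hδ)).and ?_))
    exact (reL.continuous.tendsto' (toC3 x₀) x₀ hre).eventually hreal
  obtain ⟨W, hWsub, hWo, hWm⟩ := mem_nhds_iff.1 hW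
  have hsrc : (P.restrOpen W hWo).source = P.source ∩ W := P.restrOpen_source W hWo
  refine ⟨P.restrOpen W hWo, hPc, hsrc ▸ ⟨hPm, hWm⟩, fun ξ hξ => ?_, fun w hw => ?_, fun ξ hξ => ?_⟩
  · rw [hsrc] at hξ
    change AnalyticAt ℂ P ξ
    rw [hPc]
    exact (hWsub hξ.2).1
  · have hm := (P.restrOpen W hWo).map_target hw
    have hr := (P.restrOpen W hWo).right_inv hw
    rw [hsrc] at hm
    have := (hWsub hm.2).2.1
    rw [← hPc] at this
    exact hr ▸ this
  · rw [hsrc] at hξ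
    change _ ↔ ∀ i, (P ξ i).im = 0
    rw [hPc]
    obtain ⟨-, -, hnorm, hr⟩ := hWsub hξ.2
    constructor
    · intro h
      rwa [toC3_reL h] at hr
    · intro h
      have hy : reL (Φ ξ) ∈ Metric.ball 0 δ := by
        rw [mem_ball_zero_iff]
        refine lt_of_le_of_lt ?_ hnorm
        rw [pi_norm_le_iff_of_nonneg (norm_nonneg _)]
        intro i
        exact (Complex.abs_re_le_norm _).trans (norm_le_pi_norm (Φ ξ) i)
      -- If `Φ ξ` is real, it is also attained at a real point, and injectivity on the source
      -- identifies this point with `ξ`.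
      obtain ⟨x, ⟨hx1, hx2⟩, hx3⟩ := hball hy
      have e : Φ (toC3 x) = Φ ξ := by
        rw [← toC3_reL hx1, ← toC3_reL h]
        exact congr_arg toC3 hx3
      have : toC3 x = ξ := P.injOn hx2 hξ.1 (by rw [hPc, e])
      rw [← this]
      intro i
      simp [toC3]

/-- Criticality along the crossing makes `∇G` a combination of `∇g₁` and `∇g₂`; its coefficients are
`α₁` and `α₂`. With `α₁ g₁` and `α₂ g₂` as coordinates the linear part of `G` is `w₁ + w₂`, and any
third real coordinate that is regular along the crossing line gives the normal form. -/
theorem exists_isNormalizedChart {G g₁ g₂ : C3 → ℂ} {x₀ : R3}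
    (hG : AnalyticAt ℂ G (toC3 x₀)) (hGreal : RealNear G x₀)
    (hg₁ : AnalyticAt ℂ g₁ (toC3 x₀)) (hg₁real : RealNear g₁ x₀)
    (hg₂ : AnalyticAt ℂ g₂ (toC3 x₀)) (hg₂real : RealNear g₂ x₀)
    (hx₁ : g₁ (toC3 x₀) = 0) (hx₂ : g₂ (toC3 x₀) = 0)
    (htrans : LinearIndependent ℂ ![fderiv ℂ g₁ (toC3 x₀), fderiv ℂ g₂ (toC3 x₀)])
    (hcrit : IsNondegenerateCriticalOnCrossing G g₁ g₂ x₀)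
    (hns₁ : ∀ c : ℂ, fderiv ℂ G (toC3 x₀) ≠ c • fderiv ℂ g₁ (toC3 x₀))
    (hns₂ : ∀ c : ℂ, fderiv ℂ G (toC3 x₀) ≠ c • fderiv ℂ g₂ (toC3 x₀)) :
    ∃ (Ψ : OpenPartialHomeomorph C3 C3) (α₁ α₂ β : ℝ),
      IsNormalizedChart G g₁ g₂ x₀ Ψ α₁ α₂ β := by
  obtain ⟨c, hc, hc0, hce, hcg, hcd, hcdd⟩ := hcrit
  set e := deriv c 0 with he
  have hcder : HasDerivAt c e 0 := (hc.differentiableAt two_ne_zero).hasDerivAt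
  have hcomp : ∀ {f : C3 → ℂ}, AnalyticAt ℂ f (toC3 x₀) →
      HasDerivAt (fun t => f (toC3 (c t))) (fderiv ℂ f (toC3 x₀) (toC3 e)) 0 := by
    intro f hf
    rw [← hc0] at hf ⊢
    exact (hasFDerivAt_comp_toC3 hf.differentiableAt).comp_hasDerivAt (0 : ℝ) hcder
  have hz : ∀ {f : C3 → ℂ}, AnalyticAt ℂ f (toC3 x₀) → (∀ᶠ t in 𝓝 (0 : ℝ), f (toC3 (c t)) = 0) →
      fderiv ℂ f (toC3 x₀) (toC3 e) = 0 := fun hf h =>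
    (hcomp hf).unique ((hasDerivAt_const (0 : ℝ) (0 : ℂ)).congr_of_eventuallyEq h)
  have hM : fderiv ℂ G (toC3 x₀) (toC3 e) = 0 := by
    have h1 := (Complex.reCLM.hasFDerivAt.comp_hasDerivAt (0 : ℝ) (hcomp hG)).deriv
    exact Complex.ext (h1.symm.trans hcd) (im_fderiv_toC3 hG.differentiableAt hGreal e)
  obtain ⟨hker, α₁, α₂, hα⟩ := exists_real_multipliers htrans hce
    (hz hg₁ (hcg.mono fun _ h => h.1)) (hz hg₂ (hcg.mono fun _ h => h.2)) hM
    (im_fderiv_toC3 hg₁.differentiableAt hg₁real) (im_fderiv_toC3 hg₂.differentiableAt hg₂real)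
    (im_fderiv_toC3 hG.differentiableAt hGreal)
  -- If one multiplier vanished, `∇G` would be a multiple of the other gradient.
  have hα₁ : α₁ ≠ 0 := by
    rintro rfl
    refine hns₂ α₂ (hα.trans ?_)
    ext1 v
    simp
  have hα₂ : α₂ ≠ 0 := by
    rintro rfl
    refine hns₁ α₁ (hα.trans ?_)
    ext1 v
    simp
  -- The third coordinate is the scalar product with the tangent `e` of the crossing line, which is
  -- nonzero on that line's direction.
  set Φ : C3 → C3 := fun ξ => ![α₁ * g₁ ξ, α₂ * g₂ ξ, dotL e (ξ - toC3 x₀)] with hΦ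
  have hΦa : AnalyticAt ℂ Φ (toC3 x₀) := by
    rw [analyticAt_pi_iff]
    intro i
    fin_cases i
    · exact analyticAt_const.mul hg₁
    · exact analyticAt_const.mul hg₂
    · exact AnalyticAt.fun_comp (f := fun ξ : C3 => ξ - toC3 x₀) ((dotL e).analyticAt _)
        (analyticAt_id.sub analyticAt_const)
  have hΦ0 : Φ (toC3 x₀) = 0 := by
    ext i
    fin_cases i <;> simp [hΦ, hx₁, hx₂]
  have hΦd : ∀ v, fderiv ℂ Φ (toC3 x₀) v = ![α₁ * fderiv ℂ g₁ (toC3 x₀) v,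
      α₂ * fderiv ℂ g₂ (toC3 x₀) v, dotL e v] := by
    intro v
    have h := hasFDerivAt_pi'.1 hΦa.differentiableAt.hasFDerivAt
    ext i
    fin_cases i
    · exact DFunLike.congr_fun ((h 0).unique
        (hg₁.differentiableAt.hasFDerivAt.const_mul (α₁ : ℂ))) v
    · exact DFunLike.congr_fun ((h 1).unique
        (hg₂.differentiableAt.hasFDerivAt.const_mul (α₂ : ℂ))) v
    · exact DFunLike.congr_fun ((h 2).unique ((dotL e).hasFDerivAt.comp (toC3 x₀)
        ((hasFDerivAt_id (toC3 x₀)).sub_const (toC3 x₀)))) v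
  have hα₁c : (α₁ : ℂ) ≠ 0 := Complex.ofReal_ne_zero.2 hα₁
  have hα₂c : (α₂ : ℂ) ≠ 0 := Complex.ofReal_ne_zero.2 hα₂
  have hdot : ∀ x : R3, dotL e (toC3 x - toC3 x₀) = ((∑ i, e i * (x i - x₀ i) : ℝ) : ℂ) := by
    intro x
    rw [← dotL_toC3 e fun i => x i - x₀ i]
    congr 1
    ext i
    simp [toC3]
  obtain ⟨Ψ, hΨ, hsrc, han, hans, hreal⟩ := exists_real_biholomorphism hΦa hΦ0 (fun v hv => by
    rw [hΦd] at hv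
    have v0 : α₁ * fderiv ℂ g₁ (toC3 x₀) v = 0 := congr_fun hv 0
    have v1 : α₂ * fderiv ℂ g₂ (toC3 x₀) v = 0 := congr_fun hv 1
    have v2 : dotL e v = 0 := congr_fun hv 2
    exact hker v ((mul_eq_zero.1 v0).resolve_left hα₁c) ((mul_eq_zero.1 v1).resolve_left hα₂c) v2) (by
    filter_upwards [hg₁real, hg₂real] with x h1 h2
    intro i
    fin_cases i
    · simp [hΦ, h1]
    · simp [hΦ, h2]
    · exact (congr_arg Complex.im (hdot x)).trans (Complex.ofReal_im _))
  have hΨ0 : Ψ (toC3 x₀) = 0 := by rw [hΨ, hΦ0]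
  have h0t : (0 : C3) ∈ Ψ.target := hΨ0 ▸ Ψ.map_source hsrc
  have hs0 : Ψ.symm 0 = toC3 x₀ := by rw [← hΨ0, Ψ.left_inv hsrc]
  set H : C3 → ℂ := fun w => G (Ψ.symm w) with hH
  have hHa : AnalyticAt ℂ H 0 :=
    AnalyticAt.fun_comp (f := Ψ.symm) (by rwa [hs0]) (hans 0 h0t)
  have hHd : ∀ w, fderiv ℂ H 0 w = w 0 + w 1 := by
    intro w
    have d1 : HasFDerivAt Ψ.symm (fderiv ℂ Ψ.symm 0) 0 := (hans 0 h0t).differentiableAt.hasFDerivAt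
    have d2 : HasFDerivAt Φ (fderiv ℂ Φ (toC3 x₀)) (Ψ.symm 0) := by
      rw [hs0]
      exact hΦa.differentiableAt.hasFDerivAt
    have d3 : HasFDerivAt G (fderiv ℂ G (toC3 x₀)) (Ψ.symm 0) := by
      rw [hs0]
      exact hG.differentiableAt.hasFDerivAt
    have d4 : (fderiv ℂ Φ (toC3 x₀)).comp (fderiv ℂ Ψ.symm 0) = ContinuousLinearMap.id ℂ C3 := by
      refine (d2.comp 0 d1).unique ((hasFDerivAt_id (0 : C3)).congr_of_eventuallyEq ?_)
      filter_upwards [Ψ.open_target.mem_nhds h0t] with z hz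
      exact (congr_fun hΨ _).symm.trans (Ψ.right_inv hz)
    have d5 := DFunLike.congr_fun d4 w
    rw [ContinuousLinearMap.comp_apply, hΦd] at d5
    have d6 : HasFDerivAt H ((fderiv ℂ G (toC3 x₀)).comp (fderiv ℂ Ψ.symm 0)) 0 := d3.comp 0 d1
    rw [d6.fderiv, ContinuousLinearMap.comp_apply, hα]
    exact congr_arg₂ (· + ·) (congr_fun d5 0) (congr_fun d5 1)
  set k : ℂ → ℂ := fun s => H (s • Pi.single 2 1) with hk
  have hH' : AnalyticAt ℂ H ((0 : ℂ) • (Pi.single 2 1 : C3)) := by rwa [zero_smul]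
  have hka : AnalyticAt ℂ k 0 :=
    AnalyticAt.fun_comp (f := fun s : ℂ => s • (Pi.single 2 1 : C3)) hH'
      (analyticAt_id.smul analyticAt_const)
  have hk0 : deriv k 0 = 0 := by
    have hlin : HasDerivAt (fun s : ℂ => s • (Pi.single 2 1 : C3)) (Pi.single 2 1) 0 := by
      simpa using (hasDerivAt_id (0 : ℂ)).smul_const (f := (Pi.single 2 1 : C3))
    have := (hH'.differentiableAt.hasFDerivAt.comp_hasDerivAt (0 : ℂ) hlin).deriv
    rw [zero_smul, hHd] at this
    simpa [hk, Function.comp_def] using this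
  have hHreal : ∀ᶠ y : R3 in 𝓝 0, (H (toC3 y)).im = 0 := by
    have t1 : Tendsto (fun y : R3 => toC3 y) (𝓝 0) (𝓝 0) :=
      toC3L.continuous.tendsto' 0 0 (map_zero _)
    have t2 : Tendsto (fun y : R3 => reL (Ψ.symm (toC3 y))) (𝓝 0) (𝓝 x₀) := by
      have : Tendsto Ψ.symm (𝓝 0) (𝓝 (toC3 x₀)) := by
        rw [← hs0]
        exact (hans 0 h0t).continuousAt
      have h3 := (reL.continuous.tendsto (toC3 x₀)).comp (this.comp t1)
      rwa [reL_toC3] at h3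
    filter_upwards [t2.eventually hGreal, t1.eventually_mem (Ψ.open_target.mem_nhds h0t)]
      with y h1 h2
    rwa [toC3_reL ((hreal _ (Ψ.map_target h2)).2 (by
      rw [Ψ.right_inv h2]
      intro i
      simp [toC3]))] at h1
  have hkreal : ∀ᶠ s : ℝ in 𝓝 0, (k s).im = 0 := by
    have t : Tendsto (fun s : ℝ => s • (Pi.single 2 1 : R3)) (𝓝 0) (𝓝 0) :=
      Continuous.tendsto' (by fun_prop) 0 0 (zero_smul _ _)
    filter_upwards [t.eventually hHreal] with s hs
    convert hs using 3
    ext i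
    fin_cases i <;> simp [toC3]
  have hβreal : (deriv (deriv k) 0).im = 0 := by
    simpa using (eventually_im_deriv_eq_zero hka.deriv
      (eventually_im_deriv_eq_zero hka hkreal)).self_of_nhds
  have hβ : deriv (deriv k) 0 = ((deriv (deriv k) 0).re : ℂ) := Complex.ext rfl (by simpa using hβreal)
  set s : ℝ → ℝ := fun t => ∑ i, e i * (c t i - x₀ i) with hs
  have hsc : ContDiffAt ℝ 2 s 0 := ContDiffAt.sum fun i _ =>
    contDiffAt_const.mul ((contDiffAt_pi.1 hc i).sub contDiffAt_const)
  have hβne : deriv (deriv k) 0 ≠ 0 := by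
    refine deriv_deriv_ne_zero_of_comp hka hk0 hsc (by simp [hs, hc0]) ?_ hcdd
    have t1 : Tendsto (fun t => toC3 (c t)) (𝓝 0) (𝓝 (toC3 x₀)) := by
      rw [← hc0]
      exact (toC3L.continuous.tendsto _).comp hc.continuousAt
    filter_upwards [hcg, t1.eventually_mem (Ψ.open_source.mem_nhds hsrc)] with t h1 h2
    -- In the new coordinates the crossing line is the third axis, reparametrized by `s`.
    have h3 : Ψ (toC3 (c t)) = (s t : ℂ) • Pi.single 2 1 := by
      rw [hΨ]
      ext i
      fin_cases i
      · simp [hΦ, h1.1]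
      · simp [hΦ, h1.2]
      · simpa [hΦ, hs] using hdot (c t)
    simp only [hk, hH]
    rw [← h3, Ψ.left_inv h2]
  refine ⟨Ψ, α₁, α₂, (deriv (deriv k) 0).re, hsrc, hΨ0, han, hans, hreal, hα₁, hα₂, fun h => ?_,
    fun ξ _ => ?_, fun ξ _ => ?_, ?_⟩
  · exact hβne (Complex.ext h hβreal)
  · rw [hΨ]
    rfl
  · rw [hΨ]
    rfl
  · have := phase_normal_form hHa hHd hβ
    rwa [show H 0 = G (toC3 x₀) from congr_arg G hs0] at this

end CrossingPhase
end

theorem mainTheorem2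
    (F G g₁ g₂ : C3 → ℂ) (x₀ : R3) (η₀ : R3 → R3)
    -- the phase function and the two singularities: holomorphic and real near the real point
    (hG : AnalyticAt ℂ G (toC3 x₀)) (hGreal : RealNear G x₀)
    (hg₁ : AnalyticAt ℂ g₁ (toC3 x₀)) (hg₁real : RealNear g₁ x₀)
    (hg₂ : AnalyticAt ℂ g₂ (toC3 x₀)) (hg₂real : RealNear g₂ x₀)
    -- the point lies on both singularities, which cross transversally there
    (hx₁ : g₁ (toC3 x₀) = 0) (hx₂ : g₂ (toC3 x₀) = 0)
    (htrans : LinearIndependent ℂ ![fderiv ℂ g₁ (toC3 x₀), fderiv ℂ g₂ (toC3 x₀)])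
    -- it is a nondegenerate critical point along the crossing line
    (hcrit : IsNondegenerateCriticalOnCrossing G g₁ g₂ x₀)
    -- it is not a stationary phase point on either of the two singularities
    (hns₁ : ∀ c : ℂ, fderiv ℂ G (toC3 x₀) ≠ c • fderiv ℂ g₁ (toC3 x₀))
    (hns₂ : ∀ c : ℂ, fderiv ℂ G (toC3 x₀) ≠ c • fderiv ℂ g₂ (toC3 x₀))
    -- the initial domain, displaced along a field that is transversal to both singularities
    (hη₀ : Continuous η₀)
    (hside₁ : gradDot g₁ x₀ (η₀ x₀) ≠ 0) (hside₂ : gradDot g₂ x₀ (η₀ x₀) ≠ 0)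
    -- the branch of the amplitude along the initial domain, singular at most on `g₁ g₂ = 0`
    (hF : ∃ V ∈ 𝓝 (toC3 x₀), AnalyticOnNhd ℂ F
      (V ∩ (sideDomain g₁ (gradDot g₁ x₀ (η₀ x₀)) ∩ sideDomain g₂ (gradDot g₂ x₀ (η₀ x₀))))) :
    -- normalized coordinates exist
    (∃ (Ψ : OpenPartialHomeomorph C3 C3) (α₁ α₂ β : ℝ),
      IsNormalizedChart G g₁ g₂ x₀ Ψ α₁ α₂ β) ∧
    -- in any such coordinates:
    ∀ (Ψ : OpenPartialHomeomorph C3 C3) (α₁ α₂ β : ℝ),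
      IsNormalizedChart G g₁ g₂ x₀ Ψ α₁ α₂ β →
      ∃ U ∈ 𝓝 x₀,
        -- no contribution if at least one singularity is bypassed above
        ((BypassesAbove α₁ g₁ x₀ η₀ ∨ BypassesAbove α₂ g₂ x₀ η₀) →
          (∃ D η, IsLocalPiece x₀ U D ∧ IsDeformedField G g₁ g₂ η₀ D ∅ η) ∧
          ∀ (D K : Set R3) (η : R3 → R3), IsLocalPiece x₀ U D → IsCompact K → K ⊆ D →
            IsDeformedField G g₁ g₂ η₀ D K η →
            ∀ᶠ ε in 𝓝[>] (0 : ℝ),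
              (∀ Λ : ℝ, IntegrableOn (density F G η ε Λ) D) ∧
              ∃ ζ > 0, (fun Λ : ℝ => localIntegral F G η ε D Λ)
                =O[atTop] fun Λ : ℝ => Real.exp (-ζ * Λ)) ∧
        -- the contribution if both singularities are bypassed below
        (BypassesBelow α₁ g₁ x₀ η₀ → BypassesBelow α₂ g₂ x₀ η₀ →
          (∀ (D K : Set R3) (η : R3 → R3), IsLocalPiece x₀ U D →
            IsDeformedField G g₁ g₂ η₀ D K η → x₀ ∈ K) ∧
          (∃ D, IsLocalPiece x₀ U D ∧
            ∀ N ∈ 𝓝 x₀, ∃ η, IsDeformedField G g₁ g₂ η₀ D N η) ∧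
          ∀ (μ₁ μ₂ : ℂ) (C : ℂ → ℂ),
            IsPoleOrBranchExponent μ₁ → IsPoleOrBranchExponent μ₂ →
            AnalyticAt ℂ C 0 → C 0 ≠ 0 →
            (F ~[𝓝[sideDomain g₁ (gradDot g₁ x₀ (η₀ x₀)) ∩
                  sideDomain g₂ (gradDot g₂ x₀ (η₀ x₀))] (toC3 x₀)]
              fun ξ => C (Ψ ξ 2) * powBelow (Ψ ξ 0) μ₁ * powBelow (Ψ ξ 1) μ₂) →
            (∀ᶠ r in 𝓝[>] (0 : ℝ), ∀ a ∈ Set.Ioo 0 (r ^ 2),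
              (fun Λ : ℝ => PhiPrime F Ψ r a Λ) ~[atTop] fun Λ : ℝ => Phi C μ₁ μ₂ Λ) ∧
            ∀ (D K : Set R3) (η : R3 → R3), IsLocalPiece x₀ U D → IsCompact K → K ⊆ D →
              IsDeformedField G g₁ g₂ η₀ D K η →
              ∀ᶠ ε in 𝓝[>] (0 : ℝ),
                (∀ Λ : ℝ, IntegrableOn (density F G η ε Λ) D) ∧
                (fun Λ : ℝ => localIntegral F G η ε D Λ)
                  ~[atTop] fun Λ : ℝ => leadingTerm G x₀ Ψ β C μ₁ μ₂ Λ) := by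
  refine ⟨exists_isNormalizedChart hG hGreal hg₁ hg₁real hg₂ hg₂real hx₁ hx₂ htrans hcrit hns₁ hns₂,
    fun Ψ α₁ α₂ β hc => ?_⟩
  -- The phase estimate fixes `r₀` before the neighbourhood, because the coordinates are to range
  -- over a ball of radius at most `r₀`.
  obtain ⟨r₀, hr₀, hphase⟩ := exists_phase_estimate (hc.phase_analyticAt hG)
    (hc.eventually_phase_real hGreal) hc.beta_ne hc.normal_form
  obtain ⟨R, hR, σ, U, hU, hN⟩ :=
    hc.exists_isGoodNbhd hG hGreal hg₁ hg₂ hη₀ hside₁ hside₂ hF hr₀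
  refine ⟨U, hU, fun hab => ?_, fun hb₁ hb₂ => ⟨fun D K η hD hη =>
    hN.center_mem hc hG hb₁ hb₂ hD hη, ?_, fun μ₁ μ₂ C hμ₁ hμ₂ hC hC0 hFC => ?_⟩⟩
  · obtain ⟨θ, hθ₁, hθ₂, hθd⟩ := hN.exists_desired_direction hc hG hside₁ hside₂ hab
    obtain ⟨D, hD, hθ⟩ := hN.exists_localPiece hc hU hη₀
    obtain ⟨η, hη⟩ := hθ (fun _ => θ) contDiff_const (fun _ _ => hθ₁) (fun _ _ => hθ₂) ∅
      fun y hy _ => hθd y hy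
    exact ⟨⟨D, η, hD, hη⟩, fun D K η hD hK hKD hη =>
      hN.eventually_isBigO hc hD hK hKD hη hθ₁ hθ₂ hθd⟩
  · exact hN.exists_deformed_below hc hU hη₀ hb₁ hb₂ hR
      fun y v d hd hdr hy hl => (hphase y v d hd hdr hy hl).2
  · have hlim := tendsto_amplitude hc hb₁ hb₂ hC hC0 hFC
    have hA := hN.amplitude
    rw [cutSpace_eq_lowerSpace hb₁ hb₂] at hA
    exact ⟨isEquivalent_PhiPrime hN.pos hA hlim hμ₁ hμ₂ hC0, fun D K η hD hK hKD hη =>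
      hN.eventually_isEquivalent hc hb₁ hb₂ hR hphase hμ₁ hμ₂ hC0 hlim hD hK hKD hη⟩
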